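/- **Setting.** Let $p_0,\mu>0$ and consider the Chaplygin gas $$\rho_t+(\rho u)_x=0,\qquad (\rho u)_t+(\rho u^2+p(\rho))_x=0,\qquad p(\rho)=p_0-\frac{\mu^2}{\rho},$$ with initial data $(\rho,u)(0,x)=(\rho_0,u_0)(x)$, $\rho_0,u_0\in C^2(\mathbb R)$. Put $\lambda_\pm=u\pm\mu/\rho$ and $\Lambda_\pm=u_0\pm\mu/\rho_0$. Assume * (H1) $\Lambda_-(x)<\Lambda_+(x)$ for all $x$; * (H2) $\Lambda_-'(x)<0$ and $\Lambda_+'(x)<0$ for all $x$; and that there are $\alpha_0<\beta_0$ with * (H3) $\Lambda_-(\alpha_0)=\Lambda_+(\beta_0)$; * (H4) $f(\alpha_0)=0$; (H5) $f'(\alpha_0)<0$, where, with $\beta(\alpha)=\Lambda_+^{-1}(\Lambda_-(\alpha))$, $$f(\alpha)=\frac{\Lambda_-'(\alpha)}{\Lambda_+(\beta(\alpha))-\Lambda_-(\beta(\alpha))}-\frac{\Lambda_+'(\beta(\alpha))}{\Lambda_+(\alpha)-\Lambda_-(\alpha)}.$$ Let $O=(t_0,x_0)$ be the cusp blowup point $$t_0=\int_{\alpha_0}^{\beta_0}\frac{d\zeta}{\Lambda_+-\Lambda_-},\qquad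 x_0=\frac12\Big\{\alpha_0+\beta_0+\int_{\alpha_0}^{\beta_0}\frac{\Lambda_++\Lambda_-}{\Lambda_+-\Lambda_-}\,d\zeta\Big\},$$ and $v_0=\Lambda_-(\alpha_0)=\Lambda_+(\beta_0)$ (a Galilean change of frame makes $v_0=0$). **Solutions.** For $\alpha_1<\alpha_0$, $\beta_2>\beta_0$, $w_0\in\mathbb R$ and $T>0$, a *$\delta$-shock wave type solution on $[0,t_0+T)$ with initial weight $w_0$* consists of curves $a,b$ on $[0,t_0+T)$, a $C^1$ curve $\mathbb S=\{(t,x(t)):t_0\le t<t_0+T\}$ starting at $O$, a continuous weight $w$ on $[t_0,t_0+T)$, and states $(\rho_\pm,u_\pm)$ such that, with $u_\delta=\dot x$: * $a(0)=\alpha_1$, $\dot a=\lambda_+$ along $x=a(t)$; $b(0)=\beta_2$, $\dot b=\lambda_-$ along $x=b(t)$; $a<b$ for $t<t_0$ and $a(t)<x(t)<b(t)$ for $t\ge t_0$. Let $\Omega_-$ (resp. $\Omega_+$) be the set of $(t,x)\neq O$ with $0\le t<t_0+T$, $a(t)\le x\le b(t)$ and, if $t\ge t_0$, $x\le x(t)$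 (resp. $x\ge x(t)$). * $(\rho_\pm,u_\pm)$ is $C^1$ on $\Omega_\pm$ (up to $\mathbb S\setminus\{O\}$), $\rho_\pm>0$, $u_\pm$ is bounded, $\rho_\pm$ is bounded outside every neighbourhood of $O$, and $\rho_\pm\to+\infty$, $u_\pm\to v_0$ at $O$. * $(\rho_\pm,u_\pm)$ satisfies the system in the interior of $\Omega_\pm$; for $t<t_0$ the two states coincide, and at $t=0$ they equal $(\rho_0,u_0)$ on $[\alpha_1,\beta_2]$. * $w(t_0)=w_0$, $u_\delta(t_0)=v_0$, and for $t_0<t<t_0+T$ the generalized Rankine–Hugoniot conditions hold, where $[h]=h_+-h_-$ on $\mathbb S$: $$\frac{d}{dt}\Big(w\sqrt{1+u_\delta^2}\Big)=u_\delta[\rho]-[\rho u],\qquad \frac{d}{dt}\Big(w\,u_\delta\sqrt{1+u_\delta^2}\Big)=u_\delta[\rho u]-[\rho u^2+p(\rho)].$$ * For $t_0<t<t_0+T$ the $\delta$-entropy condition holds: with $l,r$ denoting the left and right limits on $\mathbb S$, $$\lambda_-^r<\lambda_+^r\le\dot x(t)\le\lambda_-^l<\lambda_+^l .$$ **Theorem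 3.1.** There is $\varepsilon>0$ such that for all $\alpha_1\in(\alpha_0-\varepsilon,\alpha_0)$, $\beta_2\in(\beta_0,\beta_0+\varepsilon)$ and every $w_0\ne0$ there is $T>0$ for which a $\delta$-shock wave type solution on $[0,t_0+T)$ with initial weight $w_0$ exists. It satisfies the system in the sense of distributions: with $(\hat\rho,\hat u)$ equal to $(\rho_\pm,u_\pm)$ on $\Omega_\pm$, $$\langle\rho,\phi_t\rangle+\langle\rho u,\phi_x\rangle=0,\qquad \langle\rho u,\phi_t\rangle+\langle\rho u^2+p(\rho),\phi_x\rangle=0$$ for all $C^\infty$ functions $\phi$ with compact support in $\{0<t<t_0+T,\ a(t)<x<b(t)\}\setminus\{O\}$, where $$\langle\rho,\phi\rangle=\iint\hat\rho\phi\,dx\,dt+\langle w\delta_{\mathbb S},\phi\rangle,\quad \langle\rho u,\phi\rangle=\iint\hat\rho\hat u\phi\,dx\,dt+\langle wu_\delta\delta_{\mathbb S},\phi\rangle,$$ $$\langle\rho u^2+p(\rho),\phi\rangle=\iint(\hat\rho\hat u^2+p(\hat\rho))\phi\,dx\,dt+\langle wu_\delta^2\delta_{\mathbb S},\phi\rangle,$$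 $$\langle g\,\delta_{\mathbb S},\phi\rangle=\int_{t_0}^{t_0+T}g(t)\,\phi(t,x(t))\sqrt{1+\dot x(t)^2}\,dt .$$ It is unique: for every $0<T'\le T$, each $\delta$-shock wave type solution on $[0,t_0+T')$ with the same $\alpha_1,\beta_2,w_0$ coincides with it on $[0,t_0+T')$. -/

import Mathlib

namespace Chaplygin

/-! ### The Chaplygin gas, its Riemann invariants and the cusp conditions on the data -/

/-- The Chaplygin pressure law `p = p₀ - μ² / ρ`. -/
noncomputable def pressure (p₀ μ r : ℝ) : ℝ := p₀ - μ ^ 2 / r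

/-- `Λ₋ = u₀ - μ / ρ₀`. -/
noncomputable def LamMinus (μ : ℝ) (ρ₀ u₀ : ℝ → ℝ) (x : ℝ) : ℝ := u₀ x - μ / ρ₀ x

/-- `Λ₊ = u₀ + μ / ρ₀`. -/
noncomputable def LamPlus (μ : ℝ) (ρ₀ u₀ : ℝ → ℝ) (x : ℝ) : ℝ := u₀ x + μ / ρ₀ x

/-- The function `β(α) = Λ₊⁻¹(Λ₋(α))` (where `Λ₋(α)` lies in the range of the injective
function `Λ₊`). -/
noncomputable def betaOf (Lm Lp : ℝ → ℝ) (α : ℝ) : ℝ := Function.invFun Lp (Lm α)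

/-- `f(α) = Λ₋'(α) / (Λ₊(β(α)) - Λ₋(β(α))) - Λ₊'(β(α)) / (Λ₊(α) - Λ₋(α))`. -/
noncomputable def cuspFun (Lm Lp : ℝ → ℝ) (α : ℝ) : ℝ :=
  deriv Lm α / (Lp (betaOf Lm Lp α) - Lm (betaOf Lm Lp α))
    - deriv Lp (betaOf Lm Lp α) / (Lp α - Lm α)

/-- The assumptions (H1)-(H5), for a point `(α₀, β₀)` of `Σ = {α < β, Λ₋(α) = Λ₊(β)}`. -/
structure CuspAssumptions (Lm Lp : ℝ → ℝ) (α₀ β₀ : ℝ) : Prop where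
  h1 : ∀ x, Lm x < Lp x
  h2 : ∀ x, deriv Lm x < 0 ∧ deriv Lp x < 0
  lt : α₀ < β₀
  h3 : Lm α₀ = Lp β₀
  h4 : cuspFun Lm Lp α₀ = 0
  h5 : deriv (cuspFun Lm Lp) α₀ < 0

/-- The time `t(α, β)` at which the characteristics issuing from `α` and `β` meet. -/
noncomputable def charTime (Lm Lp : ℝ → ℝ) (α β : ℝ) : ℝ :=
  ∫ ζ in α..β, 1 / (Lp ζ - Lm ζ)

/-- The place `x(α, β)` at which the characteristics issuing from `α` and `β` meet. -/
noncomputable def charPlace (Lm Lp : ℝ → ℝ) (α β : ℝ) : ℝ :=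
  (1 / 2) * (α + β + ∫ ζ in α..β, (Lp ζ + Lm ζ) / (Lp ζ - Lm ζ))

/-- The slow characteristic speed `λ₋ = u - c`, with sound speed `c = μ / ρ`. -/
noncomputable def lamMinus (μ : ℝ) (ρ u : ℝ × ℝ → ℝ) (p : ℝ × ℝ) : ℝ := u p - μ / ρ p

/-- The fast characteristic speed `λ₊ = u + c`, with sound speed `c = μ / ρ`. -/
noncomputable def lamPlus (μ : ℝ) (ρ u : ℝ × ℝ → ℝ) (p : ℝ × ℝ) : ℝ := u p + μ / ρ p

/-- The system `ρ_t + (ρ u)_x = 0`, `(ρ u)_t + (ρ u² + p(ρ))_x = 0` at the point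
`P = (t, x)`. -/
def SolvesSystemAt (p₀ μ : ℝ) (ρ u : ℝ × ℝ → ℝ) (P : ℝ × ℝ) : Prop :=
  deriv (fun s => ρ (s, P.2)) P.1 + deriv (fun y => ρ (P.1, y) * u (P.1, y)) P.2 = 0 ∧
  deriv (fun s => ρ (s, P.2) * u (s, P.2)) P.1
    + deriv (fun y => ρ (P.1, y) * u (P.1, y) ^ 2 + pressure p₀ μ (ρ (P.1, y))) P.2 = 0

/-! ### Piecewise smooth fields with one `δ`-shock -/

/-- The unknowns of the `δ`-shock problem: the states `(ρm, um)` and `(ρp, up)` to the left and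
to the right of the discontinuity, as functions of `(t, x)`; the left and right boundaries
`x = a t` and `x = b t` of the domain; the discontinuity `x = X t`, its weight `w` and its
propagation speed `v`. -/
structure Profile where
  ρm : ℝ × ℝ → ℝ
  um : ℝ × ℝ → ℝ
  ρp : ℝ × ℝ → ℝ
  up : ℝ × ℝ → ℝ
  a : ℝ → ℝ
  b : ℝ → ℝ
  X : ℝ → ℝ
  w : ℝ → ℝ
  v : ℝ → ℝ

namespace Profile

/-- The left domain `Ω₋`, together with its boundary, but without the point `(t₀, x₀)`: all of
the domain before the time `t₀`, and the part `x ≤ X t` from the time `t₀` on. -/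
def leftDom (S : Profile) (t₀ x₀ T : ℝ) : Set (ℝ × ℝ) :=
  {P | 0 ≤ P.1 ∧ P.1 < t₀ + T ∧ S.a P.1 ≤ P.2 ∧ (P.1 < t₀ → P.2 ≤ S.b P.1) ∧
    (t₀ ≤ P.1 → P.2 ≤ S.X P.1) ∧ P ≠ (t₀, x₀)}

/-- The right domain `Ω₊`, together with its boundary, but without the point `(t₀, x₀)`: all of
the domain before the time `t₀`, and the part `X t ≤ x` from the time `t₀` on. -/
def rightDom (S : Profile) (t₀ x₀ T : ℝ) : Set (ℝ × ℝ) :=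
  {P | 0 ≤ P.1 ∧ P.1 < t₀ + T ∧ P.2 ≤ S.b P.1 ∧ (P.1 < t₀ → S.a P.1 ≤ P.2) ∧
    (t₀ ≤ P.1 → S.X P.1 ≤ P.2) ∧ P ≠ (t₀, x₀)}

/-- The open left domain. -/
def leftInt (S : Profile) (t₀ T : ℝ) : Set (ℝ × ℝ) :=
  {P | 0 < P.1 ∧ P.1 < t₀ + T ∧ S.a P.1 < P.2 ∧ (P.1 < t₀ → P.2 < S.b P.1) ∧
    (t₀ ≤ P.1 → P.2 < S.X P.1)}

/-- The open right domain. -/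
def rightInt (S : Profile) (t₀ T : ℝ) : Set (ℝ × ℝ) :=
  {P | 0 < P.1 ∧ P.1 < t₀ + T ∧ P.2 < S.b P.1 ∧ (P.1 < t₀ → S.a P.1 < P.2) ∧
    (t₀ ≤ P.1 → S.X P.1 < P.2)}

/-- The whole open domain. -/
def openDom (S : Profile) (t₀ T : ℝ) : Set (ℝ × ℝ) :=
  {P | 0 < P.1 ∧ P.1 < t₀ + T ∧ S.a P.1 < P.2 ∧ P.2 < S.b P.1}

/-- The jump `[h] = h₊ - h₋` of a quantity `h = g(ρ, u)` across the discontinuity, at time `t`. -/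
def jump (S : Profile) (g : ℝ → ℝ → ℝ) (t : ℝ) : ℝ :=
  g (S.ρp (t, S.X t)) (S.up (t, S.X t)) - g (S.ρm (t, S.X t)) (S.um (t, S.X t))

open Classical in
/-- The regular part `ρ̂` of the density. -/
noncomputable def rhoHat (S : Profile) (t₀ : ℝ) (P : ℝ × ℝ) : ℝ :=
  if P.1 < t₀ ∨ P.2 < S.X P.1 then S.ρm P else S.ρp P

open Classical in
/-- The regular part `û` of the velocity. -/
noncomputable def uHat (S : Profile) (t₀ : ℝ) (P : ℝ × ℝ) : ℝ :=
  if P.1 < t₀ ∨ P.2 < S.X P.1 then S.um P else S.up P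

end Profile

/-- `⟨w δ_S, φ⟩`, for the weighted delta function on the curve
`S = {(τ s, ξ s) : s₁ ≤ s ≤ s₂}`. -/
noncomputable def curveDelta (s₁ s₂ : ℝ) (τ ξ w : ℝ → ℝ) (φ : ℝ × ℝ → ℝ) : ℝ :=
  ∫ s in s₁..s₂, w s * φ (τ s, ξ s) * Real.sqrt (deriv τ s ^ 2 + deriv ξ s ^ 2)

namespace Profile

/-- `⟨ρ, φ⟩ = ∬ ρ̂ φ + ⟨w δ_S, φ⟩`. -/
noncomputable def pairMass (S : Profile) (t₀ T : ℝ) (φ : ℝ × ℝ → ℝ) : ℝ :=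
  (∫ P, S.rhoHat t₀ P * φ P) + curveDelta t₀ (t₀ + T) id S.X S.w φ

/-- `⟨ρ u, φ⟩ = ∬ ρ̂ û φ + ⟨w v δ_S, φ⟩`. -/
noncomputable def pairMomentum (S : Profile) (t₀ T : ℝ) (φ : ℝ × ℝ → ℝ) : ℝ :=
  (∫ P, S.rhoHat t₀ P * S.uHat t₀ P * φ P)
    + curveDelta t₀ (t₀ + T) id S.X (fun t => S.w t * S.v t) φ

/-- `⟨ρ u² + p(ρ), φ⟩ = ∬ (ρ̂ û² + p(ρ̂)) φ + ⟨w v² δ_S, φ⟩`. -/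
noncomputable def pairFlux (p₀ μ : ℝ) (S : Profile) (t₀ T : ℝ) (φ : ℝ × ℝ → ℝ) : ℝ :=
  (∫ P, (S.rhoHat t₀ P * S.uHat t₀ P ^ 2 + pressure p₀ μ (S.rhoHat t₀ P)) * φ P)
    + curveDelta t₀ (t₀ + T) id S.X (fun t => S.w t * S.v t ^ 2) φ

/-- The system in the sense of distributions, for all test functions with compact support in
the open domain without the point `(t₀, x₀)`. -/
def IsDeltaMeasureSolution (p₀ μ : ℝ) (S : Profile) (t₀ x₀ T : ℝ) : Prop :=
  ∀ φ : ℝ × ℝ → ℝ, ContDiff ℝ (⊤ : ℕ∞) φ → HasCompactSupport φ →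
    tsupport φ ⊆ S.openDom t₀ T \ {(t₀, x₀)} →
    S.pairMass t₀ T (fun P => fderiv ℝ φ P (1, 0))
        + S.pairMomentum t₀ T (fun P => fderiv ℝ φ P (0, 1)) = 0 ∧
    S.pairMomentum t₀ T (fun P => fderiv ℝ φ P (1, 0))
        + S.pairFlux p₀ μ t₀ T (fun P => fderiv ℝ φ P (0, 1)) = 0

/-- `S` is a `δ`-shock wave type solution, until the time `t₀ + T`, of the Cauchy problem with
the initial data `(ρ₀, u₀)` prescribed on `[α₁, β₂]` at time `0`; its `δ`-shock starts at the
point `(t₀, x₀)` with weight `w₀` and speed `v₀`. The domain is the domain of determinacy of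
`[α₁, β₂]`, bounded by the fast characteristic from `α₁` and the slow characteristic from
`β₂`. -/
structure IsDeltaShockSolution (p₀ μ : ℝ) (ρ₀ u₀ : ℝ → ℝ) (α₁ β₂ t₀ x₀ T w₀ v₀ : ℝ)
    (S : Profile) : Prop where
  -- the lateral boundaries are characteristics
  a_zero : S.a 0 = α₁
  b_zero : S.b 0 = β₂
  a_char : ∀ t ∈ Set.Ico 0 (t₀ + T),
    HasDerivWithinAt S.a (lamPlus μ S.ρm S.um (t, S.a t)) (Set.Ico 0 (t₀ + T)) t
  b_char : ∀ t ∈ Set.Ico 0 (t₀ + T),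
    HasDerivWithinAt S.b (lamMinus μ S.ρp S.up (t, S.b t)) (Set.Ico 0 (t₀ + T)) t
  a_lt_b : ∀ t ∈ Set.Ico 0 t₀, S.a t < S.b t
  -- the discontinuity: a continuously differentiable curve inside the domain, with speed `v`
  a_lt_X : ∀ t ∈ Set.Ico t₀ (t₀ + T), S.a t < S.X t
  X_lt_b : ∀ t ∈ Set.Ico t₀ (t₀ + T), S.X t < S.b t
  X_start : S.X t₀ = x₀
  X_speed : ∀ t ∈ Set.Ico t₀ (t₀ + T),
    HasDerivWithinAt S.X (S.v t) (Set.Ico t₀ (t₀ + T)) t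
  v_cont : ContinuousOn S.v (Set.Ico t₀ (t₀ + T))
  v_start : S.v t₀ = v₀
  w_cont : ContinuousOn S.w (Set.Ico t₀ (t₀ + T))
  w_start : S.w t₀ = w₀
  -- the two states are `C¹` up to the discontinuity, with positive density
  smooth_ρm : ContDiffOn ℝ 1 S.ρm (S.leftDom t₀ x₀ T)
  smooth_um : ContDiffOn ℝ 1 S.um (S.leftDom t₀ x₀ T)
  smooth_ρp : ContDiffOn ℝ 1 S.ρp (S.rightDom t₀ x₀ T)
  smooth_up : ContDiffOn ℝ 1 S.up (S.rightDom t₀ x₀ T)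
  ρm_pos : ∀ P ∈ S.leftDom t₀ x₀ T, 0 < S.ρm P
  ρp_pos : ∀ P ∈ S.rightDom t₀ x₀ T, 0 < S.ρp P
  -- the velocities are bounded, the densities are bounded away from the blowup point
  bdd_um : ∃ M, ∀ P ∈ S.leftDom t₀ x₀ T, |S.um P| ≤ M
  bdd_up : ∃ M, ∀ P ∈ S.rightDom t₀ x₀ T, |S.up P| ≤ M
  bdd_ρm : ∀ r > 0, ∃ M, ∀ P ∈ S.leftDom t₀ x₀ T, r ≤ dist P (t₀, x₀) → S.ρm P ≤ M
  bdd_ρp : ∀ r > 0, ∃ M, ∀ P ∈ S.rightDom t₀ x₀ T, r ≤ dist P (t₀, x₀) → S.ρp P ≤ M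
  -- behaviour at the blowup point: the density is infinite, the velocity is continuous
  blowup_ρm : Filter.Tendsto S.ρm (nhdsWithin (t₀, x₀) (S.leftDom t₀ x₀ T)) Filter.atTop
  blowup_ρp : Filter.Tendsto S.ρp (nhdsWithin (t₀, x₀) (S.rightDom t₀ x₀ T)) Filter.atTop
  blowup_um : Filter.Tendsto S.um (nhdsWithin (t₀, x₀) (S.leftDom t₀ x₀ T)) (nhds v₀)
  blowup_up : Filter.Tendsto S.up (nhdsWithin (t₀, x₀) (S.rightDom t₀ x₀ T)) (nhds v₀)
  -- there is one single state before the blowup time, and it has the given initial values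
  match_ρ : ∀ t ∈ Set.Ico 0 t₀, ∀ x ∈ Set.Icc (S.a t) (S.b t), S.ρm (t, x) = S.ρp (t, x)
  match_u : ∀ t ∈ Set.Ico 0 t₀, ∀ x ∈ Set.Icc (S.a t) (S.b t), S.um (t, x) = S.up (t, x)
  init_ρ : ∀ x ∈ Set.Icc α₁ β₂, S.ρm (0, x) = ρ₀ x
  init_u : ∀ x ∈ Set.Icc α₁ β₂, S.um (0, x) = u₀ x
  -- the system off the discontinuity
  solves_left : ∀ P ∈ S.leftInt t₀ T, SolvesSystemAt p₀ μ S.ρm S.um P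
  solves_right : ∀ P ∈ S.rightInt t₀ T, SolvesSystemAt p₀ μ S.ρp S.up P
  -- the generalized Rankine-Hugoniot conditions
  rankine_mass : ∀ t ∈ Set.Ioo t₀ (t₀ + T),
    HasDerivAt (fun s => S.w s * Real.sqrt (1 + S.v s ^ 2))
      (S.v t * S.jump (fun r _ => r) t - S.jump (fun r u => r * u) t) t
  rankine_momentum : ∀ t ∈ Set.Ioo t₀ (t₀ + T),
    HasDerivAt (fun s => S.w s * S.v s * Real.sqrt (1 + S.v s ^ 2))
      (S.v t * S.jump (fun r u => r * u) t
        - S.jump (fun r u => r * u ^ 2 + pressure p₀ μ r) t) t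
  -- the `δ`-entropy condition
  entropy : ∀ t ∈ Set.Ioo t₀ (t₀ + T),
    lamMinus μ S.ρp S.up (t, S.X t) < lamPlus μ S.ρp S.up (t, S.X t) ∧
    lamPlus μ S.ρp S.up (t, S.X t) ≤ S.v t ∧
    S.v t ≤ lamMinus μ S.ρm S.um (t, S.X t) ∧
    lamMinus μ S.ρm S.um (t, S.X t) < lamPlus μ S.ρm S.um (t, S.X t)

/-- `S` and `S'` describe the same solution until the time `t₀ + T`. -/
structure SameUntil (S S' : Profile) (t₀ x₀ T : ℝ) : Prop where
  a_eq : Set.EqOn S.a S'.a (Set.Ico 0 (t₀ + T))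
  b_eq : Set.EqOn S.b S'.b (Set.Ico 0 (t₀ + T))
  X_eq : Set.EqOn S.X S'.X (Set.Ico t₀ (t₀ + T))
  w_eq : Set.EqOn S.w S'.w (Set.Ico t₀ (t₀ + T))
  v_eq : Set.EqOn S.v S'.v (Set.Ico t₀ (t₀ + T))
  ρm_eq : Set.EqOn S.ρm S'.ρm (S.leftDom t₀ x₀ T)
  um_eq : Set.EqOn S.um S'.um (S.leftDom t₀ x₀ T)
  ρp_eq : Set.EqOn S.ρp S'.ρp (S.rightDom t₀ x₀ T)
  up_eq : Set.EqOn S.up S'.up (S.rightDom t₀ x₀ T)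

end Profile

end Chaplygin

/-!
For the Chaplygin gas both families of characteristics are linearly degenerate: `λ₋` is constant
along the fast characteristics `ẋ = λ₊`, and `λ₊` along the slow ones `ẋ = λ₋`. With the fast
characteristics labelled by `p`, the slow ones by `q`, and the labels normalized by the data
(`exists_time_coordinate`), two of them meet at the time `t = q - p` and at the place
`x = H q + G p`, where `λ₋ = lm p` and `λ₊ = lp q`. The solution of the initial value problem is thus
explicit as long as `lm p < lp q`. The assumptions on the data say that this first fails at a single
pair `(p₀, q₀)`, where the singularity is a nondegenerate cusp: `lp (q₀ + ξ) - lm (p₀ + ξ)` vanishes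
to exactly second order. `exists_fits` performs this change of coordinates, and the structure
`CuspDatum` keeps the quantitative consequences that are needed later.

*Off the discontinuity, every solution is the explicit one* (`LeftState.exists_label` for the left
half; the reflection `x ↦ -x` of `CuspDatum.reflect` gives the right half). The label of a point in
an arbitrary solution is recovered as the mass between the left boundary and the point (`pot`), by
Green's formula `hasDerivAt_integral_between`. Along characteristics, followed backwards in time,
the Riemann invariants keep their values, and the entropy condition prevents characteristics from
emerging from the discontinuity. Nor do they emerge from the blowup point: with a fast
characteristic, the slow characteristics that cross it would also come out of this point, both
invariants would have the value `v₀`, and the density would be infinite (`LeftState.pot_lt_after`).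

*The discontinuity obeys an ordinary differential equation.* The generalized Rankine–Hugoniot
conditions can be integrated: the mass and the momentum of the `δ`-shock at `(t, x)` are explicit
functions of the labels of the two states there (`hasDerivAt_massAt`, `hasDerivAt_momentumAt`,
`mass_momentum`), and the velocity is their quotient. At the time `t₀ + s²` the labels at the
discontinuity are at distances of order `s` from the cusp (`apriori`, `exists_label_cusp`), where
`λ₊ - λ₋` is of order `s²` (`spread`). The velocity therefore depends on the place only with a
Lipschitz constant of order `1 / s`, and `dt = 2 s ds` makes the equation Lipschitz in the variable
`s` (`drift_lipschitz`). As `w₀ ≠ 0`, the mass stays away from zero for a short time. The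
Picard–Lindelöf theorem then gives one and only one path (`exists_path`); the path deviates from the
tangent of the cusp by `O(s⁴)`, which is small compared with the width `O(s³)` of the region covered
by both states, and this gives the entropy condition (`CuspDatum.isDeltaShockSolution`). Conversely,
the a priori bounds on the labels show that every solution moves along this path (`X_eq_path`).

*The distributional form* follows from Green's formula before the blowup and on the two sides of the
discontinuity; the boundary terms there cancel the derivative of the concentrated mass and momentum
(`ConcentratedLaw.weak_form`).
-/

open Set Filter Topology MeasureTheory

namespace Chaplygin

/-! ### Calculus in the (t, x)-plane -/

/-- The linear form `(τ, ξ) ↦ A τ + B ξ` on the `(t, x)`-plane: a function has this form as its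
derivative at a point when its partial derivatives in `t` and `x` there are `A` and `B`. -/
noncomputable def gradForm (A B : ℝ) : ℝ × ℝ →L[ℝ] ℝ :=
  A • ContinuousLinearMap.fst ℝ ℝ ℝ + B • ContinuousLinearMap.snd ℝ ℝ ℝ

@[simp] theorem gradForm_apply (A B : ℝ) (z : ℝ × ℝ) : gradForm A B z = A * z.1 + B * z.2 := by
  simp [gradForm]

theorem eq_gradForm (f : ℝ × ℝ →L[ℝ] ℝ) : f = gradForm (f (1, 0)) (f (0, 1)) := by
  ext <;> simp

theorem hasFDerivAt_gradForm {F : ℝ × ℝ → ℝ} {P : ℝ × ℝ} (h : DifferentiableAt ℝ F P) :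
    HasFDerivAt F (gradForm (fderiv ℝ F P (1, 0)) (fderiv ℝ F P (0, 1))) P := by
  rw [← eq_gradForm]; exact h.hasFDerivAt

/-- Chain rule along a curve `s ↦ (γ s, χ s)`. -/
theorem HasFDerivAt.comp_curve {F : ℝ × ℝ → ℝ} {A B : ℝ} {γ χ : ℝ → ℝ} {γ' χ' s : ℝ}
    (hF : HasFDerivAt F (gradForm A B) (γ s, χ s)) (hγ : HasDerivAt γ γ' s)
    (hχ : HasDerivAt χ χ' s) :
    HasDerivAt (fun r => F (γ r, χ r)) (A * γ' + B * χ') s := by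
  have h := hF.comp_hasDerivAt (f := fun r => (γ r, χ r)) s (hγ.prodMk hχ)
  simp only [gradForm_apply] at h
  exact h

theorem hasFDerivAt_partial_t {F : ℝ × ℝ → ℝ} {A B t x : ℝ}
    (hF : HasFDerivAt F (gradForm A B) (t, x)) : HasDerivAt (fun s => F (s, x)) A t := by
  have := HasFDerivAt.comp_curve (γ := fun s => s) (χ := fun _ => x) hF (hasDerivAt_id t)
    (hasDerivAt_const t x)
  simpa using this

theorem hasFDerivAt_partial_x {F : ℝ × ℝ → ℝ} {A B t x : ℝ}
    (hF : HasFDerivAt F (gradForm A B) (t, x)) : HasDerivAt (fun y => F (t, y)) B x := by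
  have := HasFDerivAt.comp_curve (γ := fun _ => t) (χ := fun y => y) hF (hasDerivAt_const x t)
    (hasDerivAt_id x)
  simpa using this

/-- A function with continuous partial derivatives on an open subset of the plane is
differentiable there. -/
theorem hasFDerivAt_of_partials {U : Set (ℝ × ℝ)} (hU : IsOpen U) {F A B : ℝ × ℝ → ℝ}
    (ht : ∀ P ∈ U, HasDerivAt (fun s => F (s, P.2)) (A P) P.1)
    (hx : ∀ P ∈ U, HasDerivAt (fun y => F (P.1, y)) (B P) P.2)
    (hA : ContinuousOn A U) (hB : ContinuousOn B U) {P : ℝ × ℝ} (hP : P ∈ U) :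
    HasFDerivAt F (gradForm (A P) (B P)) P := by
  have hc : Continuous fun r : ℝ => ContinuousLinearMap.toSpanSingleton ℝ r := by
    have : (fun r : ℝ => ContinuousLinearMap.toSpanSingleton ℝ r)
        = fun r : ℝ => r • ContinuousLinearMap.id ℝ ℝ := by
      ext r; simp
    rw [this]; fun_prop
  have h := hasStrictFDerivAt_uncurry_coprod (𝕜 := ℝ) (u := P) (f := fun s y => F (s, y))
    (f₁ := fun s y => ContinuousLinearMap.toSpanSingleton ℝ (A (s, y)))
    (f₂ := fun s y => ContinuousLinearMap.toSpanSingleton ℝ (B (s, y)))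
    (by filter_upwards [hU.mem_nhds hP] with v hv using (ht v hv).hasFDerivAt)
    (by filter_upwards [hU.mem_nhds hP] with v hv using (hx v hv).hasFDerivAt)
    (hc.continuousAt.comp (hA.continuousAt (hU.mem_nhds hP)))
    (hc.continuousAt.comp (hB.continuousAt (hU.mem_nhds hP)))
  have h2 := h.hasFDerivAt
  convert! h2 using 1
  ext <;> simp [Function.HasUncurry.uncurry]

/-- A map `(t, p) ↦ (t, Y (t, p))` that is injective on an open set `U` and has `∂Y/∂p > 0` there
has an inverse `(t, x) ↦ (t, π (t, x))` of class `C¹`. -/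
theorem exists_fiber_inverse {U : Set (ℝ × ℝ)} (hU : IsOpen U) {Y A B : ℝ × ℝ → ℝ}
    (hY : ∀ u ∈ U, HasFDerivAt Y (gradForm (A u) (B u)) u)
    (hA : ContinuousOn A U) (hB : ContinuousOn B U) (hpos : ∀ u ∈ U, 0 < B u)
    (hinj : ∀ u ∈ U, ∀ u' ∈ U, u.1 = u'.1 → Y u = Y u' → u = u') :
    ∃ π : ℝ × ℝ → ℝ, ∀ u ∈ U, π (u.1, Y u) = u.2 ∧ ContDiffAt ℝ 1 π (u.1, Y u) ∧
      HasFDerivAt π (gradForm (-(A u) / B u) (1 / B u)) (u.1, Y u) ∧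
      ∀ᶠ z in 𝓝 (u.1, Y u), (z.1, π z) ∈ U ∧ Y (z.1, π z) = z.2 := by
  set Θ : ℝ × ℝ → ℝ × ℝ := fun u => (u.1, Y u) with hΘ
  have hΘinj : InjOn Θ U := fun u hu u' hu' h =>
    hinj u hu u' hu' (Prod.ext_iff.1 h).1 (Prod.ext_iff.1 h).2
  have hYc : ∀ u ∈ U, ContDiffAt ℝ 1 Y u := by
    intro u hu
    have hc : ContinuousOn (fun u => gradForm (A u) (B u)) U := by
      unfold gradForm; fun_prop
    exact contDiffAt_one_iff.2 ⟨_, U, hU.mem_nhds hu, hc, hY⟩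
  have hU0 : ∀ u ∈ U, U.Nonempty := fun u hu => ⟨u, hu⟩
  refine ⟨fun z => (Function.invFunOn Θ U z).2, fun u hu => ?_⟩
  have hl : ∀ v ∈ U, Function.invFunOn Θ U (Θ v) = v := fun v hv =>
    hΘinj.leftInvOn_invFunOn hv
  have hΘc : ContDiffAt ℝ 1 Θ u := contDiffAt_fst.prodMk (hYc u hu)
  let e : (ℝ × ℝ) ≃L[ℝ] ℝ × ℝ :=
    ContinuousLinearEquiv.skewProd (ContinuousLinearEquiv.refl ℝ ℝ)
      (ContinuousLinearEquiv.unitsEquivAut ℝ (Units.mk0 (B u) (hpos u hu).ne'))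
      (ContinuousLinearMap.toSpanSingleton ℝ (A u))
  have hΘd : HasFDerivAt Θ (e : ℝ × ℝ →L[ℝ] ℝ × ℝ) u := by
    have h := (hasFDerivAt_fst (𝕜 := ℝ) (p := u)).prodMk (hY u hu)
    convert! h using 1
    ext <;> simp [e]
  set g := hΘc.toOpenPartialHomeomorph Θ hΘd one_ne_zero with hg
  have hgc : ContDiffAt ℝ 1 g.symm (Θ u) := hΘc.to_localInverse hΘd one_ne_zero
  have hus : u ∈ g.source := hΘc.mem_toOpenPartialHomeomorph_source hΘd one_ne_zero
  have hgu : g.symm (Θ u) = u := g.left_inv hus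
  have hgt : Θ u ∈ g.target := g.map_source hus
  have hev : ∀ᶠ z in 𝓝 (Θ u), z ∈ g.target ∧ g.symm z ∈ U := by
    refine (g.open_target.eventually_mem hgt).and (hgc.continuousAt.eventually_mem ?_)
    rw [hgu]; exact hU.mem_nhds hu
  have hev2 : ∀ᶠ z in 𝓝 (Θ u), Function.invFunOn Θ U z = g.symm z ∧ g.symm z ∈ U
      ∧ Θ (g.symm z) = z := by
    filter_upwards [hev] with z hz
    have h1 : Θ (g.symm z) = z := g.right_inv hz.1
    refine ⟨?_, hz.2, h1⟩
    conv_lhs => rw [← h1]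
    exact hl _ hz.2
  have hπc : ContDiffAt ℝ 1 (fun z => (Function.invFunOn Θ U z).2) (Θ u) := by
    refine (contDiffAt_snd.comp _ hgc).congr_of_eventuallyEq ?_
    filter_upwards [hev2] with z hz
    simp [hz.1]
  refine ⟨by simp [show (u.1, Y u) = Θ u from rfl, hl u hu], hπc, ?_, ?_⟩
  · have hd := hasFDerivAt_gradForm (hπc.differentiableAt one_ne_zero)
    set a := fderiv ℝ (fun z => (Function.invFunOn Θ U z).2) (Θ u) (1, 0)
    set b := fderiv ℝ (fun z => (Function.invFunOn Θ U z).2) (Θ u) (0, 1)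
    have h1 := hd.comp u hΘd
    have h2 : HasFDerivAt ((fun z => (Function.invFunOn Θ U z).2) ∘ Θ)
        (ContinuousLinearMap.snd ℝ ℝ ℝ) u := by
      refine (hasFDerivAt_snd (𝕜 := ℝ) (p := u)).congr_of_eventuallyEq ?_
      filter_upwards [hU.mem_nhds hu] with v hv
      simp [hl v hv]
    have h3 := h1.unique h2
    have e1 := congrArg (fun f => f (1, 0)) h3
    have e2 := congrArg (fun f => f (0, 1)) h3
    simp [e] at e1 e2
    have hB0 := (hpos u hu).ne'
    have eb : b = 1 / B u := by field_simp; linarith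
    have ea : a = -(A u) / B u := by
      rw [eb] at e1; field_simp at e1 ⊢; linarith
    rw [← ea, ← eb]; exact hd
  · filter_upwards [hev2] with z hz
    have h2 : Θ (g.symm z) = z := hz.2.2
    have h3 : (g.symm z).1 = z.1 := (Prod.ext_iff.1 h2).1
    have h4 : Y (g.symm z) = z.2 := (Prod.ext_iff.1 h2).2
    have h5 : (z.1, (Function.invFunOn Θ U z).2) = g.symm z := by
      rw [hz.1, ← h3]
    rw [h5]
    exact ⟨hz.2.1, h4⟩

end Chaplygin

namespace Chaplygin

/-! ### Green's formula between moving curves -/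

/-- A function that is continuous on the closed region between two graphs over `[t₁, t₂]` agrees
there with a continuous function on the whole plane. -/
theorem exists_continuous_extension {F : ℝ × ℝ → ℝ} {a c : ℝ → ℝ} {t₁ t₂ : ℝ} (h12 : t₁ ≤ t₂)
    (ha : ContinuousOn a (Icc t₁ t₂)) (hc : ContinuousOn c (Icc t₁ t₂))
    (hac : ∀ t ∈ Icc t₁ t₂, a t ≤ c t)
    (hF : ContinuousOn F {P | P.1 ∈ Icc t₁ t₂ ∧ a P.1 ≤ P.2 ∧ P.2 ≤ c P.1}) :
    ∃ F' : ℝ × ℝ → ℝ, Continuous F' ∧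
      ∀ t ∈ Icc t₁ t₂, ∀ x ∈ Icc (a t) (c t), F' (t, x) = F (t, x) := by
  set τ : ℝ → ℝ := fun t => max t₁ (min t₂ t) with hτ
  have hτc : Continuous τ := by fun_prop
  have hτm : ∀ t, τ t ∈ Icc t₁ t₂ := fun t =>
    ⟨le_max_left _ _, max_le h12 (min_le_left _ _)⟩
  have hac' : Continuous (fun t => a (τ t)) := ha.comp_continuous hτc hτm
  have hcc' : Continuous (fun t => c (τ t)) := hc.comp_continuous hτc hτm
  refine ⟨fun P => F (τ P.1, max (a (τ P.1)) (min (c (τ P.1)) P.2)), ?_, ?_⟩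
  · refine hF.comp_continuous ?_ ?_
    · have h1 : Continuous (fun P : ℝ × ℝ => a (τ P.1)) := hac'.comp continuous_fst
      have h2 : Continuous (fun P : ℝ × ℝ => c (τ P.1)) := hcc'.comp continuous_fst
      exact (hτc.comp continuous_fst).prodMk (h1.max (h2.min continuous_snd))
    · intro P
      exact ⟨hτm _, le_max_left _ _, max_le (hac _ (hτm _)) (min_le_left _ _)⟩
  · intro t ht x hx
    have e1 : τ t = t := by simp [hτ, ht.1, ht.2]
    simp [e1, hx.1, hx.2]

/-- The conservation law with source `F_t + G_x = E`, integrated over a rectangle. -/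
theorem integral_rectangle {F G E : ℝ × ℝ → ℝ} (hF : Continuous F) (hG : Continuous G)
    (hE : Continuous E) {t₁ t₂ x₁ x₂ : ℝ}
    (hd : ∀ t ∈ Ioo (min t₁ t₂) (max t₁ t₂), ∀ x ∈ Ioo (min x₁ x₂) (max x₁ x₂), ∃ A B C D,
      HasFDerivAt F (gradForm A B) (t, x) ∧ HasFDerivAt G (gradForm C D) (t, x) ∧
        A + D = E (t, x)) :
    ((∫ x in x₁..x₂, F (t₂, x)) - ∫ x in x₁..x₂, F (t₁, x)) =
      ∫ t in t₁..t₂, ((∫ x in x₁..x₂, E (t, x)) + G (t, x₁) - G (t, x₂)) := by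
  have key : ∀ P ∈ Ioo (min t₁ t₂) (max t₁ t₂) ×ˢ Ioo (min x₁ x₂) (max x₁ x₂),
      HasFDerivAt F (fderiv ℝ F P) P ∧ HasFDerivAt G (E P • ContinuousLinearMap.snd ℝ ℝ ℝ
        - (fderiv ℝ F P (1, 0)) • ContinuousLinearMap.snd ℝ ℝ ℝ
        + (fderiv ℝ G P (1, 0)) • ContinuousLinearMap.fst ℝ ℝ ℝ) P := by
    rintro ⟨t, x⟩ ⟨h1, h2⟩
    obtain ⟨A, B, C, D, hA, hC, h⟩ := hd t h1 x h2
    refine ⟨hA.differentiableAt.hasFDerivAt, ?_⟩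
    convert! hC using 1
    rw [hA.fderiv, hC.fderiv, ← h]
    ext <;> simp
  have h := integral2_divergence_prod_of_hasFDerivAt_off_countable F G (fun P => fderiv ℝ F P)
    (fun P => E P • ContinuousLinearMap.snd ℝ ℝ ℝ
        - (fderiv ℝ F P (1, 0)) • ContinuousLinearMap.snd ℝ ℝ ℝ
        + (fderiv ℝ G P (1, 0)) • ContinuousLinearMap.fst ℝ ℝ ℝ) t₁ x₁ t₂ x₂ ∅ countable_empty
    hF.continuousOn hG.continuousOn (fun P hP => (key P hP.1).1) (fun P hP => (key P hP.1).2) (by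
      have : (fun P : ℝ × ℝ => fderiv ℝ F P (1, 0) + (E P • ContinuousLinearMap.snd ℝ ℝ ℝ
        - (fderiv ℝ F P (1, 0)) • ContinuousLinearMap.snd ℝ ℝ ℝ
        + (fderiv ℝ G P (1, 0)) • ContinuousLinearMap.fst ℝ ℝ ℝ) (0, 1)) = E := by
        ext P; simp
      rw [this]
      exact hE.continuousOn.integrableOn_compact (isCompact_uIcc.prod isCompact_uIcc))
  simp only [add_apply, sub_apply,
    smul_apply, ContinuousLinearMap.coe_snd', ContinuousLinearMap.coe_fst',
    smul_eq_mul, mul_one, mul_zero, add_zero, add_sub_cancel] at h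
  have i1 : Continuous fun t => ∫ x in x₁..x₂, E (t, x) :=
    intervalIntegral.continuous_parametric_intervalIntegral_of_continuous' (f := fun t x => E (t, x))
      hE _ _
  have i2 : Continuous fun t => G (t, x₁) := by fun_prop
  have i3 : Continuous fun t => G (t, x₂) := by fun_prop
  rw [intervalIntegral.integral_sub (f := fun t => (∫ x in x₁..x₂, E (t, x)) + G (t, x₁))
    ((i1.add i2).intervalIntegrable _ _)
    (i3.intervalIntegrable _ _), intervalIntegral.integral_add (i1.intervalIntegrable _ _)
    (i2.intervalIntegrable _ _), h]
  ring

/-- Differentiation under the integral sign for a continuous solution of `F_t + G_x = E` in the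
region to the right of a curve `x = a t`. No bound on the derivatives of `F` near the curve is
needed: the equation is only used in integrated form, on rectangles. -/
theorem hasDerivAt_integral_lower {F G E : ℝ × ℝ → ℝ} (hF : Continuous F) (hG : Continuous G)
    (hE : Continuous E) {a : ℝ → ℝ} {a₁ t₀ m : ℝ} (ha : HasDerivAt a a₁ t₀)
    (hd : ∀ᶠ t in 𝓝 t₀, ∀ x ∈ Ioo (a t) m, ∃ A B C D,
      HasFDerivAt F (gradForm A B) (t, x) ∧ HasFDerivAt G (gradForm C D) (t, x) ∧
        A + D = E (t, x)) (ham : a t₀ < m) :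
    HasDerivAt (fun t => ∫ x in a t..m, F (t, x))
      ((∫ x in a t₀..m, E (t₀, x)) + G (t₀, a t₀) - G (t₀, m) - a₁ * F (t₀, a t₀)) t₀ := by
  set k : ℝ → ℝ → ℝ := fun s y => (∫ x in y..m, E (s, x)) + G (s, y) - G (s, m) with hk
  have hkc : Continuous (fun P : ℝ × ℝ => k P.1 P.2) := by
    have h1 : Continuous fun P : ℝ × ℝ => ∫ x in m..P.2, E (P.1, x) :=
      intervalIntegral.continuous_parametric_primitive_of_continuous (f := fun t x => E (t, x)) hE
    have h2 : (fun P : ℝ × ℝ => k P.1 P.2)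
        = fun P => -(∫ x in m..P.2, E (P.1, x)) + G (P.1, P.2) - G (P.1, m) := by
      ext P; simp only [hk]; rw [intervalIntegral.integral_symm m P.2]
    rw [h2]; fun_prop
  set f₀ := F (t₀, a t₀)
  have hFi : ∀ t u v, IntervalIntegrable (fun x => F (t, x)) volume u v := fun t u v =>
    (show Continuous fun x => F (t, x) by fun_prop).intervalIntegrable _ _
  set L := |a₁| + 1
  have hL : 0 < L := by positivity
  -- `a` is Lipschitz at `t₀`, so the line `x = a t₀ + L |t - t₀|` lies to the right of the curve
  have hlip : ∀ᶠ t in 𝓝 t₀, |a t - a t₀| ≤ L * |t - t₀| := by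
    have h := (hasDerivAt_iff_isLittleO.1 ha).def (c := 1) one_pos
    filter_upwards [h] with t ht
    simp only [smul_eq_mul, Real.norm_eq_abs, one_mul] at ht
    have h3 : a t - a t₀ = (a t - a t₀ - (t - t₀) * a₁) + (t - t₀) * a₁ := by ring
    rw [h3]
    refine (abs_add_le _ _).trans ?_
    rw [abs_mul]
    simp only [L]; nlinarith [abs_nonneg (t - t₀)]
  rw [hasDerivAt_iff_isLittleO, Asymptotics.isLittleO_iff]
  intro ε hε
  set ε' := ε / (2 + 4 * L) with hε'
  have hε'0 : 0 < ε' := by positivity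
  obtain ⟨η, hη, hη1⟩ := Metric.eventually_nhds_iff.1 (hd.and hlip)
  have hFnear : ∀ᶠ P in 𝓝 (t₀, a t₀), |F P - f₀| < ε' ∧ |k P.1 P.2 - k t₀ (a t₀)| < ε' := by
    have h1 : Tendsto F (𝓝 (t₀, a t₀)) (𝓝 f₀) := hF.tendsto _
    have h2 : Tendsto (fun P : ℝ × ℝ => k P.1 P.2) (𝓝 (t₀, a t₀)) (𝓝 (k t₀ (a t₀))) :=
      hkc.tendsto (t₀, a t₀)
    exact (h1.eventually (Metric.ball_mem_nhds _ hε'0)).and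
      (h2.eventually (Metric.ball_mem_nhds _ hε'0))
  obtain ⟨r, hr, hr1⟩ := Metric.eventually_nhds_iff.1 hFnear
  have hm0 : 0 < (m - a t₀) / L := div_pos (by linarith) hL
  have hball : ∀ᶠ t in 𝓝 t₀, dist t t₀ < min (min η (min r (r / L))) ((m - a t₀) / L) :=
    Metric.ball_mem_nhds _ (by positivity)
  have hder : ∀ᶠ t in 𝓝 t₀, |a t - a t₀ - (t - t₀) * a₁| ≤ ε' / (|f₀| + 1) * |t - t₀| := by
    filter_upwards [(hasDerivAt_iff_isLittleO.1 ha).def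
      (show 0 < ε' / (|f₀| + 1) by positivity)] with t ht
    simpa [Real.norm_eq_abs] using ht
  filter_upwards [hball, hder] with t ht htd
  simp only [lt_min_iff] at ht
  obtain ⟨⟨h1, h2, h3⟩, h4⟩ := ht
  rw [Real.dist_eq] at h1 h2 h3 h4
  set Δ := |t - t₀| with hΔ
  have hΔ0 : 0 ≤ Δ := abs_nonneg _
  have h3' : L * Δ < r := by rw [lt_div_iff₀ hL] at h3; linarith
  have h4' : L * Δ < m - a t₀ := by rw [lt_div_iff₀ hL] at h4; linarith
  set y := a t₀ + L * Δ with hy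
  have near : ∀ s x, |s - t₀| ≤ Δ → |x - a t₀| ≤ L * Δ →
      |F (s, x) - f₀| < ε' ∧ |k s x - k t₀ (a t₀)| < ε' := by
    intro s x hs hx
    refine hr1 (y := (s, x)) ?_
    rw [Prod.dist_eq, max_lt_iff, Real.dist_eq, Real.dist_eq]
    exact ⟨hs.trans_lt h2, hx.trans_lt h3'⟩
  have hat : |a t - a t₀| ≤ L * Δ := (hη1 (y := t) (by rw [Real.dist_eq]; exact h1)).2
  have hat' := abs_le.1 hat
  have hLΔ : 0 ≤ L * Δ := by positivity
  have hrect := integral_rectangle hF hG hE (t₁ := t₀) (t₂ := t) (x₁ := y) (x₂ := m) (by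
    intro s hs x hx
    have hs' : |s - t₀| ≤ Δ := by
      rcases le_total t₀ t with h | h
      · rw [min_eq_left h, max_eq_right h] at hs
        rw [hΔ, abs_of_nonneg (by linarith [hs.1]), abs_of_nonneg (by linarith)]; linarith [hs.2]
      · rw [min_eq_right h, max_eq_left h] at hs
        rw [hΔ, abs_of_nonpos (by linarith [hs.2]), abs_of_nonpos (by linarith)]; linarith [hs.1]
    have hq := hη1 (y := s) (by rw [Real.dist_eq]; linarith)
    refine hq.1 x ⟨?_, ?_⟩
    · have := (abs_le.1 hq.2).2
      have hx1 := hx.1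
      rw [min_eq_left (by linarith)] at hx1
      nlinarith
    · have hx1 := hx.2
      rwa [max_eq_right (by linarith)] at hx1)
  -- to the right of the line the integrated equation applies; on the strip between the curve and
  -- the line, whose width is `O(|t - t₀|)`, `F` is nearly constant
  have e1 : (∫ x in a t..m, F (t, x)) - ∫ x in a t₀..m, F (t₀, x)
      = (∫ s in t₀..t, k s y) + ((∫ x in a t..y, F (t, x)) - ∫ x in a t₀..y, F (t₀, x)) := by
    rw [← hrect, ← intervalIntegral.integral_add_adjacent_intervals (hFi t (a t) y) (hFi t y m),
      ← intervalIntegral.integral_add_adjacent_intervals (hFi t₀ (a t₀) y) (hFi t₀ y m)]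
    ring
  have b1 : |(∫ s in t₀..t, k s y) - (t - t₀) * k t₀ (a t₀)| ≤ ε' * Δ := by
    have : (∫ s in t₀..t, k s y) - (t - t₀) * k t₀ (a t₀)
        = ∫ s in t₀..t, (k s y - k t₀ (a t₀)) := by
      rw [intervalIntegral.integral_sub (f := fun s => k s y)
        ((show Continuous fun s => k s y from hkc.comp (f := fun s => (s, y))
        (by fun_prop)).intervalIntegrable _ _) (by simp), intervalIntegral.integral_const,
        smul_eq_mul]
    rw [this, ← Real.norm_eq_abs]
    refine intervalIntegral.norm_integral_le_of_norm_le_const fun s hs => ?_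
    refine (near s y ?_ ?_).2.le
    · rcases le_total t₀ t with h | h
      · rw [uIoc_of_le h] at hs
        rw [hΔ, abs_of_nonneg (by linarith [hs.1]), abs_of_nonneg (by linarith)]; linarith [hs.2]
      · rw [uIoc_of_ge h] at hs
        rw [hΔ, abs_of_nonpos (by linarith [hs.2]), abs_of_nonpos (by linarith)]; linarith [hs.1]
    · rw [hy, add_sub_cancel_left, abs_of_nonneg hLΔ]
  have strip : ∀ s u, |s - t₀| ≤ Δ → |u - a t₀| ≤ L * Δ →
      |(∫ x in u..y, F (s, x)) - (y - u) * f₀| ≤ ε' * (2 * L * Δ) := by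
    intro s u hs hu
    have : (∫ x in u..y, F (s, x)) - (y - u) * f₀ = ∫ x in u..y, (F (s, x) - f₀) := by
      rw [intervalIntegral.integral_sub (hFi s u y) (by simp), intervalIntegral.integral_const,
        smul_eq_mul]
    rw [this, ← Real.norm_eq_abs]
    have hu' := abs_le.1 hu
    refine (intervalIntegral.norm_integral_le_of_norm_le_const (C := ε') fun x hx => ?_).trans ?_
    · refine (near s x hs ?_).1.le
      rw [uIoc_of_le (by linarith)] at hx
      rw [abs_le]; constructor <;> linarith [hx.1, hx.2]
    · refine mul_le_mul_of_nonneg_left ?_ hε'0.le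
      rw [abs_of_nonneg (by linarith)]; linarith
  have b2 := strip t (a t) le_rfl hat
  have b3 := strip t₀ (a t₀) (by simpa using hΔ0) (by simpa using hLΔ)
  have b4 : |(a t - a t₀ - (t - t₀) * a₁) * f₀| ≤ ε' * Δ := by
    rw [abs_mul]
    calc |a t - a t₀ - (t - t₀) * a₁| * |f₀|
        ≤ ε' / (|f₀| + 1) * Δ * (|f₀| + 1) :=
          mul_le_mul htd (by linarith) (abs_nonneg _) (by positivity)
      _ = ε' * Δ := by field_simp
  have hε2 : ε = ε' * (2 + 4 * L) := by rw [hε']; field_simp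
  have e2 : (∫ x in a t..m, F (t, x)) - (∫ x in a t₀..m, F (t₀, x)) - (t - t₀) •
      ((∫ x in a t₀..m, E (t₀, x)) + G (t₀, a t₀) - G (t₀, m) - a₁ * F (t₀, a t₀))
      = ((∫ s in t₀..t, k s y) - (t - t₀) * k t₀ (a t₀))
        + ((∫ x in a t..y, F (t, x)) - (y - a t) * f₀)
        - ((∫ x in a t₀..y, F (t₀, x)) - (y - a t₀) * f₀)
        - (a t - a t₀ - (t - t₀) * a₁) * f₀ := by
    rw [e1, smul_eq_mul]; simp only [hk, f₀]; ring
  rw [e2, Real.norm_eq_abs, Real.norm_eq_abs, ← hΔ, hε2]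
  have := abs_le.1 b1
  have := abs_le.1 b2
  have := abs_le.1 b3
  have := abs_le.1 b4
  rw [abs_le]
  constructor <;> linarith

theorem hasDerivAt_integral_upper {F G E : ℝ × ℝ → ℝ} (hF : Continuous F) (hG : Continuous G)
    (hE : Continuous E) {c : ℝ → ℝ} {c₁ t₀ m : ℝ} (hc : HasDerivAt c c₁ t₀)
    (hd : ∀ᶠ t in 𝓝 t₀, ∀ x ∈ Ioo m (c t), ∃ A B C D,
      HasFDerivAt F (gradForm A B) (t, x) ∧ HasFDerivAt G (gradForm C D) (t, x) ∧
        A + D = E (t, x)) (hmc : m < c t₀) :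
    HasDerivAt (fun t => ∫ x in m..c t, F (t, x))
      ((∫ x in m..c t₀, E (t₀, x)) + G (t₀, m) - G (t₀, c t₀) + c₁ * F (t₀, c t₀)) t₀ := by
  have hr : ∀ {K : ℝ × ℝ → ℝ} {A B t x : ℝ}, HasFDerivAt K (gradForm A B) (t, -x) →
      HasFDerivAt (fun P : ℝ × ℝ => K (P.1, -P.2)) (gradForm A (-B)) (t, x) := by
    intro K A B t x h
    have hn : HasFDerivAt (fun P : ℝ × ℝ => (P.1, -P.2))
        ((ContinuousLinearMap.fst ℝ ℝ ℝ).prod (-ContinuousLinearMap.snd ℝ ℝ ℝ)) (t, x) :=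
      hasFDerivAt_fst.prodMk hasFDerivAt_snd.neg
    have h' := HasFDerivAt.comp (t, x) (g := K) h hn
    convert! h' using 1
    ext <;> simp
  have h := hasDerivAt_integral_lower (F := fun P => F (P.1, -P.2)) (G := fun P => -G (P.1, -P.2))
    (E := fun P => E (P.1, -P.2)) (a := fun t => -c t) (a₁ := -c₁) (t₀ := t₀) (m := -m)
    (by fun_prop) (by fun_prop) (by fun_prop) hc.neg (by
      filter_upwards [hd] with t ht x hx
      obtain ⟨A, B, C, D, h1, h2, h3⟩ := ht (-x) ⟨by linarith [hx.2], by linarith [hx.1]⟩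
      exact ⟨A, -B, -C, D, hr h1, by
        have h5 := (hr h2).neg
        convert! h5 using 1
        ext <;> simp, h3⟩) (by linarith)
  have hcn : ∀ (K : ℝ × ℝ → ℝ) (s u v : ℝ), ∫ x in -v..-u, K (s, -x) = ∫ x in u..v, K (s, x) := by
    intro K s u v
    simpa using intervalIntegral.integral_comp_neg (a := -v) (b := -u) (fun x => K (s, x))
  simp only [hcn, neg_neg] at h
  convert! h using 1
  ring

/-- Differentiation of an integral between two moving end points, for a solution of
`F_t + G_x = E` that is continuous up to the two curves. -/
theorem hasDerivAt_integral_between {F G E : ℝ × ℝ → ℝ} {a c : ℝ → ℝ} {t₁ t₂ : ℝ}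
    (ha : ContinuousOn a (Icc t₁ t₂)) (hc : ContinuousOn c (Icc t₁ t₂))
    (hac : ∀ t ∈ Icc t₁ t₂, a t ≤ c t)
    (hF : ContinuousOn F {P | P.1 ∈ Icc t₁ t₂ ∧ a P.1 ≤ P.2 ∧ P.2 ≤ c P.1})
    (hG : ContinuousOn G {P | P.1 ∈ Icc t₁ t₂ ∧ a P.1 ≤ P.2 ∧ P.2 ≤ c P.1})
    (hE : ContinuousOn E {P | P.1 ∈ Icc t₁ t₂ ∧ a P.1 ≤ P.2 ∧ P.2 ≤ c P.1})
    (hd : ∀ t ∈ Ioo t₁ t₂, ∀ x ∈ Ioo (a t) (c t), ∃ A B C D,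
      HasFDerivAt F (gradForm A B) (t, x) ∧ HasFDerivAt G (gradForm C D) (t, x) ∧
        A + D = E (t, x))
    {t a₁ c₁ : ℝ} (ht : t ∈ Ioo t₁ t₂) (ha₁ : HasDerivAt a a₁ t) (hc₁ : HasDerivAt c c₁ t)
    (hlt : a t < c t) :
    HasDerivAt (fun s => ∫ x in a s..c s, F (s, x))
      ((∫ x in a t..c t, E (t, x)) + (G (t, a t) - a₁ * F (t, a t))
        - (G (t, c t) - c₁ * F (t, c t))) t := by
  have h12 : t₁ ≤ t₂ := ht.1.le.trans ht.2.le
  obtain ⟨F', hF', eF⟩ := exists_continuous_extension h12 ha hc hac hF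
  obtain ⟨G', hG', eG⟩ := exists_continuous_extension h12 ha hc hac hG
  obtain ⟨E', hE', eE⟩ := exists_continuous_extension h12 ha hc hac hE
  have htI : t ∈ Icc t₁ t₂ := Ioo_subset_Icc_self ht
  set m := (a t + c t) / 2 with hm
  have hnhd : ∀ᶠ s in 𝓝 t, s ∈ Ioo t₁ t₂ ∧ a s < m ∧ m < c s :=
    (isOpen_Ioo.eventually_mem ht).and ((ha₁.continuousAt.eventually_lt continuousAt_const
      (by linarith)).and (continuousAt_const.eventually_lt hc₁.continuousAt (by linarith)))
  -- near an interior point the extensions agree with the given functions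
  have hd' : ∀ s ∈ Ioo t₁ t₂, a s < m → m < c s → ∀ x ∈ Ioo (a s) (c s), ∃ A B C D,
      HasFDerivAt F' (gradForm A B) (s, x) ∧ HasFDerivAt G' (gradForm C D) (s, x) ∧
        A + D = E' (s, x) := by
    intro s hs _ _ x hx
    have hsn : Icc t₁ t₂ ∈ 𝓝 s := Icc_mem_nhds hs.1 hs.2
    have hev : ∀ᶠ P : ℝ × ℝ in 𝓝 (s, x), P.1 ∈ Icc t₁ t₂ ∧ P.2 ∈ Icc (a P.1) (c P.1) := by
      have h1 : ContinuousAt (fun P : ℝ × ℝ => a P.1) (s, x) :=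
        ContinuousAt.comp (f := Prod.fst) (g := a) (ha.continuousAt hsn) continuousAt_fst
      have h2 : ContinuousAt (fun P : ℝ × ℝ => c P.1) (s, x) :=
        ContinuousAt.comp (f := Prod.fst) (g := c) (hc.continuousAt hsn) continuousAt_fst
      have h3 : ContinuousAt (fun P : ℝ × ℝ => P.2) (s, x) := continuousAt_snd
      have h4 : ContinuousAt (fun P : ℝ × ℝ => P.1) (s, x) := continuousAt_fst
      filter_upwards [h1.eventually_lt h3 hx.1, h3.eventually_lt h2 hx.2, h4.eventually_mem hsn]
        with P p1 p2 p3 using ⟨p3, p1.le, p2.le⟩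
    obtain ⟨A, B, C, D, q1, q2, q3⟩ := hd s hs x hx
    refine ⟨A, B, C, D, q1.congr_of_eventuallyEq ?_, q2.congr_of_eventuallyEq ?_, ?_⟩
    · filter_upwards [hev] with P hP using eF P.1 hP.1 P.2 hP.2
    · filter_upwards [hev] with P hP using eG P.1 hP.1 P.2 hP.2
    · rw [q3, eE s (Ioo_subset_Icc_self hs) x (Ioo_subset_Icc_self hx)]
  have hlow := hasDerivAt_integral_lower hF' hG' hE' (m := m) ha₁ (by
    filter_upwards [hnhd] with s hs x hx
    exact hd' s hs.1 hs.2.1 hs.2.2 x ⟨hx.1, hx.2.trans hs.2.2⟩) (by linarith)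
  have hupp := hasDerivAt_integral_upper hF' hG' hE' (m := m) hc₁ (by
    filter_upwards [hnhd] with s hs x hx
    exact hd' s hs.1 hs.2.1 hs.2.2 x ⟨hs.2.1.trans hx.1, hx.2⟩) (by linarith)
  have hi : ∀ K : ℝ × ℝ → ℝ, Continuous K → ∀ s u v,
      IntervalIntegrable (fun x => K (s, x)) volume u v := fun K hK s u v =>
    (show Continuous fun x => K (s, x) by fun_prop).intervalIntegrable _ _
  have hsum := hlow.add hupp
  have e1 : (fun s => ∫ x in a s..c s, F (s, x)) =ᶠ[𝓝 t]
      (fun s => ∫ x in a s..m, F' (s, x)) + fun s => ∫ x in m..c s, F' (s, x) := by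
    filter_upwards [hnhd] with s hs
    simp only [Pi.add_apply]
    rw [intervalIntegral.integral_add_adjacent_intervals (hi F' hF' _ _ _) (hi F' hF' _ _ _)]
    refine intervalIntegral.integral_congr fun x hx => ?_
    rw [uIcc_of_le (by linarith [hs.2.1, hs.2.2])] at hx
    exact (eF s (Ioo_subset_Icc_self hs.1) x hx).symm
  have e2 : (∫ x in a t..c t, E (t, x)) = (∫ x in a t..m, E' (t, x)) + ∫ x in m..c t, E' (t, x) := by
    rw [intervalIntegral.integral_add_adjacent_intervals (hi E' hE' _ _ _) (hi E' hE' _ _ _)]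
    refine intervalIntegral.integral_congr fun x hx => ?_
    rw [uIcc_of_le hlt.le] at hx
    exact (eE t htI x hx).symm
  have l1 := eF t htI _ (left_mem_Icc.2 hlt.le)
  have l2 := eF t htI _ (right_mem_Icc.2 hlt.le)
  have l3 := eG t htI _ (left_mem_Icc.2 hlt.le)
  have l4 := eG t htI _ (right_mem_Icc.2 hlt.le)
  refine (hsum.congr_of_eventuallyEq e1).congr_deriv ?_
  rw [e2, ← l1, ← l2, ← l3, ← l4]
  ring

theorem continuousOn_integral_between {F : ℝ × ℝ → ℝ} {a c : ℝ → ℝ} {t₁ t₂ : ℝ} (h12 : t₁ ≤ t₂)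
    (ha : ContinuousOn a (Icc t₁ t₂)) (hc : ContinuousOn c (Icc t₁ t₂))
    (hac : ∀ t ∈ Icc t₁ t₂, a t ≤ c t)
    (hF : ContinuousOn F {P | P.1 ∈ Icc t₁ t₂ ∧ a P.1 ≤ P.2 ∧ P.2 ≤ c P.1}) :
    ContinuousOn (fun s => ∫ x in a s..c s, F (s, x)) (Icc t₁ t₂) := by
  obtain ⟨F', hF', eF⟩ := exists_continuous_extension h12 ha hc hac hF
  have h1 : Continuous fun P : ℝ × ℝ => ∫ x in (0 : ℝ)..P.2, F' (P.1, x) :=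
    intervalIntegral.continuous_parametric_primitive_of_continuous (f := fun t x => F' (t, x)) hF'
  have h2 : ContinuousOn (fun s => (∫ x in (0 : ℝ)..c s, F' (s, x)) - ∫ x in (0 : ℝ)..a s, F' (s, x))
      (Icc t₁ t₂) :=
    (h1.comp_continuousOn (continuousOn_id.prodMk hc)).sub
      (h1.comp_continuousOn (continuousOn_id.prodMk ha))
  refine h2.congr fun s hs => ?_
  have hi : ∀ u v, IntervalIntegrable (fun x => F' (s, x)) volume u v := fun u v =>
    (show Continuous fun x => F' (s, x) by fun_prop).intervalIntegrable _ _
  simp only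
  rw [intervalIntegral.integral_interval_sub_left (hi _ _) (hi _ _)]
  refine intervalIntegral.integral_congr fun x hx => ?_
  rw [uIcc_of_le (hac s hs)] at hx
  exact (eF s hs x hx).symm

end Chaplygin

namespace Chaplygin

/-! ### Riemann invariants in characteristic coordinates -/

/-- The Riemann invariants of the data near a cusp, in characteristic coordinates. The fast
characteristics are the lines `p = const` and carry `λ₋ = lm p`; the slow characteristics are the
lines `q = const` and carry `λ₊ = lp q`. The two meet at the time `t = q - p`, at the place
`x = H q + G p`. The cusp is at `(p₀, q₀)`; everything takes place for `p` and `q` in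
`(p₀ - δ, q₀ + δ)`. The numbers `κ` and `c` stand for `-lm' p₀ = -lp' q₀` and
`lp'' q₀ - lm'' p₀`: what is needed of the second order expansion at the cusp is kept in the form
of the two-sided bounds `est_left` and `est_right` on `lp q - lm p`. -/
structure CuspDatum where
  lm : ℝ → ℝ
  lp : ℝ → ℝ
  H : ℝ → ℝ
  G : ℝ → ℝ
  p₀ : ℝ
  q₀ : ℝ
  δ : ℝ
  κ : ℝ
  c : ℝ
  p₀_lt_q₀ : p₀ < q₀
  δ_pos : 0 < δ
  κ_pos : 0 < κ
  c_pos : 0 < c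
  hasDerivAt_H : ∀ q ∈ Ioo (p₀ - δ) (q₀ + δ), HasDerivAt H (lp q) q
  hasDerivAt_G : ∀ p ∈ Ioo (p₀ - δ) (q₀ + δ), HasDerivAt G (-lm p) p
  contDiff_lm : ContDiffOn ℝ 1 lm (Ioo (p₀ - δ) (q₀ + δ))
  contDiff_lp : ContDiffOn ℝ 1 lp (Ioo (p₀ - δ) (q₀ + δ))
  meet : lm p₀ = lp q₀
  anti_lm : StrictAntiOn lm (Ioo (p₀ - δ) (q₀ + δ))
  anti_lp : StrictAntiOn lp (Ioo (p₀ - δ) (q₀ + δ))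
  pos : ∀ p ∈ Ioo (p₀ - δ) (q₀ + δ), ∀ q ∈ Ioo (p₀ - δ) (q₀ + δ), q - p < q₀ - p₀ → lm p < lp q
  est_left : ∀ ξ η, -δ < ξ → ξ ≤ η → η < δ →
    9 / 20 * c * ξ ^ 2 - 11 / 10 * κ * (η - ξ) ≤ lp (q₀ + η) - lm (p₀ + ξ) ∧
    lp (q₀ + η) - lm (p₀ + ξ) ≤ 11 / 20 * c * ξ ^ 2 - 9 / 10 * κ * (η - ξ)
  est_right : ∀ ξ η, -δ < ξ → ξ ≤ η → η < δ →
    9 / 20 * c * η ^ 2 - 11 / 10 * κ * (η - ξ) ≤ lp (q₀ + η) - lm (p₀ + ξ) ∧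
    lp (q₀ + η) - lm (p₀ + ξ) ≤ 11 / 20 * c * η ^ 2 - 9 / 10 * κ * (η - ξ)
  lip_lm : ∀ ξ, |ξ| < δ → |lm (p₀ + ξ) - lm p₀| ≤ 2 * κ * |ξ|
  lip_lp : ∀ η, |η| < δ → |lp (q₀ + η) - lp q₀| ≤ 2 * κ * |η|
  seg_left : ∀ p p' t, p₀ - δ < p → p ≤ p' → p' < p₀ → p' + t < q₀ + δ → q₀ - p₀ ≤ t →
    lm p' < lp (p' + t) → lm p < lp (p + t)
  seg_right : ∀ q q' t, q₀ < q' → q' ≤ q → q < q₀ + δ → p₀ - δ < q' - t → q₀ - p₀ ≤ t →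
    lm (q' - t) < lp q' → lm (q - t) < lp q

namespace CuspDatum

variable (D : CuspDatum)

/-- The range of the characteristic coordinates. -/
def B : Set ℝ := Ioo (D.p₀ - D.δ) (D.q₀ + D.δ)

/-- The blowup time. -/
def t₀ : ℝ := D.q₀ - D.p₀

/-- The place of the blowup. -/
def x₀ : ℝ := D.H D.q₀ + D.G D.p₀

/-- The velocity at the blowup. -/
def v₀ : ℝ := D.lm D.p₀

/-- The place at time `t` on the fast characteristic labelled `p`, for `P = (t, p)`. -/
def Y (P : ℝ × ℝ) : ℝ := D.H (P.2 + P.1) + D.G P.2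

theorem t₀_pos : 0 < D.t₀ := sub_pos.2 D.p₀_lt_q₀

theorem isOpen_B : IsOpen D.B := isOpen_Ioo

theorem p₀_mem : D.p₀ ∈ D.B := by
  have := D.p₀_lt_q₀; have := D.δ_pos
  constructor <;> linarith

theorem q₀_mem : D.q₀ ∈ D.B := by
  have := D.p₀_lt_q₀; have := D.δ_pos
  constructor <;> linarith

theorem mem_B_of_mem_Icc {p q r : ℝ} (hp : p ∈ D.B) (hq : q ∈ D.B) (h1 : p ≤ r) (h2 : r ≤ q) :
    r ∈ D.B := ⟨hp.1.trans_le h1, h2.trans_lt hq.2⟩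

theorem contDiffAt_lm {p : ℝ} (hp : p ∈ D.B) : ContDiffAt ℝ 1 D.lm p :=
  D.contDiff_lm.contDiffAt (D.isOpen_B.mem_nhds hp)

theorem contDiffAt_lp {p : ℝ} (hp : p ∈ D.B) : ContDiffAt ℝ 1 D.lp p :=
  D.contDiff_lp.contDiffAt (D.isOpen_B.mem_nhds hp)

/-- The reflection `x ↦ -x`, which exchanges the two families of characteristics. -/
def reflect : CuspDatum where
  lm p := -D.lp (-p)
  lp q := -D.lm (-q)
  H q := -D.G (-q)
  G p := -D.H (-p)
  p₀ := -D.q₀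
  q₀ := -D.p₀
  δ := D.δ
  κ := D.κ
  c := D.c
  p₀_lt_q₀ := neg_lt_neg D.p₀_lt_q₀
  δ_pos := D.δ_pos
  κ_pos := D.κ_pos
  c_pos := D.c_pos
  hasDerivAt_H q hq := by
    have h := (D.hasDerivAt_G (-q) ⟨by linarith [hq.2], by linarith [hq.1]⟩).scomp q
      (hasDerivAt_neg q)
    exact h.neg.congr_deriv (by simp)
  hasDerivAt_G q hq := by
    have h := (D.hasDerivAt_H (-q) ⟨by linarith [hq.2], by linarith [hq.1]⟩).scomp q
      (hasDerivAt_neg q)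
    exact h.neg.congr_deriv (by simp)
  contDiff_lm := (D.contDiff_lp.comp contDiff_neg.contDiffOn fun q hq =>
    ⟨by linarith [hq.2], by linarith [hq.1]⟩).neg
  contDiff_lp := (D.contDiff_lm.comp contDiff_neg.contDiffOn fun q hq =>
    ⟨by linarith [hq.2], by linarith [hq.1]⟩).neg
  meet := by simp [D.meet]
  anti_lm p hp q hq h := neg_lt_neg <| D.anti_lp (a := -q) (b := -p)
    ⟨by linarith [hq.2], by linarith [hq.1]⟩ ⟨by linarith [hp.2], by linarith [hp.1]⟩ (by linarith)
  anti_lp p hp q hq h := neg_lt_neg <| D.anti_lm (a := -q) (b := -p)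
    ⟨by linarith [hq.2], by linarith [hq.1]⟩ ⟨by linarith [hp.2], by linarith [hp.1]⟩ (by linarith)
  pos p hp q hq h := neg_lt_neg <| D.pos (-q)
    ⟨by linarith [hq.2], by linarith [hq.1]⟩ (-p) ⟨by linarith [hp.2], by linarith [hp.1]⟩
    (by linarith)
  est_left ξ η h1 h2 h3 := by
    have h := D.est_right (-η) (-ξ) (by linarith) (by linarith) (by linarith)
    rw [show -(-D.p₀ + η) = D.p₀ + -η by ring, show -(-D.q₀ + ξ) = D.q₀ + -ξ by ring]
    constructor <;> nlinarith [h.1, h.2]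
  est_right ξ η h1 h2 h3 := by
    have h := D.est_left (-η) (-ξ) (by linarith) (by linarith) (by linarith)
    rw [show -(-D.p₀ + η) = D.p₀ + -η by ring, show -(-D.q₀ + ξ) = D.q₀ + -ξ by ring]
    constructor <;> nlinarith [h.1, h.2]
  lip_lm ξ h := by
    have h := D.lip_lp (-ξ) (by rwa [abs_neg])
    rw [abs_neg, abs_sub_comm] at h
    rw [show -(-D.q₀ + ξ) = D.q₀ + -ξ by ring, neg_neg, neg_sub_neg]
    exact h
  lip_lp ξ h := by
    have h := D.lip_lm (-ξ) (by rwa [abs_neg])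
    rw [abs_neg, abs_sub_comm] at h
    rw [show -(-D.p₀ + ξ) = D.p₀ + -ξ by ring, neg_neg, neg_sub_neg]
    exact h
  seg_left p p' t h1 h2 h3 h4 h5 h6 := by
    have h := D.seg_right (-p) (-p') t (by linarith) (by linarith) (by linarith) (by linarith)
      (by linarith) (by rw [show -p' - t = -(p' + t) by ring]; linarith)
    rw [show -p - t = -(p + t) by ring] at h
    linarith
  seg_right p p' t h1 h2 h3 h4 h5 h6 := by
    have h := D.seg_left (-p) (-p') t (by linarith) (by linarith) (by linarith) (by linarith)
      (by linarith) (by rw [show -p' + t = -(p' - t) by ring]; linarith)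
    rw [show -p + t = -(p - t) by ring] at h
    linarith

@[simp] theorem reflect_t₀ : D.reflect.t₀ = D.t₀ := by simp [t₀, reflect]; ring

@[simp] theorem reflect_x₀ : D.reflect.x₀ = -D.x₀ := by simp [x₀, reflect]

@[simp] theorem reflect_v₀ : D.reflect.v₀ = -D.v₀ := by simp [v₀, reflect, D.meet]

theorem reflect_reflect : D.reflect.reflect = D := by
  cases D; simp [reflect]

theorem mem_reflect_B {p : ℝ} : p ∈ D.reflect.B ↔ -p ∈ D.B := by
  simp only [B, reflect, mem_Ioo]
  constructor <;> rintro ⟨h1, h2⟩ <;> constructor <;> linarith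

theorem reflect_Y (t p : ℝ) : D.reflect.Y (t, -(p + t)) = -D.Y (t, p) := by
  simp [Y, reflect]

/-- The states `(t, p)` on the left of the discontinuity: up to the blowup time all of the
characteristic triangle, from then on only the part to the left of the cusp in which the
characteristics have not focussed yet. The labels are allowed to exceed those of the initial
interval, so that the set is open. -/
def U : Set (ℝ × ℝ) :=
  {P | P.2 ∈ D.B ∧ P.2 + P.1 ∈ D.B ∧ (P.1 < D.t₀ ∨ P.2 < D.p₀) ∧ D.lm P.2 < D.lp (P.2 + P.1)}

theorem isOpen_U : IsOpen D.U := by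
  have h1 : IsOpen {P : ℝ × ℝ | P.2 ∈ D.B ∧ P.2 + P.1 ∈ D.B} :=
    (D.isOpen_B.preimage continuous_snd).inter
      (D.isOpen_B.preimage (continuous_snd.add continuous_fst))
  have h2 : IsOpen {P : ℝ × ℝ | P.1 < D.t₀ ∨ P.2 < D.p₀} :=
    (isOpen_lt continuous_fst continuous_const).union (isOpen_lt continuous_snd continuous_const)
  have h3 : ContinuousOn (fun P : ℝ × ℝ => D.lp (P.2 + P.1) - D.lm P.2)
      {P : ℝ × ℝ | P.2 ∈ D.B ∧ P.2 + P.1 ∈ D.B} :=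
    (D.contDiff_lp.continuousOn.comp (by fun_prop) fun P hP => hP.2).sub
      (D.contDiff_lm.continuousOn.comp (by fun_prop) fun P hP => hP.1)
  have h4 := (h3.isOpen_inter_preimage h1 isOpen_Ioi (t := Ioi 0)).inter h2
  convert! h4 using 1
  ext P
  simp only [U, mem_ofPred_eq, mem_inter_iff, mem_preimage, mem_Ioi, sub_pos]
  tauto

theorem hasFDerivAt_Y {P : ℝ × ℝ} (h1 : P.2 ∈ D.B) (h2 : P.2 + P.1 ∈ D.B) :
    HasFDerivAt D.Y (gradForm (D.lp (P.2 + P.1)) (D.lp (P.2 + P.1) - D.lm P.2)) P := by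
  have ha : HasFDerivAt (fun P : ℝ × ℝ => P.2 + P.1)
      (ContinuousLinearMap.snd ℝ ℝ ℝ + ContinuousLinearMap.fst ℝ ℝ ℝ) P :=
    hasFDerivAt_snd.add hasFDerivAt_fst
  have h3 := (D.hasDerivAt_H _ h2).comp_hasFDerivAt P ha
  have h4 := (D.hasDerivAt_G _ h1).comp_hasFDerivAt P
    (hasFDerivAt_snd (𝕜 := ℝ) (E := ℝ) (F := ℝ) (p := P))
  have h := h3.add h4
  convert! h using 1
  ext <;> simp
  ring

theorem hasDerivAt_Y_p {t p : ℝ} (h1 : p ∈ D.B) (h2 : p + t ∈ D.B) :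
    HasDerivAt (fun p => D.Y (t, p)) (D.lp (p + t) - D.lm p) p :=
  hasFDerivAt_partial_x (D.hasFDerivAt_Y (P := (t, p)) h1 h2)

theorem hasDerivAt_Y_t {t p : ℝ} (h1 : p ∈ D.B) (h2 : p + t ∈ D.B) :
    HasDerivAt (fun t => D.Y (t, p)) (D.lp (p + t)) t :=
  hasFDerivAt_partial_t (D.hasFDerivAt_Y (P := (t, p)) h1 h2)

/-- At a fixed time, the labels of the left states form an interval. -/
theorem U_ordConnected {t p p' r : ℝ} (hp : (t, p) ∈ D.U) (hp' : (t, p') ∈ D.U) (h1 : p ≤ r)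
    (h2 : r ≤ p') : (t, r) ∈ D.U := by
  have hr : r ∈ D.B := D.mem_B_of_mem_Icc hp.1 hp'.1 h1 h2
  have hrt : r + t ∈ D.B := D.mem_B_of_mem_Icc hp.2.1 hp'.2.1 (by simpa) (by simpa)
  rcases lt_or_ge t D.t₀ with ht | ht
  · exact ⟨hr, hrt, Or.inl ht, D.pos _ hr _ hrt (by simpa [t₀] using ht)⟩
  · have h3 : p' < D.p₀ := hp'.2.2.1.resolve_left (by simpa using ht)
    exact ⟨hr, hrt, Or.inr (h2.trans_lt h3), D.seg_left r p' t hr.1 h2 h3 hp'.2.1.2 ht hp'.2.2.2⟩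

theorem Y_lt_Y {t p p' : ℝ} (hp : (t, p) ∈ D.U) (hp' : (t, p') ∈ D.U) (h : p < p') :
    D.Y (t, p) < D.Y (t, p') := by
  have hU : ∀ r ∈ Icc p p', (t, r) ∈ D.U := fun r hr => D.U_ordConnected hp hp' hr.1 hr.2
  have hd : ∀ r ∈ Icc p p', HasDerivAt (fun r => D.Y (t, r)) (D.lp (r + t) - D.lm r) r :=
    fun r hr => D.hasDerivAt_Y_p (hU r hr).1 (hU r hr).2.1
  refine strictMonoOn_of_deriv_pos (convex_Icc p p')
    (fun r hr => (hd r hr).continuousAt.continuousWithinAt) (fun r hr => ?_)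
    (left_mem_Icc.2 h.le) (right_mem_Icc.2 h.le) h
  rw [interior_Icc] at hr
  rw [(hd r (Ioo_subset_Icc_self hr)).deriv]
  exact sub_pos.2 (hU r (Ioo_subset_Icc_self hr)).2.2.2

theorem Y_injOn {u u' : ℝ × ℝ} (hu : u ∈ D.U) (hu' : u' ∈ D.U) (h1 : u.1 = u'.1)
    (h2 : D.Y u = D.Y u') : u = u' := by
  obtain ⟨t, p⟩ := u
  obtain ⟨t', p'⟩ := u'
  obtain rfl : t = t' := h1
  rcases lt_trichotomy p p' with h | h | h
  · exact absurd h2 (D.Y_lt_Y hu hu' h).ne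
  · rw [h]
  · exact absurd h2 (D.Y_lt_Y hu' hu h).ne'

theorem exists_label : ∃ π : ℝ × ℝ → ℝ, ∀ u ∈ D.U, π (u.1, D.Y u) = u.2 ∧
    ContDiffAt ℝ 1 π (u.1, D.Y u) ∧
    HasFDerivAt π (gradForm (-(D.lp (u.2 + u.1)) / (D.lp (u.2 + u.1) - D.lm u.2))
      (1 / (D.lp (u.2 + u.1) - D.lm u.2))) (u.1, D.Y u) ∧
    ∀ᶠ z in 𝓝 (u.1, D.Y u), (z.1, π z) ∈ D.U ∧ D.Y (z.1, π z) = z.2 := by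
  have h3 : ContinuousOn (fun P : ℝ × ℝ => D.lp (P.2 + P.1)) D.U :=
    D.contDiff_lp.continuousOn.comp (by fun_prop) fun P hP => hP.2.1
  have h4 : ContinuousOn (fun P : ℝ × ℝ => D.lm P.2) D.U :=
    D.contDiff_lm.continuousOn.comp (by fun_prop) fun P hP => hP.1
  exact exists_fiber_inverse D.isOpen_U (fun u hu => D.hasFDerivAt_Y hu.1 hu.2.1)
    h3 (h3.sub h4) (fun u hu => sub_pos.2 hu.2.2.2)
    (fun u hu u' hu' => D.Y_injOn hu hu')

/-- The label `p` of the fast characteristic through the point `(t, x)` of the left state. -/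
noncomputable def label : ℝ × ℝ → ℝ := D.exists_label.choose

theorem label_Y {t p : ℝ} (h : (t, p) ∈ D.U) : D.label (t, D.Y (t, p)) = p :=
  (D.exists_label.choose_spec _ h).1

theorem contDiffAt_label {t p : ℝ} (h : (t, p) ∈ D.U) : ContDiffAt ℝ 1 D.label (t, D.Y (t, p)) :=
  (D.exists_label.choose_spec _ h).2.1

theorem hasFDerivAt_label {t p : ℝ} (h : (t, p) ∈ D.U) :
    HasFDerivAt D.label (gradForm (-(D.lp (p + t)) / (D.lp (p + t) - D.lm p))
      (1 / (D.lp (p + t) - D.lm p))) (t, D.Y (t, p)) :=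
  (D.exists_label.choose_spec _ h).2.2.1

/-- The slow speed `λ₋` of the left state. -/
noncomputable def gm (z : ℝ × ℝ) : ℝ := D.lm (D.label z)

/-- The fast speed `λ₊` of the left state. -/
noncomputable def gp (z : ℝ × ℝ) : ℝ := D.lp (D.label z + z.1)

theorem gm_Y {t p : ℝ} (h : (t, p) ∈ D.U) : D.gm (t, D.Y (t, p)) = D.lm p := by
  rw [gm, D.label_Y h]

theorem gp_Y {t p : ℝ} (h : (t, p) ∈ D.U) : D.gp (t, D.Y (t, p)) = D.lp (p + t) := by
  rw [gp, D.label_Y h]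

theorem contDiffAt_gm {t p : ℝ} (h : (t, p) ∈ D.U) : ContDiffAt ℝ 1 D.gm (t, D.Y (t, p)) := by
  refine ContDiffAt.comp (t, D.Y (t, p)) (g := D.lm) ?_ (D.contDiffAt_label h)
  rw [D.label_Y h]; exact D.contDiffAt_lm h.1

theorem contDiffAt_gp {t p : ℝ} (h : (t, p) ∈ D.U) : ContDiffAt ℝ 1 D.gp (t, D.Y (t, p)) := by
  refine ContDiffAt.comp (t, D.Y (t, p)) (g := D.lp) (f := fun z => D.label z + z.1) ?_
    ((D.contDiffAt_label h).add contDiffAt_fst)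
  simp only [D.label_Y h]; exact D.contDiffAt_lp h.2.1

/-- The Riemann invariants are transported along the characteristics of the other family. -/
theorem transport_gm_gp {t p : ℝ} (h : (t, p) ∈ D.U) : ∃ A B C E,
    HasFDerivAt D.gm (gradForm A B) (t, D.Y (t, p)) ∧
    HasFDerivAt D.gp (gradForm C E) (t, D.Y (t, p)) ∧
    A + D.gp (t, D.Y (t, p)) * B = 0 ∧ C + D.gm (t, D.Y (t, p)) * E = 0 := by
  have hl := D.hasFDerivAt_label h
  have h1 := ((D.contDiffAt_lm h.1).differentiableAt one_ne_zero).hasDerivAt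
  have h2 := ((D.contDiffAt_lp h.2.1).differentiableAt one_ne_zero).hasDerivAt
  have hne : D.lp (p + t) - D.lm p ≠ 0 := (sub_pos.2 h.2.2.2).ne'
  rw [← D.label_Y h] at h1
  have h3 := h1.comp_hasFDerivAt (t, D.Y (t, p)) hl
  have h5 := hl.add (hasFDerivAt_fst (𝕜 := ℝ) (p := (t, D.Y (t, p))))
  have h6 : D.label (t, D.Y (t, p)) + t = p + t := by rw [D.label_Y h]
  have h4 := HasDerivAt.comp_hasFDerivAt (h₂ := D.lp) (h₂' := deriv D.lp (p + t))
    (f := fun z => D.label z + z.1) (t, D.Y (t, p)) (by simp only [h6]; exact h2) h5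
  rw [eq_gradForm (_ • gradForm _ _)] at h3
  rw [eq_gradForm (_ • (_ + _))] at h4
  refine ⟨_, _, _, _, h3, h4, ?_, ?_⟩
  · rw [D.gp_Y h]; simp; field_simp; ring
  · rw [D.gm_Y h]; simp; field_simp; ring

end CuspDatum

end Chaplygin

namespace Chaplygin

/-! ### Mass labels on one half of a solution -/

/-- The left domain of a `δ`-shock, with its boundary but without the blowup point, in terms of its
lateral boundaries `a`, `b` and the discontinuity `X`. -/
def leftSet (a b X : ℝ → ℝ) (t₀ x₀ T : ℝ) : Set (ℝ × ℝ) :=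
  {P | 0 ≤ P.1 ∧ P.1 < t₀ + T ∧ a P.1 ≤ P.2 ∧ (P.1 < t₀ → P.2 ≤ b P.1) ∧
    (t₀ ≤ P.1 → P.2 ≤ X P.1) ∧ P ≠ (t₀, x₀)}

/-- The open left domain. -/
def leftOpen (a b X : ℝ → ℝ) (t₀ T : ℝ) : Set (ℝ × ℝ) :=
  {P | 0 < P.1 ∧ P.1 < t₀ + T ∧ a P.1 < P.2 ∧ (P.1 < t₀ → P.2 < b P.1) ∧
    (t₀ ≤ P.1 → P.2 < X P.1)}

/-- The right end of the left domain at the time `t`. -/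
noncomputable def rightEnd (b X : ℝ → ℝ) (t₀ t : ℝ) : ℝ := if t < t₀ then b t else X t

theorem mem_leftOpen_iff {a b X : ℝ → ℝ} {t₀ T t x : ℝ} :
    (t, x) ∈ leftOpen a b X t₀ T ↔ 0 < t ∧ t < t₀ + T ∧ a t < x ∧ x < rightEnd b X t₀ t := by
  unfold leftOpen rightEnd
  simp only [mem_ofPred_eq]
  split_ifs with h
  · simp [h, not_le.2 h]
  · simp [h, not_lt.1 h]

theorem mem_leftSet_iff {a b X : ℝ → ℝ} {t₀ x₀ T t x : ℝ} :
    (t, x) ∈ leftSet a b X t₀ x₀ T ↔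
      0 ≤ t ∧ t < t₀ + T ∧ a t ≤ x ∧ x ≤ rightEnd b X t₀ t ∧ (t, x) ≠ (t₀, x₀) := by
  unfold leftSet rightEnd
  simp only [mem_ofPred_eq]
  split_ifs with h
  · simp [h, not_le.2 h]
  · simp [h, not_lt.1 h]

/-- Points of the open left domain stay in it for nearby times. At the time `t₀` this uses `X < b`,
as the right end is `b` just before that time and `X` from then on. -/
theorem eventually_slice {a b X : ℝ → ℝ} {t₀ T t x : ℝ}
    (ha : ContinuousOn a (Ico 0 (t₀ + T))) (hb : ContinuousOn b (Ico 0 (t₀ + T)))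
    (hX : ContinuousOn X (Ico t₀ (t₀ + T))) (hXb : ∀ t ∈ Ico t₀ (t₀ + T), X t < b t)
    (hx : (t, x) ∈ leftOpen a b X t₀ T) : ∀ᶠ s in 𝓝 t, (s, x) ∈ leftOpen a b X t₀ T := by
  rw [mem_leftOpen_iff] at hx
  obtain ⟨h1, h2, h3, h4⟩ := hx
  have ha : ∀ᶠ s in 𝓝 t, a s < x :=
    (ha.continuousAt (Ico_mem_nhds h1 h2)).eventually_lt continuousAt_const h3
  have hb : ContinuousAt b t := hb.continuousAt (Ico_mem_nhds h1 h2)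
  have he : ∀ᶠ s in 𝓝 t, x < rightEnd b X t₀ s := by
    unfold rightEnd at h4 ⊢
    rcases lt_trichotomy t t₀ with ht | ht | ht
    · rw [if_pos ht] at h4
      filter_upwards [eventually_lt_nhds ht, continuousAt_const.eventually_lt hb h4] with s hs hs'
      rwa [if_pos hs]
    · rw [if_neg (by simp [ht])] at h4
      have hXb := hXb t ⟨ht.ge, h2⟩
      have hX : ContinuousWithinAt X (Ici t₀) t :=
        (hX t ⟨ht.ge, h2⟩).mono_of_mem_nhdsWithin (by
          subst ht; exact Ico_mem_nhdsGE h2)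
      have hX' : ∀ᶠ s in 𝓝[Ici t₀] t, x < X s :=
        (tendsto_const_nhds.eventually_lt hX h4)
      rw [eventually_nhdsWithin_iff] at hX'
      filter_upwards [hX', continuousAt_const.eventually_lt hb (h4.trans hXb)] with s hs hs'
      split_ifs with hst
      · exact hs'
      · exact hs (not_lt.1 hst)
    · rw [if_neg (not_lt.2 ht.le)] at h4
      have hX : ContinuousAt X t := hX.continuousAt (Ico_mem_nhds ht h2)
      filter_upwards [eventually_gt_nhds ht, continuousAt_const.eventually_lt hX h4] with s hs hs'
      rwa [if_neg (not_lt.2 (le_of_lt hs))]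
  filter_upwards [ha, he, eventually_gt_nhds h1, eventually_lt_nhds h2] with s k1 k2 k3 k4
  rw [mem_leftOpen_iff]
  exact ⟨k3, k4, k1, k2⟩

theorem isOpen_leftOpen {a b X : ℝ → ℝ} {t₀ T : ℝ}
    (ha : ContinuousOn a (Ico 0 (t₀ + T))) (hb : ContinuousOn b (Ico 0 (t₀ + T)))
    (hX : ContinuousOn X (Ico t₀ (t₀ + T))) (hXb : ∀ t ∈ Ico t₀ (t₀ + T), X t < b t) :
    IsOpen (leftOpen a b X t₀ T) := by
  rw [isOpen_iff_mem_nhds]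
  rintro ⟨t, x⟩ hx
  have hx' := mem_leftOpen_iff.1 hx
  obtain ⟨x₁, h1, h2⟩ := exists_between hx'.2.2.1
  obtain ⟨x₂, h3, h4⟩ := exists_between hx'.2.2.2
  have e1 := eventually_slice ha hb hX hXb (t := t) (x := x₁)
    (mem_leftOpen_iff.2 ⟨hx'.1, hx'.2.1, h1, h2.trans hx'.2.2.2⟩)
  have e2 := eventually_slice ha hb hX hXb (t := t) (x := x₂)
    (mem_leftOpen_iff.2 ⟨hx'.1, hx'.2.1, hx'.2.2.1.trans h3, h4⟩)
  have e3 : ∀ᶠ y in 𝓝 x, x₁ < y ∧ y < x₂ := (eventually_gt_nhds h2).and (eventually_lt_nhds h3)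
  rw [nhds_prod_eq]
  filter_upwards [(e1.and e2).prod_mk e3] with P hP
  have k1 := mem_leftOpen_iff.1 hP.1.1
  have k2 := mem_leftOpen_iff.1 hP.1.2
  exact mem_leftOpen_iff.2 ⟨k1.1, k1.2.1, k1.2.2.1.trans hP.2.1, hP.2.2.trans k2.2.2.2⟩

theorem eq_of_hasDerivAt_zero {f : ℝ → ℝ} {a b : ℝ} (hab : a ≤ b) (hf : ContinuousOn f (Icc a b))
    (hf' : ∀ x ∈ Ioo a b, HasDerivAt f 0 x) : f b = f a := by
  rcases hab.eq_or_lt with rfl | hab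
  · rfl
  · obtain ⟨c, -, hc⟩ := exists_hasDerivAt_eq_slope f (fun _ => 0) hab hf hf'
    have : b - a ≠ 0 := (sub_pos.2 hab).ne'
    field_simp at hc
    linarith

/-- The left half of an arbitrary solution with one `δ`-shock, in terms of its Riemann invariants
`gm = λ₋` and `gp = λ₊`: they are transported along the characteristics, they have the initial
values prescribed by `D`, and they satisfy the entropy condition at the discontinuity `X`. -/
structure LeftState (D : CuspDatum) (p₁ q₂ T : ℝ) (gm gp : ℝ × ℝ → ℝ) (a b X v : ℝ → ℝ) :
    Prop where
  p₁_mem : p₁ ∈ Ioo (D.p₀ - D.δ) D.p₀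
  q₂_mem : q₂ ∈ Ioo D.q₀ (D.q₀ + D.δ)
  T_pos : 0 < T
  a_zero : a 0 = D.Y (0, p₁)
  b_zero : b 0 = D.Y (0, q₂)
  a_char : ∀ t ∈ Ico 0 (D.t₀ + T), HasDerivWithinAt a (gp (t, a t)) (Ico 0 (D.t₀ + T)) t
  b_char : ∀ t ∈ Ico 0 D.t₀, HasDerivWithinAt b (gm (t, b t)) (Ico 0 (D.t₀ + T)) t
  b_cont : ContinuousOn b (Ico 0 (D.t₀ + T))
  a_lt_b : ∀ t ∈ Ico 0 D.t₀, a t < b t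
  a_lt_X : ∀ t ∈ Ico D.t₀ (D.t₀ + T), a t < X t
  X_lt_b : ∀ t ∈ Ico D.t₀ (D.t₀ + T), X t < b t
  X_start : X D.t₀ = D.x₀
  X_speed : ∀ t ∈ Ico D.t₀ (D.t₀ + T), HasDerivWithinAt X (v t) (Ico D.t₀ (D.t₀ + T)) t
  v_le : ∀ t ∈ Ioo D.t₀ (D.t₀ + T), v t ≤ gm (t, X t)
  gm_cont : ContinuousOn gm (leftSet a b X D.t₀ D.x₀ T)
  gp_cont : ContinuousOn gp (leftSet a b X D.t₀ D.x₀ T)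
  gm_lt_gp : ∀ P ∈ leftSet a b X D.t₀ D.x₀ T, gm P < gp P
  transport : ∀ P ∈ leftOpen a b X D.t₀ T, ∃ A B C E, HasFDerivAt gm (gradForm A B) P ∧
    HasFDerivAt gp (gradForm C E) P ∧ A + gp P * B = 0 ∧ C + gm P * E = 0
  init : ∀ p ∈ Icc p₁ q₂, gm (0, D.Y (0, p)) = D.lm p ∧ gp (0, D.Y (0, p)) = D.lp p
  blowup_gm : Tendsto gm (𝓝[leftSet a b X D.t₀ D.x₀ T] (D.t₀, D.x₀)) (𝓝 D.v₀)
  blowup_gp : Tendsto gp (𝓝[leftSet a b X D.t₀ D.x₀ T] (D.t₀, D.x₀)) (𝓝 D.v₀)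

namespace LeftState

variable {D : CuspDatum} {p₁ q₂ T : ℝ} {gm gp : ℝ × ℝ → ℝ} {a b X v : ℝ → ℝ}

/-- The Lagrangian label of the fast characteristic through a point: `p₁` plus the (normalised)
mass `∫ ρ / (2 μ)` between the left boundary and the point. -/
noncomputable def pot (p₁ : ℝ) (gm gp : ℝ × ℝ → ℝ) (a : ℝ → ℝ) (P : ℝ × ℝ) : ℝ :=
  p₁ + ∫ y in a P.1..P.2, (gp (P.1, y) - gm (P.1, y))⁻¹

theorem continuousOn_a (h : LeftState D p₁ q₂ T gm gp a b X v) :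
    ContinuousOn a (Ico 0 (D.t₀ + T)) := fun t ht => (h.a_char t ht).continuousWithinAt

theorem hasDerivAt_a (h : LeftState D p₁ q₂ T gm gp a b X v) {t : ℝ} (h1 : 0 < t)
    (h2 : t < D.t₀ + T) : HasDerivAt a (gp (t, a t)) t :=
  (h.a_char t ⟨h1.le, h2⟩).hasDerivAt (Ico_mem_nhds h1 h2)

theorem hasDerivAt_b (h : LeftState D p₁ q₂ T gm gp a b X v) {t : ℝ} (h1 : 0 < t)
    (h2 : t < D.t₀) : HasDerivAt b (gm (t, b t)) t :=
  (h.b_char t ⟨h1.le, h2⟩).hasDerivAt (Ico_mem_nhds h1 (by linarith [h.T_pos]))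

theorem continuousOn_X (h : LeftState D p₁ q₂ T gm gp a b X v) :
    ContinuousOn X (Ico D.t₀ (D.t₀ + T)) := fun t ht => (h.X_speed t ht).continuousWithinAt

theorem a_lt_rightEnd (h : LeftState D p₁ q₂ T gm gp a b X v) {t : ℝ} (h1 : 0 ≤ t)
    (h2 : t < D.t₀ + T) : a t < rightEnd b X D.t₀ t := by
  unfold rightEnd; split_ifs with h3
  · exact h.a_lt_b t ⟨h1, h3⟩
  · exact h.a_lt_X t ⟨not_lt.1 h3, h2⟩

theorem leftOpen_subset (h : LeftState D p₁ q₂ T gm gp a b X v) :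
    leftOpen a b X D.t₀ T ⊆ leftSet a b X D.t₀ D.x₀ T := by
  rintro ⟨t, x⟩ hP
  rw [mem_leftOpen_iff] at hP
  rw [mem_leftSet_iff]
  refine ⟨hP.1.le, hP.2.1, hP.2.2.1.le, hP.2.2.2.le, fun he => ?_⟩
  have h1 : t = D.t₀ := (Prod.ext_iff.1 he).1
  have h2 : x = D.x₀ := (Prod.ext_iff.1 he).2
  have h3 := hP.2.2.2
  rw [h1, h2, rightEnd, if_neg (lt_irrefl _), h.X_start] at h3
  exact lt_irrefl _ h3

/-- A point of the segment from the left boundary to a point of the domain. -/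
theorem mem_leftSet_of_le (h : LeftState D p₁ q₂ T gm gp a b X v) {t x y : ℝ}
    (hx : (t, x) ∈ leftSet a b X D.t₀ D.x₀ T) (h1 : a t ≤ y) (h2 : y ≤ x) :
    (t, y) ∈ leftSet a b X D.t₀ D.x₀ T := by
  rw [mem_leftSet_iff] at hx ⊢
  refine ⟨hx.1, hx.2.1, h1, h2.trans hx.2.2.2.1, fun he => hx.2.2.2.2 ?_⟩
  have h3 : t = D.t₀ := (Prod.ext_iff.1 he).1
  have h4 : y = D.x₀ := (Prod.ext_iff.1 he).2
  have h5 := hx.2.2.2.1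
  rw [h3, rightEnd, if_neg (lt_irrefl _), h.X_start] at h5
  rw [h3, le_antisymm h5 (h4 ▸ h2)]

theorem mem_leftOpen_of_lt {t x y : ℝ} (ht : 0 < t)
    (hx : (t, x) ∈ leftSet a b X D.t₀ D.x₀ T) (h1 : a t < y) (h2 : y < x) :
    (t, y) ∈ leftOpen a b X D.t₀ T := by
  rw [mem_leftSet_iff] at hx
  rw [mem_leftOpen_iff]
  exact ⟨ht, hx.2.1, h1, h2.trans_le hx.2.2.2.1⟩

theorem eventually_slice (h : LeftState D p₁ q₂ T gm gp a b X v) {t x : ℝ}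
    (hx : (t, x) ∈ leftOpen a b X D.t₀ T) : ∀ᶠ s in 𝓝 t, (s, x) ∈ leftOpen a b X D.t₀ T :=
  Chaplygin.eventually_slice h.continuousOn_a h.b_cont h.continuousOn_X h.X_lt_b hx

theorem isOpen_leftOpen (h : LeftState D p₁ q₂ T gm gp a b X v) :
    IsOpen (leftOpen a b X D.t₀ T) :=
  Chaplygin.isOpen_leftOpen h.continuousOn_a h.b_cont h.continuousOn_X h.X_lt_b

theorem continuousOn_density (h : LeftState D p₁ q₂ T gm gp a b X v) :
    ContinuousOn (fun P => (gp P - gm P)⁻¹) (leftSet a b X D.t₀ D.x₀ T) :=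
  (h.gp_cont.sub h.gm_cont).inv₀ fun P hP => (sub_pos.2 (h.gm_lt_gp P hP)).ne'

theorem density_pos (h : LeftState D p₁ q₂ T gm gp a b X v) {P : ℝ × ℝ}
    (hP : P ∈ leftSet a b X D.t₀ D.x₀ T) : 0 < (gp P - gm P)⁻¹ :=
  inv_pos.2 (sub_pos.2 (h.gm_lt_gp P hP))

/-- Conservation of mass. -/
theorem density_conservation (h : LeftState D p₁ q₂ T gm gp a b X v) {P : ℝ × ℝ}
    (hP : P ∈ leftOpen a b X D.t₀ T) : ∃ A B C E,
    HasFDerivAt (fun P => (gp P - gm P)⁻¹) (gradForm A B) P ∧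
    HasFDerivAt (fun P => (gp P - gm P)⁻¹ * gp P) (gradForm C E) P ∧ A + E = 0 := by
  obtain ⟨A, B, C, E, h1, h2, h3, h4⟩ := h.transport P hP
  have hne : gp P - gm P ≠ 0 := (sub_pos.2 (h.gm_lt_gp P (h.leftOpen_subset hP))).ne'
  have h5 := (hasDerivAt_inv hne).comp_hasFDerivAt P (h2.sub h1)
  have h6 := HasFDerivAt.mul h5 h2
  rw [eq_gradForm (_ • (gradForm C E - gradForm A B))] at h5
  rw [eq_gradForm (_ + _)] at h6
  refine ⟨_, _, _, _, h5, h6, ?_⟩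
  have hA : A = -(gp P * B) := by linarith
  have hC : C = -(gm P * E) := by linarith
  simp only [Function.comp, add_apply, sub_apply, smul_apply,
    gradForm_apply, smul_eq_mul, hA, hC, Pi.sub_apply]
  field_simp
  ring

theorem continuousOn_density_slice (h : LeftState D p₁ q₂ T gm gp a b X v) {t x : ℝ}
    (hx : (t, x) ∈ leftSet a b X D.t₀ D.x₀ T) :
    ContinuousOn (fun y => (gp (t, y) - gm (t, y))⁻¹) (Icc (a t) x) :=
  h.continuousOn_density.comp (f := fun y => (t, y)) (by fun_prop) fun _ hy =>
    h.mem_leftSet_of_le hx hy.1 hy.2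

theorem continuousOn_pot_slice (h : LeftState D p₁ q₂ T gm gp a b X v) {t x : ℝ}
    (hx : (t, x) ∈ leftSet a b X D.t₀ D.x₀ T) :
    ContinuousOn (fun y => pot p₁ gm gp a (t, y)) (Icc (a t) x) := by
  have hax : a t ≤ x := (mem_leftSet_iff.1 hx).2.2.1
  have h1 := (h.continuousOn_density_slice hx).integrableOn_Icc (μ := volume)
  have h2 := intervalIntegral.continuousOn_primitive_interval
    (f := fun y => (gp (t, y) - gm (t, y))⁻¹) (a := a t) (b := x) (μ := volume)
    (by rwa [uIcc_of_le hax])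
  rw [uIcc_of_le hax] at h2
  exact continuousOn_const.add h2

theorem hasDerivAt_pot_x (h : LeftState D p₁ q₂ T gm gp a b X v) {t x : ℝ}
    (hx : (t, x) ∈ leftOpen a b X D.t₀ T) :
    HasDerivAt (fun y => pot p₁ gm gp a (t, y)) (gp (t, x) - gm (t, x))⁻¹ x := by
  have hx' := mem_leftOpen_iff.1 hx
  obtain ⟨z, hz1, hz2⟩ := exists_between hx'.2.2.2
  have hz : (t, z) ∈ leftSet a b X D.t₀ D.x₀ T := h.leftOpen_subset
    (mem_leftOpen_iff.2 ⟨hx'.1, hx'.2.1, hx'.2.2.1.trans hz1, hz2⟩)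
  have hc := h.continuousOn_density_slice hz
  refine HasDerivAt.const_add _ ?_
  change HasDerivAt (fun z => ∫ y in a t..z, (gp (t, y) - gm (t, y))⁻¹) _ x
  refine intervalIntegral.integral_hasDerivAt_right
    (f := fun y => (gp (t, y) - gm (t, y))⁻¹) ?_ ?_ ?_
  · refine ContinuousOn.intervalIntegrable ?_
    rw [uIcc_of_le hx'.2.2.1.le]
    exact hc.mono (Icc_subset_Icc_right hz1.le)
  · exact (hc.mono Ioo_subset_Icc_self).stronglyMeasurableAtFilter isOpen_Ioo x ⟨hx'.2.2.1, hz1⟩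
  · exact hc.continuousAt (Icc_mem_nhds hx'.2.2.1 hz1)

theorem pot_lt_pot (h : LeftState D p₁ q₂ T gm gp a b X v) {t x y : ℝ} (ht : 0 < t)
    (hx : (t, x) ∈ leftSet a b X D.t₀ D.x₀ T) (h1 : a t ≤ y) (h2 : y < x) :
    pot p₁ gm gp a (t, y) < pot p₁ gm gp a (t, x) := by
  have hy := h.mem_leftSet_of_le hx h1 h2.le
  refine strictMonoOn_of_deriv_pos (convex_Icc (a t) x) (h.continuousOn_pot_slice hx)
    (fun z hz => ?_) ⟨h1, h2.le⟩ (right_mem_Icc.2 (h1.trans h2.le)) h2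
  rw [interior_Icc] at hz
  have hz' := mem_leftOpen_of_lt ht hx hz.1 hz.2
  rw [(h.hasDerivAt_pot_x hz').deriv]
  exact h.density_pos (h.leftOpen_subset hz')

@[simp] theorem pot_left (t : ℝ) : pot p₁ gm gp a (t, a t) = p₁ := by simp [pot]

theorem hasDerivAt_pot_t (h : LeftState D p₁ q₂ T gm gp a b X v) {t x : ℝ}
    (hx : (t, x) ∈ leftOpen a b X D.t₀ T) :
    HasDerivAt (fun s => pot p₁ gm gp a (s, x)) (-((gp (t, x) - gm (t, x))⁻¹ * gp (t, x))) t := by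
  obtain ⟨η, hη, hη'⟩ := Metric.eventually_nhds_iff.1 (h.eventually_slice hx)
  have hI : ∀ s ∈ Icc (t - η / 2) (t + η / 2), (s, x) ∈ leftOpen a b X D.t₀ T := fun s hs =>
    hη' (by rw [Real.dist_eq, abs_lt]; constructor <;> linarith [hs.1, hs.2])
  have hI' : Icc (t - η / 2) (t + η / 2) ⊆ Ico 0 (D.t₀ + T) := fun s hs =>
    ⟨(mem_leftOpen_iff.1 (hI s hs)).1.le, (mem_leftOpen_iff.1 (hI s hs)).2.1⟩
  have hx' := mem_leftOpen_iff.1 hx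
  have hsub : {P : ℝ × ℝ | P.1 ∈ Icc (t - η / 2) (t + η / 2) ∧ a P.1 ≤ P.2 ∧ P.2 ≤ x} ⊆
      leftSet a b X D.t₀ D.x₀ T := fun P hP =>
    h.mem_leftSet_of_le (h.leftOpen_subset (hI P.1 hP.1)) hP.2.1 hP.2.2
  have key := hasDerivAt_integral_between (F := fun P => (gp P - gm P)⁻¹)
    (G := fun P => (gp P - gm P)⁻¹ * gp P) (E := fun _ => 0) (a := a) (c := fun _ => x)
    (t₁ := t - η / 2) (t₂ := t + η / 2) (h.continuousOn_a.mono hI') continuousOn_const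
    (fun s hs => (mem_leftOpen_iff.1 (hI s hs)).2.2.1.le)
    (h.continuousOn_density.mono hsub)
    ((h.continuousOn_density.mul h.gp_cont).mono hsub) continuousOn_const
    (fun s hs y hy => h.density_conservation (mem_leftOpen_of_lt
      (mem_leftOpen_iff.1 (hI s (Ioo_subset_Icc_self hs))).1
      (h.leftOpen_subset (hI s (Ioo_subset_Icc_self hs))) hy.1 hy.2))
    (t := t) ⟨by linarith, by linarith⟩ (h.hasDerivAt_a hx'.1 hx'.2.1) (hasDerivAt_const t x)
    hx'.2.2.1
  refine (key.const_add p₁).congr_deriv ?_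
  simp only [intervalIntegral.integral_zero]
  ring

/-- The label is a potential of the mass flow: `pot_x = ρ / (2 μ)` and `pot_t = -λ₊ ρ / (2 μ)`, so
that it is constant along fast characteristics, and `pot + t` is constant along slow ones. -/
theorem hasFDerivAt_pot (h : LeftState D p₁ q₂ T gm gp a b X v) {P : ℝ × ℝ}
    (hP : P ∈ leftOpen a b X D.t₀ T) : HasFDerivAt (pot p₁ gm gp a)
      (gradForm (-((gp P - gm P)⁻¹ * gp P)) (gp P - gm P)⁻¹) P :=
  hasFDerivAt_of_partials h.isOpen_leftOpen
    (A := fun P => -((gp P - gm P)⁻¹ * gp P)) (B := fun P => (gp P - gm P)⁻¹)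
    (fun P hP => h.hasDerivAt_pot_t (t := P.1) (x := P.2) hP)
    (fun P hP => h.hasDerivAt_pot_x (t := P.1) (x := P.2) hP)
    ((h.continuousOn_density.mul h.gp_cont).neg.mono h.leftOpen_subset)
    (h.continuousOn_density.mono h.leftOpen_subset) hP

/-- A line `p = ℓ s` of slope `-σ` in the `(t, p)`-plane, as long as it stays in the domain, is
a characteristic: fast for `σ = 0` and slow for `σ = 1`. Along it the invariant `g` that is
transported with this speed is constant. -/
theorem exists_characteristic (h : LeftState D p₁ q₂ T gm gp a b X v) {g : ℝ × ℝ → ℝ} {σ : ℝ}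
    (hg : ∀ P ∈ leftOpen a b X D.t₀ T, ∃ A B, HasFDerivAt g (gradForm A B) P ∧
      A + (gp P - σ * (gp P - gm P)) * B = 0) {t₁ x₁ s₀ : ℝ}
    (hP : (t₁, x₁) ∈ leftOpen a b X D.t₀ T) {ℓ : ℝ → ℝ}
    (hℓ : ∀ s, ℓ s = pot p₁ gm gp a (t₁, x₁) + σ * (t₁ - s))
    (hs : ∀ s ∈ Ioc s₀ t₁, ∃ x, (s, x) ∈ leftOpen a b X D.t₀ T ∧ pot p₁ gm gp a (s, x) = ℓ s) :
    ∃ χ : ℝ → ℝ, ∀ s ∈ Ioc s₀ t₁, (s, χ s) ∈ leftOpen a b X D.t₀ T ∧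
      pot p₁ gm gp a (s, χ s) = ℓ s ∧ g (s, χ s) = g (t₁, x₁) := by
  obtain ⟨π, hπ⟩ := exists_fiber_inverse h.isOpen_leftOpen (fun u hu => h.hasFDerivAt_pot hu)
    ((h.continuousOn_density.mul h.gp_cont).neg.mono h.leftOpen_subset)
    (h.continuousOn_density.mono h.leftOpen_subset)
    (fun u hu => h.density_pos (h.leftOpen_subset hu)) (by
      rintro ⟨t, x⟩ hu ⟨t', x'⟩ hu' (rfl : t = t') he
      have ht := (mem_leftOpen_iff.1 hu).1
      rcases lt_trichotomy x x' with hlt | hlt | hlt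
      · exact absurd he (h.pot_lt_pot ht (h.leftOpen_subset hu')
          (mem_leftOpen_iff.1 hu).2.2.1.le hlt).ne
      · rw [hlt]
      · exact absurd he (h.pot_lt_pot ht (h.leftOpen_subset hu)
          (mem_leftOpen_iff.1 hu').2.2.1.le hlt).ne')
  have hχ : ∀ s ∈ Ioc s₀ t₁, (s, π (s, ℓ s)) ∈ leftOpen a b X D.t₀ T ∧
      pot p₁ gm gp a (s, π (s, ℓ s)) = ℓ s := by
    intro s hs'
    obtain ⟨x, hx, he⟩ := hs s hs'
    have := (hπ _ hx).1
    simp only [he] at this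
    rw [this]; exact ⟨hx, he⟩
  have hd : ∀ s ∈ Ioc s₀ t₁, HasDerivAt (fun s => g (s, π (s, ℓ s))) 0 s := by
    intro s hs'
    obtain ⟨hx, he⟩ := hχ s hs'
    obtain ⟨A, B, hA, hAB⟩ := hg _ hx
    have h1 := (hπ _ hx).2.2.1
    simp only [he] at h1
    have hℓd : HasDerivAt ℓ (-σ) s := by
      have : ℓ = fun s => pot p₁ gm gp a (t₁, x₁) + σ * (t₁ - s) := funext hℓ
      rw [this]
      have := (((hasDerivAt_id s).const_sub t₁).const_mul σ).const_add (pot p₁ gm gp a (t₁, x₁))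
      exact this.congr_deriv (by simp)
    have h2 := HasFDerivAt.comp_curve (γ := fun s => s) h1 (hasDerivAt_id s) hℓd
    have h3 := HasFDerivAt.comp_curve (γ := fun s => s) hA (hasDerivAt_id s) h2
    refine h3.congr_deriv ?_
    have hne : gp (s, π (s, ℓ s)) - gm (s, π (s, ℓ s)) ≠ 0 :=
      (sub_pos.2 (h.gm_lt_gp _ (h.leftOpen_subset hx))).ne'
    rw [eq_neg_of_add_eq_zero_left hAB]
    field_simp
    ring
  refine ⟨fun s => π (s, ℓ s), fun s hs' => ⟨(hχ s hs').1, (hχ s hs').2, ?_⟩⟩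
  have h1 := eq_of_hasDerivAt_zero (f := fun s => g (s, π (s, ℓ s))) hs'.2
    (fun r hr => (hd r ⟨hs'.1.trans_le hr.1, hr.2⟩).continuousAt.continuousWithinAt)
    (fun r hr => hd r ⟨hs'.1.trans hr.1, hr.2.le⟩)
  have h2 := (hπ _ hP).1
  have h3 : ℓ t₁ = pot p₁ gm gp a (t₁, x₁) := by rw [hℓ]; ring
  simp only at h2
  simp only [h3, h2] at h1
  exact h1.symm

end LeftState
end Chaplygin

namespace Chaplygin

/-! ### Characteristics traced back to the initial line -/

namespace CuspDatum

variable (D : CuspDatum)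

theorem mem_U_zero {p : ℝ} (hp : p ∈ D.B) : ((0 : ℝ), p) ∈ D.U :=
  ⟨hp, by simpa using hp, Or.inl D.t₀_pos,
    D.pos _ hp _ (by rw [add_zero]; exact hp) (by simpa using D.p₀_lt_q₀)⟩

theorem mem_U_of_lt {t p : ℝ} (hp : p ∈ D.B) (hq : p + t ∈ D.B) (ht : t < D.t₀) :
    (t, p) ∈ D.U :=
  ⟨hp, hq, Or.inl ht, D.pos _ hp _ hq (by simpa [t₀] using ht)⟩

/-- At the blowup time the characteristics to the left of the cusp have not focussed. -/
theorem mem_U_t₀ {p : ℝ} (hp : p ∈ D.B) (h : p < D.p₀) : (D.t₀, p) ∈ D.U := by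
  have hq := D.q₀_mem
  have h0 : p + D.t₀ ∈ D.B := by
    have := D.t₀_pos
    exact ⟨by linarith [hp.1], by linarith [hq.2, show p + D.t₀ < D.q₀ by unfold t₀; linarith]⟩
  refine ⟨hp, h0, Or.inr h, ?_⟩
  have h1 := (D.est_left (p - D.p₀) (p - D.p₀) (by linarith [hp.1]) le_rfl
    (by linarith [D.δ_pos])).1
  rw [show D.p₀ + (p - D.p₀) = p by ring, show D.q₀ + (p - D.p₀) = p + D.t₀ by unfold t₀; ring]
    at h1
  have : 0 < 9 / 20 * D.c * (p - D.p₀) ^ 2 := by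
    have := D.c_pos
    have : p - D.p₀ ≠ 0 := by linarith
    positivity
  linarith

/-- At the blowup time, the labels below the cusp belong to places to the left of the blowup
point. -/
theorem Y_t₀_lt {p : ℝ} (hp : p ∈ D.B) (h : p < D.p₀) : D.Y (D.t₀, p) < D.x₀ := by
  have hx : D.Y (D.t₀, D.p₀) = D.x₀ := by
    unfold Y x₀ t₀; simp
  rw [← hx]
  have hB : ∀ r ∈ Icc p D.p₀, r ∈ D.B ∧ r + D.t₀ ∈ D.B := fun r hr =>
    ⟨D.mem_B_of_mem_Icc hp D.p₀_mem hr.1 hr.2,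
      ⟨by linarith [hp.1, hr.1, D.t₀_pos], by
        have := D.q₀_mem.2; unfold t₀; linarith [hr.2]⟩⟩
  refine strictMonoOn_of_deriv_pos (convex_Icc p D.p₀) (f := fun r => D.Y (D.t₀, r))
    (fun r hr => (D.hasDerivAt_Y_p (hB r hr).1 (hB r hr).2).continuousAt.continuousWithinAt)
    (fun r hr => ?_) (left_mem_Icc.2 h.le) (right_mem_Icc.2 h.le) h
  rw [interior_Icc] at hr
  have hr' := hB r (Ioo_subset_Icc_self hr)
  rw [(D.hasDerivAt_Y_p hr'.1 hr'.2).deriv]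
  exact sub_pos.2 (D.mem_U_t₀ hr'.1 hr.2).2.2.2

/-- At the blowup time, no label beyond the cusp belongs to a place to the left of the blowup
point. -/
theorem x₀_le_Y_t₀ {p : ℝ} (hp : p ∈ D.B) (hq : p + D.t₀ ∈ D.B) (h : D.p₀ ≤ p) :
    D.x₀ ≤ D.Y (D.t₀, p) := by
  have hx : D.Y (D.t₀, D.p₀) = D.x₀ := by
    unfold Y x₀ t₀; simp
  rw [← hx]
  have hB : ∀ r ∈ Icc D.p₀ p, r ∈ D.B ∧ r + D.t₀ ∈ D.B := fun r hr =>
    ⟨D.mem_B_of_mem_Icc D.p₀_mem hp hr.1 hr.2,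
      ⟨by linarith [D.p₀_mem.1, hr.1, D.t₀_pos], by linarith [hr.2, hq.2]⟩⟩
  refine monotoneOn_of_deriv_nonneg (convex_Icc D.p₀ p) (f := fun r => D.Y (D.t₀, r))
    (fun r hr => (D.hasDerivAt_Y_p (hB r hr).1 (hB r hr).2).continuousAt.continuousWithinAt)
    (fun r hr => ?_) (fun r hr => ?_) (left_mem_Icc.2 h) (right_mem_Icc.2 h) h
  · rw [interior_Icc] at hr
    have hr' := hB r (Ioo_subset_Icc_self hr)
    exact (D.hasDerivAt_Y_p hr'.1 hr'.2).differentiableAt.differentiableWithinAt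
  · rw [interior_Icc] at hr
    have hr' := hB r (Ioo_subset_Icc_self hr)
    rw [(D.hasDerivAt_Y_p hr'.1 hr'.2).deriv]
    have h1 := (D.est_left (r - D.p₀) (r - D.p₀) (by linarith [hr.1, D.δ_pos]) le_rfl (by
      have := hr'.2.2; unfold t₀ at this; linarith)).1
    rw [show D.p₀ + (r - D.p₀) = r by ring, show D.q₀ + (r - D.p₀) = r + D.t₀ by unfold t₀; ring]
      at h1
    have : 0 ≤ 9 / 20 * D.c * (r - D.p₀) ^ 2 := by
      have := D.c_pos
      positivity
    linarith

end CuspDatum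

namespace LeftState

variable {D : CuspDatum} {p₁ q₂ T : ℝ} {gm gp : ℝ × ℝ → ℝ} {a b X v : ℝ → ℝ}

theorem p₁_mem_B (h : LeftState D p₁ q₂ T gm gp a b X v) : p₁ ∈ D.B :=
  ⟨h.p₁_mem.1, h.p₁_mem.2.trans D.p₀_mem.2⟩

theorem q₂_mem_B (h : LeftState D p₁ q₂ T gm gp a b X v) : q₂ ∈ D.B :=
  ⟨D.q₀_mem.1.trans h.q₂_mem.1, h.q₂_mem.2⟩

theorem p₁_lt_q₂ (h : LeftState D p₁ q₂ T gm gp a b X v) : p₁ + D.t₀ < q₂ := by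
  have := h.p₁_mem.2; have := h.q₂_mem.1; unfold CuspDatum.t₀; linarith

theorem mem_B_of_mem (h : LeftState D p₁ q₂ T gm gp a b X v) {p : ℝ} (hp : p ∈ Icc p₁ q₂) :
    p ∈ D.B := D.mem_B_of_mem_Icc h.p₁_mem_B h.q₂_mem_B hp.1 hp.2

/-- At the initial time the labels are the characteristic coordinates of the data. -/
theorem pot_zero (h : LeftState D p₁ q₂ T gm gp a b X v) {p : ℝ} (hp : p ∈ Icc p₁ q₂) :
    pot p₁ gm gp a (0, D.Y (0, p)) = p := by
  have hB : ∀ r ∈ Icc p₁ p, r ∈ D.B := fun r hr => h.mem_B_of_mem ⟨hr.1, hr.2.trans hp.2⟩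
  have hd : ∀ r ∈ Icc p₁ p, HasDerivAt (fun r => D.Y (0, r)) (D.lp r - D.lm r) r := fun r hr => by
    simpa using D.hasDerivAt_Y_p (t := 0) (hB r hr) (by simpa using hB r hr)
  have hmono : ∀ r ∈ Icc p₁ p, ∀ s ∈ Icc p₁ p, r ≤ s → D.Y (0, r) ≤ D.Y (0, s) := by
    intro r hr s hs hrs
    rcases hrs.eq_or_lt with rfl | hrs
    · exact le_rfl
    · exact (D.Y_lt_Y (D.mem_U_zero (hB r hr)) (D.mem_U_zero (hB s hs)) hrs).le
  have hsub : (fun r => D.Y (0, r)) '' Icc p₁ p ⊆ Icc (a 0) (D.Y (0, p)) := by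
    rintro _ ⟨r, hr, rfl⟩
    rw [h.a_zero]
    exact ⟨hmono _ (left_mem_Icc.2 hp.1) _ hr hr.1, hmono _ hr _ (right_mem_Icc.2 hp.1) hr.2⟩
  have hin : ((0 : ℝ), D.Y (0, p)) ∈ leftSet a b X D.t₀ D.x₀ T := by
    rw [mem_leftSet_iff, rightEnd, if_pos D.t₀_pos, h.a_zero, h.b_zero]
    refine ⟨le_rfl, by linarith [D.t₀_pos, h.T_pos],
      hmono _ (left_mem_Icc.2 hp.1) _ (right_mem_Icc.2 hp.1) hp.1, ?_, ?_⟩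
    · rcases hp.2.eq_or_lt with rfl | hlt
      · exact le_rfl
      · exact (D.Y_lt_Y (D.mem_U_zero (hB p (right_mem_Icc.2 hp.1)))
          (D.mem_U_zero h.q₂_mem_B) hlt).le
    · intro he
      exact D.t₀_pos.ne (Prod.ext_iff.1 he).1
  have hI : uIcc p₁ p = Icc p₁ p := uIcc_of_le hp.1
  have key := intervalIntegral.integral_comp_mul_deriv''
    (f := fun r => D.Y (0, r)) (f' := fun r => D.lp r - D.lm r) (a := p₁) (b := p)
    (g := fun y => (gp (0, y) - gm (0, y))⁻¹)
    (fun r hr => (hd r (hI ▸ hr)).continuousAt.continuousWithinAt)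
    (fun r hr => (hd r (by
      rw [min_eq_left hp.1, max_eq_right hp.1] at hr
      exact Ioo_subset_Icc_self hr)).hasDerivWithinAt)
    (by rw [hI]; exact (D.contDiff_lp.continuousOn.sub D.contDiff_lm.continuousOn).mono hB)
    (by rw [hI]; exact (h.continuousOn_density_slice hin).mono hsub)
  have e : (∫ r in p₁..p, ((fun y => (gp (0, y) - gm (0, y))⁻¹) ∘ fun r => D.Y (0, r)) r
      * (D.lp r - D.lm r)) = ∫ r in p₁..p, (1 : ℝ) := by
    refine intervalIntegral.integral_congr fun r hr => ?_
    rw [hI] at hr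
    have hi := h.init r ⟨hr.1, hr.2.trans hp.2⟩
    have hne : D.lp r - D.lm r ≠ 0 := by
      have := (D.mem_U_zero (hB r hr)).2.2.2
      simp only [add_zero] at this
      exact (sub_pos.2 this).ne'
    simp only [Function.comp, hi.1, hi.2]
    field_simp
  rw [e] at key
  simp only [intervalIntegral.integral_const, smul_eq_mul, mul_one] at key
  unfold pot
  simp only [h.a_zero]
  rw [← key]; ring

/-- Before the blowup the right boundary is the slow characteristic `q₂`: along it `pot + t` is
constant. -/
theorem pot_b (h : LeftState D p₁ q₂ T gm gp a b X v) {t : ℝ} (ht : t ∈ Ico 0 D.t₀) :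
    pot p₁ gm gp a (t, b t) = q₂ - t := by
  have hsub : Icc 0 t ⊆ Ico 0 (D.t₀ + T) := fun s hs => ⟨hs.1, by linarith [hs.2, ht.2, h.T_pos]⟩
  have hset : ∀ s ∈ Icc 0 t, ∀ y ∈ Icc (a s) (b s), (s, y) ∈ leftSet a b X D.t₀ D.x₀ T := by
    intro s hs y hy
    have hst : s < D.t₀ := hs.2.trans_lt ht.2
    rw [mem_leftSet_iff, rightEnd, if_pos hst]
    exact ⟨hs.1, (hsub hs).2, hy.1, hy.2, fun he => hst.ne (Prod.ext_iff.1 he).1⟩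
  have hsub2 : {P : ℝ × ℝ | P.1 ∈ Icc 0 t ∧ a P.1 ≤ P.2 ∧ P.2 ≤ b P.1} ⊆
      leftSet a b X D.t₀ D.x₀ T := fun P hP => hset P.1 hP.1 P.2 hP.2
  have hab : ∀ s ∈ Icc 0 t, a s < b s := fun s hs => h.a_lt_b s ⟨hs.1, hs.2.trans_lt ht.2⟩
  have hcont := continuousOn_integral_between ht.1 (h.continuousOn_a.mono hsub)
    (h.b_cont.mono hsub) (fun s hs => (hab s hs).le) (h.continuousOn_density.mono hsub2)
  have hd : ∀ s ∈ Ioo 0 t, HasDerivAt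
      (fun s => (∫ x in a s..b s, (gp (s, x) - gm (s, x))⁻¹) + s) 0 s := by
    intro s hs
    have hs' := Ioo_subset_Icc_self hs
    have hst : s < D.t₀ := hs.2.trans ht.2
    have key := hasDerivAt_integral_between (F := fun P => (gp P - gm P)⁻¹)
      (G := fun P => (gp P - gm P)⁻¹ * gp P) (E := fun _ => 0) (a := a) (c := b)
      (t₁ := 0) (t₂ := t) (h.continuousOn_a.mono hsub) (h.b_cont.mono hsub)
      (fun s hs => (hab s hs).le) (h.continuousOn_density.mono hsub2)
      ((h.continuousOn_density.mul h.gp_cont).mono hsub2) continuousOn_const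
      (fun s hs y hy => h.density_conservation (mem_leftOpen_of_lt hs.1
        (hset s (Ioo_subset_Icc_self hs) (b s)
          (right_mem_Icc.2 (hab s (Ioo_subset_Icc_self hs)).le)) hy.1 hy.2))
      hs (h.hasDerivAt_a hs.1 (hsub hs').2) (h.hasDerivAt_b hs.1 hst) (hab s hs')
    refine (key.add (hasDerivAt_id s)).congr_deriv ?_
    have hne := sub_pos.2 (h.gm_lt_gp _ (hset s hs' (b s) (right_mem_Icc.2 (hab s hs').le)))
    simp only [intervalIntegral.integral_zero]
    field_simp
    ring
  have h1 := eq_of_hasDerivAt_zero ht.1 (hcont.add continuousOn_id) hd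
  have h2 := h.pot_zero (p := q₂) ⟨by linarith [h.p₁_lt_q₂, D.t₀_pos], le_rfl⟩
  rw [← h.b_zero] at h2
  unfold pot at h2 ⊢
  simp only [Pi.add_apply, id] at h1 h2 ⊢
  linarith

/-- By the intermediate value theorem, every label between `p₁` and the one of a given point is
taken at the same time to the left of that point. -/
theorem exists_pot_eq (h : LeftState D p₁ q₂ T gm gp a b X v) {t x p : ℝ} (ht : 0 < t)
    (hx : (t, x) ∈ leftSet a b X D.t₀ D.x₀ T) (h1 : p₁ < p) (h2 : p < pot p₁ gm gp a (t, x)) :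
    ∃ y, y < x ∧ (t, y) ∈ leftOpen a b X D.t₀ T ∧ pot p₁ gm gp a (t, y) = p := by
  have hax : a t ≤ x := (mem_leftSet_iff.1 hx).2.2.1
  have := intermediate_value_Ioo hax (h.continuousOn_pot_slice hx)
  obtain ⟨y, hy, he⟩ := this ⟨by simpa using h1, h2⟩
  exact ⟨y, hy.2, mem_leftOpen_of_lt ht hx hy.1 hy.2, he⟩

theorem lt_of_pot_lt (h : LeftState D p₁ q₂ T gm gp a b X v) {t x y : ℝ}
    (hx : (t, x) ∈ leftOpen a b X D.t₀ T) (hy : (t, y) ∈ leftOpen a b X D.t₀ T)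
    (hlt : pot p₁ gm gp a (t, x) < pot p₁ gm gp a (t, y)) : x < y := by
  have hx' := mem_leftOpen_iff.1 hx
  have hy' := mem_leftOpen_iff.1 hy
  refine lt_of_not_ge fun hle => hlt.not_ge ?_
  rcases hle.eq_or_lt with rfl | hlt'
  · exact le_rfl
  · exact (h.pot_lt_pot hx'.1 (h.leftOpen_subset hx) hy'.2.2.1.le hlt').le

theorem p₁_lt_pot (h : LeftState D p₁ q₂ T gm gp a b X v) {t x : ℝ}
    (hx : (t, x) ∈ leftOpen a b X D.t₀ T) : p₁ < pot p₁ gm gp a (t, x) := by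
  have hx' := mem_leftOpen_iff.1 hx
  have := h.pot_lt_pot hx'.1 (h.leftOpen_subset hx) le_rfl hx'.2.2.1
  simpa using this

/-- Before the blowup, the labels at the time `t` fill the interval `(p₁, q₂ - t)`. -/
theorem exists_pot_eq_before (h : LeftState D p₁ q₂ T gm gp a b X v) {t p : ℝ} (ht : 0 < t)
    (ht' : t < D.t₀) (h1 : p₁ < p) (h2 : p < q₂ - t) :
    ∃ y, (t, y) ∈ leftOpen a b X D.t₀ T ∧ pot p₁ gm gp a (t, y) = p := by
  have hb : (t, b t) ∈ leftSet a b X D.t₀ D.x₀ T := by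
    rw [mem_leftSet_iff, rightEnd, if_pos ht']
    exact ⟨ht.le, by linarith [h.T_pos], (h.a_lt_b t ⟨ht.le, ht'⟩).le, le_rfl,
      fun he => ht'.ne (Prod.ext_iff.1 he).1⟩
  obtain ⟨y, -, h3, h4⟩ := h.exists_pot_eq ht hb h1 (by rwa [h.pot_b ⟨ht.le, ht'⟩])
  exact ⟨y, h3, h4⟩

/-- Up to the blowup time, slow labels are below that of the right boundary. -/
theorem pot_add_lt (h : LeftState D p₁ q₂ T gm gp a b X v) {t x : ℝ}
    (hx : (t, x) ∈ leftOpen a b X D.t₀ T) (ht : t ≤ D.t₀) :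
    pot p₁ gm gp a (t, x) + t < q₂ := by
  have lt_case : ∀ {s y : ℝ}, (s, y) ∈ leftOpen a b X D.t₀ T → s < D.t₀ →
      pot p₁ gm gp a (s, y) + s < q₂ := by
    intro s y hy hs
    have hy' := mem_leftOpen_iff.1 hy
    rw [rightEnd, if_pos hs] at hy'
    have hb : (s, b s) ∈ leftSet a b X D.t₀ D.x₀ T := by
      rw [mem_leftSet_iff, rightEnd, if_pos hs]
      exact ⟨hy'.1.le, hy'.2.1, (hy'.2.2.1.trans hy'.2.2.2).le, le_rfl,
        fun he => hs.ne (Prod.ext_iff.1 he).1⟩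
    have := h.pot_lt_pot hy'.1 hb hy'.2.2.1.le hy'.2.2.2
    rw [h.pot_b ⟨hy'.1.le, hs⟩] at this
    linarith
  rcases ht.lt_or_eq with ht | ht
  · exact lt_case hx ht
  · -- pass to the limit from earlier times, at a point farther to the right
    have hx' := mem_leftOpen_iff.1 hx
    obtain ⟨z, hz1, hz2⟩ := exists_between hx'.2.2.2
    have hz : (t, z) ∈ leftOpen a b X D.t₀ T :=
      mem_leftOpen_iff.2 ⟨hx'.1, hx'.2.1, hx'.2.2.1.trans hz1, hz2⟩
    have hc : ContinuousAt (fun s => pot p₁ gm gp a (s, z) + s) t :=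
      (h.hasDerivAt_pot_t hz).continuousAt.add continuousAt_id
    have hle : pot p₁ gm gp a (t, z) + t ≤ q₂ := by
      refine le_of_tendsto (hc.tendsto.mono_left nhdsWithin_le_nhds : Tendsto _ (𝓝[<] t) _) ?_
      filter_upwards [nhdsWithin_le_nhds (h.eventually_slice hz), self_mem_nhdsWithin] with s k1 k2
      exact (lt_case k1 (ht ▸ k2)).le
    have := h.pot_lt_pot hx'.1 (h.leftOpen_subset hz) hx'.2.2.1.le hz1
    linarith

/-- A characteristic that reaches the initial line carries the initial value. -/
theorem eq_initial (h : LeftState D p₁ q₂ T gm gp a b X v) {g : ℝ × ℝ → ℝ}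
    (hgc : ContinuousOn g (leftSet a b X D.t₀ D.x₀ T)) {ℓ χ : ℝ → ℝ} {t₁ g₁ : ℝ} (ht₁ : 0 < t₁)
    (hℓ : Continuous ℓ) (h1 : p₁ < ℓ 0) (h2 : ℓ 0 < q₂)
    (hχ : ∀ s ∈ Ioc 0 t₁, (s, χ s) ∈ leftOpen a b X D.t₀ T ∧
      pot p₁ gm gp a (s, χ s) = ℓ s ∧ g (s, χ s) = g₁) : g₁ = g (0, D.Y (0, ℓ 0)) := by
  have hYc : ∀ p ∈ Ioo p₁ q₂, ContinuousAt (fun p => D.Y (0, p)) p := fun p hp =>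
    (D.hasDerivAt_Y_p (t := 0) (h.mem_B_of_mem (Ioo_subset_Icc_self hp))
      (by simpa using h.mem_B_of_mem (Ioo_subset_Icc_self hp))).continuousAt
  have hmem : ∀ p ∈ Ioo p₁ q₂, a 0 < D.Y (0, p) ∧ D.Y (0, p) < b 0 := by
    intro p hp
    have hpB := D.mem_U_zero (h.mem_B_of_mem (Ioo_subset_Icc_self hp))
    rw [h.a_zero, h.b_zero]
    exact ⟨D.Y_lt_Y (D.mem_U_zero h.p₁_mem_B) hpB hp.1,
      D.Y_lt_Y hpB (D.mem_U_zero h.q₂_mem_B) hp.2⟩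
  have hIco : Ico 0 (D.t₀ + T) ∈ 𝓝[≥] (0 : ℝ) :=
    Ico_mem_nhdsGE (by linarith [D.t₀_pos, h.T_pos])
  have h0 : (0 : ℝ) ∈ Ico 0 (D.t₀ + T) := ⟨le_rfl, by linarith [D.t₀_pos, h.T_pos]⟩
  have hac : ContinuousWithinAt a (Ici 0) 0 :=
    (h.continuousOn_a 0 h0).mono_of_mem_nhdsWithin hIco
  have hbc : ContinuousWithinAt b (Ici 0) 0 := (h.b_cont 0 h0).mono_of_mem_nhdsWithin hIco
  have hlim : ∀ p ∈ Ioo p₁ q₂,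
      Tendsto (fun s => pot p₁ gm gp a (s, D.Y (0, p))) (𝓝[>] 0) (𝓝 p) := by
    intro p hp
    have e1 : ∀ᶠ s in 𝓝[≥] (0 : ℝ), a s < D.Y (0, p) :=
      Tendsto.eventually_lt hac.tendsto tendsto_const_nhds (hmem p hp).1
    have e2 : ∀ᶠ s in 𝓝[≥] (0 : ℝ), D.Y (0, p) < b s :=
      Tendsto.eventually_lt tendsto_const_nhds hbc.tendsto (hmem p hp).2
    have e3 : ∀ᶠ s in 𝓝[≥] (0 : ℝ), s < D.t₀ :=
      nhdsWithin_le_nhds (eventually_lt_nhds D.t₀_pos)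
    obtain ⟨η, hη, hη'⟩ := (mem_nhdsGE_iff_exists_Icc_subset).1 (e1.and (e2.and e3))
    have hη0 : 0 < η := hη
    have hsub : Icc 0 η ⊆ Ico 0 (D.t₀ + T) := fun s hs =>
      ⟨hs.1, by linarith [(hη' hs).2.2, h.T_pos]⟩
    have hc := continuousOn_integral_between (F := fun P => (gp P - gm P)⁻¹) hη0.le
      (h.continuousOn_a.mono hsub)
      (continuousOn_const (c := D.Y (0, p))) (fun s hs => (hη' hs).1.le)
      (h.continuousOn_density.mono (by
        rintro ⟨s, y⟩ ⟨hs, hy1, hy2⟩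
        rw [mem_leftSet_iff, rightEnd, if_pos (hη' hs).2.2]
        exact ⟨hs.1, (hsub hs).2, hy1, hy2.trans (hη' hs).2.1.le,
          fun he => (hη' hs).2.2.ne (Prod.ext_iff.1 he).1⟩))
    have hc0 := ((hc 0 (left_mem_Icc.2 hη0.le)).const_add p₁).tendsto
    have hz := h.pot_zero (Ioo_subset_Icc_self hp)
    unfold pot at hz ⊢
    simp only at hz hc0 ⊢
    rw [hz] at hc0
    refine hc0.mono_left ?_
    rw [nhdsWithin_le_iff]
    exact mem_of_superset (Ioc_mem_nhdsGT hη0) Ioc_subset_Icc_self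
  have hs0 : ∀ᶠ s in 𝓝[>] (0 : ℝ), s < D.t₀ := nhdsWithin_le_nhds (eventually_lt_nhds D.t₀_pos)
  have hac' : Tendsto a (𝓝[>] 0) (𝓝 (a 0)) :=
    hac.tendsto.mono_left (nhdsWithin_mono _ Ioi_subset_Ici_self)
  have hbc' : Tendsto b (𝓝[>] 0) (𝓝 (b 0)) :=
    hbc.tendsto.mono_left (nhdsWithin_mono _ Ioi_subset_Ici_self)
  have hopen : ∀ p ∈ Ioo p₁ q₂, ∀ᶠ s in 𝓝[>] (0 : ℝ),
      (s, D.Y (0, p)) ∈ leftOpen a b X D.t₀ T := by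
    intro p hp
    filter_upwards [hac'.eventually_lt_const (hmem p hp).1, hbc'.eventually_const_lt (hmem p hp).2,
      hs0, self_mem_nhdsWithin] with s k1 k2 k3 k4
    rw [mem_leftOpen_iff, rightEnd, if_pos k3]
    exact ⟨k4, by linarith [h.T_pos], k1, k2⟩
  have hℓ0 : Tendsto ℓ (𝓝[>] 0) (𝓝 (ℓ 0)) := hℓ.continuousAt.tendsto.mono_left nhdsWithin_le_nhds
  have hIoc : ∀ᶠ s in 𝓝[>] (0 : ℝ), s ∈ Ioc 0 t₁ := Ioc_mem_nhdsGT ht₁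
  -- the labels order the points of a time slice, so that the characteristic is squeezed between
  -- vertical lines through neighbouring points of the initial line
  have hχlim : Tendsto χ (𝓝[>] 0) (𝓝 (D.Y (0, ℓ 0))) := by
    refine tendsto_order.2 ⟨fun l hl => ?_, fun l hl => ?_⟩
    · have hev : ∀ᶠ p in 𝓝[<] (ℓ 0), l < D.Y (0, p) ∧ p₁ < p ∧ p < ℓ 0 := by
        have e1 := ((hYc (ℓ 0) ⟨h1, h2⟩).eventually (lt_mem_nhds hl))
        filter_upwards [nhdsWithin_le_nhds e1, nhdsWithin_le_nhds (lt_mem_nhds h1),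
          self_mem_nhdsWithin] with p k1 k2 k3 using ⟨k1, k2, k3⟩
      obtain ⟨p, hp1, hp2, hp3⟩ := hev.exists
      have hp : p ∈ Ioo p₁ q₂ := ⟨hp2, hp3.trans h2⟩
      filter_upwards [(hlim p hp).eventually_lt hℓ0 hp3, hIoc,
        hopen p hp] with s k1 k2 k3
      exact hp1.trans (h.lt_of_pot_lt k3 (hχ s k2).1 (by rwa [(hχ s k2).2.1]))
    · have hev : ∀ᶠ p in 𝓝[>] (ℓ 0), D.Y (0, p) < l ∧ p < q₂ ∧ ℓ 0 < p := by
        have e1 := ((hYc (ℓ 0) ⟨h1, h2⟩).eventually (gt_mem_nhds hl))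
        filter_upwards [nhdsWithin_le_nhds e1, nhdsWithin_le_nhds (gt_mem_nhds h2),
          self_mem_nhdsWithin] with p k1 k2 k3 using ⟨k1, k2, k3⟩
      obtain ⟨p, hp1, hp2, hp3⟩ := hev.exists
      have hp : p ∈ Ioo p₁ q₂ := ⟨h1.trans hp3, hp2⟩
      filter_upwards [hℓ0.eventually_lt (hlim p hp) hp3, hIoc, hopen p hp] with s k1 k2 k3
      exact (h.lt_of_pot_lt (hχ s k2).1 k3 (by rwa [(hχ s k2).2.1])).trans hp1
  have hmem0 := hmem _ ⟨h1, h2⟩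
  have hin : ((0 : ℝ), D.Y (0, ℓ 0)) ∈ leftSet a b X D.t₀ D.x₀ T := by
    rw [mem_leftSet_iff, rightEnd, if_pos D.t₀_pos]
    exact ⟨le_rfl, h0.2, hmem0.1.le, hmem0.2.le, fun he => D.t₀_pos.ne (Prod.ext_iff.1 he).1⟩
  have hlim2 : Tendsto (fun s => g (s, χ s)) (𝓝[>] 0) (𝓝 (g (0, D.Y (0, ℓ 0)))) := by
    refine (hgc _ hin).tendsto.comp (tendsto_nhdsWithin_iff.2 ⟨?_, ?_⟩)
    · exact (tendsto_id.mono_left nhdsWithin_le_nhds).prodMk_nhds hχlim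
    · filter_upwards [hIoc] with s hs using h.leftOpen_subset (hχ s hs).1
  refine tendsto_nhds_unique (tendsto_const_nhds.congr' ?_) hlim2
  filter_upwards [hIoc] with s hs using (hχ s hs).2.2.symm

/-- A characteristic of the left state that comes out of the blowup point carries the value `v₀`:
this is the case if at the time `t₀` its label is at least that of each point to the left of the
blowup point. -/
theorem eq_v₀ (h : LeftState D p₁ q₂ T gm gp a b X v) {g : ℝ × ℝ → ℝ}
    (hg : Tendsto g (𝓝[leftSet a b X D.t₀ D.x₀ T] (D.t₀, D.x₀)) (𝓝 D.v₀)) {ℓ χ : ℝ → ℝ}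
    {t₁ g₁ : ℝ} (ht₁ : D.t₀ < t₁) (ht₁' : t₁ < D.t₀ + T) (hℓ : Continuous ℓ)
    (h1 : ∀ x, (D.t₀, x) ∈ leftOpen a b X D.t₀ T → pot p₁ gm gp a (D.t₀, x) < ℓ D.t₀)
    (hχ : ∀ s ∈ Ioc D.t₀ t₁, (s, χ s) ∈ leftOpen a b X D.t₀ T ∧
      pot p₁ gm gp a (s, χ s) = ℓ s ∧ g (s, χ s) = g₁) : g₁ = D.v₀ := by
  have ht0 : D.t₀ ∈ Ico D.t₀ (D.t₀ + T) := ⟨le_rfl, ht₁.trans ht₁'⟩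
  have hax := h.a_lt_X D.t₀ ht0
  rw [h.X_start] at hax
  have hIoc : ∀ᶠ s in 𝓝[>] D.t₀, s ∈ Ioc D.t₀ t₁ := Ioc_mem_nhdsGT ht₁
  have hX : Tendsto X (𝓝[>] D.t₀) (𝓝 D.x₀) := by
    rw [← h.X_start]
    refine (h.continuousOn_X D.t₀ ht0).tendsto.mono_left ?_
    rw [nhdsWithin_le_iff]
    exact mem_of_superset (Ioo_mem_nhdsGT ht0.2) Ioo_subset_Ico_self
  -- the characteristic stays to the right of each vertical line left of the blowup point, and to
  -- the left of `X`
  have hχlim : Tendsto χ (𝓝[>] D.t₀) (𝓝 D.x₀) := by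
    refine tendsto_order.2 ⟨fun l hl => ?_, fun l hl => ?_⟩
    · obtain ⟨x, hx1, hx2⟩ := exists_between (max_lt hl hax)
      have hx : (D.t₀, x) ∈ leftOpen a b X D.t₀ T := by
        rw [mem_leftOpen_iff, rightEnd, if_neg (lt_irrefl _), h.X_start]
        exact ⟨D.t₀_pos, ht0.2, (le_max_right _ _).trans_lt hx1, hx2⟩
      have hc := (h.hasDerivAt_pot_t hx).continuousAt.eventually_lt hℓ.continuousAt (h1 x hx)
      filter_upwards [nhdsWithin_le_nhds hc, nhdsWithin_le_nhds (h.eventually_slice hx), hIoc]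
        with s k1 k2 k3
      exact ((le_max_left _ _).trans_lt hx1).trans
        (h.lt_of_pot_lt k2 (hχ s k3).1 (by rwa [(hχ s k3).2.1]))
    · filter_upwards [hX.eventually_lt_const hl, hIoc] with s k1 k2
      have h3 := (mem_leftOpen_iff.1 (hχ s k2).1).2.2.2
      rw [rightEnd, if_neg (not_lt.2 k2.1.le)] at h3
      exact h3.trans k1
  have hlim2 : Tendsto (fun s => g (s, χ s)) (𝓝[>] D.t₀) (𝓝 D.v₀) := by
    refine hg.comp (tendsto_nhdsWithin_iff.2 ⟨?_, ?_⟩)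
    · exact (tendsto_id.mono_left nhdsWithin_le_nhds).prodMk_nhds hχlim
    · filter_upwards [hIoc] with s hs using h.leftOpen_subset (hχ s hs).1
  refine tendsto_nhds_unique (tendsto_const_nhds.congr' ?_) hlim2
  filter_upwards [hIoc] with s hs using (hχ s hs).2.2.symm

/-- The transport of `λ₋` in the form required by `exists_characteristic`, with `σ = 0`. -/
theorem gm_transport (h : LeftState D p₁ q₂ T gm gp a b X v) :
    ∀ P ∈ leftOpen a b X D.t₀ T, ∃ A B, HasFDerivAt gm (gradForm A B) P ∧
      A + (gp P - 0 * (gp P - gm P)) * B = 0 := fun P hP => by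
  obtain ⟨A, B, C, E, h1, h2, h3, h4⟩ := h.transport P hP
  exact ⟨A, B, h1, by linarith⟩

/-- The transport of `λ₊` in the form required by `exists_characteristic`, with `σ = 1`. -/
theorem gp_transport (h : LeftState D p₁ q₂ T gm gp a b X v) :
    ∀ P ∈ leftOpen a b X D.t₀ T, ∃ A B, HasFDerivAt gp (gradForm A B) P ∧
      A + (gp P - 1 * (gp P - gm P)) * B = 0 := fun P hP => by
  obtain ⟨A, B, C, E, h1, h2, h3, h4⟩ := h.transport P hP
  exact ⟨C, E, h2, by linarith⟩

/-- If the fast characteristic through a point reaches the initial line, `λ₋` is known there. -/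
theorem gm_eq_of_line (h : LeftState D p₁ q₂ T gm gp a b X v) {t x : ℝ}
    (hx : (t, x) ∈ leftOpen a b X D.t₀ T) (hlt : pot p₁ gm gp a (t, x) < q₂)
    (hs : ∀ s ∈ Ioc 0 t, ∃ y, (s, y) ∈ leftOpen a b X D.t₀ T ∧
      pot p₁ gm gp a (s, y) = pot p₁ gm gp a (t, x)) :
    gm (t, x) = D.lm (pot p₁ gm gp a (t, x)) := by
  obtain ⟨χ, hχ⟩ := h.exists_characteristic h.gm_transport hx
    (ℓ := fun _ => pot p₁ gm gp a (t, x)) (fun s => by ring) hs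
  have h1 := h.p₁_lt_pot hx
  rw [h.eq_initial h.gm_cont (mem_leftOpen_iff.1 hx).1 continuous_const h1 hlt hχ]
  exact (h.init _ ⟨h1.le, hlt.le⟩).1

/-- If the slow characteristic through a point reaches the initial line, `λ₊` is known there. -/
theorem gp_eq_of_line (h : LeftState D p₁ q₂ T gm gp a b X v) {t x : ℝ}
    (hx : (t, x) ∈ leftOpen a b X D.t₀ T) (hlt : pot p₁ gm gp a (t, x) + t < q₂)
    (hs : ∀ s ∈ Ioc 0 t, ∃ y, (s, y) ∈ leftOpen a b X D.t₀ T ∧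
      pot p₁ gm gp a (s, y) = pot p₁ gm gp a (t, x) + t - s) :
    gp (t, x) = D.lp (pot p₁ gm gp a (t, x) + t) := by
  obtain ⟨χ, hχ⟩ := h.exists_characteristic h.gp_transport hx
    (ℓ := fun s => pot p₁ gm gp a (t, x) + t - s) (fun s => by ring) hs
  have h1 := h.p₁_lt_pot hx
  have h0 := (mem_leftOpen_iff.1 hx).1
  rw [h.eq_initial h.gp_cont h0 (by fun_prop) (by simp only [sub_zero]; linarith)
    (by simpa using hlt) hχ]
  simp only [sub_zero]
  exact (h.init _ ⟨by linarith, hlt.le⟩).2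

/-- Up to the blowup time all characteristics reach the initial line, so that the labels determine
the state. -/
theorem values_before (h : LeftState D p₁ q₂ T gm gp a b X v) {t x : ℝ}
    (hx : (t, x) ∈ leftOpen a b X D.t₀ T) (ht : t ≤ D.t₀) :
    gm (t, x) = D.lm (pot p₁ gm gp a (t, x)) ∧ gp (t, x) = D.lp (pot p₁ gm gp a (t, x) + t) := by
  have h1 := h.p₁_lt_pot hx
  have h2 := h.pot_add_lt hx ht
  have h0 := (mem_leftOpen_iff.1 hx).1
  constructor
  · refine h.gm_eq_of_line hx (by linarith) fun s hs => ?_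
    rcases hs.2.eq_or_lt with rfl | hlt
    · exact ⟨x, hx, rfl⟩
    · exact h.exists_pot_eq_before hs.1 (hlt.trans_le ht) h1 (by linarith)
  · refine h.gp_eq_of_line hx h2 fun s hs => ?_
    rcases hs.2.eq_or_lt with rfl | hlt
    · exact ⟨x, hx, by ring⟩
    · exact h.exists_pot_eq_before hs.1 (hlt.trans_le ht) (by linarith) (by linarith)

/-- The left boundary is the fast characteristic labelled `p₁`, as long as the state is the one
prescribed by its labels. -/
theorem a_eq_of_values (h : LeftState D p₁ q₂ T gm gp a b X v) {t : ℝ} (ht : 0 ≤ t)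
    (ht' : t < D.t₀ + T) (hB : p₁ + t ∈ D.B)
    (hv : ∀ s ∈ Ioo 0 t, ∀ x, (s, x) ∈ leftOpen a b X D.t₀ T →
      gp (s, x) = D.lp (pot p₁ gm gp a (s, x) + s)) : a t = D.Y (t, p₁) := by
  have hBs : ∀ s ∈ Icc 0 t, p₁ + s ∈ D.B := fun s hs =>
    D.mem_B_of_mem_Icc h.p₁_mem_B hB (by linarith [hs.1]) (by linarith [hs.2])
  have hYd : ∀ s ∈ Icc 0 t, HasDerivAt (fun s => D.Y (s, p₁)) (D.lp (p₁ + s)) s := fun s hs =>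
    D.hasDerivAt_Y_t h.p₁_mem_B (hBs s hs)
  have hsub : Icc 0 t ⊆ Ico 0 (D.t₀ + T) := fun s hs => ⟨hs.1, hs.2.trans_lt ht'⟩
  have key := eq_of_hasDerivAt_zero (f := fun s => a s - D.Y (s, p₁)) ht
    ((h.continuousOn_a.mono hsub).sub fun s hs => (hYd s hs).continuousAt.continuousWithinAt)
    (fun s hs => by
      have hs' := Ioo_subset_Icc_self hs
      refine ((h.hasDerivAt_a hs.1 (hsub hs').2).sub (hYd s hs')).congr_deriv ?_
      -- the speed of the boundary is the limit of `λ₊` from the interior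
      have hlt := h.a_lt_rightEnd hs.1.le (hsub hs').2
      obtain ⟨z, hz1, hz2⟩ := exists_between hlt
      have hz := h.leftOpen_subset (mem_leftOpen_iff.2 ⟨hs.1, (hsub hs').2, hz1, hz2⟩)
      have hza := h.mem_leftSet_of_le hz le_rfl hz1.le
      have hne : (𝓝[Ioo (a s) z] (a s)).NeBot := by
        rw [nhdsWithin_Ioo_eq_nhdsGT hz1]; infer_instance
      have l1 : Tendsto (fun x => gp (s, x)) (𝓝[Ioo (a s) z] (a s)) (𝓝 (gp (s, a s))) := by
        refine (h.gp_cont _ hza).tendsto.comp (tendsto_nhdsWithin_iff.2 ⟨?_, ?_⟩)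
        · exact tendsto_const_nhds.prodMk_nhds (tendsto_id.mono_left nhdsWithin_le_nhds)
        · filter_upwards [self_mem_nhdsWithin] with x hx
          exact h.mem_leftSet_of_le hz hx.1.le hx.2.le
      have l2 : Tendsto (fun x => D.lp (pot p₁ gm gp a (s, x) + s)) (𝓝[Ioo (a s) z] (a s))
          (𝓝 (D.lp (p₁ + s))) := by
        have hc := (h.continuousOn_pot_slice hz (a s) (left_mem_Icc.2 hz1.le)).tendsto.mono_left
          (nhdsWithin_mono _ Ioo_subset_Icc_self)
        rw [pot_left] at hc
        exact (D.contDiffAt_lp (hBs s hs')).continuousAt.tendsto.comp (hc.add_const s)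
      have := tendsto_nhds_unique l1 (l2.congr' (by
        filter_upwards [self_mem_nhdsWithin] with x hx
        exact (hv s hs x (mem_leftOpen_of_lt hs.1 hz hx.1 hx.2)).symm))
      rw [this, sub_self])
  have h0 : a 0 = D.Y (0, p₁) := h.a_zero
  linarith

end LeftState
end Chaplygin

namespace Chaplygin

/-! ### The half solution after the blowup -/

namespace LeftState

variable {D : CuspDatum} {p₁ q₂ T : ℝ} {gm gp : ℝ × ℝ → ℝ} {a b X v : ℝ → ℝ}

/-- If at the time `t` the state is the one prescribed by its labels, then so are the places. -/
theorem Y_pot (h : LeftState D p₁ q₂ T gm gp a b X v) {t x r : ℝ} (ht : 0 < t)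
    (hx : (t, x) ∈ leftSet a b X D.t₀ D.x₀ T) (hat : a t = D.Y (t, p₁)) (hr : r ∈ D.B)
    (hrt : r + t ∈ D.B)
    (hv : ∀ y, (t, y) ∈ leftOpen a b X D.t₀ T → gm (t, y) = D.lm (pot p₁ gm gp a (t, y)) ∧
      gp (t, y) = D.lp (pot p₁ gm gp a (t, y) + t))
    (hle : pot p₁ gm gp a (t, x) ≤ r) : D.Y (t, pot p₁ gm gp a (t, x)) = x := by
  have hax : a t ≤ x := (mem_leftSet_iff.1 hx).2.2.1
  have hpot : ∀ y ∈ Icc (a t) x, pot p₁ gm gp a (t, y) ∈ Icc p₁ r := by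
    intro y hy
    have h1 : pot p₁ gm gp a (t, a t) ≤ pot p₁ gm gp a (t, y) := by
      rcases hy.1.eq_or_lt with he | hlt
      · rw [← he]
      · exact (h.pot_lt_pot ht (h.mem_leftSet_of_le hx hy.1 hy.2) le_rfl hlt).le
    have h2 : pot p₁ gm gp a (t, y) ≤ pot p₁ gm gp a (t, x) := by
      rcases hy.2.eq_or_lt with he | hlt
      · rw [he]
      · exact (h.pot_lt_pot ht hx hy.1 hlt).le
    rw [pot_left] at h1
    exact ⟨h1, h2.trans hle⟩
  have hB : ∀ y ∈ Icc (a t) x, pot p₁ gm gp a (t, y) ∈ D.B ∧ pot p₁ gm gp a (t, y) + t ∈ D.B := by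
    intro y hy
    have hy' := hpot y hy
    have h1 := D.mem_B_of_mem_Icc h.p₁_mem_B hr hy'.1 hy'.2
    exact ⟨h1, ⟨by linarith [h1.1], by linarith [hrt.2, hy'.2]⟩⟩
  have hY : ∀ y ∈ Icc (a t) x, HasDerivAt (fun p => D.Y (t, p))
      (D.lp (pot p₁ gm gp a (t, y) + t) - D.lm (pot p₁ gm gp a (t, y)))
      (pot p₁ gm gp a (t, y)) := fun y hy => D.hasDerivAt_Y_p (hB y hy).1 (hB y hy).2
  have key := eq_of_hasDerivAt_zero (f := fun y => D.Y (t, pot p₁ gm gp a (t, y)) - y) hax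
    (ContinuousOn.sub (fun y hy => ContinuousAt.comp_continuousWithinAt
      (g := fun p => D.Y (t, p)) (hY y hy).continuousAt (h.continuousOn_pot_slice hx y hy))
      continuousOn_id)
    (fun y hy => by
      have hy' := Ioo_subset_Icc_self hy
      have hyo := mem_leftOpen_of_lt ht hx hy.1 hy.2
      have h1 := (hY y hy').scomp y (h.hasDerivAt_pot_x hyo)
      refine (h1.sub (hasDerivAt_id y)).congr_deriv ?_
      have hne := sub_pos.2 (h.gm_lt_gp _ (h.leftOpen_subset hyo))
      rw [← (hv y hyo).1, ← (hv y hyo).2, smul_eq_mul]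
      field_simp
      ring)
  simp only [pot_left] at key
  rw [hat] at key
  linarith

theorem p₁_add_mem_B (h : LeftState D p₁ q₂ T gm gp a b X v) {t : ℝ} (ht : 0 ≤ t)
    (ht' : t ≤ D.t₀) : p₁ + t ∈ D.B :=
  D.mem_B_of_mem_Icc h.p₁_mem_B h.q₂_mem_B (by linarith) (by linarith [h.p₁_lt_q₂])

theorem a_eq_before (h : LeftState D p₁ q₂ T gm gp a b X v) {t : ℝ} (ht : 0 ≤ t)
    (ht' : t ≤ D.t₀) : a t = D.Y (t, p₁) :=
  h.a_eq_of_values ht (by linarith [h.T_pos]) (h.p₁_add_mem_B ht ht') fun s hs x hx =>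
    (h.values_before hx (hs.2.le.trans ht')).2

/-- At the blowup time the labels to the left of the blowup point are those below `p₀`. -/
theorem pot_t₀_lt (h : LeftState D p₁ q₂ T gm gp a b X v) {x : ℝ}
    (hx : (D.t₀, x) ∈ leftOpen a b X D.t₀ T) : pot p₁ gm gp a (D.t₀, x) < D.p₀ := by
  have h1 := h.p₁_lt_pot hx
  have h2 := h.pot_add_lt hx le_rfl
  have hB : pot p₁ gm gp a (D.t₀, x) ∈ D.B :=
    h.mem_B_of_mem ⟨h1.le, by linarith [D.t₀_pos]⟩
  have hBt : pot p₁ gm gp a (D.t₀, x) + D.t₀ ∈ D.B :=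
    h.mem_B_of_mem ⟨by linarith [D.t₀_pos], h2.le⟩
  have hY := h.Y_pot D.t₀_pos (h.leftOpen_subset hx) (h.a_eq_before D.t₀_pos.le le_rfl) hB hBt
    (fun y hy => h.values_before hy le_rfl) le_rfl
  have hlt := (mem_leftOpen_iff.1 hx).2.2.2
  rw [rightEnd, if_neg (lt_irrefl _), h.X_start] at hlt
  refine lt_of_not_ge fun hge => ?_
  have := D.x₀_le_Y_t₀ hB hBt hge
  rw [hY] at this
  exact this.not_gt hlt

/-- At the blowup time, all labels between `p₁` and `p₀` are present. -/
theorem exists_pot_eq_t₀ (h : LeftState D p₁ q₂ T gm gp a b X v) {p : ℝ} (h1 : p₁ < p)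
    (h2 : p < D.p₀) : ∃ y, (D.t₀, y) ∈ leftOpen a b X D.t₀ T ∧ pot p₁ gm gp a (D.t₀, y) = p := by
  have hpB : p ∈ D.B := D.mem_B_of_mem_Icc h.p₁_mem_B D.p₀_mem h1.le h2.le
  have hU := D.mem_U_t₀ hpB h2
  have hU1 := D.mem_U_t₀ h.p₁_mem_B (h1.trans h2)
  have ha := h.a_eq_before D.t₀_pos.le le_rfl
  have hx : (D.t₀, D.Y (D.t₀, p)) ∈ leftOpen a b X D.t₀ T := by
    rw [mem_leftOpen_iff, rightEnd, if_neg (lt_irrefl _), h.X_start, ha]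
    exact ⟨D.t₀_pos, by linarith [h.T_pos], D.Y_lt_Y hU1 hU h1, D.Y_t₀_lt hpB h2⟩
  refine ⟨_, hx, ?_⟩
  have h3 := h.p₁_lt_pot hx
  have h4 := h.pot_t₀_lt hx
  have hB : pot p₁ gm gp a (D.t₀, D.Y (D.t₀, p)) ∈ D.B :=
    D.mem_B_of_mem_Icc h.p₁_mem_B D.p₀_mem h3.le h4.le
  have hU' := D.mem_U_t₀ hB h4
  have hY := h.Y_pot D.t₀_pos (h.leftOpen_subset hx) ha hB hU'.2.1
    (fun y hy => h.values_before hy le_rfl) le_rfl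
  exact (Prod.ext_iff.1 (D.Y_injOn hU' hU rfl hY)).2

/-- The label at the discontinuity decreases at least as fast as along a slow characteristic: this
is the entropy condition. -/
theorem pot_X_add_le (h : LeftState D p₁ q₂ T gm gp a b X v) {s t : ℝ} (hs : D.t₀ < s)
    (hst : s ≤ t) (ht : t < D.t₀ + T) :
    pot p₁ gm gp a (t, X t) + t ≤ pot p₁ gm gp a (s, X s) + s := by
  have h0 : ∀ r ∈ Icc s t, D.t₀ < r := fun r hr => hs.trans_le hr.1
  have hsub : Icc s t ⊆ Ico 0 (D.t₀ + T) := fun r hr =>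
    ⟨(D.t₀_pos.trans (h0 r hr)).le, hr.2.trans_lt ht⟩
  have hsub' : Icc s t ⊆ Ico D.t₀ (D.t₀ + T) := fun r hr => ⟨(h0 r hr).le, hr.2.trans_lt ht⟩
  have hset : ∀ r ∈ Icc s t, ∀ y ∈ Icc (a r) (X r), (r, y) ∈ leftSet a b X D.t₀ D.x₀ T := by
    intro r hr y hy
    rw [mem_leftSet_iff, rightEnd, if_neg (h0 r hr).not_gt]
    exact ⟨(hsub hr).1, (hsub hr).2, hy.1, hy.2, fun he => (h0 r hr).ne' (Prod.ext_iff.1 he).1⟩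
  have hsub2 : {P : ℝ × ℝ | P.1 ∈ Icc s t ∧ a P.1 ≤ P.2 ∧ P.2 ≤ X P.1} ⊆
      leftSet a b X D.t₀ D.x₀ T := fun P hP => hset P.1 hP.1 P.2 hP.2
  have haX : ∀ r ∈ Icc s t, a r < X r := fun r hr => h.a_lt_X r (hsub' hr)
  have hcont := continuousOn_integral_between hst (h.continuousOn_a.mono hsub)
    (h.continuousOn_X.mono hsub') (fun r hr => (haX r hr).le) (h.continuousOn_density.mono hsub2)
  have hd : ∀ r ∈ Ioo s t, ∃ m ≤ 0, HasDerivAt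
      (fun r => (∫ x in a r..X r, (gp (r, x) - gm (r, x))⁻¹) + r) m r := by
    intro r hr
    have hr' := Ioo_subset_Icc_self hr
    have hX : HasDerivAt X (v r) r :=
      (h.X_speed r (hsub' hr')).hasDerivAt (Ico_mem_nhds (h0 r hr') (hsub hr').2)
    have key := hasDerivAt_integral_between (F := fun P => (gp P - gm P)⁻¹)
      (G := fun P => (gp P - gm P)⁻¹ * gp P) (E := fun _ => 0) (a := a) (c := X)
      (t₁ := s) (t₂ := t) (h.continuousOn_a.mono hsub) (h.continuousOn_X.mono hsub')
      (fun r hr => (haX r hr).le) (h.continuousOn_density.mono hsub2)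
      ((h.continuousOn_density.mul h.gp_cont).mono hsub2) continuousOn_const
      (fun r hr y hy => h.density_conservation (mem_leftOpen_of_lt
        (D.t₀_pos.trans (h0 r (Ioo_subset_Icc_self hr)))
        (hset r (Ioo_subset_Icc_self hr) (X r)
          (right_mem_Icc.2 (haX r (Ioo_subset_Icc_self hr)).le)) hy.1 hy.2))
      hr (h.hasDerivAt_a (D.t₀_pos.trans (h0 r hr')) (hsub hr').2) hX (haX r hr')
    refine ⟨_, ?_, key.add (hasDerivAt_id r)⟩
    have hXin := hset r hr' (X r) (right_mem_Icc.2 (haX r hr').le)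
    have hN := h.density_pos hXin
    have hv := h.v_le r ⟨h0 r hr', (hsub hr').2⟩
    have h1 : (gp (r, X r) - gm (r, X r))⁻¹ * (gp (r, X r) - gm (r, X r)) = 1 :=
      inv_mul_cancel₀ (sub_pos.2 (h.gm_lt_gp _ hXin)).ne'
    simp only [intervalIntegral.integral_zero]
    nlinarith [mul_le_mul_of_nonneg_left hv hN.le]
  have hanti : AntitoneOn (fun r => (∫ x in a r..X r, (gp (r, x) - gm (r, x))⁻¹) + r)
      (Icc s t) := by
    refine antitoneOn_of_deriv_nonpos (convex_Icc s t) (hcont.add continuousOn_id) ?_ ?_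
    · intro r hr
      rw [interior_Icc] at hr
      obtain ⟨m, -, hm⟩ := hd r hr
      exact hm.differentiableAt.differentiableWithinAt
    · intro r hr
      rw [interior_Icc] at hr
      obtain ⟨m, hm0, hm⟩ := hd r hr
      rw [hm.deriv]; exact hm0
  have := hanti (left_mem_Icc.2 hst) (right_mem_Icc.2 hst) hst
  simp only [pot] at this ⊢
  linarith

theorem mem_leftSet_X (h : LeftState D p₁ q₂ T gm gp a b X v) {t : ℝ} (ht : D.t₀ < t)
    (ht' : t < D.t₀ + T) : (t, X t) ∈ leftSet a b X D.t₀ D.x₀ T := by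
  rw [mem_leftSet_iff, rightEnd, if_neg ht.not_gt]
  exact ⟨(D.t₀_pos.trans ht).le, ht', (h.a_lt_X t ⟨ht.le, ht'⟩).le, le_rfl,
    fun he => ht.ne' (Prod.ext_iff.1 he).1⟩

/-- After the blowup, if the label `p` lies, at the time `s ∈ (t₀, t]`, on or to the left of the
slow characteristic through the point `(t, x)`, then it is present at the time `s`. -/
theorem exists_pot_eq_after (h : LeftState D p₁ q₂ T gm gp a b X v) {t x s p : ℝ}
    (hx : (t, x) ∈ leftOpen a b X D.t₀ T) (hs : D.t₀ < s) (hst : s ≤ t) (h1 : p₁ < p)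
    (h2 : p + s ≤ pot p₁ gm gp a (t, x) + t) :
    ∃ y, (s, y) ∈ leftOpen a b X D.t₀ T ∧ pot p₁ gm gp a (s, y) = p := by
  have hx' := mem_leftOpen_iff.1 hx
  have ht : D.t₀ < t := hs.trans_le hst
  rw [rightEnd, if_neg ht.not_gt] at hx'
  have h3 := h.pot_lt_pot hx'.1 (h.mem_leftSet_X ht hx'.2.1) hx'.2.2.1.le hx'.2.2.2
  have h4 := h.pot_X_add_le hs hst hx'.2.1
  obtain ⟨y, -, hy, he⟩ := h.exists_pot_eq (D.t₀_pos.trans hs)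
    (h.mem_leftSet_X hs (hst.trans_lt hx'.2.1)) h1 (by linarith)
  exact ⟨y, hy, he⟩

/-- After the blowup, no characteristic of the left state comes out of the blowup point: two such
characteristics, one of each family, would carry the same value `v₀`, and the density would be
infinite where they meet. -/
theorem pot_lt_after (h : LeftState D p₁ q₂ T gm gp a b X v) {t x : ℝ}
    (hx : (t, x) ∈ leftOpen a b X D.t₀ T) (ht : D.t₀ < t) :
    pot p₁ gm gp a (t, x) < D.p₀ ∧ gm (t, x) = D.lm (pot p₁ gm gp a (t, x)) ∧
      pot p₁ gm gp a (t, x) + t < D.q₀ := by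
  have hx' := mem_leftOpen_iff.1 hx
  have hp₁ := h.p₁_lt_pot hx
  have hlt := h.gm_lt_gp _ (h.leftOpen_subset hx)
  -- slow characteristics with a large label come out of the blowup point
  have hq : D.q₀ ≤ pot p₁ gm gp a (t, x) + t → gp (t, x) = D.v₀ := by
    intro hge
    obtain ⟨χ, hχ⟩ := h.exists_characteristic h.gp_transport hx (s₀ := D.t₀)
      (ℓ := fun s => pot p₁ gm gp a (t, x) + t - s) (fun s => by ring) fun s hs =>
        h.exists_pot_eq_after hx hs.1 hs.2 (by linarith [hs.2]) (by linarith)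
    refine h.eq_v₀ h.blowup_gp ht hx'.2.1 (by fun_prop) (fun y hy => ?_) hχ
    have := h.pot_t₀_lt hy
    simp only [CuspDatum.t₀] at this ⊢
    linarith
  have hp : pot p₁ gm gp a (t, x) < D.p₀ := by
    refine lt_of_not_ge fun hge => ?_
    have e1 : gp (t, x) = D.v₀ := hq (by unfold CuspDatum.t₀ at ht; linarith)
    obtain ⟨χ, hχ⟩ := h.exists_characteristic h.gm_transport hx (s₀ := D.t₀)
      (ℓ := fun _ => pot p₁ gm gp a (t, x)) (fun s => by ring) fun s hs =>
        h.exists_pot_eq_after hx hs.1 hs.2 hp₁ (by linarith [hs.2])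
    have e2 := h.eq_v₀ h.blowup_gm ht hx'.2.1 continuous_const
      (fun y hy => (h.pot_t₀_lt hy).trans_le hge) hχ
    rw [e1, e2] at hlt
    exact lt_irrefl _ hlt
  have hgm : gm (t, x) = D.lm (pot p₁ gm gp a (t, x)) := by
    refine h.gm_eq_of_line hx (by linarith [h.p₁_lt_q₂, h.q₂_mem.1, D.p₀_lt_q₀]) fun s hs => ?_
    rcases lt_trichotomy s D.t₀ with hs' | rfl | hs'
    · refine h.exists_pot_eq_before hs.1 hs' hp₁ ?_
      have := h.q₂_mem.1
      unfold CuspDatum.t₀ at hs'; linarith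
    · exact h.exists_pot_eq_t₀ hp₁ hp
    · exact h.exists_pot_eq_after hx hs' hs.2 hp₁ (by linarith [hs.2])
  refine ⟨hp, hgm, lt_of_not_ge fun hge => ?_⟩
  have hB : pot p₁ gm gp a (t, x) ∈ D.B :=
    D.mem_B_of_mem_Icc h.p₁_mem_B D.p₀_mem hp₁.le hp.le
  have := D.anti_lm hB D.p₀_mem hp
  rw [hgm, hq hge] at hlt
  exact lt_asymm hlt this

/-- After the blowup too, all characteristics of the left state reach the initial line. -/
theorem values_after (h : LeftState D p₁ q₂ T gm gp a b X v) {t x : ℝ}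
    (hx : (t, x) ∈ leftOpen a b X D.t₀ T) (ht : D.t₀ < t) :
    gp (t, x) = D.lp (pot p₁ gm gp a (t, x) + t) := by
  obtain ⟨hp, -, hq⟩ := h.pot_lt_after hx ht
  have hp₁ := h.p₁_lt_pot hx
  have hq₂ := h.q₂_mem.1
  refine h.gp_eq_of_line hx (by linarith) fun s hs => ?_
  rcases lt_trichotomy s D.t₀ with hs' | rfl | hs'
  · exact h.exists_pot_eq_before hs.1 hs' (by linarith [hs.2]) (by linarith)
  · exact h.exists_pot_eq_t₀ (by linarith [hs.2]) (by unfold CuspDatum.t₀; linarith)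
  · exact h.exists_pot_eq_after hx hs' hs.2 (by linarith [hs.2]) (by linarith)

/-- In the open left domain, the labels determine the state. -/
theorem values (h : LeftState D p₁ q₂ T gm gp a b X v) {t x : ℝ}
    (hx : (t, x) ∈ leftOpen a b X D.t₀ T) :
    gm (t, x) = D.lm (pot p₁ gm gp a (t, x)) ∧ gp (t, x) = D.lp (pot p₁ gm gp a (t, x) + t) := by
  rcases le_or_gt t D.t₀ with ht | ht
  · exact h.values_before hx ht
  · exact ⟨(h.pot_lt_after hx ht).2.1, h.values_after hx ht⟩

/-- The largest slow label at the time `t`. -/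
theorem pot_add_le (h : LeftState D p₁ q₂ T gm gp a b X v) {t x : ℝ} (ht : 0 < t)
    (hx : (t, x) ∈ leftSet a b X D.t₀ D.x₀ T) (hax : a t < x) :
    pot p₁ gm gp a (t, x) + t ≤ if t < D.t₀ then q₂ else D.q₀ := by
  have hc := (h.continuousOn_pot_slice hx x (right_mem_Icc.2 hax.le)).tendsto.mono_left
    (nhdsWithin_mono _ Ioo_subset_Icc_self)
  have hne : (𝓝[Ioo (a t) x] x).NeBot := by
    rw [nhdsWithin_Ioo_eq_nhdsLT hax]; infer_instance
  refine le_of_tendsto (hc.add_const t) ?_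
  filter_upwards [self_mem_nhdsWithin] with y hy
  have hy' := mem_leftOpen_of_lt ht hx hy.1 hy.2
  split_ifs with h1
  · exact (h.pot_add_lt hy' h1.le).le
  · rcases (not_lt.1 h1).eq_or_lt with rfl | h2
    · have := h.pot_t₀_lt hy'
      unfold CuspDatum.t₀ at this ⊢; linarith
    · exact (h.pot_lt_after hy' h2).2.2.le

theorem pot_add_le_q₂ (h : LeftState D p₁ q₂ T gm gp a b X v) {t x : ℝ} (ht : 0 < t)
    (hx : (t, x) ∈ leftSet a b X D.t₀ D.x₀ T) (hax : a t < x) :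
    pot p₁ gm gp a (t, x) + t ≤ q₂ := by
  have := h.pot_add_le ht hx hax
  split_ifs at this
  · exact this
  · exact this.trans h.q₂_mem.1.le

theorem exists_mem_leftSet (h : LeftState D p₁ q₂ T gm gp a b X v) {t : ℝ} (ht : 0 < t)
    (ht' : t < D.t₀ + T) : ∃ x, a t < x ∧ (t, x) ∈ leftOpen a b X D.t₀ T := by
  obtain ⟨z, h1, h2⟩ := exists_between (h.a_lt_rightEnd ht.le ht')
  exact ⟨z, h1, mem_leftOpen_iff.2 ⟨ht, ht', h1, h2⟩⟩

theorem p₁_add_lt_q₀ (h : LeftState D p₁ q₂ T gm gp a b X v) {t : ℝ} (ht : t < D.t₀ + T) :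
    p₁ + t < D.q₀ := by
  rcases lt_or_ge t D.t₀ with h1 | h1
  · have := h.p₁_mem.2; unfold CuspDatum.t₀ at h1; linarith
  · obtain ⟨x, hx1, hx2⟩ := h.exists_mem_leftSet (D.t₀_pos.trans_le h1) ht
    have h2 := h.pot_add_le (D.t₀_pos.trans_le h1) (h.leftOpen_subset hx2) hx1
    rw [if_neg h1.not_gt] at h2
    linarith [h.p₁_lt_pot hx2]

/-- The left boundary is the fast characteristic labelled `p₁`. -/
theorem a_eq (h : LeftState D p₁ q₂ T gm gp a b X v) {t : ℝ} (ht : t ∈ Ico 0 (D.t₀ + T)) :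
    a t = D.Y (t, p₁) :=
  h.a_eq_of_values ht.1 ht.2 (D.mem_B_of_mem_Icc h.p₁_mem_B D.q₀_mem (by linarith [ht.1])
    (h.p₁_add_lt_q₀ ht.2).le) fun _ _ _ hx => (h.values hx).2

/-- On a time slice up to a point `x`, boundary points included, the state is the explicit one. -/
theorem exists_label_of_lt (h : LeftState D p₁ q₂ T gm gp a b X v) {t x : ℝ} (ht : 0 < t)
    (hx : (t, x) ∈ leftSet a b X D.t₀ D.x₀ T) (hax : a t < x) :
    ∀ y ∈ Icc (a t) x, p₁ ≤ pot p₁ gm gp a (t, y) ∧ (t, pot p₁ gm gp a (t, y)) ∈ D.U ∧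
      D.Y (t, pot p₁ gm gp a (t, y)) = y ∧ gm (t, y) = D.lm (pot p₁ gm gp a (t, y)) ∧
      gp (t, y) = D.lp (pot p₁ gm gp a (t, y) + t) := by
  have htT : t < D.t₀ + T := (mem_leftSet_iff.1 hx).2.1
  have hle := h.pot_add_le ht hx hax
  have hpot : ∀ y ∈ Icc (a t) x, p₁ ≤ pot p₁ gm gp a (t, y) ∧
      pot p₁ gm gp a (t, y) ≤ pot p₁ gm gp a (t, x) := by
    intro y hy
    constructor
    · rcases hy.1.eq_or_lt with he | hlt
      · rw [← he, pot_left]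
      · have := (h.pot_lt_pot ht (h.mem_leftSet_of_le hx hy.1 hy.2) le_rfl hlt).le
        rwa [pot_left] at this
    · rcases hy.2.eq_or_lt with he | hlt
      · rw [he]
      · exact (h.pot_lt_pot ht hx hy.1 hlt).le
  have hle' := h.pot_add_le_q₂ ht hx hax
  have hB : ∀ y ∈ Icc (a t) x, pot p₁ gm gp a (t, y) ∈ D.B ∧ pot p₁ gm gp a (t, y) + t ∈ D.B :=
    fun y hy => ⟨h.mem_B_of_mem ⟨(hpot y hy).1, by linarith [(hpot y hy).2]⟩,
      h.mem_B_of_mem ⟨by linarith [(hpot y hy).1], by linarith [(hpot y hy).2]⟩⟩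
  have hcl : Icc (a t) x ⊆ closure (Ioo (a t) x) := by rw [closure_Ioo hax.ne]
  have hcpot := h.continuousOn_pot_slice hx
  have hmap : MapsTo (fun y => ((t, y) : ℝ × ℝ)) (Icc (a t) x) (leftSet a b X D.t₀ D.x₀ T) :=
    fun y hy => h.mem_leftSet_of_le hx hy.1 hy.2
  -- the identities extend from the interior to the boundary by continuity
  have e1 : EqOn (fun y => gm (t, y)) (fun y => D.lm (pot p₁ gm gp a (t, y))) (Icc (a t) x) := by
    refine EqOn.of_subset_closure
      (fun y hy => (h.values (mem_leftOpen_of_lt ht hx hy.1 hy.2)).1)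
      (h.gm_cont.comp (by fun_prop) hmap) ?_ Ioo_subset_Icc_self hcl
    exact D.contDiff_lm.continuousOn.comp hcpot fun y hy => (hB y hy).1
  have e2 : EqOn (fun y => gp (t, y)) (fun y => D.lp (pot p₁ gm gp a (t, y) + t))
      (Icc (a t) x) := by
    refine EqOn.of_subset_closure
      (fun y hy => (h.values (mem_leftOpen_of_lt ht hx hy.1 hy.2)).2)
      (h.gp_cont.comp (by fun_prop) hmap) ?_ Ioo_subset_Icc_self hcl
    exact D.contDiff_lp.continuousOn.comp (hcpot.add continuousOn_const) fun y hy => (hB y hy).2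
  intro y hy
  have hyS := hmap hy
  have hlt := h.gm_lt_gp _ hyS
  refine ⟨(hpot y hy).1, ⟨(hB y hy).1, (hB y hy).2, ?_, ?_⟩, ?_, e1 hy, e2 hy⟩
  · rcases lt_trichotomy t D.t₀ with h1 | h1 | h1
    · exact Or.inl h1
    · right
      have hyx : y < X t := by
        have h3 := mem_leftSet_iff.1 hyS
        rw [rightEnd, if_neg (by simp [h1])] at h3
        refine lt_of_le_of_ne h3.2.2.2.1 fun he => h3.2.2.2.2 ?_
        rw [he, h1, h.X_start]
      rcases hy.1.eq_or_lt with he | hay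
      · simp only [← he, pot_left]; exact h.p₁_mem.2
      · subst h1
        exact h.pot_t₀_lt (mem_leftOpen_iff.2 ⟨ht, htT, hay, by
          rwa [rightEnd, if_neg (lt_irrefl _)]⟩)
    · right
      rw [if_neg h1.not_gt] at hle
      have h2 := (hpot y hy).2
      simp only
      unfold CuspDatum.t₀ at h1
      linarith
  · have := e1 hy
    have := e2 hy
    simp only at *
    linarith
  · exact h.Y_pot ht hyS (h.a_eq ⟨ht.le, htT⟩) (hB y hy).1 (hB y hy).2 (fun z hz => h.values hz)
      le_rfl

theorem Y_zero_mem (h : LeftState D p₁ q₂ T gm gp a b X v) {x : ℝ} (hx : x ∈ Icc (a 0) (b 0)) :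
    ∃ p ∈ Icc p₁ q₂, D.Y (0, p) = x := by
  have hle : p₁ ≤ q₂ := by linarith [h.p₁_lt_q₂, D.t₀_pos]
  have hc : ContinuousOn (fun p => D.Y (0, p)) (Icc p₁ q₂) := fun p hp =>
    (D.hasDerivAt_Y_p (t := 0) (h.mem_B_of_mem hp)
      (by simpa using h.mem_B_of_mem hp)).continuousAt.continuousWithinAt
  have := intermediate_value_Icc hle hc
  rw [h.a_zero, h.b_zero] at hx
  exact this hx

/-- The left half of every solution is the explicit state of the datum. -/
theorem exists_label (h : LeftState D p₁ q₂ T gm gp a b X v) {t x : ℝ}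
    (hx : (t, x) ∈ leftSet a b X D.t₀ D.x₀ T) : ∃ p, p₁ ≤ p ∧ (t, p) ∈ D.U ∧ D.Y (t, p) = x ∧
      gm (t, x) = D.lm p ∧ gp (t, x) = D.lp (p + t) := by
  have hx' := mem_leftSet_iff.1 hx
  rcases hx'.1.eq_or_lt with rfl | ht
  · rw [rightEnd, if_pos D.t₀_pos] at hx'
    obtain ⟨p, hp, rfl⟩ := h.Y_zero_mem ⟨hx'.2.2.1, hx'.2.2.2.1⟩
    have := h.init p hp
    exact ⟨p, hp.1, D.mem_U_zero (h.mem_B_of_mem hp), rfl, this.1, by rw [this.2, add_zero]⟩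
  · rcases hx'.2.2.1.eq_or_lt with he | hax
    · obtain ⟨z, hz, hz'⟩ := h.exists_mem_leftSet ht hx'.2.1
      exact ⟨_, h.exists_label_of_lt ht (h.leftOpen_subset hz') hz x ⟨he.le, he ▸ hz.le⟩⟩
    · exact ⟨_, h.exists_label_of_lt ht hx hax x ⟨hax.le, le_rfl⟩⟩

theorem gm_eq (h : LeftState D p₁ q₂ T gm gp a b X v) {P : ℝ × ℝ}
    (hP : P ∈ leftSet a b X D.t₀ D.x₀ T) : gm P = D.gm P := by
  obtain ⟨t, x⟩ := P
  obtain ⟨p, -, hU, rfl, h1, -⟩ := h.exists_label hP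
  rw [h1, D.gm_Y hU]

theorem gp_eq (h : LeftState D p₁ q₂ T gm gp a b X v) {P : ℝ × ℝ}
    (hP : P ∈ leftSet a b X D.t₀ D.x₀ T) : gp P = D.gp P := by
  obtain ⟨t, x⟩ := P
  obtain ⟨p, -, hU, rfl, -, h1⟩ := h.exists_label hP
  rw [h1, D.gp_Y hU]

end LeftState
end Chaplygin

namespace Chaplygin

/-! ### Geometry of the characteristics at the cusp -/

theorem le_of_hasDerivAt_nonneg {f f' : ℝ → ℝ} {a b : ℝ} (hab : a ≤ b)
    (hf : ∀ x ∈ Icc a b, HasDerivAt f (f' x) x) (hf' : ∀ x ∈ Ioo a b, 0 ≤ f' x) : f a ≤ f b := by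
  refine monotoneOn_of_deriv_nonneg (convex_Icc a b)
    (fun x hx => (hf x hx).continuousAt.continuousWithinAt) (fun x hx => ?_) (fun x hx => ?_)
    (left_mem_Icc.2 hab) (right_mem_Icc.2 hab) hab
  · rw [interior_Icc] at hx
    exact (hf x (Ioo_subset_Icc_self hx)).differentiableAt.differentiableWithinAt
  · rw [interior_Icc] at hx
    rw [(hf x (Ioo_subset_Icc_self hx)).deriv]
    exact hf' x hx

namespace CuspDatum

variable (D : CuspDatum)

/-- The length scale of the focussed region: at the time `t₀ + s²` the discontinuity has labels at
distance between `2 r s` and `4 r s` from the cusp. -/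
noncomputable def r : ℝ := √(D.κ / D.c)

/-- At the time `t₀ + s²`, every place at distance at most `θ s³` from the line `x = x₀ + v₀ s²` is
reached from the left. -/
noncomputable def θ : ℝ := D.κ * D.r / 5

@[simp] theorem reflect_r : D.reflect.r = D.r := rfl

@[simp] theorem reflect_θ : D.reflect.θ = D.θ := rfl

theorem r_pos : 0 < D.r := Real.sqrt_pos.2 (div_pos D.κ_pos D.c_pos)

theorem θ_pos : 0 < D.θ := div_pos (mul_pos D.κ_pos D.r_pos) (by norm_num)

theorem c_mul_r_sq : D.c * D.r ^ 2 = D.κ := by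
  rw [r, Real.sq_sqrt (div_pos D.κ_pos D.c_pos).le]
  have := D.c_pos.ne'
  field_simp

/-- The place `x₀ + v₀ τ + y` at the time `t₀ + τ`, in the frame moving with the cusp. -/
def cuspPoint (τ y : ℝ) : ℝ × ℝ := (D.t₀ + τ, D.x₀ + D.v₀ * τ + y)

/-- The fast characteristic of the cusp label bends to the left of the tangent of the cusp, by at
most `11 / 20 κ τ²`. -/
theorem Y_p₀_bounds {τ : ℝ} (h0 : 0 ≤ τ) (h1 : τ < D.δ) :
    -(11 / 20 * D.κ * τ ^ 2) ≤ D.Y (D.t₀ + τ, D.p₀) - D.x₀ - D.v₀ * τ ∧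
      D.Y (D.t₀ + τ, D.p₀) - D.x₀ - D.v₀ * τ ≤ 0 := by
  have hδ := D.δ_pos
  have he : ∀ τ, D.Y (D.t₀ + τ, D.p₀) = D.H (D.q₀ + τ) + D.G D.p₀ := by
    intro τ; simp only [Y, t₀]; congr 2; ring
  have hd : ∀ σ ∈ Icc 0 τ, HasDerivAt (fun σ => D.H (D.q₀ + σ)) (D.lp (D.q₀ + σ)) σ := by
    intro σ hσ
    exact (D.hasDerivAt_H (D.q₀ + σ) ⟨by linarith [hσ.1, D.p₀_lt_q₀], by linarith [hσ.2]⟩).comp_const_add _ _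
  have hest : ∀ σ ∈ Icc 0 τ, -(11 / 10 * D.κ * σ) ≤ D.lp (D.q₀ + σ) - D.v₀ ∧
      D.lp (D.q₀ + σ) - D.v₀ ≤ -(9 / 10 * D.κ * σ) := by
    intro σ hσ
    have := D.est_left 0 σ (by linarith) hσ.1 (by linarith [hσ.2])
    rw [add_zero] at this
    unfold v₀
    constructor <;> nlinarith [this.1, this.2]
  rw [he, x₀]
  constructor
  · have := le_of_hasDerivAt_nonneg (f := fun σ => D.H (D.q₀ + σ) - (D.v₀ * σ - 11 / 20 * D.κ * σ ^ 2)) h0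
      (fun σ hσ => (hd σ hσ).sub (((hasDerivAt_id σ).const_mul _).sub
        (((hasDerivAt_id σ).pow 2).const_mul _)))
      (fun σ hσ => by
        have := (hest σ (Ioo_subset_Icc_self hσ)).1
        simp only [id]; push_cast; nlinarith)
    simp only [add_zero, mul_zero, zero_pow two_ne_zero] at this
    linarith
  · have := le_of_hasDerivAt_nonneg (f := fun σ => D.v₀ * σ - D.H (D.q₀ + σ)) h0
      (fun σ hσ => ((hasDerivAt_id σ).const_mul _).sub (hd σ hσ))
      (fun σ hσ => by
        have := (hest σ (Ioo_subset_Icc_self hσ)).2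
        nlinarith [mul_nonneg D.κ_pos.le hσ.1.le])
    simp only [add_zero, mul_zero] at this
    linarith

theorem hasDerivAt_Y_cusp {τ ξ : ℝ} (h1 : -D.δ < ξ) (h2 : ξ ≤ 0) (h3 : 0 ≤ τ) (h4 : τ < D.δ) :
    HasDerivAt (fun ξ => D.Y (D.t₀ + τ, D.p₀ + ξ)) (D.lp (D.q₀ + (ξ + τ)) - D.lm (D.p₀ + ξ)) ξ := by
  have hpq := D.p₀_lt_q₀
  have := (D.hasDerivAt_Y_p (t := D.t₀ + τ) (p := D.p₀ + ξ) ⟨by linarith, by linarith⟩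
    ⟨by linarith [D.t₀_pos], by unfold t₀; linarith⟩).comp_const_add D.p₀ ξ
  rwa [show D.p₀ + ξ + (D.t₀ + τ) = D.q₀ + (ξ + τ) by unfold t₀; ring] at this

/-- To leading order the place in the frame of the cusp is `c ξ³ / 6 - κ τ ξ`. This upper bound,
with a margin of ten per cent, results from the integration of `est_left` from `ξ` to `0`. -/
theorem Y_cusp_le {τ ξ : ℝ} (h1 : -D.δ < ξ) (h2 : ξ ≤ 0) (h3 : 0 ≤ τ) (h4 : τ < D.δ) :
    D.Y (D.t₀ + τ, D.p₀ + ξ) - D.x₀ - D.v₀ * τ ≤ 3 / 20 * D.c * ξ ^ 3 - 11 / 10 * D.κ * τ * ξ := by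
  have := le_of_hasDerivAt_nonneg
    (f := fun ξ => D.Y (D.t₀ + τ, D.p₀ + ξ) - (3 / 20 * D.c * ξ ^ 3 - 11 / 10 * D.κ * τ * ξ)) h2
    (fun σ hσ => (D.hasDerivAt_Y_cusp (h1.trans_le hσ.1) hσ.2 h3 h4).sub
      ((((hasDerivAt_id σ).pow 3).const_mul _).sub ((hasDerivAt_id σ).const_mul _)))
    (fun σ hσ => by
      have := (D.est_left σ (σ + τ) (h1.trans hσ.1) (by linarith) (by linarith [hσ.2])).1
      simp only [id]; push_cast; nlinarith)
  have h5 := (D.Y_p₀_bounds h3 h4).2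
  simp only [add_zero] at this
  nlinarith

/-- The lower bound corresponding to `Y_cusp_le`. The last term is the deviation of the fast
characteristic `p₀` from the tangent. -/
theorem le_Y_cusp {τ ξ : ℝ} (h1 : -D.δ < ξ) (h2 : ξ ≤ 0) (h3 : 0 ≤ τ) (h4 : τ < D.δ) :
    11 / 60 * D.c * ξ ^ 3 - 9 / 10 * D.κ * τ * ξ - 11 / 20 * D.κ * τ ^ 2 ≤
      D.Y (D.t₀ + τ, D.p₀ + ξ) - D.x₀ - D.v₀ * τ := by
  have := le_of_hasDerivAt_nonneg
    (f := fun ξ => 11 / 60 * D.c * ξ ^ 3 - 9 / 10 * D.κ * τ * ξ - D.Y (D.t₀ + τ, D.p₀ + ξ)) h2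
    (fun σ hσ => ((((hasDerivAt_id σ).pow 3).const_mul _).sub ((hasDerivAt_id σ).const_mul _)).sub
      (D.hasDerivAt_Y_cusp (h1.trans_le hσ.1) hσ.2 h3 h4))
    (fun σ hσ => by
      have := (D.est_left σ (σ + τ) (h1.trans hσ.1) (by linarith) (by linarith [hσ.2])).2
      simp only [id]; push_cast; nlinarith)
  have h5 := (D.Y_p₀_bounds h3 h4).1
  simp only [add_zero] at this
  nlinarith

/-- The scale up to which the leading terms at the cusp dominate. -/
noncomputable def s₁ : ℝ := min (D.r / 5) (min (D.δ / (5 * D.r)) (min 1 (D.δ / 2)))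

theorem s₁_pos : 0 < D.s₁ := by
  have h1 := D.r_pos
  have h2 := D.δ_pos
  unfold s₁
  positivity

theorem le_s₁ {s : ℝ} (hs : s ≤ D.s₁) (h0 : 0 < s) :
    s ≤ D.r / 5 ∧ 4 * D.r * s < D.δ ∧ s ^ 2 < D.δ := by
  unfold s₁ at hs
  simp only [le_min_iff] at hs
  obtain ⟨h1, h2, h3, h4⟩ := hs
  have hr := D.r_pos
  refine ⟨h1, ?_, by nlinarith⟩
  rw [le_div_iff₀ (by positivity)] at h2
  nlinarith [mul_pos hr h0]

/-- In the region which the discontinuity will reach, the characteristics are spread out at a rate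
of order `s²`. -/
theorem spread {s ξ : ℝ} (h0 : 0 < s) (hs : s ≤ D.s₁) (h1 : -D.δ < ξ)
    (h2 : ξ ≤ -(2 * D.r * s)) :
    7 / 10 * D.κ * s ^ 2 ≤ D.lp (D.q₀ + (ξ + s ^ 2)) - D.lm (D.p₀ + ξ) := by
  obtain ⟨h3, h4, h5⟩ := D.le_s₁ hs h0
  have hr := D.r_pos
  have hrs := mul_pos hr h0
  have h6 := (D.est_left ξ (ξ + s ^ 2) h1 (by nlinarith) (by nlinarith)).1
  have h7 : (2 * D.r * s) ^ 2 ≤ ξ ^ 2 := by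
    rw [sq_le_sq, abs_of_pos (by positivity), abs_of_neg (by linarith)]; linarith
  have h8 := mul_le_mul_of_nonneg_left h7 D.c_pos.le
  have h9 : D.c * (2 * D.r * s) ^ 2 = 4 * D.κ * s ^ 2 := by
    rw [← D.c_mul_r_sq]; ring
  nlinarith

theorem mem_U_cusp {s ξ : ℝ} (h0 : 0 < s) (hs : s ≤ D.s₁) (h1 : -D.δ < ξ)
    (h2 : ξ ≤ -(2 * D.r * s)) : (D.t₀ + s ^ 2, D.p₀ + ξ) ∈ D.U := by
  have h3 := D.spread h0 hs h1 h2
  obtain ⟨_, h4, h5⟩ := D.le_s₁ hs h0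
  have hpq := D.p₀_lt_q₀
  have hrs := mul_pos D.r_pos h0
  have he : D.p₀ + ξ + (D.t₀ + s ^ 2) = D.q₀ + (ξ + s ^ 2) := by unfold t₀; ring
  refine ⟨⟨by simp; linarith, by simp; linarith⟩, ?_, Or.inr (by simp; linarith), ?_⟩
  · simp only [he]
    exact ⟨by nlinarith, by linarith⟩
  · simp only [he]
    nlinarith [mul_pos D.κ_pos (pow_pos h0 2)]

/-- Near the tangent of the cusp there are left states, with labels between `-4 r s` and `-2 r s`
relative to the cusp: by the cubic bounds, with `c r² = κ`, the place is at most `- 26 / 5 κ r s³`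
at the one end and at least `κ r s³ / 3 - 11 / 20 κ s⁴` at the other. -/
theorem exists_label_cusp {s y : ℝ} (h0 : 0 < s) (hs : s ≤ D.s₁) (hy : |y| ≤ D.θ * s ^ 3) :
    ∃ ξ, -(4 * D.r * s) ≤ ξ ∧ ξ ≤ -(2 * D.r * s) ∧ (D.t₀ + s ^ 2, D.p₀ + ξ) ∈ D.U ∧
      D.Y (D.t₀ + s ^ 2, D.p₀ + ξ) = D.x₀ + D.v₀ * s ^ 2 + y := by
  obtain ⟨h3, h4, h5⟩ := D.le_s₁ hs h0
  have hr := D.r_pos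
  have hrs := mul_pos hr h0
  have hκ := D.κ_pos
  have hcr := D.c_mul_r_sq
  have hle : -(4 * D.r * s) ≤ -(2 * D.r * s) := by nlinarith
  obtain ⟨hy1, hy2⟩ := abs_le.1 hy
  have hE : 0 < D.κ * D.r * s ^ 3 := by positivity
  have hθ : D.θ * s ^ 3 = D.κ * D.r * s ^ 3 / 5 := by unfold θ; ring
  have hlow := D.Y_cusp_le (τ := s ^ 2) (ξ := -(4 * D.r * s)) (by linarith) (by nlinarith)
    (sq_nonneg s) h5
  have hhigh := D.le_Y_cusp (τ := s ^ 2) (ξ := -(2 * D.r * s)) (by linarith) (by nlinarith)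
    (sq_nonneg s) h5
  have e1 : 3 / 20 * D.c * (-(4 * D.r * s)) ^ 3 - 11 / 10 * D.κ * s ^ 2 * (-(4 * D.r * s))
      = -(26 / 5 * (D.κ * D.r * s ^ 3)) := by rw [← hcr]; ring
  have e2 : 11 / 60 * D.c * (-(2 * D.r * s)) ^ 3 - 9 / 10 * D.κ * s ^ 2 * (-(2 * D.r * s))
      = 1 / 3 * (D.κ * D.r * s ^ 3) := by rw [← hcr]; ring
  rw [e1] at hlow
  rw [e2] at hhigh
  have e3 : D.κ * (s ^ 2) ^ 2 ≤ D.κ * D.r * s ^ 3 / 5 := by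
    have := mul_le_mul_of_nonneg_left h3 (show 0 ≤ D.κ * s ^ 3 by positivity)
    nlinarith
  have hc : ContinuousOn (fun ξ => D.Y (D.t₀ + s ^ 2, D.p₀ + ξ))
      (Icc (-(4 * D.r * s)) (-(2 * D.r * s))) := fun ξ hξ =>
    (D.hasDerivAt_Y_cusp (by linarith [hξ.1]) (by nlinarith [hξ.2]) (sq_nonneg s)
      h5).continuousAt.continuousWithinAt
  obtain ⟨ξ, hξ, he⟩ := intermediate_value_Icc hle hc
    (show D.x₀ + D.v₀ * s ^ 2 + y ∈ Icc _ _ from ⟨by linarith, by linarith⟩)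
  exact ⟨ξ, hξ.1, hξ.2, D.mem_U_cusp h0 hs (by linarith [hξ.1]) hξ.2, he⟩

/-- The fast label, relative to the cusp, of a place near the cusp. -/
noncomputable def cuspLabel (s y : ℝ) : ℝ := D.label (D.cuspPoint (s ^ 2) y) - D.p₀

/-- The momentum potential in the frame moving with the cusp. -/
def potH (η : ℝ) : ℝ := D.H (D.q₀ + η) - D.H D.q₀ - D.v₀ * η

theorem cuspLabel_spec {s y : ℝ} (h0 : 0 < s) (hs : s ≤ D.s₁) (hy : |y| ≤ D.θ * s ^ 3) :
    -(4 * D.r * s) ≤ D.cuspLabel s y ∧ D.cuspLabel s y ≤ -(2 * D.r * s) ∧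
      (D.t₀ + s ^ 2, D.p₀ + D.cuspLabel s y) ∈ D.U ∧
      D.Y (D.t₀ + s ^ 2, D.p₀ + D.cuspLabel s y) = D.x₀ + D.v₀ * s ^ 2 + y := by
  obtain ⟨ξ, h1, h2, h3, h4⟩ := D.exists_label_cusp h0 hs hy
  have : D.cuspLabel s y = ξ := by
    rw [cuspLabel, cuspPoint, ← h4, D.label_Y h3, add_sub_cancel_left]
  rw [this]
  exact ⟨h1, h2, h3, h4⟩

/-- `potH` vanishes to second order at the cusp. -/
theorem potH_sub_le {b η η' : ℝ} (hb : b < D.δ) (h : |η| ≤ b) (h' : |η'| ≤ b) :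
    |D.potH η - D.potH η'| ≤ 2 * D.κ * b * |η - η'| := by
  have hpq := D.p₀_lt_q₀
  have := (convex_Icc (-b) b).norm_image_sub_le_of_norm_hasDerivWithin_le (f := D.potH)
    (f' := fun η => D.lp (D.q₀ + η) - D.lp D.q₀) (C := 2 * D.κ * b) (fun η hη => ?_)
    (fun η hη => ?_) (abs_le.1 h') (abs_le.1 h)
  · simpa [Real.norm_eq_abs] using this
  · have h1 := (D.hasDerivAt_H (D.q₀ + η) ⟨by linarith [hη.1], by linarith [hη.2]⟩).comp_const_add
      D.q₀ η
    have h2 := (h1.sub_const (D.H D.q₀)).sub ((hasDerivAt_id η).const_mul D.v₀)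
    exact (h2.congr_deriv (by rw [mul_one, v₀, D.meet])).hasDerivWithinAt
  · have h1 := abs_le.2 hη
    rw [Real.norm_eq_abs]
    exact (D.lip_lp η (h1.trans_lt hb)).trans
      (mul_le_mul_of_nonneg_left h1 (by linarith [D.κ_pos]))

theorem potH_zero : D.potH 0 = 0 := by simp [potH]

theorem potH_le {b η : ℝ} (hb : b < D.δ) (h : |η| ≤ b) : |D.potH η| ≤ 2 * D.κ * b ^ 2 := by
  have h0 : 0 ≤ b := (abs_nonneg _).trans h
  have := D.potH_sub_le hb h (η' := 0) (by simpa)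
  rw [potH_zero, sub_zero, sub_zero] at this
  refine this.trans ?_
  have := mul_le_mul_of_nonneg_left h (show 0 ≤ 2 * D.κ * b by have := D.κ_pos; positivity)
  linarith

/-- As `∂Y/∂p` is of order `s²` by `spread`, the label is Lipschitz in the place with a constant of
order `s⁻²`. -/
theorem cuspLabel_sub_le {s y y' : ℝ} (h0 : 0 < s) (hs : s ≤ D.s₁) (hy : |y| ≤ D.θ * s ^ 3)
    (hy' : |y'| ≤ D.θ * s ^ 3) :
    |D.cuspLabel s y - D.cuspLabel s y'| ≤ 2 / (D.κ * s ^ 2) * |y - y'| := by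
  have hκ := D.κ_pos
  have hrs := mul_pos D.r_pos h0
  have key : ∀ y y', |y| ≤ D.θ * s ^ 3 → |y'| ≤ D.θ * s ^ 3 →
      D.cuspLabel s y' ≤ D.cuspLabel s y →
      7 / 10 * D.κ * s ^ 2 * (D.cuspLabel s y - D.cuspLabel s y') ≤ y - y' := by
    intro y y' hy hy' hle
    obtain ⟨h1, h2, h3, h4⟩ := D.cuspLabel_spec h0 hs hy
    obtain ⟨k1, k2, k3, k4⟩ := D.cuspLabel_spec h0 hs hy'
    obtain ⟨_, h6, h7⟩ := D.le_s₁ hs h0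
    have := le_of_hasDerivAt_nonneg
      (f := fun ξ => D.Y (D.t₀ + s ^ 2, D.p₀ + ξ) - 7 / 10 * D.κ * s ^ 2 * ξ) hle
      (fun σ hσ => (D.hasDerivAt_Y_cusp (by linarith [hσ.1]) (by nlinarith [hσ.2]) (sq_nonneg s)
        h7).sub ((hasDerivAt_id σ).const_mul _))
      (fun σ hσ => by
        have := D.spread h0 hs (by linarith [hσ.1]) (hσ.2.le.trans h2)
        linarith)
    simp only [h4, k4] at this
    linarith
  have hpos : 0 < D.κ * s ^ 2 := by positivity
  have key2 : 7 / 10 * (D.κ * s ^ 2) * |D.cuspLabel s y - D.cuspLabel s y'| ≤ |y - y'| := by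
    rcases le_total (D.cuspLabel s y') (D.cuspLabel s y) with h | h
    · rw [abs_of_nonneg (sub_nonneg.2 h)]
      linarith [key y y' hy hy' h, le_abs_self (y - y')]
    · rw [abs_of_nonpos (sub_nonpos.2 h)]
      linarith [key y' y hy' hy h, neg_abs_le (y - y')]
  rw [div_mul_eq_mul_div, le_div_iff₀ hpos]
  nlinarith [mul_nonneg hpos.le (abs_nonneg (D.cuspLabel s y - D.cuspLabel s y'))]

theorem abs_cuspLabel_add_le {s ξ : ℝ} (h0 : 0 < s) (hs : s ≤ D.s₁) (h1 : -(4 * D.r * s) ≤ ξ)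
    (h2 : ξ ≤ 0) : |ξ + s ^ 2| ≤ 4 * D.r * s := by
  obtain ⟨h3, h4, h5⟩ := D.le_s₁ hs h0
  rw [abs_le]
  have := D.r_pos
  constructor <;> nlinarith

theorem cuspLabel_nonpos {s y : ℝ} (h0 : 0 < s) (hs : s ≤ D.s₁) (hy : |y| ≤ D.θ * s ^ 3) :
    D.cuspLabel s y ≤ 0 := by
  have := mul_pos D.r_pos h0
  linarith [(D.cuspLabel_spec h0 hs hy).2.1]

/-- The derivative of `potH` is of order `s` at the labels in question, which compensates one of
the two orders lost in `cuspLabel_sub_le`. -/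
theorem potH_cuspLabel_sub_le {s y y' : ℝ} (h0 : 0 < s) (hs : s ≤ D.s₁) (hy : |y| ≤ D.θ * s ^ 3)
    (hy' : |y'| ≤ D.θ * s ^ 3) :
    |D.potH (D.cuspLabel s y + s ^ 2) - D.potH (D.cuspLabel s y' + s ^ 2)| ≤
      16 * D.r / s * |y - y'| := by
  have hκ := D.κ_pos
  have hr := D.r_pos
  have h1 := D.potH_sub_le (D.le_s₁ hs h0).2.1
    (D.abs_cuspLabel_add_le h0 hs (D.cuspLabel_spec h0 hs hy).1 (D.cuspLabel_nonpos h0 hs hy))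
    (D.abs_cuspLabel_add_le h0 hs (D.cuspLabel_spec h0 hs hy').1 (D.cuspLabel_nonpos h0 hs hy'))
  rw [add_sub_add_right_eq_sub] at h1
  refine h1.trans ((mul_le_mul_of_nonneg_left (D.cuspLabel_sub_le h0 hs hy hy') (by positivity)).trans
    (le_of_eq ?_))
  field_simp
  ring

/-- A priori bound: if the same place is reached from both sides, both labels are within `4 r s` of
the cusp. -/
theorem apriori {s y ξ ξ' : ℝ} (h0 : 0 < s) (hs : s ≤ D.s₁) (h1 : -D.δ < ξ) (h2 : ξ ≤ 0)
    (h1' : -D.δ < ξ') (h2' : ξ' ≤ 0) (h3 : D.Y (D.t₀ + s ^ 2, D.p₀ + ξ) = D.x₀ + D.v₀ * s ^ 2 + y)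
    (h3' : D.reflect.Y (D.t₀ + s ^ 2, D.reflect.p₀ + ξ') = -(D.x₀ + D.v₀ * s ^ 2 + y)) :
    -(4 * D.r * s) ≤ ξ := by
  have h5 := (D.le_s₁ hs h0).2.2
  have hr := D.r_pos
  have hc := D.c_pos
  -- the cubic upper bounds for the two states are bounds from opposite sides for the same place;
  -- in their sum `ξ³ + ξ'³ = (ξ + ξ') (ξ² - ξ ξ' + ξ'²)`, and the second factor is at least `3 / 4
  -- ξ²`
  have k1 := D.Y_cusp_le h1 h2 (sq_nonneg s) h5
  have k2 := D.reflect.Y_cusp_le h1' h2' (sq_nonneg s) h5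
  rw [reflect_t₀, h3', reflect_x₀, reflect_v₀] at k2
  rw [h3] at k1
  have k3 : (0 : ℝ) ≤ 3 / 20 * D.c * (ξ ^ 3 + ξ' ^ 3) - 11 / 10 * D.κ * s ^ 2 * (ξ + ξ') := by
    have e1 : D.reflect.c = D.c := rfl
    have e2 : D.reflect.κ = D.κ := rfl
    rw [e1, e2] at k2
    linarith
  rw [← D.c_mul_r_sq] at k3
  by_contra! hlt
  have hrs := mul_pos hr h0
  have h6 : ξ + ξ' < 0 := by linarith
  have h7 : (4 * D.r * s) ^ 2 < ξ ^ 2 := by nlinarith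
  have h8 : 0 < 3 / 20 * (ξ ^ 2 - ξ * ξ' + ξ' ^ 2) - 11 / 10 * (D.r * s) ^ 2 := by
    nlinarith [sq_nonneg (ξ - 2 * ξ')]
  have h9 : 3 / 20 * D.c * (ξ ^ 3 + ξ' ^ 3) - 11 / 10 * (D.c * D.r ^ 2) * s ^ 2 * (ξ + ξ') =
      D.c * ((ξ + ξ') * (3 / 20 * (ξ ^ 2 - ξ * ξ' + ξ' ^ 2) - 11 / 10 * (D.r * s) ^ 2)) := by ring
  rw [h9] at k3
  have := mul_neg_of_neg_of_pos h6 h8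
  nlinarith

theorem cuspPoint_eq {s y : ℝ} : D.cuspPoint (s ^ 2) y = (D.t₀ + s ^ 2, D.x₀ + D.v₀ * s ^ 2 + y) :=
  rfl

theorem continuousAt_label_cusp {s y : ℝ} (h0 : 0 < s) (hs : s ≤ D.s₁)
    (hy : |y| ≤ D.θ * s ^ 3) : ContinuousAt D.label (D.cuspPoint (s ^ 2) y) := by
  obtain ⟨_, _, h3, h4⟩ := D.cuspLabel_spec h0 hs hy
  rw [cuspPoint, ← h4]
  exact (D.contDiffAt_label h3).continuousAt

theorem continuousAt_potH {η : ℝ} (h : |η| < D.δ) : ContinuousAt D.potH η := by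
  have hpq := D.p₀_lt_q₀
  have := (D.hasDerivAt_H (D.q₀ + η) ⟨by linarith [(abs_lt.1 h).1], by linarith [(abs_lt.1 h).2]⟩).comp_const_add
      D.q₀ η
  exact (this.continuousAt.sub continuousAt_const).sub (by fun_prop)

end CuspDatum
end Chaplygin

namespace Chaplygin

/-! ### The equation of motion of the δ-shock -/

open scoped NNReal

theorem abs_div_sub_div_le {n₁ n₂ d₁ d₂ A B N m : ℝ} (hm : 0 < m) (h1 : m ≤ |d₁|) (h2 : m ≤ |d₂|)
    (hn : |n₁ - n₂| ≤ A) (hd : |d₁ - d₂| ≤ B) (hN : |n₂| ≤ N) :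
    |n₁ / d₁ - n₂ / d₂| ≤ A / m + N * B / m ^ 2 := by
  have k1 : 0 < |d₁| := hm.trans_le h1
  have k2 : 0 < |d₂| := hm.trans_le h2
  have hA : 0 ≤ A := (abs_nonneg _).trans hn
  have hB : 0 ≤ B := (abs_nonneg _).trans hd
  have hN' : 0 ≤ N := (abs_nonneg _).trans hN
  have e : n₁ / d₁ - n₂ / d₂ = (n₁ - n₂) / d₁ + n₂ * (d₂ - d₁) / (d₁ * d₂) := by
    have := abs_pos.1 k1
    have := abs_pos.1 k2
    field_simp
    ring
  rw [e]
  refine (abs_add_le _ _).trans (add_le_add ?_ ?_)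
  · rw [abs_div]; gcongr
  · rw [abs_div, abs_mul, abs_mul, abs_sub_comm d₂, sq]; gcongr

/-- The initial value problem `y' = F s y`, `y 0 = 0` in the cone `|y| ≤ θ s³`, for `F` of order
`s³`. -/
theorem exists_unique_cone {F : ℝ → ℝ → ℝ} {σ θ C : ℝ} {L : ℝ≥0} (hσ : 0 < σ)
    (hC : 0 ≤ C) (hCθ : C * σ ≤ θ)
    (hlip : ∀ s ∈ Ioc 0 σ, LipschitzOnWith L (F s) {y | |y| ≤ θ * s ^ 3})
    (hbd : ∀ s ∈ Ioc 0 σ, ∀ y, |y| ≤ θ * s ^ 3 → |F s y| ≤ 4 * C * s ^ 3)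
    (hcont : ∀ s ∈ Ioc 0 σ, ∀ y, |y| ≤ θ * s ^ 3 → ContinuousAt (fun P : ℝ × ℝ => F P.1 P.2) (s, y))
    (hF0 : ∀ y, F 0 y = 0) :
    ∃ y : ℝ → ℝ, y 0 = 0 ∧ (∀ s ∈ Icc 0 σ, HasDerivWithinAt y (F s (y s)) (Icc 0 σ) s) ∧
      (∀ s ∈ Icc 0 σ, |y s| ≤ C * s ^ 4) ∧
      ∀ z : ℝ → ℝ, ∀ σ' ≤ σ, z 0 = 0 → (∀ s ∈ Ioo 0 σ', |z s| ≤ θ * s ^ 3) →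
        (∀ s ∈ Ioo 0 σ', HasDerivAt z (F s (z s)) s) → EqOn z y (Ico 0 σ') := by
  have hθ : 0 ≤ θ := (by positivity : 0 ≤ C * σ).trans hCθ
  -- the equation with `y` truncated to the cone is globally Lipschitz
  let cl : ℝ → ℝ → ℝ := fun s y => max (-(θ * s ^ 3)) (min (θ * s ^ 3) y)
  have hcl : ∀ s, 0 ≤ s → ∀ y, |cl s y| ≤ θ * s ^ 3 := by
    intro s hs y
    have : 0 ≤ θ * s ^ 3 := by positivity
    exact abs_le.2 ⟨le_max_left _ _, max_le (by linarith) (min_le_left _ _)⟩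
  have hcl' : ∀ s y, |y| ≤ θ * s ^ 3 → cl s y = y := by
    intro s y h
    rw [abs_le] at h
    simp only [cl]
    rw [min_eq_right h.2, max_eq_right h.1]
  have hcllip : ∀ s y y', |cl s y - cl s y'| ≤ |y - y'| := by
    intro s y y'
    refine (abs_max_sub_max_le_max _ _ _ _).trans ?_
    rw [sub_self, abs_zero, max_eq_right (abs_nonneg _)]
    refine (abs_min_sub_min_le_max _ _ _ _).trans ?_
    rw [sub_self, abs_zero, max_eq_right (abs_nonneg _)]
  have hbd' : ∀ s ∈ Icc 0 σ, ∀ y, |F s (cl s y)| ≤ 4 * C * s ^ 3 := by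
    intro s hs y
    rcases hs.1.eq_or_lt with rfl | h0
    · simp [hF0]
    · exact hbd s ⟨h0, hs.2⟩ _ (hcl s h0.le y)
  have hPL : IsPicardLindelof (fun s y => F s (cl s y)) (tmin := 0) (tmax := σ)
      ⟨0, left_mem_Icc.2 hσ.le⟩ (0 : ℝ) (4 * C.toNNReal * σ.toNNReal ^ 3 * σ.toNNReal) 0
      (4 * C.toNNReal * σ.toNNReal ^ 3) L := by
    have hco : ((4 * C.toNNReal * σ.toNNReal ^ 3 : ℝ≥0) : ℝ) = 4 * C * σ ^ 3 := by
      push_cast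
      rw [Real.coe_toNNReal _ hC, Real.coe_toNNReal _ hσ.le]
    refine ⟨?_, ?_, ?_, ?_⟩
    · intro s hs
      rcases hs.1.eq_or_lt with rfl | h0
      · simp only [hF0]; exact (LipschitzWith.const' (0 : ℝ)).lipschitzOnWith
      · refine LipschitzOnWith.of_dist_le_mul fun y _ y' _ => ?_
        refine ((hlip s ⟨h0, hs.2⟩).dist_le_mul _ (hcl s h0.le y) _ (hcl s h0.le y')).trans ?_
        exact mul_le_mul_of_nonneg_left (hcllip s y y') L.2
    · intro y _ s hs
      rcases hs.1.eq_or_lt with rfl | h0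
      · have h1 : Tendsto (fun s : ℝ => 4 * C * s ^ 3) (𝓝[Icc 0 σ] 0) (𝓝 0) := by
          have : Tendsto (fun s : ℝ => 4 * C * s ^ 3) (𝓝 0) (𝓝 (4 * C * 0 ^ 3)) :=
            (by fun_prop : Continuous fun s : ℝ => 4 * C * s ^ 3).tendsto 0
          rw [show 4 * C * 0 ^ 3 = 0 by ring] at this
          exact this.mono_left nhdsWithin_le_nhds
        unfold ContinuousWithinAt
        simp only [hF0]
        refine squeeze_zero_norm' ?_ h1
        filter_upwards [self_mem_nhdsWithin] with r hr
        exact hbd' r hr y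
      · have h1 := hcont s ⟨h0, hs.2⟩ (cl s y) (hcl s h0.le y)
        have h2 : ContinuousAt (fun s => (s, cl s y)) s := by
          simp only [cl]; fun_prop
        exact (ContinuousAt.comp (g := fun P : ℝ × ℝ => F P.1 P.2) (f := fun s => (s, cl s y))
          h1 h2).continuousWithinAt
    · intro s hs y _
      rw [hco]
      refine (hbd' s hs y).trans ?_
      have := hs.1
      have := hs.2
      gcongr
    · push_cast
      rw [Real.coe_toNNReal _ hC, Real.coe_toNNReal _ hσ.le, sub_zero, sub_self,
        max_eq_left hσ.le, sub_zero]
  obtain ⟨y, hy0, hy⟩ := hPL.exists_eq_forall_mem_Icc_hasDerivWithinAt₀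
  have hy0 : y 0 = 0 := hy0
  -- the bound on `F` keeps the solution in the cone, where the truncation has no effect
  have hybd : ∀ s ∈ Icc 0 σ, |y s| ≤ C * s ^ 4 := by
    intro s hs
    have := image_norm_le_of_norm_deriv_right_le_deriv_boundary (f := y) (a := 0) (b := σ)
      (f' := fun s => F s (cl s (y s))) (B := fun s => C * s ^ 4) (B' := fun s => 4 * C * s ^ 3)
      (fun s hs => (hy s hs).continuousWithinAt)
      (fun s hs => (hy s (Ico_subset_Icc_self hs)).mono_of_mem_nhdsWithin
        (Icc_mem_nhdsGE_of_mem hs))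
      (by simp [hy0])
      (fun s => (((hasDerivAt_id s).pow 4).const_mul C).congr_deriv (by simp; ring))
      (fun s hs => hbd' s (Ico_subset_Icc_self hs) (y s)) hs
    exact this
  have hycone : ∀ s ∈ Icc 0 σ, |y s| ≤ θ * s ^ 3 := by
    intro s hs
    refine (hybd s hs).trans ?_
    have h1 : C * s ≤ θ := (mul_le_mul_of_nonneg_left hs.2 hC).trans hCθ
    have := mul_le_mul_of_nonneg_right h1 (pow_nonneg hs.1 3)
    linarith
  have hy' : ∀ s ∈ Icc 0 σ, HasDerivWithinAt y (F s (y s)) (Icc 0 σ) s := by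
    intro s hs
    have := hy s hs
    rwa [hcl' s _ (hycone s hs)] at this
  refine ⟨y, hy0, hy', hybd, fun z σ' hσ' hz0 hzc hz s hs => ?_⟩
  rcases hs.1.eq_or_lt with rfl | hs0
  · rw [hz0, hy0]
  -- a competitor is only known to solve the equation for `s > 0`; being in the cone, it is
  -- differentiable at `0` as well
  have hz1 : HasDerivWithinAt z 0 (Ici 0) 0 := by
    rw [hasDerivWithinAt_iff_tendsto]
    have h1 : Tendsto (fun s : ℝ => θ * s ^ 2) (𝓝[Ici 0] 0) (𝓝 0) := by
      have : Tendsto (fun s : ℝ => θ * s ^ 2) (𝓝 0) (𝓝 (θ * 0 ^ 2)) :=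
        (by fun_prop : Continuous fun s : ℝ => θ * s ^ 2).tendsto 0
      rw [show θ * 0 ^ 2 = 0 by ring] at this
      exact this.mono_left nhdsWithin_le_nhds
    refine squeeze_zero' (Eventually.of_forall fun s => by positivity) ?_ h1
    filter_upwards [self_mem_nhdsWithin, nhdsWithin_le_nhds (Iio_mem_nhds (hs0.trans hs.2))]
      with r hr hr'
    rcases (show (0 : ℝ) ≤ r from hr).eq_or_lt with rfl | hr0
    · simp
    · rw [hz0, sub_zero, sub_zero, smul_zero, sub_zero, Real.norm_eq_abs, Real.norm_eq_abs,
        abs_of_pos hr0, inv_mul_le_iff₀ hr0]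
      have := hzc r ⟨hr0, hr'⟩
      linarith
  refine ODE_solution_unique_of_mem_Icc_right (v := F) (s := fun s => {y | |y| ≤ θ * s ^ 3})
    (K := L) (a := 0) (b := s) ?_ ?_ ?_ ?_ ?_ ?_ ?_ (by rw [hz0, hy0]) (right_mem_Icc.2 hs0.le)
  · intro r hr
    rcases hr.1.eq_or_lt with rfl | hr0
    · have : F 0 = fun _ => 0 := funext hF0
      rw [this]; exact (LipschitzWith.const' (0 : ℝ)).lipschitzOnWith
    · exact hlip r ⟨hr0, by linarith [hr.2, hs.2]⟩
  · intro r hr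
    rcases hr.1.eq_or_lt with rfl | hr0
    · exact hz1.continuousWithinAt.mono Icc_subset_Ici_self
    · exact (hz r ⟨hr0, hr.2.trans_lt hs.2⟩).continuousAt.continuousWithinAt
  · intro r hr
    rcases hr.1.eq_or_lt with rfl | hr0
    · rw [hF0]; exact hz1
    · exact (hz r ⟨hr0, hr.2.trans hs.2⟩).hasDerivWithinAt
  · intro r hr
    rcases hr.1.eq_or_lt with rfl | hr0
    · simp [hz0]
    · exact hzc r ⟨hr0, hr.2.trans hs.2⟩
  · exact fun r hr => ((hy r ⟨hr.1, by linarith [hr.2, hs.2]⟩).continuousWithinAt).mono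
      (Icc_subset_Icc_right (by linarith [hs.2]))
  · intro r hr
    have hr' : r ∈ Ico 0 σ := ⟨hr.1, by linarith [hr.2, hs.2]⟩
    exact (hy' r (Ico_subset_Icc_self hr')).mono_of_mem_nhdsWithin (Icc_mem_nhdsGE_of_mem hr')
  · exact fun r hr => hycone r ⟨hr.1, by linarith [hr.2, hs.2]⟩

namespace CuspDatum

variable (D : CuspDatum)

/-- The mass `w √(1 + v²)` of the `δ`-shock at the place `x₀ + v₀ s² + y` and the time `t₀ + s²`,
when its mass is `m₀` at the cusp. -/
noncomputable def shockMass (μ m₀ s y : ℝ) : ℝ :=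
  m₀ - 2 * μ * (D.reflect.cuspLabel s (-y) + D.cuspLabel s y + s ^ 2)

/-- The momentum of the `δ`-shock in the frame moving with the cusp. -/
noncomputable def shockMomentum (μ s y : ℝ) : ℝ :=
  2 * μ * (y + D.reflect.potH (D.reflect.cuspLabel s (-y) + s ^ 2) -
    D.potH (D.cuspLabel s y + s ^ 2))

/-- The velocity of the `δ`-shock in the frame moving with the cusp. -/
noncomputable def drift (μ m₀ s y : ℝ) : ℝ := D.shockMomentum μ s y / D.shockMass μ m₀ s y

/-- The drift is at most `driftConst · s²`: the momentum is at most `130 μ κ r² s²` and the mass at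
least `|m₀| / 2`. -/
noncomputable def driftConst (μ m₀ : ℝ) : ℝ := 260 * μ * D.κ * D.r ^ 2 / |m₀|

theorem driftConst_pos {μ m₀ : ℝ} (hμ : 0 < μ) (hm : m₀ ≠ 0) : 0 < D.driftConst μ m₀ := by
  have := D.κ_pos
  have := D.r_pos
  have := abs_pos.2 hm
  unfold driftConst
  positivity

/-- The scale up to which the mass of the `δ`-shock is close to its initial value. -/
noncomputable def s₂ (μ m₀ : ℝ) : ℝ :=
  min D.s₁ (min (|m₀| / (32 * μ * D.r)) (D.θ / D.driftConst μ m₀))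

theorem s₂_pos {μ m₀ : ℝ} (hμ : 0 < μ) (hm : m₀ ≠ 0) : 0 < D.s₂ μ m₀ := by
  have h1 := D.s₁_pos
  have h2 := abs_pos.2 hm
  have h3 := D.r_pos
  have h4 := D.θ_pos
  have h5 := D.driftConst_pos hμ hm
  unfold s₂
  positivity

theorem le_s₂ {μ m₀ s : ℝ} (hμ : 0 < μ) (hm : m₀ ≠ 0) (hs : s ≤ D.s₂ μ m₀) :
    s ≤ D.s₁ ∧ 32 * μ * D.r * s ≤ |m₀| ∧ D.driftConst μ m₀ * s ≤ D.θ := by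
  unfold s₂ at hs
  simp only [le_min_iff] at hs
  obtain ⟨h1, h2, h3⟩ := hs
  have h4 := D.r_pos
  rw [le_div_iff₀ (by positivity)] at h2
  rw [le_div_iff₀ (D.driftConst_pos hμ hm)] at h3
  exact ⟨h1, by linarith, by linarith⟩

/-- As long as the labels are within `4 r s` of the cusp, the mass stays away from zero. -/
theorem le_abs_mass {μ m₀ s ξ ξ' : ℝ} (hμ : 0 < μ) (h0 : 0 < s) (hs : s ≤ D.s₁)
    (hs' : 32 * μ * D.r * s ≤ |m₀|) (h1 : -(4 * D.r * s) ≤ ξ) (h1' : -(4 * D.r * s) ≤ ξ')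
    (h2 : ξ ≤ 0) (h2' : ξ' ≤ 0) :
    |m₀| / 2 ≤ |m₀ - 2 * μ * (ξ' + ξ + s ^ 2)| := by
  have h3 := (D.le_s₁ hs h0).1
  have hr := D.r_pos
  have h4 : |ξ' + ξ + s ^ 2| ≤ 8 * D.r * s := by
    rw [abs_le]; constructor <;> nlinarith
  have h5 : |2 * μ * (ξ' + ξ + s ^ 2)| ≤ 16 * μ * D.r * s := by
    rw [abs_mul, abs_of_pos (by positivity : 0 < 2 * μ)]
    nlinarith
  have h6 := abs_sub_abs_le_abs_sub m₀ (2 * μ * (ξ' + ξ + s ^ 2))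
  linarith

/-- As long as the labels are within `4 r s` of the cusp, the momentum is of order `s²`. The
constant is `130 = 2 (1 + 2 · 32)`, where `32 = 2 · 4²` comes from `potH_le`. -/
theorem abs_momentum_le {μ s y ξ ξ' : ℝ} (hμ : 0 < μ) (h0 : 0 < s) (hs : s ≤ D.s₁)
    (h1 : -(4 * D.r * s) ≤ ξ) (h1' : -(4 * D.r * s) ≤ ξ') (h2 : ξ ≤ 0) (h2' : ξ' ≤ 0)
    (hy : |y| ≤ D.κ * D.r ^ 2 * s ^ 2) :
    |2 * μ * (y + D.reflect.potH (ξ' + s ^ 2) - D.potH (ξ + s ^ 2))| ≤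
      130 * μ * D.κ * D.r ^ 2 * s ^ 2 := by
  have h3 := (D.le_s₁ hs h0).2.1
  have h4 := D.potH_le h3 (D.abs_cuspLabel_add_le h0 hs h1 h2)
  have h5 := D.reflect.potH_le h3 (D.reflect.abs_cuspLabel_add_le h0 hs h1' h2')
  have e2 : D.reflect.κ = D.κ := rfl
  rw [e2] at h5
  have h6 : |y + D.reflect.potH (ξ' + s ^ 2) - D.potH (ξ + s ^ 2)| ≤ 65 * D.κ * D.r ^ 2 * s ^ 2 := by
    refine (abs_sub _ _).trans ((add_le_add_left (abs_add_le _ _) _).trans ?_)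
    nlinarith
  rw [abs_mul, abs_of_pos (by positivity : 0 < 2 * μ)]
  nlinarith

theorem θ_mul_le {s : ℝ} (h0 : 0 < s) (hs : s ≤ D.s₁) :
    D.θ * s ^ 3 ≤ D.κ * D.r ^ 2 * s ^ 2 := by
  have h3 := (D.le_s₁ hs h0).1
  have hr := D.r_pos
  have hκ := D.κ_pos
  have : D.θ * s ^ 3 = D.κ * D.r * s ^ 2 * (s / 5) := by unfold θ; ring
  rw [this]
  have h4 : s / 5 ≤ D.r := by linarith
  have := mul_le_mul_of_nonneg_left h4 (show 0 ≤ D.κ * D.r * s ^ 2 by positivity)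
  linarith

theorem quotient_le {μ m₀ s n d : ℝ} (hm : m₀ ≠ 0)
    (hn : |n| ≤ 130 * μ * D.κ * D.r ^ 2 * s ^ 2) (hd : |m₀| / 2 ≤ |d|) :
    |n / d| ≤ D.driftConst μ m₀ * s ^ 2 := by
  have h1 := abs_pos.2 hm
  rw [abs_div, div_le_iff₀ (by linarith)]
  refine hn.trans ?_
  have h0 := (abs_nonneg n).trans hn
  have : D.driftConst μ m₀ * s ^ 2 * (|m₀| / 2) = 130 * μ * D.κ * D.r ^ 2 * s ^ 2 := by
    unfold driftConst; field_simp; ring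
  rw [← this] at h0 ⊢
  have h2 : 0 ≤ D.driftConst μ m₀ * s ^ 2 := by
    by_contra! h; nlinarith
  exact mul_le_mul_of_nonneg_left hd h2

theorem reflect_cone {s y : ℝ} (hy : |y| ≤ D.θ * s ^ 3) : |(-y)| ≤ D.reflect.θ * s ^ 3 := by
  rwa [abs_neg]

theorem le_abs_shockMass {μ m₀ s y : ℝ} (hμ : 0 < μ) (hm : m₀ ≠ 0) (h0 : 0 < s)
    (hs : s ≤ D.s₂ μ m₀) (hy : |y| ≤ D.θ * s ^ 3) : |m₀| / 2 ≤ |D.shockMass μ m₀ s y| := by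
  obtain ⟨h1, h2, h3⟩ := D.le_s₂ hμ hm hs
  exact D.le_abs_mass hμ h0 h1 h2 (D.cuspLabel_spec h0 h1 hy).1
    (D.reflect.cuspLabel_spec h0 h1 (D.reflect_cone hy)).1 (D.cuspLabel_nonpos h0 h1 hy)
    (D.reflect.cuspLabel_nonpos h0 h1 (D.reflect_cone hy))

theorem abs_shockMomentum_le {μ s y : ℝ} (hμ : 0 < μ) (h0 : 0 < s)
    (hs : s ≤ D.s₁) (hy : |y| ≤ D.θ * s ^ 3) :
    |D.shockMomentum μ s y| ≤ 130 * μ * D.κ * D.r ^ 2 * s ^ 2 :=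
  D.abs_momentum_le hμ h0 hs (D.cuspLabel_spec h0 hs hy).1
    (D.reflect.cuspLabel_spec h0 hs (D.reflect_cone hy)).1 (D.cuspLabel_nonpos h0 hs hy)
    (D.reflect.cuspLabel_nonpos h0 hs (D.reflect_cone hy)) (hy.trans (D.θ_mul_le h0 hs))

theorem abs_drift_le {μ m₀ s y : ℝ} (hμ : 0 < μ) (hm : m₀ ≠ 0) (h0 : 0 < s)
    (hs : s ≤ D.s₂ μ m₀) (hy : |y| ≤ D.θ * s ^ 3) :
    |D.drift μ m₀ s y| ≤ D.driftConst μ m₀ * s ^ 2 :=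
  D.quotient_le hm (D.abs_shockMomentum_le hμ h0 (D.le_s₂ hμ hm hs).1 hy)
    (D.le_abs_shockMass hμ hm h0 hs hy)

/-- The momentum has a Lipschitz constant of order `s⁻¹`, and the mass one of order `s⁻²`, which
the quotient rule multiplies by the momentum, of order `s²`. The factor `2 s = dt / ds` makes up
for the loss of one order. -/
theorem drift_lipschitz {μ m₀ s : ℝ} (hμ : 0 < μ) (hm : m₀ ≠ 0) (h0 : 0 < s)
    (hs : s ≤ D.s₂ μ m₀) {y y' : ℝ} (hy : |y| ≤ D.θ * s ^ 3) (hy' : |y'| ≤ D.θ * s ^ 3) :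
    |2 * s * D.drift μ m₀ s y - 2 * s * D.drift μ m₀ s y'| ≤
      (264 * μ * D.r / |m₀| + 8320 * μ ^ 2 * D.r ^ 3 / |m₀| ^ 2) * |y - y'| := by
  obtain ⟨h1, h2, h3⟩ := D.le_s₂ hμ hm hs
  have hm' := abs_pos.2 hm
  have hr := D.r_pos
  have hκ := D.κ_pos
  have hsr := (D.le_s₁ h1 h0).1
  have a1 := D.cuspLabel_sub_le h0 h1 hy hy'
  have a2 := D.reflect.cuspLabel_sub_le h0 h1 (D.reflect_cone hy) (D.reflect_cone hy')
  have a3 := D.potH_cuspLabel_sub_le h0 h1 hy hy'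
  have a4 := D.reflect.potH_cuspLabel_sub_le h0 h1 (D.reflect_cone hy) (D.reflect_cone hy')
  have e1 : |(-y - -y')| = |y - y'| := by rw [← abs_neg]; congr 1; ring
  have e2 : D.reflect.κ = D.κ := rfl
  rw [e1, e2] at a2
  rw [e1, reflect_r] at a4
  set Δ := |y - y'| with hΔ
  have hΔ0 : 0 ≤ Δ := abs_nonneg _
  have b1 : |D.shockMomentum μ s y - D.shockMomentum μ s y'| ≤ 66 * μ * D.r / s * Δ := by
    have e3 : D.shockMomentum μ s y - D.shockMomentum μ s y' = 2 * μ * ((y - y') +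
        (D.reflect.potH (D.reflect.cuspLabel s (-y) + s ^ 2) -
          D.reflect.potH (D.reflect.cuspLabel s (-y') + s ^ 2)) -
        (D.potH (D.cuspLabel s y + s ^ 2) - D.potH (D.cuspLabel s y' + s ^ 2))) := by
      unfold shockMomentum; ring
    rw [e3, abs_mul, abs_of_pos (by positivity : 0 < 2 * μ)]
    have h5 : Δ ≤ D.r / s * Δ := by
      have : 1 ≤ D.r / s := by rw [le_div_iff₀ h0]; linarith
      nlinarith
    have h6 := (abs_sub _ _).trans ((add_le_add_left (abs_add_le (y - y') _) _).trans
      (add_le_add (add_le_add (h5) a4) a3))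
    refine (mul_le_mul_of_nonneg_left h6 (by positivity)).trans (le_of_eq ?_)
    ring
  have b2 : |D.shockMass μ m₀ s y - D.shockMass μ m₀ s y'| ≤ 8 * μ / (D.κ * s ^ 2) * Δ := by
    have e3 : D.shockMass μ m₀ s y - D.shockMass μ m₀ s y' = -(2 * μ * (
        (D.reflect.cuspLabel s (-y) - D.reflect.cuspLabel s (-y')) +
          (D.cuspLabel s y - D.cuspLabel s y'))) := by
      unfold shockMass; ring
    rw [e3, abs_neg, abs_mul, abs_of_pos (by positivity : 0 < 2 * μ)]
    refine (mul_le_mul_of_nonneg_left ((abs_add_le _ _).trans (add_le_add a2 a1))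
      (by positivity)).trans (le_of_eq ?_)
    ring
  have b3 := abs_div_sub_div_le (by linarith) (D.le_abs_shockMass hμ hm h0 hs hy)
    (D.le_abs_shockMass hμ hm h0 hs hy') b1 b2 (D.abs_shockMomentum_le hμ h0 h1 hy')
  rw [← mul_sub, abs_mul, abs_of_pos (by positivity : 0 < 2 * s)]
  unfold drift
  refine (mul_le_mul_of_nonneg_left b3 (by positivity)).trans ?_
  have e4 : 2 * s * (66 * μ * D.r / s * Δ / (|m₀| / 2) + 130 * μ * D.κ * D.r ^ 2 * s ^ 2 *
      (8 * μ / (D.κ * s ^ 2) * Δ) / (|m₀| / 2) ^ 2) =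
      (264 * μ * D.r / |m₀| + 8320 * μ ^ 2 * D.r ^ 2 * s / |m₀| ^ 2) * Δ := by
    field_simp
    ring
  rw [e4]
  have h7 : D.r ^ 2 * s ≤ D.r ^ 3 := by
    have : s ≤ D.r := by linarith
    nlinarith [sq_nonneg D.r]
  have h8 : 8320 * μ ^ 2 * D.r ^ 2 * s ≤ 8320 * μ ^ 2 * D.r ^ 3 := by
    have := mul_le_mul_of_nonneg_left h7 (show 0 ≤ 8320 * μ ^ 2 by positivity)
    linarith
  gcongr

theorem continuousAt_cuspLabel {s y : ℝ} (h0 : 0 < s) (hs : s ≤ D.s₁) (hy : |y| ≤ D.θ * s ^ 3) :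
    ContinuousAt (fun P : ℝ × ℝ => D.cuspLabel P.1 P.2) (s, y) := by
  unfold cuspLabel
  refine ContinuousAt.sub (ContinuousAt.comp (g := D.label)
    (f := fun P : ℝ × ℝ => D.cuspPoint (P.1 ^ 2) P.2) (D.continuousAt_label_cusp h0 hs hy) ?_)
    continuousAt_const
  unfold cuspPoint
  fun_prop

theorem continuousAt_potH_cuspLabel {s y : ℝ} (h0 : 0 < s) (hs : s ≤ D.s₁)
    (hy : |y| ≤ D.θ * s ^ 3) :
    ContinuousAt (fun P : ℝ × ℝ => D.potH (D.cuspLabel P.1 P.2 + P.1 ^ 2)) (s, y) := by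
  refine ContinuousAt.comp (g := D.potH) (f := fun P : ℝ × ℝ => D.cuspLabel P.1 P.2 + P.1 ^ 2)
    (D.continuousAt_potH ?_) ((D.continuousAt_cuspLabel h0 hs hy).add (by fun_prop))
  exact (D.abs_cuspLabel_add_le h0 hs (D.cuspLabel_spec h0 hs hy).1
    (D.cuspLabel_nonpos h0 hs hy)).trans_lt (D.le_s₁ hs h0).2.1

theorem continuousAt_reflect_neg {F : ℝ × ℝ → ℝ} {s y : ℝ} (h : ContinuousAt F (s, -y)) :
    ContinuousAt (fun P : ℝ × ℝ => F (P.1, -P.2)) (s, y) :=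
  ContinuousAt.comp (g := F) (f := fun P : ℝ × ℝ => (P.1, -P.2)) h (by fun_prop)

theorem continuousAt_shockMass {μ m₀ s y : ℝ} (h0 : 0 < s) (hs : s ≤ D.s₁)
    (hy : |y| ≤ D.θ * s ^ 3) :
    ContinuousAt (fun P : ℝ × ℝ => D.shockMass μ m₀ P.1 P.2) (s, y) := by
  unfold shockMass
  have h1 := D.continuousAt_cuspLabel h0 hs hy
  have h2 := continuousAt_reflect_neg
    (D.reflect.continuousAt_cuspLabel h0 hs (D.reflect_cone hy))
  fun_prop

theorem continuousAt_drift {μ m₀ s y : ℝ} (hμ : 0 < μ) (hm : m₀ ≠ 0) (h0 : 0 < s)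
    (hs : s ≤ D.s₂ μ m₀) (hy : |y| ≤ D.θ * s ^ 3) :
    ContinuousAt (fun P : ℝ × ℝ => D.drift μ m₀ P.1 P.2) (s, y) := by
  have hs' := (D.le_s₂ hμ hm hs).1
  unfold drift
  refine ContinuousAt.div ?_ (D.continuousAt_shockMass h0 hs' hy) ?_
  · unfold shockMomentum
    have h1 := D.continuousAt_potH_cuspLabel h0 hs' hy
    have h2 := continuousAt_reflect_neg
      (D.reflect.continuousAt_potH_cuspLabel h0 hs' (D.reflect_cone hy))
    fun_prop
  · have := D.le_abs_shockMass hμ hm h0 hs hy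
    exact abs_pos.1 (lt_of_lt_of_le (by have := abs_pos.2 hm; positivity) this)

/-- The path of the `δ`-shock, in the variable `s = √(t - t₀)` in which its equation is
Lipschitz. -/
theorem exists_path {μ m₀ : ℝ} (hμ : 0 < μ) (hm : m₀ ≠ 0) :
    ∃ y : ℝ → ℝ, y 0 = 0 ∧ (∀ s ∈ Icc 0 (D.s₂ μ m₀),
        HasDerivWithinAt y (2 * s * D.drift μ m₀ s (y s)) (Icc 0 (D.s₂ μ m₀)) s) ∧
      (∀ s ∈ Icc 0 (D.s₂ μ m₀), |y s| ≤ D.driftConst μ m₀ * s ^ 4) ∧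
      ∀ z : ℝ → ℝ, ∀ σ' ≤ D.s₂ μ m₀, z 0 = 0 → (∀ s ∈ Ioo 0 σ', |z s| ≤ D.θ * s ^ 3) →
        (∀ s ∈ Ioo 0 σ', HasDerivAt z (2 * s * D.drift μ m₀ s (z s)) s) →
          EqOn z y (Ico 0 σ') := by
  have hC := D.driftConst_pos hμ hm
  have hσ := D.s₂_pos hμ hm
  have hr := D.r_pos
  refine exists_unique_cone (F := fun s y => 2 * s * D.drift μ m₀ s y) (C := D.driftConst μ m₀)
    (L := (264 * μ * D.r / |m₀| + 8320 * μ ^ 2 * D.r ^ 3 / |m₀| ^ 2).toNNReal) hσ hC.le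
    (D.le_s₂ hμ hm le_rfl).2.2 ?_ ?_ ?_ (fun y => by simp)
  · intro s hs
    refine LipschitzOnWith.of_dist_le_mul fun y hy y' hy' => ?_
    rw [Real.coe_toNNReal _ (by positivity)]
    exact D.drift_lipschitz hμ hm hs.1 hs.2 hy hy'
  · intro s hs y hy
    have := D.abs_drift_le hμ hm hs.1 hs.2 hy
    have h0 := hs.1
    rw [abs_mul, abs_of_pos (by positivity)]
    have h2 := mul_le_mul_of_nonneg_left this (show 0 ≤ 2 * s by positivity)
    have h3 : 0 ≤ D.driftConst μ m₀ * s ^ 3 := by positivity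
    nlinarith
  · intro s hs y hy
    have := D.continuousAt_drift hμ hm hs.1 hs.2 hy
    fun_prop

end CuspDatum
end Chaplygin

namespace Chaplygin

/-! ### The system in Riemann invariants, and the mass and momentum of the δ-shock -/

/-- The system in diagonal form implies the system in conservation form. -/
theorem solvesSystemAt_of_transport {p₀ μ : ℝ} (hμ : 0 < μ) {gm gp : ℝ × ℝ → ℝ} {P : ℝ × ℝ}
    {A B C E : ℝ} (hgm : HasFDerivAt gm (gradForm A B) P) (hgp : HasFDerivAt gp (gradForm C E) P)
    (h1 : A + gp P * B = 0) (h2 : C + gm P * E = 0) (hlt : gm P < gp P) :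
    SolvesSystemAt p₀ μ (fun P => 2 * μ / (gp P - gm P)) (fun P => (gm P + gp P) / 2) P := by
  obtain ⟨t, x⟩ := P
  have a1 := hasFDerivAt_partial_t hgm
  have a2 := hasFDerivAt_partial_t hgp
  have b1 := hasFDerivAt_partial_x hgm
  have b2 := hasFDerivAt_partial_x hgp
  have hne : gp (t, x) - gm (t, x) ≠ 0 := (sub_pos.2 hlt).ne'
  have hρ : 2 * μ / (gp (t, x) - gm (t, x)) ≠ 0 := div_ne_zero (by positivity) hne
  have ρt := (hasDerivAt_const t (2 * μ)).div (a2.sub a1) hne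
  have ρx := (hasDerivAt_const x (2 * μ)).div (b2.sub b1) hne
  have ut := (a1.add a2).div_const 2
  have ux := (b1.add b2).div_const 2
  have hA : A = -(gp (t, x) * B) := by linarith
  have hC : C = -(gm (t, x) * E) := by linarith
  unfold SolvesSystemAt pressure
  constructor
  · have e1 := ρt.deriv
    have e2 := (ρx.mul ux).deriv
    simp only [Pi.div_def, Pi.mul_def, Pi.sub_def, Pi.add_def] at e1 e2
    rw [e1, e2, hA, hC]
    field_simp
    ring
  · have e1 := (ρt.mul ut).deriv
    have e2 := ((ρx.mul (ux.pow 2)).add (((hasDerivAt_const x (μ ^ 2)).div ρx hρ).const_sub p₀)).deriv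
    simp only [Pi.div_def, Pi.mul_def, Pi.sub_def, Pi.add_def, Pi.pow_def] at e1 e2
    rw [e1, e2, hA, hC]
    push_cast
    field_simp
    ring

/-- The system in conservation form implies the system in diagonal form. -/
theorem transport_of_solvesSystemAt {p₀ μ : ℝ} {ρ u : ℝ × ℝ → ℝ} {P : ℝ × ℝ}
    (hρ : DifferentiableAt ℝ ρ P) (hu : DifferentiableAt ℝ u P) (hpos : 0 < ρ P)
    (h : SolvesSystemAt p₀ μ ρ u P) : ∃ A B C E,
    HasFDerivAt (lamMinus μ ρ u) (gradForm A B) P ∧ HasFDerivAt (lamPlus μ ρ u) (gradForm C E) P ∧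
      A + lamPlus μ ρ u P * B = 0 ∧ C + lamMinus μ ρ u P * E = 0 := by
  obtain ⟨t, x⟩ := P
  have hne := hpos.ne'
  have hi : DifferentiableAt ℝ (fun P => μ / ρ P) (t, x) := by
    simp only [div_eq_mul_inv]
    exact ((hasDerivAt_inv hne).differentiableAt.comp (t, x) hρ).const_mul μ
  have dm : DifferentiableAt ℝ (lamMinus μ ρ u) (t, x) := hu.sub hi
  have dp : DifferentiableAt ℝ (lamPlus μ ρ u) (t, x) := hu.add hi
  have hm := hasFDerivAt_gradForm dm
  have hp := hasFDerivAt_gradForm dp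
  refine ⟨_, _, _, _, hm, hp, ?_, ?_⟩
  all_goals
    have ρt := hasFDerivAt_partial_t (hasFDerivAt_gradForm hρ)
    have ρx := hasFDerivAt_partial_x (hasFDerivAt_gradForm hρ)
    have ut := hasFDerivAt_partial_t (hasFDerivAt_gradForm hu)
    have ux := hasFDerivAt_partial_x (hasFDerivAt_gradForm hu)
    have mt := (hasFDerivAt_partial_t hm).unique (ut.sub ((hasDerivAt_const t μ).div ρt hne))
    have mx := (hasFDerivAt_partial_x hm).unique (ux.sub ((hasDerivAt_const x μ).div ρx hne))
    have pt := (hasFDerivAt_partial_t hp).unique (ut.add ((hasDerivAt_const t μ).div ρt hne))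
    have px := (hasFDerivAt_partial_x hp).unique (ux.add ((hasDerivAt_const x μ).div ρx hne))
    have e1 := h.1
    have e2 := h.2
    have k1 := (ρx.mul ux).deriv
    have k2 := (ρt.mul ut).deriv
    have k3 := ((ρx.mul (ux.pow 2)).add (((hasDerivAt_const x (μ ^ 2)).div ρx hne).const_sub p₀)).deriv
    simp only [Pi.div_def, Pi.mul_def, Pi.add_def, Pi.pow_def] at k1 k2 k3
    unfold pressure at e2
    simp only at e1 e2
    rw [ρt.deriv, k1] at e1
    rw [k2, k3] at e2
    rw [mt, mx, pt, px] at *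
    simp only [lamMinus, lamPlus]
    set r := ρ (t, x)
    set w := u (t, x)
    set rt := fderiv ℝ ρ (t, x) (1, 0)
    set rx := fderiv ℝ ρ (t, x) (0, 1)
    set wt := fderiv ℝ u (t, x) (1, 0)
    set wx := fderiv ℝ u (t, x) (0, 1)
    have e3 : rt = -(rx * w + r * wx) := by linarith
    rw [e3] at e2 ⊢
    have e4 : wt = -(w * wx) - μ ^ 2 * rx / r ^ 3 := by
      push_cast at e2
      field_simp at e2 ⊢
      linear_combination (1 : ℝ) * e2
    rw [e4]
    field_simp
    ring

/-- The diagonal system under the reflection `x ↦ -x`. -/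
theorem transport_neg {gm gp : ℝ × ℝ → ℝ} {t x : ℝ}
    (h : ∃ A B C E, HasFDerivAt gm (gradForm A B) (t, -x) ∧
      HasFDerivAt gp (gradForm C E) (t, -x) ∧ A + gp (t, -x) * B = 0 ∧ C + gm (t, -x) * E = 0) :
    ∃ A B C E, HasFDerivAt (fun P : ℝ × ℝ => -gp (P.1, -P.2)) (gradForm A B) (t, x) ∧
      HasFDerivAt (fun P : ℝ × ℝ => -gm (P.1, -P.2)) (gradForm C E) (t, x) ∧
      A + -gm (t, -x) * B = 0 ∧ C + -gp (t, -x) * E = 0 := by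
  obtain ⟨A, B, C, E, h1, h2, h3, h4⟩ := h
  have hn : HasFDerivAt (fun P : ℝ × ℝ => (P.1, -P.2))
      ((ContinuousLinearMap.fst ℝ ℝ ℝ).prod (-ContinuousLinearMap.snd ℝ ℝ ℝ)) (t, x) :=
    hasFDerivAt_fst.prodMk hasFDerivAt_snd.neg
  have k1 := (HasFDerivAt.comp (g := gm) (f := fun P : ℝ × ℝ => (P.1, -P.2)) (t, x) h1 hn).neg
  have k2 := (HasFDerivAt.comp (g := gp) (f := fun P : ℝ × ℝ => (P.1, -P.2)) (t, x) h2 hn).neg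
  refine ⟨-C, E, -A, B, ?_, ?_, by linarith, by linarith⟩
  · convert! k2 using 1
    ext <;> simp
  · convert! k1 using 1
    ext <;> simp

namespace CuspDatum

variable (D : CuspDatum)

/-- The density of the left state. -/
noncomputable def rho (μ : ℝ) (P : ℝ × ℝ) : ℝ := 2 * μ / (D.gp P - D.gm P)

/-- The velocity of the left state. -/
noncomputable def vel (P : ℝ × ℝ) : ℝ := (D.gm P + D.gp P) / 2

theorem half_width {μ : ℝ} (hμ : 0 < μ) (P : ℝ × ℝ) : μ / D.rho μ P = (D.gp P - D.gm P) / 2 := by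
  unfold rho
  rcases eq_or_ne (D.gp P - D.gm P) 0 with h | h
  · simp [h]
  · field_simp

theorem lamMinus_rho_vel {μ : ℝ} (hμ : 0 < μ) (P : ℝ × ℝ) :
    lamMinus μ (D.rho μ) D.vel P = D.gm P := by
  rw [lamMinus, D.half_width hμ, vel]; ring

theorem lamPlus_rho_vel {μ : ℝ} (hμ : 0 < μ) (P : ℝ × ℝ) :
    lamPlus μ (D.rho μ) D.vel P = D.gp P := by
  rw [lamPlus, D.half_width hμ, vel]; ring

theorem gm_lt_gp {t p : ℝ} (h : (t, p) ∈ D.U) : D.gm (t, D.Y (t, p)) < D.gp (t, D.Y (t, p)) := by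
  rw [D.gm_Y h, D.gp_Y h]; exact h.2.2.2

theorem rho_pos {μ t p : ℝ} (hμ : 0 < μ) (h : (t, p) ∈ D.U) : 0 < D.rho μ (t, D.Y (t, p)) :=
  div_pos (by positivity) (sub_pos.2 (D.gm_lt_gp h))

theorem contDiffAt_rho {μ t p : ℝ} (h : (t, p) ∈ D.U) :
    ContDiffAt ℝ 1 (D.rho μ) (t, D.Y (t, p)) :=
  contDiffAt_const.div ((D.contDiffAt_gp h).sub (D.contDiffAt_gm h)) (sub_pos.2 (D.gm_lt_gp h)).ne'

theorem contDiffAt_vel {t p : ℝ} (h : (t, p) ∈ D.U) : ContDiffAt ℝ 1 D.vel (t, D.Y (t, p)) :=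
  ((D.contDiffAt_gm h).add (D.contDiffAt_gp h)).div_const 2

theorem solvesSystemAt {p₀ μ t p : ℝ} (hμ : 0 < μ) (h : (t, p) ∈ D.U) :
    SolvesSystemAt p₀ μ (D.rho μ) D.vel (t, D.Y (t, p)) := by
  obtain ⟨A, B, C, E, h1, h2, h3, h4⟩ := D.transport_gm_gp h
  exact solvesSystemAt_of_transport hμ h1 h2 h3 h4 (D.gm_lt_gp h)

/-- The density of the right state. -/
noncomputable def rhoRight (μ : ℝ) (P : ℝ × ℝ) : ℝ := D.reflect.rho μ (P.1, -P.2)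

/-- The velocity of the right state. -/
noncomputable def velRight (P : ℝ × ℝ) : ℝ := -D.reflect.vel (P.1, -P.2)

theorem lamMinus_right {μ : ℝ} (hμ : 0 < μ) (t x : ℝ) :
    lamMinus μ (D.rhoRight μ) D.velRight (t, x) = -D.reflect.gp (t, -x) := by
  rw [lamMinus, rhoRight, D.reflect.half_width hμ, velRight, vel]; ring

theorem lamPlus_right {μ : ℝ} (hμ : 0 < μ) (t x : ℝ) :
    lamPlus μ (D.rhoRight μ) D.velRight (t, x) = -D.reflect.gm (t, -x) := by
  rw [lamPlus, rhoRight, D.reflect.half_width hμ, velRight, vel]; ring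

/-- The right state solves the system, as the reflection of a left state. -/
theorem solvesSystemAt_right {p₀ μ t x p : ℝ} (hμ : 0 < μ) (h : (t, p) ∈ D.reflect.U)
    (hx : D.reflect.Y (t, p) = -x) : SolvesSystemAt p₀ μ (D.rhoRight μ) D.velRight (t, x) := by
  have k := D.reflect.transport_gm_gp h
  have hlt := D.reflect.gm_lt_gp h
  rw [hx] at k hlt
  obtain ⟨A, B, C, E, h1, h2, h3, h4⟩ := transport_neg k
  have := solvesSystemAt_of_transport (p₀ := p₀) hμ h1 h2 h3 h4 (neg_lt_neg hlt)
  convert! this using 1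
  · funext P; unfold rhoRight rho; congr 1; ring
  · funext P; unfold velRight vel; ring

/-- The mass of the `δ`-shock when it is at `x` at the time `t`. -/
noncomputable def massAt (μ m₀ t x : ℝ) : ℝ :=
  m₀ - 2 * μ * ((D.reflect.label (t, -x) - D.reflect.p₀) + (D.label (t, x) - D.p₀) + (t - D.t₀))

/-- The momentum of the `δ`-shock, in the frame moving with the cusp, when it is at `x` at the
time `t`. -/
noncomputable def momentumAt (μ t x : ℝ) : ℝ :=
  2 * μ * ((x - D.x₀ - D.v₀ * (t - D.t₀)) +
    D.reflect.potH (D.reflect.label (t, -x) - D.reflect.p₀ + (t - D.t₀)) -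
    D.potH (D.label (t, x) - D.p₀ + (t - D.t₀)))

theorem reflect_cuspPoint (τ y : ℝ) :
    D.reflect.cuspPoint τ (-y) = (D.t₀ + τ, -(D.x₀ + D.v₀ * τ + y)) := by
  simp only [cuspPoint, reflect_t₀, reflect_x₀, reflect_v₀, Prod.mk.injEq, true_and]
  ring

theorem massAt_cusp (μ m₀ s y : ℝ) :
    D.massAt μ m₀ (D.t₀ + s ^ 2) (D.x₀ + D.v₀ * s ^ 2 + y) = D.shockMass μ m₀ s y := by
  simp only [massAt, shockMass, cuspLabel, reflect_cuspPoint, add_sub_cancel_left]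
  rw [cuspPoint_eq]

theorem momentumAt_cusp (μ s y : ℝ) :
    D.momentumAt μ (D.t₀ + s ^ 2) (D.x₀ + D.v₀ * s ^ 2 + y) = D.shockMomentum μ s y := by
  simp only [momentumAt, shockMomentum, cuspLabel, reflect_cuspPoint, add_sub_cancel_left]
  rw [cuspPoint_eq]
  ring_nf

/-- Along a curve of speed `v`, the fast label changes at the rate `(v - λ₊) / (λ₊ - λ₋)`. -/
theorem hasDerivAt_label_curve {X : ℝ → ℝ} {v t p : ℝ} (h : (t, p) ∈ D.U)
    (hX : D.Y (t, p) = X t) (hX' : HasDerivAt X v t) :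
    HasDerivAt (fun s => D.label (s, X s))
      ((v - D.gp (t, X t)) / (D.gp (t, X t) - D.gm (t, X t))) t := by
  have h1 := D.hasFDerivAt_label h
  rw [← D.gm_Y h, ← D.gp_Y h, hX] at h1
  refine (HasFDerivAt.comp_curve (γ := fun s => s) h1 (hasDerivAt_id t) hX').congr_deriv ?_
  ring

/-- The slow label `p + t` changes at the rate `(v - λ₋) / (λ₊ - λ₋)`, and `H` has the derivative
`λ₊`. -/
theorem hasDerivAt_potH_curve {X : ℝ → ℝ} {v t p : ℝ} (h : (t, p) ∈ D.U)
    (hX : D.Y (t, p) = X t) (hX' : HasDerivAt X v t) :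
    HasDerivAt (fun s => D.potH (D.label (s, X s) - D.p₀ + (s - D.t₀)))
      ((D.gp (t, X t) - D.v₀) *
        ((v - D.gp (t, X t)) / (D.gp (t, X t) - D.gm (t, X t)) + 1)) t := by
  have hl : D.label (t, X t) = p := by rw [← hX, D.label_Y h]
  have hg : D.gp (t, X t) = D.lp (p + t) := by rw [← hX, D.gp_Y h]
  have e : D.q₀ + (D.label (t, X t) - D.p₀ + (t - D.t₀)) = p + t := by
    rw [hl]; unfold t₀; ring
  have h1 := (D.hasDerivAt_label_curve h hX hX').sub_const D.p₀ |>.add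
    ((hasDerivAt_id t).sub_const D.t₀)
  have h2 : HasDerivAt D.potH (D.gp (t, X t) - D.v₀)
      (D.label (t, X t) - D.p₀ + (t - D.t₀)) := by
    have := (D.hasDerivAt_H (p + t) h.2.1)
    rw [← e] at this
    have := ((this.comp_const_add D.q₀ _).sub_const (D.H D.q₀)).sub
      ((hasDerivAt_id _).const_mul D.v₀)
    exact this.congr_deriv (by rw [e, hg, mul_one])
  exact h2.comp t h1

/-- Along any curve, the mass given by the labels changes according to the first generalized
Rankine-Hugoniot condition. -/
theorem hasDerivAt_massAt {μ m₀ v t p p' : ℝ} {X : ℝ → ℝ} (h : (t, p) ∈ D.U)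
    (hX : D.Y (t, p) = X t) (h' : (t, p') ∈ D.reflect.U) (hX' : D.reflect.Y (t, p') = -X t)
    (hv : HasDerivAt X v t) :
    HasDerivAt (fun s => D.massAt μ m₀ s (X s))
      (v * (D.rhoRight μ (t, X t) - D.rho μ (t, X t)) -
        (D.rhoRight μ (t, X t) * D.velRight (t, X t) - D.rho μ (t, X t) * D.vel (t, X t))) t := by
  have h1 := D.hasDerivAt_label_curve h hX hv
  have h2 := D.reflect.hasDerivAt_label_curve (X := fun s => -X s) h' hX' hv.neg
  have h3 := (((h2.sub_const D.reflect.p₀).add (h1.sub_const D.p₀)).add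
    ((hasDerivAt_id t).sub_const D.t₀)).const_mul (2 * μ) |>.const_sub m₀
  refine h3.congr_deriv ?_
  have hne := D.gm_lt_gp h
  have hne' := D.reflect.gm_lt_gp h'
  rw [hX] at hne
  rw [hX'] at hne'
  have k1 := (sub_pos.2 hne).ne'
  have k2 := (sub_pos.2 hne').ne'
  simp only [rhoRight, velRight, rho, vel]
  field_simp
  ring

/-- Along any curve, the momentum given by the labels changes according to the second generalized
Rankine-Hugoniot condition. -/
theorem hasDerivAt_momentumAt {p₀ μ v t p p' : ℝ} {X : ℝ → ℝ} (h : (t, p) ∈ D.U)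
    (hX : D.Y (t, p) = X t) (h' : (t, p') ∈ D.reflect.U) (hX' : D.reflect.Y (t, p') = -X t)
    (hv : HasDerivAt X v t) :
    HasDerivAt (fun s => D.momentumAt μ s (X s))
      ((v * (D.rhoRight μ (t, X t) * D.velRight (t, X t) - D.rho μ (t, X t) * D.vel (t, X t)) -
        ((D.rhoRight μ (t, X t) * D.velRight (t, X t) ^ 2 + pressure p₀ μ (D.rhoRight μ (t, X t))) -
          (D.rho μ (t, X t) * D.vel (t, X t) ^ 2 + pressure p₀ μ (D.rho μ (t, X t))))) -
        D.v₀ * (v * (D.rhoRight μ (t, X t) - D.rho μ (t, X t)) -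
        (D.rhoRight μ (t, X t) * D.velRight (t, X t) - D.rho μ (t, X t) * D.vel (t, X t)))) t := by
  have h1 := D.hasDerivAt_potH_curve h hX hv
  have h2 := D.reflect.hasDerivAt_potH_curve (X := fun s => -X s) h' hX' hv.neg
  simp only [reflect_t₀, reflect_v₀] at h2
  have h3 := (((hv.sub_const D.x₀).sub (((hasDerivAt_id t).sub_const D.t₀).const_mul D.v₀)).add
    h2 |>.sub h1).const_mul (2 * μ)
  refine h3.congr_deriv ?_
  have hne := D.gm_lt_gp h
  have hne' := D.reflect.gm_lt_gp h'
  rw [hX] at hne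
  rw [hX'] at hne'
  have k1 := (sub_pos.2 hne).ne'
  have k2 := (sub_pos.2 hne').ne'
  simp only [rhoRight, velRight, rho, vel, pressure]
  field_simp
  ring

end CuspDatum
end Chaplygin

namespace Chaplygin

/-! ### Layout of the explicit solution -/

namespace CuspDatum

variable (D : CuspDatum)

/-- Before the blowup, each label `p` of a left state corresponds to the label `-(p + t)` of the
reflected datum. -/
theorem mem_U_reflect {t p : ℝ} (hp : p ∈ D.B) (hq : p + t ∈ D.B) (ht : t < D.t₀) :
    (t, -(p + t)) ∈ D.reflect.U :=
  D.reflect.mem_U_of_lt (D.mem_reflect_B.2 (by rwa [neg_neg]))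
    (D.mem_reflect_B.2 (by rwa [show -(-(p + t) + t) = p by ring])) (by rwa [reflect_t₀])

/-- A compact set of labels that contains those of the left state, and on which the
characteristics focus only at the cusp. -/
def region (p₁ q₂ σ : ℝ) : Set (ℝ × ℝ) :=
  {P | 0 ≤ P.1 ∧ P.1 ≤ D.t₀ + σ ^ 2 ∧ p₁ ≤ P.2 ∧ P.2 + P.1 ≤ q₂ ∧
    (P.1 ≤ D.t₀ ∨ P.2 ≤ D.p₀ - 2 * D.r * √(P.1 - D.t₀))}

theorem isCompact_region (p₁ q₂ σ : ℝ) : IsCompact (D.region p₁ q₂ σ) := by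
  have hc : IsClosed (D.region p₁ q₂ σ) := by
    have h1 : IsClosed {P : ℝ × ℝ | 0 ≤ P.1} := isClosed_le (by fun_prop) (by fun_prop)
    have h2 : IsClosed {P : ℝ × ℝ | P.1 ≤ D.t₀ + σ ^ 2} := isClosed_le (by fun_prop) (by fun_prop)
    have h3 : IsClosed {P : ℝ × ℝ | p₁ ≤ P.2} := isClosed_le (by fun_prop) (by fun_prop)
    have h4 : IsClosed {P : ℝ × ℝ | P.2 + P.1 ≤ q₂} := isClosed_le (by fun_prop) (by fun_prop)
    have h5 : IsClosed {P : ℝ × ℝ | P.1 ≤ D.t₀} := isClosed_le (by fun_prop) (by fun_prop)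
    have h6 : IsClosed {P : ℝ × ℝ | P.2 ≤ D.p₀ - 2 * D.r * √(P.1 - D.t₀)} :=
      isClosed_le (by fun_prop) (by fun_prop)
    exact h1.inter (h2.inter (h3.inter (h4.inter (h5.union h6))))
  refine IsCompact.of_isClosed_subset
    ((isCompact_Icc (a := (0 : ℝ)) (b := D.t₀ + σ ^ 2)).prod (isCompact_Icc (a := p₁) (b := q₂))) hc ?_
  rintro ⟨t, p⟩ ⟨h1, h2, h3, h4, -⟩
  exact ⟨⟨h1, h2⟩, h3, by simp only at *; linarith⟩

theorem region_mem_B {p₁ q₂ σ t p : ℝ} (hp₁ : p₁ ∈ D.B) (hq₂ : q₂ ∈ D.B)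
    (h : (t, p) ∈ D.region p₁ q₂ σ) : p ∈ D.B ∧ p + t ∈ D.B := by
  obtain ⟨h1, -, h3, h4, -⟩ := h
  simp only at h1 h3 h4
  exact ⟨D.mem_B_of_mem_Icc hp₁ hq₂ h3 (by linarith), D.mem_B_of_mem_Icc hp₁ hq₂ (by linarith) h4⟩

/-- At the blowup time the cusp is the only label at which the characteristics focus, and the only
one that belongs to the blowup point. -/
theorem Y_t₀_ne {p : ℝ} (hp : p ∈ D.B) (hq : p + D.t₀ ∈ D.B) (hne : p ≠ D.p₀) :
    D.lm p < D.lp (p + D.t₀) ∧ D.Y (D.t₀, p) ≠ D.x₀ := by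
  rcases hne.lt_or_gt with h | h
  · exact ⟨(D.mem_U_t₀ hp h).2.2.2, (D.Y_t₀_lt hp h).ne⟩
  · have hB : -(p + D.t₀) ∈ D.reflect.B := D.mem_reflect_B.2 (by rwa [neg_neg])
    have hlt : -(p + D.t₀) < D.reflect.p₀ := by
      change -(p + D.t₀) < -D.q₀
      unfold t₀; linarith
    have h1 := (D.reflect.mem_U_t₀ hB hlt).2.2.2
    have h2 := D.reflect.Y_t₀_lt hB hlt
    rw [reflect_t₀] at h1
    rw [reflect_t₀, reflect_x₀, reflect_Y] at h2
    refine ⟨?_, by linarith [h2] |> fun h : D.x₀ < D.Y (D.t₀, p) => h.ne'⟩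
    have h3 : -D.lp (- -(p + D.t₀)) < -D.lm (-(-(p + D.t₀) + D.t₀)) := h1
    rw [neg_neg, show -(-(p + D.t₀) + D.t₀) = p by ring] at h3
    linarith

/-- On the region, the cusp is the only label at which the density is infinite. -/
theorem region_pos {p₁ q₂ σ t p : ℝ} (hp₁ : p₁ ∈ D.B) (hq₂ : q₂ ∈ D.B) (h0 : 0 ≤ σ) (hσ : σ ≤ D.s₁)
    (h : (t, p) ∈ D.region p₁ q₂ σ) (hne : (t, p) ≠ (D.t₀, D.p₀)) : D.lm p < D.lp (p + t) := by
  obtain ⟨hB, hB'⟩ := D.region_mem_B hp₁ hq₂ h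
  rcases lt_trichotomy t D.t₀ with ht | rfl | ht
  · exact (D.mem_U_of_lt hB hB' ht).2.2.2
  · exact (D.Y_t₀_ne hB hB' (fun he => hne (by rw [he]))).1
  · obtain ⟨-, h2, h3, h4, h5⟩ := h
    have h6 := h5.resolve_left (not_le.2 ht)
    simp only at h2 h3 h4 h6
    have hs : 0 < √(t - D.t₀) := Real.sqrt_pos.2 (sub_pos.2 ht)
    have hs2 : √(t - D.t₀) ^ 2 = t - D.t₀ := Real.sq_sqrt (sub_pos.2 ht).le
    have hs' : √(t - D.t₀) ≤ σ := Real.sqrt_le_iff.2 ⟨h0, by linarith⟩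
    have := D.mem_U_cusp hs (hs'.trans hσ) (ξ := p - D.p₀) (by linarith [hB.1]) (by linarith)
    rw [hs2, add_sub_cancel, add_sub_cancel] at this
    exact this.2.2.2

theorem continuousOn_region_Y {p₁ q₂ σ : ℝ} (hp₁ : p₁ ∈ D.B) (hq₂ : q₂ ∈ D.B) :
    ContinuousOn D.Y (D.region p₁ q₂ σ) := fun _ hP =>
  (D.hasFDerivAt_Y (D.region_mem_B hp₁ hq₂ hP).1
    (D.region_mem_B hp₁ hq₂ hP).2).continuousAt.continuousWithinAt

theorem continuousOn_region_lm {p₁ q₂ σ : ℝ} (hp₁ : p₁ ∈ D.B) (hq₂ : q₂ ∈ D.B) :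
    ContinuousOn (fun P : ℝ × ℝ => D.lm P.2) (D.region p₁ q₂ σ) :=
  D.contDiff_lm.continuousOn.comp (by fun_prop) fun _ hP => (D.region_mem_B hp₁ hq₂ hP).1

theorem continuousOn_region_lp {p₁ q₂ σ : ℝ} (hp₁ : p₁ ∈ D.B) (hq₂ : q₂ ∈ D.B) :
    ContinuousOn (fun P : ℝ × ℝ => D.lp (P.2 + P.1)) (D.region p₁ q₂ σ) :=
  D.contDiff_lp.continuousOn.comp (by fun_prop) fun _ hP => (D.region_mem_B hp₁ hq₂ hP).2

end CuspDatum

/-- The geometry of the solution: its lateral boundaries are the fast characteristic `p₁` and the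
slow characteristic `q₂`, and its discontinuity stays, up to `O(s³)`, on the tangent of the cusp
at the time `t₀ + s²`. -/
structure Layout (D : CuspDatum) (p₁ q₂ σ : ℝ) (a b X : ℝ → ℝ) : Prop where
  p₁_mem : p₁ ∈ Ioo (D.p₀ - D.δ) D.p₀
  q₂_mem : q₂ ∈ Ioo D.q₀ (D.q₀ + D.δ)
  σ_pos : 0 < σ
  σ_le : σ ≤ D.s₁
  σ_p₁ : 4 * D.r * σ ≤ D.p₀ - p₁
  σ_q₂ : 4 * D.r * σ ≤ q₂ - D.q₀
  a_eq : ∀ t ∈ Ico 0 (D.t₀ + σ ^ 2), a t = D.Y (t, p₁)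
  b_eq : ∀ t ∈ Ico 0 (D.t₀ + σ ^ 2), b t = -D.reflect.Y (t, -q₂)
  X_t₀ : X D.t₀ = D.x₀
  X_cone : ∀ t ∈ Ioo D.t₀ (D.t₀ + σ ^ 2),
    |X t - D.x₀ - D.v₀ * (t - D.t₀)| ≤ D.θ * √(t - D.t₀) ^ 3

namespace Layout

variable {D : CuspDatum} {p₁ q₂ σ : ℝ} {a b X : ℝ → ℝ}

theorem reflect (h : Layout D p₁ q₂ σ a b X) :
    Layout D.reflect (-q₂) (-p₁) σ (fun t => -b t) (fun t => -a t) (fun t => -X t) where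
  p₁_mem := by
    have := h.q₂_mem
    constructor
    · change -D.q₀ - D.δ < -q₂; linarith [this.2]
    · change -q₂ < -D.q₀; linarith [this.1]
  q₂_mem := by
    have := h.p₁_mem
    constructor
    · change -D.p₀ < -p₁; linarith [this.2]
    · change -p₁ < -D.p₀ + D.δ; linarith [this.1]
  σ_pos := h.σ_pos
  σ_le := h.σ_le
  σ_p₁ := by change 4 * D.r * σ ≤ -D.q₀ - -q₂; linarith [h.σ_q₂]
  σ_q₂ := by change 4 * D.r * σ ≤ -p₁ - -D.p₀; linarith [h.σ_p₁]
  a_eq t ht := by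
    rw [D.reflect_t₀] at ht
    simp only [h.b_eq t ht, neg_neg]
  b_eq t ht := by
    rw [D.reflect_t₀] at ht
    simp only [D.reflect_reflect, h.a_eq t ht, neg_neg]
  X_t₀ := by simp [h.X_t₀]
  X_cone t ht := by
    rw [D.reflect_t₀] at ht ⊢
    rw [D.reflect_x₀, D.reflect_v₀, D.reflect_θ,
      show -X t - -D.x₀ - -D.v₀ * (t - D.t₀) = -(X t - D.x₀ - D.v₀ * (t - D.t₀)) by ring, abs_neg]
    exact h.X_cone t ht

theorem p₁_mem_B (h : Layout D p₁ q₂ σ a b X) : p₁ ∈ D.B :=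
  ⟨h.p₁_mem.1, by linarith [h.p₁_mem.2, D.p₀_mem.2]⟩

theorem q₂_mem_B (h : Layout D p₁ q₂ σ a b X) : q₂ ∈ D.B :=
  ⟨by linarith [h.q₂_mem.1, D.q₀_mem.1], h.q₂_mem.2⟩

theorem b_eq_before (h : Layout D p₁ q₂ σ a b X) {t : ℝ} (h0 : 0 ≤ t) (ht : t < D.t₀) :
    b t = D.Y (t, q₂ - t) := by
  rw [h.b_eq t ⟨h0, by nlinarith [h.σ_pos]⟩]
  have := D.reflect_Y t (q₂ - t)
  rw [sub_add_cancel] at this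
  rw [this, neg_neg]

theorem sqrt_lt (h : Layout D p₁ q₂ σ a b X) {t : ℝ} (ht : t ∈ Ioo D.t₀ (D.t₀ + σ ^ 2)) :
    0 < √(t - D.t₀) ∧ √(t - D.t₀) < σ ∧ √(t - D.t₀) ≤ D.s₁ ∧ √(t - D.t₀) ^ 2 = t - D.t₀ := by
  have h1 : 0 < t - D.t₀ := sub_pos.2 ht.1
  have h2 : √(t - D.t₀) < σ := (Real.sqrt_lt' h.σ_pos).2 (by linarith [ht.2])
  exact ⟨Real.sqrt_pos.2 h1, h2, h2.le.trans h.σ_le, Real.sq_sqrt h1.le⟩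

/-- The label of the left state at the discontinuity. -/
theorem exists_label_X (h : Layout D p₁ q₂ σ a b X) {t : ℝ}
    (ht : t ∈ Ioo D.t₀ (D.t₀ + σ ^ 2)) : ∃ ξ, -(4 * D.r * √(t - D.t₀)) ≤ ξ ∧
      ξ ≤ -(2 * D.r * √(t - D.t₀)) ∧ (t, D.p₀ + ξ) ∈ D.U ∧ D.Y (t, D.p₀ + ξ) = X t ∧ p₁ < D.p₀ + ξ := by
  obtain ⟨h0, h1, h2, h3⟩ := h.sqrt_lt ht
  obtain ⟨ξ, k1, k2, k3, k4⟩ := D.exists_label_cusp h0 h2 (h.X_cone t ht)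
  rw [h3, add_sub_cancel] at k3
  rw [h3, add_sub_cancel] at k4
  refine ⟨ξ, k1, k2, k3, by rw [k4]; ring, ?_⟩
  have := h.σ_p₁
  have hr := D.r_pos
  nlinarith

theorem mem_U_left (h : Layout D p₁ q₂ σ a b X) {t p : ℝ} (h0 : 0 ≤ t) (ht : t < D.t₀)
    (h1 : p₁ ≤ p) (h2 : p + t ≤ q₂) : (t, p) ∈ D.U :=
  D.mem_U_of_lt (D.mem_B_of_mem_Icc h.p₁_mem_B h.q₂_mem_B h1 (by linarith))
    (D.mem_B_of_mem_Icc h.p₁_mem_B h.q₂_mem_B (by linarith) h2) ht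

theorem mem_U_after (h : Layout D p₁ q₂ σ a b X) {t p r : ℝ} (ht : D.t₀ ≤ t)
    (hp : (t, p) ∈ D.U) (h1 : p₁ ≤ r) (h2 : r ≤ p) : (t, r) ∈ D.U := by
  have hp₀ : p < D.p₀ := hp.2.2.1.resolve_left (by simpa using ht)
  have hr : r ∈ D.B := D.mem_B_of_mem_Icc h.p₁_mem_B hp.1 h1 h2
  refine ⟨hr, D.mem_B_of_mem_Icc h.p₁_mem_B hp.2.1 ?_ ?_, Or.inr (h2.trans_lt hp₀),
    D.seg_left r p t hr.1 h2 hp₀ hp.2.1.2 ht hp.2.2.2⟩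
  · simp only; linarith [D.t₀_pos]
  · simp only; linarith

theorem a_mem_U (h : Layout D p₁ q₂ σ a b X) {t : ℝ} (ht : t ∈ Ico 0 (D.t₀ + σ ^ 2)) :
    (t, p₁) ∈ D.U := by
  rcases lt_trichotomy t D.t₀ with h1 | rfl | h1
  · refine h.mem_U_left ht.1 h1 le_rfl ?_
    have := h.p₁_mem.2; have := h.q₂_mem.1
    unfold CuspDatum.t₀ at h1; linarith
  · exact D.mem_U_t₀ h.p₁_mem_B h.p₁_mem.2
  · obtain ⟨ξ, -, -, k3, -, k5⟩ := h.exists_label_X ⟨h1, ht.2⟩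
    exact h.mem_U_after h1.le k3 le_rfl k5.le

theorem a_lt_b (h : Layout D p₁ q₂ σ a b X) {t : ℝ} (ht : t ∈ Ico 0 D.t₀) : a t < b t := by
  have h1 : p₁ < q₂ - t := by
    have := h.p₁_mem.2; have := h.q₂_mem.1; have := ht.2
    unfold CuspDatum.t₀ at this; linarith
  rw [h.b_eq_before ht.1 ht.2, h.a_eq t ⟨ht.1, by nlinarith [h.σ_pos, ht.2]⟩]
  exact D.Y_lt_Y (h.mem_U_left ht.1 ht.2 le_rfl (by linarith))
    (h.mem_U_left ht.1 ht.2 h1.le (by linarith)) h1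

theorem a_lt_X (h : Layout D p₁ q₂ σ a b X) {t : ℝ} (ht : t ∈ Ico D.t₀ (D.t₀ + σ ^ 2)) :
    a t < X t := by
  rw [h.a_eq t ⟨D.t₀_pos.le.trans ht.1, ht.2⟩]
  rcases ht.1.eq_or_lt with rfl | h1
  · rw [h.X_t₀]; exact D.Y_t₀_lt h.p₁_mem_B h.p₁_mem.2
  · obtain ⟨ξ, -, -, k3, k4, k5⟩ := h.exists_label_X ⟨h1, ht.2⟩
    rw [← k4]
    exact D.Y_lt_Y (h.mem_U_after h1.le k3 le_rfl k5.le) k3 k5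

theorem X_lt_b (h : Layout D p₁ q₂ σ a b X) {t : ℝ} (ht : t ∈ Ico D.t₀ (D.t₀ + σ ^ 2)) :
    X t < b t := by
  have := h.reflect.a_lt_X (t := t) (by rwa [D.reflect_t₀])
  linarith

/-- Every point of the left domain has a label. -/
theorem exists_label (h : Layout D p₁ q₂ σ a b X) {t x : ℝ}
    (hx : (t, x) ∈ leftSet a b X D.t₀ D.x₀ (σ ^ 2)) : ∃ p, (t, p) ∈ D.U ∧ D.Y (t, p) = x ∧
      (t, p) ∈ D.region p₁ q₂ σ := by
  obtain ⟨h0, h1, h2, h3, h4⟩ := mem_leftSet_iff.1 hx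
  have hp₁ := h.p₁_mem.2
  have hq₂ := h.q₂_mem.1
  rw [h.a_eq t ⟨h0, h1⟩] at h2
  have hivt : ∀ p', p₁ ≤ p' → p' ∈ D.B → p' + t ∈ D.B → x ≤ D.Y (t, p') →
      ∃ p ∈ Icc p₁ p', D.Y (t, p) = x := by
    intro p' hle hB hB' hxp
    have hc : ContinuousOn (fun p => D.Y (t, p)) (Icc p₁ p') := fun p hp =>
      (D.hasDerivAt_Y_p (D.mem_B_of_mem_Icc h.p₁_mem_B hB hp.1 hp.2)
        (D.mem_B_of_mem_Icc h.p₁_mem_B hB' (by linarith [hp.1])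
          (by linarith [hp.2]))).continuousAt.continuousWithinAt
    exact intermediate_value_Icc hle hc ⟨h2, hxp⟩
  rcases lt_trichotomy t D.t₀ with ht | rfl | ht
  · rw [rightEnd, if_pos ht, h.b_eq_before h0 ht] at h3
    have hle : p₁ ≤ q₂ - t := by unfold CuspDatum.t₀ at ht; linarith
    have hU := h.mem_U_left h0 ht hle (by linarith)
    obtain ⟨p, hp, he⟩ := hivt _ hle hU.1 hU.2.1 h3
    exact ⟨p, h.mem_U_left h0 ht hp.1 (by linarith [hp.2]), he,
      ⟨h0, h1.le, hp.1, by simp only; linarith [hp.2], Or.inl ht.le⟩⟩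
  · rw [rightEnd, if_neg (lt_irrefl _), h.X_t₀] at h3
    have hY : D.Y (D.t₀, D.p₀) = D.x₀ := by
      unfold CuspDatum.Y CuspDatum.x₀ CuspDatum.t₀; simp
    have e : D.p₀ + D.t₀ = D.q₀ := by unfold CuspDatum.t₀; ring
    obtain ⟨p, hp, he⟩ := hivt _ hp₁.le D.p₀_mem (by rw [e]; exact D.q₀_mem) (by rw [hY]; exact h3)
    have hne : p ≠ D.p₀ := by
      rintro rfl
      exact h4 (by rw [← he, hY])
    exact ⟨p, D.mem_U_t₀ (D.mem_B_of_mem_Icc h.p₁_mem_B D.p₀_mem hp.1 hp.2)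
      (lt_of_le_of_ne hp.2 hne), he,
      ⟨h0, h1.le, hp.1, by simp only; linarith [hp.2], Or.inl le_rfl⟩⟩
  · rw [rightEnd, if_neg ht.not_gt] at h3
    obtain ⟨ξ, k1, k2, k3, k4, k5⟩ := h.exists_label_X ⟨ht, h1⟩
    obtain ⟨k6, k7, k8, k9⟩ := h.sqrt_lt ⟨ht, h1⟩
    obtain ⟨p, hp, he⟩ := hivt _ k5.le k3.1 k3.2.1 (by rw [k4]; exact h3)
    have k10 := D.le_s₁ k8 k6
    have hr := D.r_pos
    refine ⟨p, h.mem_U_after ht.le k3 hp.1 hp.2, he,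
      ⟨h0, h1.le, hp.1, ?_, Or.inr (by simp only; linarith [hp.2])⟩⟩
    have e : D.p₀ + D.t₀ = D.q₀ := by unfold CuspDatum.t₀; ring
    simp only
    nlinarith [hp.2]

theorem contDiffOn_rho (h : Layout D p₁ q₂ σ a b X) (μ : ℝ) :
    ContDiffOn ℝ 1 (D.rho μ) (leftSet a b X D.t₀ D.x₀ (σ ^ 2)) := by
  rintro ⟨t, x⟩ hx
  obtain ⟨p, hU, rfl, -⟩ := h.exists_label hx
  exact (D.contDiffAt_rho hU).contDiffWithinAt

theorem contDiffOn_vel (h : Layout D p₁ q₂ σ a b X) :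
    ContDiffOn ℝ 1 D.vel (leftSet a b X D.t₀ D.x₀ (σ ^ 2)) := by
  rintro ⟨t, x⟩ hx
  obtain ⟨p, hU, rfl, -⟩ := h.exists_label hx
  exact (D.contDiffAt_vel hU).contDiffWithinAt

theorem exists_vel_bound (h : Layout D p₁ q₂ σ a b X) :
    ∃ M, ∀ P ∈ leftSet a b X D.t₀ D.x₀ (σ ^ 2), |D.vel P| ≤ M := by
  obtain ⟨M, hM⟩ := (D.isCompact_region p₁ q₂ σ).exists_bound_of_continuousOn
    (((D.continuousOn_region_lm h.p₁_mem_B h.q₂_mem_B).add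
      (D.continuousOn_region_lp h.p₁_mem_B h.q₂_mem_B)).div_const 2)
  refine ⟨M, ?_⟩
  rintro ⟨t, x⟩ hx
  obtain ⟨p, hU, rfl, hK⟩ := h.exists_label hx
  have := hM _ hK
  rw [CuspDatum.vel, D.gm_Y hU, D.gp_Y hU]
  exact this

/-- Away from the blowup point the labels range over a compact set on which the density is finite.
-/
theorem exists_rho_bound (h : Layout D p₁ q₂ σ a b X) (μ : ℝ) {d : ℝ} (hd : 0 < d) :
    ∃ M, ∀ P ∈ leftSet a b X D.t₀ D.x₀ (σ ^ 2), d ≤ dist P (D.t₀, D.x₀) → D.rho μ P ≤ M := by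
  have hYc : ContinuousOn (fun P : ℝ × ℝ => dist (P.1, D.Y P) (D.t₀, D.x₀)) (D.region p₁ q₂ σ) :=
    (continuous_id.dist continuous_const).comp_continuousOn
      (continuousOn_fst.prodMk (D.continuousOn_region_Y h.p₁_mem_B h.q₂_mem_B))
  set K : Set (ℝ × ℝ) := D.region p₁ q₂ σ ∩ {P | d ≤ dist (P.1, D.Y P) (D.t₀, D.x₀)} with hK
  have hKc : IsCompact K := by
    have := hYc.preimage_isClosed_of_isClosed (D.isCompact_region p₁ q₂ σ).isClosed
      (isClosed_Ici (a := d))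
    exact (D.isCompact_region p₁ q₂ σ).of_isClosed_subset this inter_subset_left
  have hpos : ∀ P ∈ K, 0 < D.lp (P.2 + P.1) - D.lm P.2 := by
    rintro ⟨t, p⟩ ⟨hP, hdP⟩
    refine sub_pos.2 (D.region_pos h.p₁_mem_B h.q₂_mem_B h.σ_pos.le h.σ_le hP fun he => ?_)
    have h1 : t = D.t₀ := (Prod.ext_iff.1 he).1
    have h2 : p = D.p₀ := (Prod.ext_iff.1 he).2
    have hY : D.Y (D.t₀, D.p₀) = D.x₀ := by
      unfold CuspDatum.Y CuspDatum.x₀ CuspDatum.t₀; simp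
    rw [mem_ofPred_eq, h1, h2, hY, dist_self] at hdP
    linarith
  have hc : ContinuousOn (fun P : ℝ × ℝ => 2 * μ / (D.lp (P.2 + P.1) - D.lm P.2)) K :=
    continuousOn_const.div (((D.continuousOn_region_lp h.p₁_mem_B h.q₂_mem_B).sub
      (D.continuousOn_region_lm h.p₁_mem_B h.q₂_mem_B)).mono inter_subset_left)
      fun P hP => (hpos P hP).ne'
  obtain ⟨M, hM⟩ := hKc.exists_bound_of_continuousOn hc
  refine ⟨M, ?_⟩
  rintro ⟨t, x⟩ hx hdx
  obtain ⟨p, hU, rfl, hR⟩ := h.exists_label hx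
  have := hM (t, p) ⟨hR, hdx⟩
  rw [CuspDatum.rho, D.gm_Y hU, D.gp_Y hU]
  exact (le_abs_self _).trans this

/-- At the blowup point the labels tend to the cusp. -/
theorem tendsto_label (h : Layout D p₁ q₂ σ a b X) :
    Tendsto (fun P => (P.1, D.label P)) (𝓝[leftSet a b X D.t₀ D.x₀ (σ ^ 2)] (D.t₀, D.x₀))
      (𝓝 (D.t₀, D.p₀)) := by
  rw [(nhds_basis_opens (D.t₀, D.p₀)).tendsto_right_iff]
  rintro V ⟨hV, hVo⟩
  -- the labels outside a neighbourhood of the cusp form a compact set, whose places keep away from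
  -- the blowup point
  have hc : ContinuousOn (fun P : ℝ × ℝ => (P.1, D.Y P)) (D.region p₁ q₂ σ) :=
    continuousOn_fst.prodMk (D.continuousOn_region_Y h.p₁_mem_B h.q₂_mem_B)
  have hK : IsCompact (D.region p₁ q₂ σ \ V) := (D.isCompact_region p₁ q₂ σ).diff hVo
  have hI := (hK.image_of_continuousOn (hc.mono sdiff_subset)).isClosed
  have hnot : (D.t₀, D.x₀) ∉ (fun P : ℝ × ℝ => (P.1, D.Y P)) '' (D.region p₁ q₂ σ \ V) := by
    rintro ⟨⟨t, p⟩, ⟨hP, hPV⟩, he⟩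
    have h1 : t = D.t₀ := (Prod.ext_iff.1 he).1
    have h2 : D.Y (t, p) = D.x₀ := (Prod.ext_iff.1 he).2
    subst h1
    by_cases hp : p = D.p₀
    · exact hPV (hp ▸ hV)
    · exact (D.Y_t₀_ne (D.region_mem_B h.p₁_mem_B h.q₂_mem_B hP).1
        (D.region_mem_B h.p₁_mem_B h.q₂_mem_B hP).2 hp).2 h2
  filter_upwards [self_mem_nhdsWithin, nhdsWithin_le_nhds (hI.isOpen_compl.mem_nhds hnot)]
    with P hP hP'
  obtain ⟨t, x⟩ := P
  obtain ⟨p, hU, rfl, hR⟩ := h.exists_label hP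
  rw [D.label_Y hU]
  by_contra hV'
  exact hP' ⟨(t, p), ⟨hR, hV'⟩, rfl⟩

theorem tendsto_gm (h : Layout D p₁ q₂ σ a b X) :
    Tendsto D.gm (𝓝[leftSet a b X D.t₀ D.x₀ (σ ^ 2)] (D.t₀, D.x₀)) (𝓝 D.v₀) := by
  have h1 : ContinuousAt (fun P : ℝ × ℝ => D.lm P.2) (D.t₀, D.p₀) :=
    ContinuousAt.comp (g := D.lm) (f := fun P : ℝ × ℝ => P.2)
      (D.contDiffAt_lm D.p₀_mem).continuousAt continuousAt_snd
  exact h1.tendsto.comp h.tendsto_label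

theorem tendsto_gp (h : Layout D p₁ q₂ σ a b X) :
    Tendsto D.gp (𝓝[leftSet a b X D.t₀ D.x₀ (σ ^ 2)] (D.t₀, D.x₀)) (𝓝 D.v₀) := by
  have e : D.p₀ + D.t₀ = D.q₀ := by unfold CuspDatum.t₀; ring
  have h1 : ContinuousAt (fun P : ℝ × ℝ => D.lp (P.2 + P.1)) (D.t₀, D.p₀) :=
    ContinuousAt.comp (g := D.lp) (f := fun P : ℝ × ℝ => P.2 + P.1)
      (by rw [e]; exact (D.contDiffAt_lp D.q₀_mem).continuousAt) (by fun_prop)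
  have h2 := h1.tendsto.comp h.tendsto_label
  rwa [e, ← D.meet] at h2

theorem tendsto_vel (h : Layout D p₁ q₂ σ a b X) :
    Tendsto D.vel (𝓝[leftSet a b X D.t₀ D.x₀ (σ ^ 2)] (D.t₀, D.x₀)) (𝓝 D.v₀) := by
  have := (h.tendsto_gm.add h.tendsto_gp).div_const 2
  rwa [add_self_div_two] at this

theorem tendsto_rho (h : Layout D p₁ q₂ σ a b X) {μ : ℝ} (hμ : 0 < μ) :
    Tendsto (D.rho μ) (𝓝[leftSet a b X D.t₀ D.x₀ (σ ^ 2)] (D.t₀, D.x₀)) atTop := by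
  have h1 := h.tendsto_gp.sub h.tendsto_gm
  rw [sub_self] at h1
  have h2 : Tendsto (fun P => D.gp P - D.gm P) (𝓝[leftSet a b X D.t₀ D.x₀ (σ ^ 2)] (D.t₀, D.x₀))
      (𝓝[>] 0) := by
    refine tendsto_nhdsWithin_iff.2 ⟨h1, ?_⟩
    filter_upwards [self_mem_nhdsWithin] with P hP
    obtain ⟨t, x⟩ := P
    obtain ⟨p, hU, rfl, -⟩ := h.exists_label hP
    exact sub_pos.2 (D.gm_lt_gp hU)
  exact (h2.inv_tendsto_nhdsGT_zero).const_mul_atTop (show 0 < 2 * μ by positivity)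

theorem hasDerivAt_a (h : Layout D p₁ q₂ σ a b X) {t : ℝ} (ht : t ∈ Ico 0 (D.t₀ + σ ^ 2)) :
    HasDerivWithinAt a (D.gp (t, a t)) (Ico 0 (D.t₀ + σ ^ 2)) t := by
  have hU := h.a_mem_U ht
  rw [h.a_eq t ht, D.gp_Y hU]
  exact (D.hasDerivAt_Y_t hU.1 hU.2.1).hasDerivWithinAt.congr h.a_eq (h.a_eq t ht)

/-- The entropy condition on the left of the discontinuity. -/
theorem entropy_left (h : Layout D p₁ q₂ σ a b X) {t : ℝ} (ht : t ∈ Ioo D.t₀ (D.t₀ + σ ^ 2)) :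
    D.v₀ + D.θ * √(t - D.t₀) ≤ D.gm (t, X t) := by
  obtain ⟨ξ, k1, k2, k3, k4, k5⟩ := h.exists_label_X ht
  obtain ⟨h0, h1, h2, h3⟩ := h.sqrt_lt ht
  set s := √(t - D.t₀)
  obtain ⟨k6, k7, k8⟩ := D.le_s₁ h2 h0
  have hr := D.r_pos
  have hκ := D.κ_pos
  have hrs := mul_pos hr h0
  rw [← k4, D.gm_Y k3]
  have := (D.est_left ξ 0 (by linarith) (by linarith) D.δ_pos).2
  rw [add_zero, ← D.meet] at this
  change D.lm D.p₀ - _ ≤ _ at this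
  have hcr := D.c_mul_r_sq
  have hc := D.c_pos
  have e1 : D.c * ξ ^ 2 ≤ 4 / 5 * D.κ * (-ξ) := by
    have : D.c * (-ξ) ≤ 4 / 5 * D.κ := by
      have : D.c * (-ξ) ≤ D.c * (4 * D.r * (D.r / 5)) := by
        refine mul_le_mul_of_nonneg_left ?_ hc.le
        nlinarith
      nlinarith
    have h9 := mul_le_mul_of_nonneg_right this (show 0 ≤ -ξ by linarith)
    nlinarith
  have e2 : D.θ * s ≤ D.κ * (-ξ) / 10 := by
    have := mul_le_mul_of_nonneg_left (show 2 * D.r * s ≤ -ξ by linarith) hκ.le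
    unfold CuspDatum.θ
    nlinarith
  unfold CuspDatum.v₀
  nlinarith [mul_nonneg hκ.le (show 0 ≤ -ξ by linarith)]

end Layout
end Chaplygin

namespace Chaplygin

/-! ### The explicit δ-shock -/

theorem hasDerivWithinAt_zero_of_sq_bound {f : ℝ → ℝ} {S : Set ℝ} {a C : ℝ}
    (h : ∀ x ∈ S, |f x - f a| ≤ C * (x - a) ^ 2) : HasDerivWithinAt f 0 S a := by
  rw [hasDerivWithinAt_iff_tendsto]
  have h1 : Tendsto (fun x : ℝ => C * |x - a|) (𝓝[S] a) (𝓝 0) := by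
    have : Tendsto (fun x : ℝ => C * |x - a|) (𝓝 a) (𝓝 (C * |a - a|)) :=
      (by fun_prop : Continuous fun x : ℝ => C * |x - a|).tendsto a
    rw [sub_self, abs_zero, mul_zero] at this
    exact this.mono_left nhdsWithin_le_nhds
  refine squeeze_zero' (Eventually.of_forall fun s => by positivity) ?_ h1
  filter_upwards [self_mem_nhdsWithin] with x hx
  rw [smul_zero, sub_zero, Real.norm_eq_abs, Real.norm_eq_abs]
  rcases eq_or_ne x a with rfl | hne
  · simp
  · have hpos : 0 < |x - a| := abs_pos.2 (sub_ne_zero.2 hne)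
    rw [inv_mul_le_iff₀ hpos]
    have := h x hx
    rw [← sq_abs (x - a)] at this
    linarith

namespace CuspDatum

variable (D : CuspDatum)

theorem abs_shockMass_sub_le {μ m₀ s y : ℝ} (hμ : 0 < μ) (h0 : 0 < s) (hs : s ≤ D.s₁)
    (hy : |y| ≤ D.θ * s ^ 3) : |D.shockMass μ m₀ s y - m₀| ≤ 16 * μ * D.r * s := by
  have h3 := (D.le_s₁ hs h0).1
  have hr := D.r_pos
  have h4 : |D.reflect.cuspLabel s (-y) + D.cuspLabel s y + s ^ 2| ≤ 8 * D.r * s := by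
    have k1 := D.cuspLabel_spec h0 hs hy
    have k2 := D.reflect.cuspLabel_spec h0 hs (D.reflect_cone hy)
    rw [reflect_r] at k2
    rw [abs_le]; constructor <;> nlinarith
  unfold shockMass
  rw [sub_sub_cancel_left, abs_neg, abs_mul, abs_of_pos (by positivity : 0 < 2 * μ)]
  nlinarith

/-- The path of the discontinuity, from its deviation `y` from the tangent in the variable
`s = √(t - t₀)`. -/
noncomputable def pathX (y : ℝ → ℝ) (t : ℝ) : ℝ := D.x₀ + D.v₀ * (t - D.t₀) + y (√(t - D.t₀))

open Classical in
/-- The velocity of the discontinuity. -/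
noncomputable def pathV (μ m₀ : ℝ) (y : ℝ → ℝ) (t : ℝ) : ℝ :=
  if t ≤ D.t₀ then D.v₀ else D.v₀ + D.drift μ m₀ (√(t - D.t₀)) (y (√(t - D.t₀)))

open Classical in
/-- The mass of the `δ`-shock. -/
noncomputable def pathM (μ m₀ : ℝ) (y : ℝ → ℝ) (t : ℝ) : ℝ :=
  if t ≤ D.t₀ then m₀ else D.massAt μ m₀ t (D.pathX y t)

/-- The equation of motion of the `δ`-shock in the variable `s = √(t - t₀)`. -/
structure IsPath (μ m₀ σ : ℝ) (y : ℝ → ℝ) : Prop where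
  μ_pos : 0 < μ
  m₀_ne : m₀ ≠ 0
  σ_le : σ ≤ D.s₂ μ m₀
  y_zero : y 0 = 0
  y_deriv : ∀ s ∈ Ioo 0 σ, HasDerivAt y (2 * s * D.drift μ m₀ s (y s)) s
  y_bound : ∀ s ∈ Ico 0 σ, |y s| ≤ D.driftConst μ m₀ * s ^ 4

end CuspDatum

namespace CuspDatum.IsPath

variable {D : CuspDatum} {μ m₀ σ : ℝ} {y : ℝ → ℝ}

theorem cone (h : D.IsPath μ m₀ σ y) {s : ℝ} (hs : s ∈ Ioo 0 σ) : |y s| ≤ D.θ * s ^ 3 := by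
  refine (h.y_bound s ⟨hs.1.le, hs.2⟩).trans ?_
  have h1 := (D.le_s₂ h.μ_pos h.m₀_ne (hs.2.le.trans h.σ_le)).2.2
  have := mul_le_mul_of_nonneg_right h1 (pow_nonneg hs.1.le 3)
  linarith

theorem sqrt_mem (h : D.IsPath μ m₀ σ y) {t : ℝ} (hσ : 0 < σ)
    (ht : t ∈ Ioo D.t₀ (D.t₀ + σ ^ 2)) :
    √(t - D.t₀) ∈ Ioo 0 σ ∧ √(t - D.t₀) ^ 2 = t - D.t₀ ∧ √(t - D.t₀) ≤ D.s₁ ∧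
      √(t - D.t₀) ≤ D.s₂ μ m₀ := by
  have h1 : 0 < t - D.t₀ := sub_pos.2 ht.1
  have h2 : √(t - D.t₀) < σ := (Real.sqrt_lt' hσ).2 (by linarith [ht.2])
  have h3 := h2.le.trans h.σ_le
  exact ⟨⟨Real.sqrt_pos.2 h1, h2⟩, Real.sq_sqrt h1.le, (D.le_s₂ h.μ_pos h.m₀_ne h3).1, h3⟩

theorem massAt_path (h : D.IsPath μ m₀ σ y) {t : ℝ} (hσ : 0 < σ)
    (ht : t ∈ Ioo D.t₀ (D.t₀ + σ ^ 2)) : D.massAt μ m₀ t (D.pathX y t) =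
      D.shockMass μ m₀ (√(t - D.t₀)) (y (√(t - D.t₀))) ∧
    D.momentumAt μ t (D.pathX y t) = D.shockMomentum μ (√(t - D.t₀)) (y (√(t - D.t₀))) := by
  obtain ⟨_, h2, _, _⟩ := h.sqrt_mem hσ ht
  have h3 := D.massAt_cusp μ m₀ (√(t - D.t₀)) (y (√(t - D.t₀)))
  have h4 := D.momentumAt_cusp μ (√(t - D.t₀)) (y (√(t - D.t₀)))
  rw [h2, add_sub_cancel] at h3 h4
  exact ⟨h3, h4⟩

theorem pathX_t₀ (h : D.IsPath μ m₀ σ y) : D.pathX y D.t₀ = D.x₀ := by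
  simp [pathX, h.y_zero]

theorem abs_pathV_sub_le (h : D.IsPath μ m₀ σ y) (hσ : 0 < σ) {t : ℝ}
    (ht : t ∈ Ioo D.t₀ (D.t₀ + σ ^ 2)) :
    |D.pathV μ m₀ y t - D.v₀| ≤ D.driftConst μ m₀ * (t - D.t₀) := by
  obtain ⟨h1, h2, h3, h4⟩ := h.sqrt_mem hσ ht
  rw [pathV, if_neg (not_le.2 ht.1), add_sub_cancel_left]
  have := D.abs_drift_le h.μ_pos h.m₀_ne h1.1 h4 (h.cone h1)
  rwa [h2] at this

theorem hasDerivAt_pathX (h : D.IsPath μ m₀ σ y) (hσ : 0 < σ) {t : ℝ}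
    (ht : t ∈ Ioo D.t₀ (D.t₀ + σ ^ 2)) : HasDerivAt (D.pathX y) (D.pathV μ m₀ y t) t := by
  obtain ⟨h1, h2, h3, h4⟩ := h.sqrt_mem hσ ht
  have k1 : HasDerivAt (fun t => √(t - D.t₀)) (1 / (2 * √(t - D.t₀))) t :=
    ((hasDerivAt_id t).sub_const D.t₀).sqrt (sub_pos.2 ht.1).ne'
  have k2 := (h.y_deriv _ h1).comp t k1
  have k3 := ((((hasDerivAt_id t).sub_const D.t₀).const_mul D.v₀).const_add D.x₀).add k2
  refine k3.congr_deriv ?_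
  rw [pathV, if_neg (not_le.2 ht.1)]
  have := h1.1.ne'
  field_simp

theorem hasDerivWithinAt_pathX (h : D.IsPath μ m₀ σ y) (hσ : 0 < σ) {t : ℝ}
    (ht : t ∈ Ico D.t₀ (D.t₀ + σ ^ 2)) :
    HasDerivWithinAt (D.pathX y) (D.pathV μ m₀ y t) (Ico D.t₀ (D.t₀ + σ ^ 2)) t := by
  rcases ht.1.eq_or_lt with rfl | h1
  · have k1 : HasDerivWithinAt (fun t => y (√(t - D.t₀))) 0 (Ico D.t₀ (D.t₀ + σ ^ 2)) D.t₀ := by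
      refine hasDerivWithinAt_zero_of_sq_bound (C := D.driftConst μ m₀) fun x hx => ?_
      rcases hx.1.eq_or_lt with rfl | hx1
      · simp
      · obtain ⟨h1, h2, h3, h4⟩ := h.sqrt_mem hσ ⟨hx1, hx.2⟩
        have := h.y_bound _ ⟨h1.1.le, h1.2⟩
        rw [sub_self, Real.sqrt_zero, h.y_zero, sub_zero]
        calc _ ≤ _ := this
          _ = D.driftConst μ m₀ * (√(x - D.t₀) ^ 2) ^ 2 := by ring
          _ = _ := by rw [h2]
    have k3 := ((((hasDerivWithinAt_id D.t₀ (Ico D.t₀ (D.t₀ + σ ^ 2))).sub_const D.t₀).const_mul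
      D.v₀).const_add D.x₀).add k1
    exact k3.congr_deriv (by rw [pathV, if_pos le_rfl]; ring)
  · exact (h.hasDerivAt_pathX hσ ⟨h1, ht.2⟩).hasDerivWithinAt

theorem continuousAt_sqrt_path (h : D.IsPath μ m₀ σ y) (hσ : 0 < σ) {t : ℝ}
    (ht : t ∈ Ioo D.t₀ (D.t₀ + σ ^ 2)) :
    ContinuousAt (fun t => (√(t - D.t₀), y (√(t - D.t₀)))) t := by
  have h1 := h.sqrt_mem hσ ht
  have k1 : ContinuousAt (fun t => √(t - D.t₀)) t := by fun_prop
  exact k1.prodMk (ContinuousAt.comp (g := y) (f := fun t => √(t - D.t₀))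
    (h.y_deriv _ h1.1).continuousAt k1)

theorem continuousWithinAt_of_bound {f : ℝ → ℝ} {a b C : ℝ} {n : ℕ} (hn : n ≠ 0)
    (h : ∀ x ∈ Ioo a b, |f x - f a| ≤ C * √(x - a) ^ n) : ContinuousWithinAt f (Ico a b) a := by
  rw [ContinuousWithinAt, tendsto_iff_norm_sub_tendsto_zero]
  have h1 : Tendsto (fun x : ℝ => C * √(x - a) ^ n) (𝓝[Ico a b] a) (𝓝 0) := by
    have : Tendsto (fun x : ℝ => C * √(x - a) ^ n) (𝓝 a) (𝓝 (C * √(a - a) ^ n)) :=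
      (by fun_prop : Continuous fun x : ℝ => C * √(x - a) ^ n).tendsto a
    rw [sub_self, Real.sqrt_zero, zero_pow hn, mul_zero] at this
    exact this.mono_left nhdsWithin_le_nhds
  refine squeeze_zero' (Eventually.of_forall fun s => by positivity) ?_ h1
  filter_upwards [self_mem_nhdsWithin] with x hx
  rcases hx.1.eq_or_lt with rfl | hx1
  · simp [hn]
  · exact h x ⟨hx1, hx.2⟩

theorem continuousOn_pathV (h : D.IsPath μ m₀ σ y) (hσ : 0 < σ) :
    ContinuousOn (D.pathV μ m₀ y) (Ico D.t₀ (D.t₀ + σ ^ 2)) := by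
  intro t ht
  rcases ht.1.eq_or_lt with rfl | h1
  · refine continuousWithinAt_of_bound (n := 2) two_ne_zero (C := D.driftConst μ m₀) fun x hx => ?_
    rw [(h.sqrt_mem hσ hx).2.1]
    have := h.abs_pathV_sub_le hσ hx
    rwa [pathV, pathV, if_pos le_rfl, ← pathV]
  · obtain ⟨h2, h3, h4, h5⟩ := h.sqrt_mem hσ ⟨h1, ht.2⟩
    have k1 : ContinuousAt (fun t => D.v₀ + D.drift μ m₀ (√(t - D.t₀)) (y (√(t - D.t₀)))) t :=
      continuousAt_const.add (ContinuousAt.comp (g := fun P : ℝ × ℝ => D.drift μ m₀ P.1 P.2)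
        (f := fun t => (√(t - D.t₀), y (√(t - D.t₀))))
        (D.continuousAt_drift h.μ_pos h.m₀_ne h2.1 h5 (h.cone h2))
        (h.continuousAt_sqrt_path hσ ⟨h1, ht.2⟩))
    refine (k1.congr ?_).continuousWithinAt
    filter_upwards [eventually_gt_nhds h1] with s hs
    rw [pathV, if_neg (not_le.2 hs)]

theorem continuousOn_pathM (h : D.IsPath μ m₀ σ y) (hσ : 0 < σ) :
    ContinuousOn (D.pathM μ m₀ y) (Ico D.t₀ (D.t₀ + σ ^ 2)) := by
  intro t ht
  rcases ht.1.eq_or_lt with rfl | h1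
  · refine continuousWithinAt_of_bound (n := 1) one_ne_zero (C := 16 * μ * D.r) fun x hx => ?_
    obtain ⟨h2, h3, h4, h5⟩ := h.sqrt_mem hσ hx
    have := D.abs_shockMass_sub_le (m₀ := m₀) h.μ_pos h2.1 h4 (h.cone h2)
    rw [pathM, if_neg (not_le.2 hx.1), pathM, if_pos le_rfl, (h.massAt_path hσ hx).1, pow_one]
    exact this
  · obtain ⟨h2, h3, h4, h5⟩ := h.sqrt_mem hσ ⟨h1, ht.2⟩
    have k1 := ContinuousAt.comp (g := fun P : ℝ × ℝ => D.shockMass μ m₀ P.1 P.2)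
        (f := fun t => (√(t - D.t₀), y (√(t - D.t₀))))
        (D.continuousAt_shockMass h2.1 h4 (h.cone h2))
        (h.continuousAt_sqrt_path hσ ⟨h1, ht.2⟩)
    refine (k1.congr ?_).continuousWithinAt
    filter_upwards [eventually_gt_nhds h1, eventually_lt_nhds ht.2] with s hs hs'
    rw [pathM, if_neg (not_le.2 hs), (h.massAt_path hσ ⟨hs, hs'⟩).1]
    rfl

theorem layout {p₁ q₂ : ℝ} {a b : ℝ → ℝ} (h : D.IsPath μ m₀ σ y)
    (hp₁ : p₁ ∈ Ioo (D.p₀ - D.δ) D.p₀) (hq₂ : q₂ ∈ Ioo D.q₀ (D.q₀ + D.δ)) (hσ : 0 < σ)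
    (h1 : 4 * D.r * σ ≤ D.p₀ - p₁) (h2 : 4 * D.r * σ ≤ q₂ - D.q₀)
    (ha : ∀ t, a t = D.Y (t, p₁)) (hb : ∀ t, b t = -D.reflect.Y (t, -q₂)) :
    Layout D p₁ q₂ σ a b (D.pathX y) where
  p₁_mem := hp₁
  q₂_mem := hq₂
  σ_pos := hσ
  σ_le := (D.le_s₂ h.μ_pos h.m₀_ne h.σ_le).1
  σ_p₁ := h1
  σ_q₂ := h2
  a_eq t _ := ha t
  b_eq t _ := hb t
  X_t₀ := h.pathX_t₀
  X_cone t ht := by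
    have e : D.pathX y t - D.x₀ - D.v₀ * (t - D.t₀) = y (√(t - D.t₀)) := by
      unfold pathX; ring
    rw [e]
    exact h.cone (h.sqrt_mem hσ ht).1

end CuspDatum.IsPath

/-- The initial data agree, between the labels `p₁` and `q₂`, with those that `D` describes. -/
structure CuspDatum.Fits (D : CuspDatum) (μ : ℝ) (ρ₀ u₀ : ℝ → ℝ) (α₁ β₂ p₁ q₂ : ℝ) : Prop where
  p₁_mem : p₁ ∈ Ioo (D.p₀ - D.δ) D.p₀
  q₂_mem : q₂ ∈ Ioo D.q₀ (D.q₀ + D.δ)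
  left : D.Y (0, p₁) = α₁
  right : D.Y (0, q₂) = β₂
  density : ∀ p ∈ Icc p₁ q₂, ρ₀ (D.Y (0, p)) = 2 * μ / (D.lp p - D.lm p)
  velocity : ∀ p ∈ Icc p₁ q₂, u₀ (D.Y (0, p)) = (D.lm p + D.lp p) / 2

/-- The `δ`-shock wave type solution. -/
noncomputable def CuspDatum.profile (D : CuspDatum) (μ m₀ p₁ q₂ : ℝ) (y : ℝ → ℝ) : Profile where
  ρm := D.rho μ
  um := D.vel
  ρp := D.rhoRight μ
  up := D.velRight
  a t := D.Y (t, p₁)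
  b t := -D.reflect.Y (t, -q₂)
  X := D.pathX y
  w t := D.pathM μ m₀ y t / √(1 + D.pathV μ m₀ y t ^ 2)
  v := D.pathV μ m₀ y

/-- The right domain is the reflection of a left domain. -/
theorem mem_rightDom_iff {S : Profile} {t₀ x₀ T : ℝ} {P : ℝ × ℝ} :
    P ∈ S.rightDom t₀ x₀ T ↔ (P.1, -P.2) ∈
      leftSet (fun t => -S.b t) (fun t => -S.a t) (fun t => -S.X t) t₀ (-x₀) T := by
  obtain ⟨t, x⟩ := P
  simp only [Profile.rightDom, leftSet, mem_ofPred_eq, neg_le_neg_iff, ne_eq, Prod.mk.injEq,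
    neg_inj]

theorem mem_rightInt_iff {S : Profile} {t₀ T : ℝ} {P : ℝ × ℝ} :
    P ∈ S.rightInt t₀ T ↔ (P.1, -P.2) ∈
      leftOpen (fun t => -S.b t) (fun t => -S.a t) (fun t => -S.X t) t₀ T := by
  obtain ⟨t, x⟩ := P
  simp only [Profile.rightInt, leftOpen, mem_ofPred_eq, neg_lt_neg_iff]

theorem dist_neg_snd (t x t₀ x₀ : ℝ) : dist (t, -x) (t₀, -x₀) = dist (t, x) (t₀, x₀) := by
  simp only [Prod.dist_eq, dist_neg_neg]

theorem tendsto_neg_rightDom {S : Profile} {t₀ x₀ T : ℝ} :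
    Tendsto (fun P : ℝ × ℝ => (P.1, -P.2)) (𝓝[S.rightDom t₀ x₀ T] (t₀, x₀))
      (𝓝[leftSet (fun t => -S.b t) (fun t => -S.a t) (fun t => -S.X t) t₀ (-x₀) T] (t₀, -x₀)) := by
  refine tendsto_nhdsWithin_iff.2 ⟨?_, ?_⟩
  · have : Continuous (fun P : ℝ × ℝ => (P.1, -P.2)) := by fun_prop
    exact (this.tendsto (t₀, x₀)).mono_left nhdsWithin_le_nhds
  · filter_upwards [self_mem_nhdsWithin] with P hP
    exact mem_rightDom_iff.1 hP

theorem CuspDatum.isDeltaShockSolution {D : CuspDatum} {μ σ p₀ w₀ α₁ β₂ p₁ q₂ : ℝ}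
    {ρ₀ u₀ y : ℝ → ℝ} (hD : D.Fits μ ρ₀ u₀ α₁ β₂ p₁ q₂)
    (h : D.IsPath μ (w₀ * √(1 + D.v₀ ^ 2)) σ y) (hσ : 0 < σ)
    (h1 : 4 * D.r * σ ≤ D.p₀ - p₁) (h2 : 4 * D.r * σ ≤ q₂ - D.q₀) :
    (D.profile μ (w₀ * √(1 + D.v₀ ^ 2)) p₁ q₂ y).IsDeltaShockSolution p₀ μ ρ₀ u₀ α₁ β₂ D.t₀ D.x₀
      (σ ^ 2) w₀ D.v₀ := by
  set m₀ := w₀ * √(1 + D.v₀ ^ 2) with hm₀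
  set S := D.profile μ m₀ p₁ q₂ y with hS
  have L : Layout D p₁ q₂ σ S.a S.b S.X :=
    h.layout hD.p₁_mem hD.q₂_mem hσ h1 h2 (fun _ => rfl) (fun _ => rfl)
  have R := L.reflect
  have hμ := h.μ_pos
  have ht₀ := D.t₀_pos
  have hRset : ∀ P ∈ S.rightDom D.t₀ D.x₀ (σ ^ 2), (P.1, -P.2) ∈ leftSet (fun t => -S.b t)
      (fun t => -S.a t) (fun t => -S.X t) D.reflect.t₀ D.reflect.x₀ (σ ^ 2) := by
    intro P hP
    rw [D.reflect_t₀, D.reflect_x₀]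
    exact mem_rightDom_iff.1 hP
  have hneg : ContDiff ℝ 1 (fun P : ℝ × ℝ => (P.1, -P.2)) := by fun_prop
  have hsqrt : ∀ v : ℝ, √(1 + v ^ 2) ≠ 0 := fun v => (Real.sqrt_pos.2 (by positivity)).ne'
  have hw : ∀ t, S.w t * √(1 + S.v t ^ 2) = D.pathM μ m₀ y t := fun t =>
    div_mul_cancel₀ _ (hsqrt _)
  have hXl : ∀ t ∈ Ioo D.t₀ (D.t₀ + σ ^ 2), ∃ p, (t, p) ∈ D.U ∧ D.Y (t, p) = D.pathX y t := by
    intro t ht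
    obtain ⟨ξ, -, -, k3, k4, -⟩ := L.exists_label_X ht
    exact ⟨_, k3, k4⟩
  have hXr : ∀ t ∈ Ioo D.t₀ (D.t₀ + σ ^ 2),
      ∃ p, (t, p) ∈ D.reflect.U ∧ D.reflect.Y (t, p) = -D.pathX y t := by
    intro t ht
    obtain ⟨ξ, -, -, k3, k4, -⟩ := R.exists_label_X (t := t) (by rwa [D.reflect_t₀])
    exact ⟨_, k3, k4⟩
  -- before the blowup the two states coincide, as `p` and, in the reflected datum, `-(p + t)` are
  -- labels of the same point
  have hmatch : ∀ t ∈ Ico 0 D.t₀, ∀ x ∈ Icc (S.a t) (S.b t),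
      D.reflect.gp (t, -x) = -D.gm (t, x) ∧ D.reflect.gm (t, -x) = -D.gp (t, x) := by
    intro t ht x hx
    have hmem : (t, x) ∈ leftSet S.a S.b S.X D.t₀ D.x₀ (σ ^ 2) := by
      rw [mem_leftSet_iff, rightEnd, if_pos ht.2]
      exact ⟨ht.1, by nlinarith [ht.2], hx.1, hx.2, fun he => ht.2.ne (Prod.ext_iff.1 he).1⟩
    obtain ⟨p, hU, rfl, -⟩ := L.exists_label hmem
    have hU' := D.mem_U_reflect hU.1 hU.2.1 ht.2
    rw [← D.reflect_Y, D.reflect.gp_Y hU', D.reflect.gm_Y hU', D.gm_Y hU, D.gp_Y hU]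
    constructor
    · change -D.lm (-(-(p + t) + t)) = _; congr 2; ring
    · change -D.lp (-(-(p + t))) = _; rw [neg_neg]
  -- the initial interval in terms of labels
  have hinit : ∀ x ∈ Icc α₁ β₂, ∃ p ∈ Icc p₁ q₂, D.Y (0, p) = x ∧ (0, p) ∈ D.U := by
    intro x hx
    have hle : p₁ ≤ q₂ := by linarith [hD.p₁_mem.2, hD.q₂_mem.1, D.p₀_lt_q₀]
    have hU : ∀ p ∈ Icc p₁ q₂, (0, p) ∈ D.U := fun p hp =>
      L.mem_U_left le_rfl ht₀ hp.1 (by linarith [hp.2])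
    have hc : ContinuousOn (fun p => D.Y (0, p)) (Icc p₁ q₂) := fun p hp =>
      (D.hasDerivAt_Y_p (hU p hp).1 (hU p hp).2.1).continuousAt.continuousWithinAt
    obtain ⟨p, hp, he⟩ := intermediate_value_Icc hle hc (by
      simp only [hD.left, hD.right]; exact hx)
    exact ⟨p, hp, he, hU p hp⟩
  have hpathM : ∀ t ∈ Ioo D.t₀ (D.t₀ + σ ^ 2),
      D.pathM μ m₀ y =ᶠ[𝓝 t] fun s => D.massAt μ m₀ s (D.pathX y s) := by
    intro t ht
    filter_upwards [eventually_gt_nhds ht.1] with s hs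
    rw [pathM, if_neg (not_le.2 hs)]
  refine
    { a_zero := hD.left
      b_zero := ?_
      a_char := ?_
      b_char := ?_
      a_lt_b := fun t ht => L.a_lt_b ht
      a_lt_X := fun t ht => L.a_lt_X ht
      X_lt_b := fun t ht => L.X_lt_b ht
      X_start := L.X_t₀
      X_speed := fun t ht => h.hasDerivWithinAt_pathX hσ ht
      v_cont := h.continuousOn_pathV hσ
      v_start := ?_
      w_cont := ?_
      w_start := ?_
      smooth_ρm := L.contDiffOn_rho μ
      smooth_um := L.contDiffOn_vel
      smooth_ρp := ?_
      smooth_up := ?_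
      ρm_pos := ?_
      ρp_pos := ?_
      bdd_um := L.exists_vel_bound
      bdd_up := ?_
      bdd_ρm := fun d hd => L.exists_rho_bound μ hd
      bdd_ρp := ?_
      blowup_ρm := L.tendsto_rho hμ
      blowup_ρp := ?_
      blowup_um := L.tendsto_vel
      blowup_up := ?_
      match_ρ := ?_
      match_u := ?_
      init_ρ := ?_
      init_u := ?_
      solves_left := ?_
      solves_right := ?_
      rankine_mass := ?_
      rankine_momentum := ?_
      entropy := ?_ }
  · rw [L.b_eq_before le_rfl ht₀, sub_zero, hD.right]
  · intro t ht
    have := L.hasDerivAt_a ht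
    change HasDerivWithinAt S.a (lamPlus μ (D.rho μ) D.vel (t, S.a t)) _ t
    rwa [D.lamPlus_rho_vel hμ]
  · intro t ht
    have := (R.hasDerivAt_a (t := t) (by rwa [D.reflect_t₀])).neg
    change HasDerivWithinAt S.b (lamMinus μ (D.rhoRight μ) D.velRight (t, S.b t)) _ t
    rw [D.lamMinus_right hμ]
    rw [D.reflect_t₀] at this
    exact this.congr_of_mem (fun s _ => (neg_neg (S.b s)).symm) ht
  · change D.pathV μ m₀ y D.t₀ = _
    rw [pathV, if_pos le_rfl]
  · exact (h.continuousOn_pathM hσ).div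
      (((h.continuousOn_pathV hσ).pow 2).const_add 1 |>.sqrt) fun t _ => hsqrt _
  · change D.pathM μ m₀ y D.t₀ / √(1 + D.pathV μ m₀ y D.t₀ ^ 2) = _
    rw [pathM, if_pos le_rfl, pathV, if_pos le_rfl, hm₀, mul_div_cancel_right₀ _ (hsqrt _)]
  · exact (R.contDiffOn_rho μ).comp hneg.contDiffOn hRset
  · exact (R.contDiffOn_vel.comp hneg.contDiffOn hRset).neg
  · rintro ⟨t, x⟩ hP
    obtain ⟨p, hU, rfl, -⟩ := L.exists_label hP
    exact D.rho_pos hμ hU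
  · rintro ⟨t, x⟩ hP
    obtain ⟨p, hU, he, -⟩ := R.exists_label (hRset _ hP)
    have := D.reflect.rho_pos hμ hU
    rwa [he] at this
  · obtain ⟨M, hM⟩ := R.exists_vel_bound
    refine ⟨M, fun P hP => ?_⟩
    change |-D.reflect.vel (P.1, -P.2)| ≤ M
    rw [abs_neg]
    exact hM _ (hRset P hP)
  · intro d hd
    obtain ⟨M, hM⟩ := R.exists_rho_bound μ hd
    refine ⟨M, fun P hP hdP => hM _ (hRset P hP) ?_⟩
    rwa [D.reflect_t₀, D.reflect_x₀, dist_neg_snd]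
  · have := R.tendsto_rho hμ
    rw [D.reflect_t₀, D.reflect_x₀] at this
    exact this.comp tendsto_neg_rightDom
  · have := R.tendsto_vel
    rw [D.reflect_t₀, D.reflect_x₀, D.reflect_v₀] at this
    have := (this.comp (tendsto_neg_rightDom (S := S))).neg
    rw [neg_neg] at this
    exact this
  · intro t ht x hx
    have := hmatch t ht x hx
    change 2 * μ / (D.gp (t, x) - D.gm (t, x)) =
      2 * μ / (D.reflect.gp (t, -x) - D.reflect.gm (t, -x))
    rw [this.1, this.2]
    congr 1; ring
  · intro t ht x hx
    have := hmatch t ht x hx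
    change (D.gm (t, x) + D.gp (t, x)) / 2 =
      -((D.reflect.gm (t, -x) + D.reflect.gp (t, -x)) / 2)
    rw [this.1, this.2]
    ring
  · intro x hx
    obtain ⟨p, hp, rfl, hU⟩ := hinit x hx
    rw [hD.density p hp]
    change 2 * μ / (D.gp (0, D.Y (0, p)) - D.gm (0, D.Y (0, p))) = _
    rw [D.gm_Y hU, D.gp_Y hU, add_zero]
  · intro x hx
    obtain ⟨p, hp, rfl, hU⟩ := hinit x hx
    rw [hD.velocity p hp]
    change (D.gm (0, D.Y (0, p)) + D.gp (0, D.Y (0, p))) / 2 = _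
    rw [D.gm_Y hU, D.gp_Y hU, add_zero]
  · rintro ⟨t, x⟩ hP
    have hP' : (t, x) ∈ leftSet S.a S.b S.X D.t₀ D.x₀ (σ ^ 2) := by
      have hP1 := mem_leftOpen_iff.1 hP
      refine mem_leftSet_iff.2 ⟨hP1.1.le, hP1.2.1, hP1.2.2.1.le, hP1.2.2.2.le, fun he => ?_⟩
      have e1 : t = D.t₀ := (Prod.ext_iff.1 he).1
      have e2 : x = D.x₀ := (Prod.ext_iff.1 he).2
      have e3 := hP1.2.2.2
      rw [rightEnd, e1, if_neg (lt_irrefl _), L.X_t₀, e2] at e3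
      exact lt_irrefl _ e3
    obtain ⟨p, hU, rfl, -⟩ := L.exists_label hP'
    exact D.solvesSystemAt hμ hU
  · rintro ⟨t, x⟩ hP
    have hP' : (t, x) ∈ S.rightDom D.t₀ D.x₀ (σ ^ 2) := by
      refine ⟨hP.1.le, hP.2.1, hP.2.2.1.le, fun k => (hP.2.2.2.1 k).le, fun k => (hP.2.2.2.2 k).le,
        fun he => ?_⟩
      have e1 : t = D.t₀ := (Prod.ext_iff.1 he).1
      have e2 : x = D.x₀ := (Prod.ext_iff.1 he).2
      have e3 := hP.2.2.2.2 e1.ge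
      simp only [e1, e2] at e3
      rw [L.X_t₀] at e3
      exact lt_irrefl _ e3
    obtain ⟨p, hU, he, -⟩ := R.exists_label (hRset _ hP')
    exact D.solvesSystemAt_right hμ hU he
  · intro t ht
    obtain ⟨p, hU, he⟩ := hXl t ht
    obtain ⟨p', hU', he'⟩ := hXr t ht
    have := D.hasDerivAt_massAt (μ := μ) (m₀ := m₀) hU he hU' he' (h.hasDerivAt_pathX hσ ht)
    simp only [hw]
    exact this.congr_of_eventuallyEq (hpathM t ht)
  · intro t ht
    obtain ⟨p, hU, he⟩ := hXl t ht
    obtain ⟨p', hU', he'⟩ := hXr t ht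
    have k1 := D.hasDerivAt_massAt (μ := μ) (m₀ := m₀) hU he hU' he' (h.hasDerivAt_pathX hσ ht)
    have k2 := D.hasDerivAt_momentumAt (p₀ := p₀) (μ := μ) hU he hU' he'
      (h.hasDerivAt_pathX hσ ht)
    have k3 := (k1.const_mul D.v₀).add k2
    -- by the equation of motion, mass times velocity is `v₀` times the mass plus the momentum in
    -- the frame of the cusp
    have k4 : (fun s => S.w s * S.v s * √(1 + S.v s ^ 2)) =ᶠ[𝓝 t]
        fun s => D.v₀ * D.massAt μ m₀ s (D.pathX y s) + D.momentumAt μ s (D.pathX y s) := by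
      filter_upwards [eventually_gt_nhds ht.1, eventually_lt_nhds ht.2] with s hs hs'
      obtain ⟨j1, j2, j3, j4⟩ := h.sqrt_mem hσ ⟨hs, hs'⟩
      rw [show S.w s * S.v s * √(1 + S.v s ^ 2) = S.w s * √(1 + S.v s ^ 2) * S.v s by ring, hw,
        pathM, if_neg (not_le.2 hs)]
      change _ * D.pathV μ m₀ y s = _
      rw [pathV, if_neg (not_le.2 hs), (h.massAt_path hσ ⟨hs, hs'⟩).1,
        (h.massAt_path hσ ⟨hs, hs'⟩).2, CuspDatum.drift]
      have hne : D.shockMass μ m₀ (√(s - D.t₀)) (y (√(s - D.t₀))) ≠ 0 := by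
        have := D.le_abs_shockMass hμ h.m₀_ne j1.1 j4 (h.cone j1)
        have h0 := abs_pos.2 h.m₀_ne
        exact abs_pos.1 (by linarith)
      field_simp
    refine (k3.congr_of_eventuallyEq k4).congr_deriv ?_
    change _ = D.pathV μ m₀ y t * (D.rhoRight μ (t, D.pathX y t) * D.velRight (t, D.pathX y t) -
      D.rho μ (t, D.pathX y t) * D.vel (t, D.pathX y t)) -
      ((D.rhoRight μ (t, D.pathX y t) * D.velRight (t, D.pathX y t) ^ 2 +
        pressure p₀ μ (D.rhoRight μ (t, D.pathX y t))) -
        (D.rho μ (t, D.pathX y t) * D.vel (t, D.pathX y t) ^ 2 +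
          pressure p₀ μ (D.rho μ (t, D.pathX y t))))
    ring
  · intro t ht
    obtain ⟨p, hU, he⟩ := hXl t ht
    obtain ⟨p', hU', he'⟩ := hXr t ht
    obtain ⟨j1, j2, j3, j4⟩ := h.sqrt_mem hσ ht
    have e1 := L.entropy_left ht
    have e2 := R.entropy_left (t := t) (by rwa [D.reflect_t₀])
    rw [D.reflect_t₀, D.reflect_v₀, D.reflect_θ] at e2
    have e3 := abs_le.1 (h.abs_pathV_sub_le hσ ht)
    -- `λ₋` on the left exceeds `v₀` by at least `θ s`, and `λ₊` on the right is below `v₀` by as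
    -- much, while the speed of the `δ`-shock is `v₀ + O(s²)`
    have e4 : D.driftConst μ m₀ * (t - D.t₀) ≤ D.θ * √(t - D.t₀) := by
      calc D.driftConst μ m₀ * (t - D.t₀) =
          D.driftConst μ m₀ * √(t - D.t₀) * √(t - D.t₀) := by rw [mul_assoc, ← sq, j2]
        _ ≤ _ := mul_le_mul_of_nonneg_right (D.le_s₂ hμ h.m₀_ne j4).2.2 j1.1.le
    have lt1 := D.gm_lt_gp hU
    have lt2 := D.reflect.gm_lt_gp hU'
    rw [he] at lt1
    rw [he'] at lt2
    change lamMinus μ (D.rhoRight μ) D.velRight (t, D.pathX y t) <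
        lamPlus μ (D.rhoRight μ) D.velRight (t, D.pathX y t) ∧
      lamPlus μ (D.rhoRight μ) D.velRight (t, D.pathX y t) ≤ D.pathV μ m₀ y t ∧
      D.pathV μ m₀ y t ≤ lamMinus μ (D.rho μ) D.vel (t, D.pathX y t) ∧
      lamMinus μ (D.rho μ) D.vel (t, D.pathX y t) < lamPlus μ (D.rho μ) D.vel (t, D.pathX y t)
    rw [D.lamMinus_right hμ, D.lamPlus_right hμ, D.lamMinus_rho_vel hμ, D.lamPlus_rho_vel hμ]
    have e5 : S.X t = D.pathX y t := rfl
    rw [e5] at e1 e2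
    exact ⟨by linarith, by linarith, by linarith, lt1⟩

end Chaplygin

namespace Chaplygin

/-! ### The two halves of an arbitrary solution -/

theorem eq_zero_of_hasDerivAt_zero {f : ℝ → ℝ} {a b : ℝ} (hf : ∀ t ∈ Ioo a b, HasDerivAt f 0 t)
    (hlim : Tendsto f (𝓝[>] a) (𝓝 0)) {t : ℝ} (ht : t ∈ Ioo a b) : f t = 0 := by
  refine tendsto_nhds_unique (tendsto_const_nhds.congr' ?_) hlim
  filter_upwards [Ioo_mem_nhdsGT ht.1] with s hs
  have hsub : Icc s t ⊆ Ioo a b := fun r hr => ⟨hs.1.trans_le hr.1, hr.2.trans_lt ht.2⟩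
  exact eq_of_hasDerivAt_zero hs.2.le
    (fun r hr => (hf r (hsub hr)).continuousAt.continuousWithinAt)
    (fun r hr => hf r (hsub (Ioo_subset_Icc_self hr)))

section Halves

variable {D : CuspDatum} {μ T p₀ w₀ α₁ β₂ p₁ q₂ : ℝ} {ρ₀ u₀ : ℝ → ℝ} {S : Profile}

theorem CuspDatum.Fits.le (hD : D.Fits μ ρ₀ u₀ α₁ β₂ p₁ q₂) : p₁ ≤ q₂ := by
  linarith [hD.p₁_mem.2, hD.q₂_mem.1, D.p₀_lt_q₀]

theorem CuspDatum.Fits.mem_B (hD : D.Fits μ ρ₀ u₀ α₁ β₂ p₁ q₂) {p : ℝ} (hp : p ∈ Icc p₁ q₂) :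
    p ∈ D.B := ⟨hD.p₁_mem.1.trans_le hp.1, hp.2.trans_lt hD.q₂_mem.2⟩

theorem CuspDatum.Fits.Y_mem (hD : D.Fits μ ρ₀ u₀ α₁ β₂ p₁ q₂) {p : ℝ} (hp : p ∈ Icc p₁ q₂) :
    D.Y (0, p) ∈ Icc α₁ β₂ := by
  have hm : ∀ r ∈ Icc p₁ q₂, ∀ s ∈ Icc p₁ q₂, r ≤ s → D.Y (0, r) ≤ D.Y (0, s) := by
    intro r hr s hs hrs
    rcases hrs.eq_or_lt with rfl | h
    · exact le_rfl
    · exact (D.Y_lt_Y (D.mem_U_zero (hD.mem_B hr)) (D.mem_U_zero (hD.mem_B hs)) h).le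
  rw [← hD.left, ← hD.right]
  exact ⟨hm _ (left_mem_Icc.2 hD.le) _ hp hp.1, hm _ hp _ (right_mem_Icc.2 hD.le) hp.2⟩

theorem lamMinus_lt_lamPlus {ρ u : ℝ × ℝ → ℝ} {P : ℝ × ℝ} (hμ : 0 < μ) (h : 0 < ρ P) :
    lamMinus μ ρ u P < lamPlus μ ρ u P := by
  have : 0 < μ / ρ P := by positivity
  unfold lamMinus lamPlus; linarith

theorem tendsto_lam {ρ u : ℝ × ℝ → ℝ} {l : Filter (ℝ × ℝ)} {c : ℝ} (hρ : Tendsto ρ l atTop)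
    (hu : Tendsto u l (𝓝 c)) :
    Tendsto (lamMinus μ ρ u) l (𝓝 c) ∧ Tendsto (lamPlus μ ρ u) l (𝓝 c) := by
  have h : Tendsto (fun P => μ / ρ P) l (𝓝 0) := hρ.const_div_atTop μ
  constructor
  · have := hu.sub h
    rwa [sub_zero] at this
  · have := hu.add h
    rwa [add_zero] at this

/-- The values of the initial data in Riemann invariants. -/
theorem CuspDatum.Fits.lam (hD : D.Fits μ ρ₀ u₀ α₁ β₂ p₁ q₂) (hμ : 0 < μ) {p : ℝ}
    (hp : p ∈ Icc p₁ q₂) :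
    u₀ (D.Y (0, p)) - μ / ρ₀ (D.Y (0, p)) = D.lm p ∧
      u₀ (D.Y (0, p)) + μ / ρ₀ (D.Y (0, p)) = D.lp p := by
  have h := (D.mem_U_zero (hD.mem_B hp)).2.2.2
  simp only [add_zero] at h
  have hne := (sub_pos.2 h).ne'
  rw [hD.density p hp, hD.velocity p hp]
  constructor <;> · field_simp; ring

theorem Profile.IsDeltaShockSolution.init_lam
    (h : S.IsDeltaShockSolution p₀ μ ρ₀ u₀ α₁ β₂ D.t₀ D.x₀ T w₀ D.v₀)
    (hD : D.Fits μ ρ₀ u₀ α₁ β₂ p₁ q₂) (hμ : 0 < μ) {p : ℝ} (hp : p ∈ Icc p₁ q₂) :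
    lamMinus μ S.ρm S.um (0, D.Y (0, p)) = D.lm p ∧
      lamPlus μ S.ρm S.um (0, D.Y (0, p)) = D.lp p := by
  rw [lamMinus, lamPlus, h.init_ρ _ (hD.Y_mem hp), h.init_u _ (hD.Y_mem hp)]
  exact hD.lam hμ hp

/-- The left half of a solution. -/
theorem Profile.IsDeltaShockSolution.leftState
    (h : S.IsDeltaShockSolution p₀ μ ρ₀ u₀ α₁ β₂ D.t₀ D.x₀ T w₀ D.v₀)
    (hD : D.Fits μ ρ₀ u₀ α₁ β₂ p₁ q₂) (hμ : 0 < μ) (hT : 0 < T) :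
    LeftState D p₁ q₂ T (lamMinus μ S.ρm S.um) (lamPlus μ S.ρm S.um) S.a S.b S.X S.v := by
  have ha : ContinuousOn S.a (Ico 0 (D.t₀ + T)) := fun t ht => (h.a_char t ht).continuousWithinAt
  have hb : ContinuousOn S.b (Ico 0 (D.t₀ + T)) := fun t ht => (h.b_char t ht).continuousWithinAt
  have hX : ContinuousOn S.X (Ico D.t₀ (D.t₀ + T)) := fun t ht =>
    (h.X_speed t ht).continuousWithinAt
  have hopen := isOpen_leftOpen ha hb hX h.X_lt_b
  have hsub : leftOpen S.a S.b S.X D.t₀ T ⊆ S.leftDom D.t₀ D.x₀ T := by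
    rintro ⟨t, x⟩ hP
    refine ⟨hP.1.le, hP.2.1, hP.2.2.1.le, fun k => (hP.2.2.2.1 k).le, fun k => (hP.2.2.2.2 k).le,
      fun he => ?_⟩
    have e1 : t = D.t₀ := (Prod.ext_iff.1 he).1
    have e2 : x = D.x₀ := (Prod.ext_iff.1 he).2
    have e3 := hP.2.2.2.2 e1.ge
    simp only [e1, e2] at e3
    rw [h.X_start] at e3
    exact lt_irrefl _ e3
  have hinv : ContinuousOn (fun P => μ / S.ρm P) (S.leftDom D.t₀ D.x₀ T) :=
    continuousOn_const.div h.smooth_ρm.continuousOn fun P hP => (h.ρm_pos P hP).ne'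
  have hlim := tendsto_lam (μ := μ) h.blowup_ρm h.blowup_um
  exact
    { p₁_mem := hD.p₁_mem
      q₂_mem := hD.q₂_mem
      T_pos := hT
      a_zero := by rw [h.a_zero, hD.left]
      b_zero := by rw [h.b_zero, hD.right]
      a_char := h.a_char
      b_char := fun t ht => by
        have hle := (h.a_lt_b t ht).le
        have := h.b_char t ⟨ht.1, by linarith [ht.2]⟩
        rwa [lamMinus, ← h.match_ρ t ht _ (right_mem_Icc.2 hle),
          ← h.match_u t ht _ (right_mem_Icc.2 hle)] at this
      b_cont := hb
      a_lt_b := h.a_lt_b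
      a_lt_X := h.a_lt_X
      X_lt_b := h.X_lt_b
      X_start := h.X_start
      X_speed := h.X_speed
      v_le := fun t ht => (h.entropy t ht).2.2.1
      gm_cont := h.smooth_um.continuousOn.sub hinv
      gp_cont := h.smooth_um.continuousOn.add hinv
      gm_lt_gp := fun P hP => lamMinus_lt_lamPlus hμ (h.ρm_pos P hP)
      transport := fun P hP => by
        have hn := mem_of_superset (hopen.mem_nhds hP) hsub
        exact transport_of_solvesSystemAt
          ((h.smooth_ρm.contDiffAt hn).differentiableAt one_ne_zero)
          ((h.smooth_um.contDiffAt hn).differentiableAt one_ne_zero) (h.ρm_pos P (hsub hP))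
          (h.solves_left P hP)
      init := fun p hp => h.init_lam hD hμ hp
      blowup_gm := hlim.1
      blowup_gp := hlim.2 }

/-- The right half of a solution, reflected. -/
theorem Profile.IsDeltaShockSolution.rightState
    (h : S.IsDeltaShockSolution p₀ μ ρ₀ u₀ α₁ β₂ D.t₀ D.x₀ T w₀ D.v₀)
    (hD : D.Fits μ ρ₀ u₀ α₁ β₂ p₁ q₂) (hμ : 0 < μ) (hT : 0 < T) :
    LeftState D.reflect (-q₂) (-p₁) T (fun P => -lamPlus μ S.ρp S.up (P.1, -P.2))
      (fun P => -lamMinus μ S.ρp S.up (P.1, -P.2)) (fun t => -S.b t) (fun t => -S.a t)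
      (fun t => -S.X t) (fun t => -S.v t) := by
  have ha : ContinuousOn S.a (Ico 0 (D.t₀ + T)) := fun t ht => (h.a_char t ht).continuousWithinAt
  have hb : ContinuousOn S.b (Ico 0 (D.t₀ + T)) := fun t ht => (h.b_char t ht).continuousWithinAt
  have hX : ContinuousOn S.X (Ico D.t₀ (D.t₀ + T)) := fun t ht =>
    (h.X_speed t ht).continuousWithinAt
  have hneg : Continuous fun P : ℝ × ℝ => (P.1, -P.2) := by fun_prop
  have hopen : IsOpen (S.rightInt D.t₀ T) := by
    have := (isOpen_leftOpen hb.neg ha.neg hX.neg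
      (fun t ht => neg_lt_neg (h.a_lt_X t ht))).preimage hneg
    convert! this using 1
    ext P
    exact mem_rightInt_iff
  have hsub : S.rightInt D.t₀ T ⊆ S.rightDom D.t₀ D.x₀ T := by
    rintro ⟨t, x⟩ hP
    refine ⟨hP.1.le, hP.2.1, hP.2.2.1.le, fun k => (hP.2.2.2.1 k).le, fun k => (hP.2.2.2.2 k).le,
      fun he => ?_⟩
    have e1 : t = D.t₀ := (Prod.ext_iff.1 he).1
    have e2 : x = D.x₀ := (Prod.ext_iff.1 he).2
    have e3 := hP.2.2.2.2 e1.ge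
    simp only [e1, e2] at e3
    rw [h.X_start] at e3
    exact lt_irrefl _ e3
  have hset : ∀ P ∈ leftSet (fun t => -S.b t) (fun t => -S.a t) (fun t => -S.X t) D.t₀ (-D.x₀) T,
      (P.1, -P.2) ∈ S.rightDom D.t₀ D.x₀ T := by
    intro P hP
    rw [mem_rightDom_iff, neg_neg]
    exact hP
  have hinv : ContinuousOn (fun P => μ / S.ρp P) (S.rightDom D.t₀ D.x₀ T) :=
    continuousOn_const.div h.smooth_ρp.continuousOn fun P hP => (h.ρp_pos P hP).ne'
  have hlim := tendsto_lam (μ := μ) h.blowup_ρp h.blowup_up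
  have htend : Tendsto (fun P : ℝ × ℝ => (P.1, -P.2))
      (𝓝[leftSet (fun t => -S.b t) (fun t => -S.a t) (fun t => -S.X t) D.t₀ (-D.x₀) T]
        (D.t₀, -D.x₀)) (𝓝[S.rightDom D.t₀ D.x₀ T] (D.t₀, D.x₀)) := by
    refine tendsto_nhdsWithin_iff.2 ⟨?_, ?_⟩
    · have := hneg.tendsto (D.t₀, -D.x₀)
      simp only [neg_neg] at this
      exact this.mono_left nhdsWithin_le_nhds
    · filter_upwards [self_mem_nhdsWithin] with P hP using hset P hP
  exact
    { p₁_mem := by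
        have := hD.q₂_mem
        exact ⟨by change -D.q₀ - D.δ < -q₂; linarith [this.2],
          by change -q₂ < -D.q₀; linarith [this.1]⟩
      q₂_mem := by
        have := hD.p₁_mem
        exact ⟨by change -D.p₀ < -p₁; linarith [this.2],
          by change -p₁ < -D.p₀ + D.δ; linarith [this.1]⟩
      T_pos := hT
      a_zero := by
        have := D.reflect_Y 0 q₂
        rw [add_zero] at this
        rw [this, hD.right, h.b_zero]
      b_zero := by
        have := D.reflect_Y 0 p₁
        rw [add_zero] at this
        rw [this, hD.left, h.a_zero]
      a_char := fun t ht => by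
        rw [D.reflect_t₀] at ht ⊢
        simp only [neg_neg]
        exact (h.b_char t ht).neg
      -- before the blowup the speed of `a` can be read off from the right state
      b_char := fun t ht => by
        rw [D.reflect_t₀] at ht ⊢
        simp only [neg_neg]
        have hle := (h.a_lt_b t ht).le
        have := h.a_char t ⟨ht.1, by linarith [ht.2]⟩
        rw [lamPlus, h.match_ρ t ht _ (left_mem_Icc.2 hle),
          h.match_u t ht _ (left_mem_Icc.2 hle)] at this
        exact this.neg
      b_cont := by rw [D.reflect_t₀]; exact ha.neg
      a_lt_b := by rw [D.reflect_t₀]; exact fun t ht => neg_lt_neg (h.a_lt_b t ht)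
      a_lt_X := by rw [D.reflect_t₀]; exact fun t ht => neg_lt_neg (h.X_lt_b t ht)
      X_lt_b := by rw [D.reflect_t₀]; exact fun t ht => neg_lt_neg (h.a_lt_X t ht)
      X_start := by simp [h.X_start]
      X_speed := by rw [D.reflect_t₀]; exact fun t ht => (h.X_speed t ht).neg
      v_le := by
        rw [D.reflect_t₀]
        intro t ht
        simp only [neg_neg]
        exact neg_le_neg (h.entropy t ht).2.1
      gm_cont := by
        rw [D.reflect_t₀, D.reflect_x₀]
        exact ((h.smooth_up.continuousOn.add hinv).comp hneg.continuousOn hset).neg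
      gp_cont := by
        rw [D.reflect_t₀, D.reflect_x₀]
        exact ((h.smooth_up.continuousOn.sub hinv).comp hneg.continuousOn hset).neg
      gm_lt_gp := by
        rw [D.reflect_t₀, D.reflect_x₀]
        exact fun P hP => neg_lt_neg (lamMinus_lt_lamPlus hμ (h.ρp_pos _ (hset P hP)))
      transport := by
        rw [D.reflect_t₀]
        rintro ⟨t, x⟩ hP
        have hP' : (t, -x) ∈ S.rightInt D.t₀ T := by
          rw [mem_rightInt_iff, neg_neg]; exact hP
        have hn := mem_of_superset (hopen.mem_nhds hP') hsub
        exact transport_neg (transport_of_solvesSystemAt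
          ((h.smooth_ρp.contDiffAt hn).differentiableAt one_ne_zero)
          ((h.smooth_up.contDiffAt hn).differentiableAt one_ne_zero) (h.ρp_pos _ (hsub hP'))
          (h.solves_right _ hP'))
      init := by
        intro p hp
        have hp' : -p ∈ Icc p₁ q₂ := ⟨by linarith [hp.2], by linarith [hp.1]⟩
        have e := D.reflect_Y 0 (-p)
        rw [add_zero, neg_neg] at e
        have k := h.init_lam hD hμ hp'
        have hmem : D.Y (0, -p) ∈ Icc (S.a 0) (S.b 0) := by
          rw [h.a_zero, h.b_zero]; exact hD.Y_mem hp'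
        rw [lamMinus, lamPlus, h.match_ρ 0 ⟨le_rfl, D.t₀_pos⟩ _ hmem,
          h.match_u 0 ⟨le_rfl, D.t₀_pos⟩ _ hmem] at k
        simp only [e, neg_neg]
        exact ⟨congrArg Neg.neg k.2, congrArg Neg.neg k.1⟩
      blowup_gm := by
        rw [D.reflect_t₀, D.reflect_x₀, D.reflect_v₀]
        exact (hlim.2.comp htend).neg
      blowup_gp := by
        rw [D.reflect_t₀, D.reflect_x₀, D.reflect_v₀]
        exact (hlim.1.comp htend).neg }

theorem two_mul_div_lam {ρ u : ℝ × ℝ → ℝ} {P : ℝ × ℝ} (hμ : 0 < μ) :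
    2 * μ / (lamPlus μ ρ u P - lamMinus μ ρ u P) = ρ P := by
  have e : lamPlus μ ρ u P - lamMinus μ ρ u P = 2 * μ / ρ P := by unfold lamPlus lamMinus; ring
  rw [e, div_div_cancel₀ (by positivity)]

end Halves

end Chaplygin

namespace Chaplygin

/-! ### Existence and uniqueness -/

namespace CuspDatum

variable (D : CuspDatum)

/-- If the place `x₀ + v₀ s² + y` is reached from both sides, then `y ≤ κ r² s²`. The estimate for
`-y` is that of the reflected datum. -/
theorem apriori_y {s y ξ ξ' : ℝ} (h0 : 0 < s) (hs : s ≤ D.s₁) (h1 : -D.δ < ξ) (h2 : ξ ≤ 0)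
    (h1' : -D.δ < ξ') (h2' : ξ' ≤ 0) (h3 : D.Y (D.t₀ + s ^ 2, D.p₀ + ξ) = D.x₀ + D.v₀ * s ^ 2 + y)
    (h3' : D.reflect.Y (D.t₀ + s ^ 2, D.reflect.p₀ + ξ') = -(D.x₀ + D.v₀ * s ^ 2 + y)) :
    y ≤ D.κ * D.r ^ 2 * s ^ 2 := by
  have hξ := D.apriori h0 hs h1 h2 h1' h2' h3 h3'
  obtain ⟨k1, k2, k3⟩ := D.le_s₁ hs h0
  have h4 := D.Y_cusp_le h1 h2 (sq_nonneg s) k3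
  rw [h3] at h4
  have hκ := D.κ_pos
  have hr := D.r_pos
  have h5 : D.c * ξ ^ 3 ≤ 0 := mul_nonpos_of_nonneg_of_nonpos D.c_pos.le (by
    have : ξ ^ 3 = ξ * ξ ^ 2 := by ring
    rw [this]; exact mul_nonpos_of_nonpos_of_nonneg h2 (sq_nonneg _))
  have h6 : D.κ * s ^ 2 * (-ξ) ≤ D.κ * s ^ 2 * (4 * D.r * s) :=
    mul_le_mul_of_nonneg_left (by linarith) (by positivity)
  have h7 : D.κ * s ^ 2 * (4 * D.r * s) ≤ D.κ * s ^ 2 * (4 * D.r * (D.r / 5)) := by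
    gcongr
  have h8 : 0 ≤ D.κ * D.r ^ 2 * s ^ 2 := by positivity
  nlinarith

end CuspDatum

section Uniqueness

variable {D : CuspDatum} {μ T p₀ w₀ α₁ β₂ p₁ q₂ : ℝ} {ρ₀ u₀ : ℝ → ℝ} {S : Profile}

theorem tendsto_nhdsGT_of_continuousOn_Ico {l : ℝ → ℝ} {a b : ℝ} (hab : a < b) (h : ContinuousOn l (Ico a b)) :
    Tendsto l (𝓝[>] a) (𝓝 (l a)) := by
  have := (h a (left_mem_Ico.2 hab)).mono_left
    (nhdsWithin_mono a (Ioo_subset_Ico_self (a := a) (b := b)))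
  rwa [nhdsWithin_Ioo_eq_nhdsGT hab] at this

namespace Profile.IsDeltaShockSolution

/-- The left state of every solution is the explicit one. -/
theorem left_eq (h : S.IsDeltaShockSolution p₀ μ ρ₀ u₀ α₁ β₂ D.t₀ D.x₀ T w₀ D.v₀)
    (hD : D.Fits μ ρ₀ u₀ α₁ β₂ p₁ q₂) (hμ : 0 < μ) (hT : 0 < T) :
    EqOn S.ρm (D.rho μ) (S.leftDom D.t₀ D.x₀ T) ∧ EqOn S.um D.vel (S.leftDom D.t₀ D.x₀ T) := by
  have L := h.leftState hD hμ hT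
  constructor <;> intro P hP
  · rw [CuspDatum.rho, ← L.gm_eq hP, ← L.gp_eq hP, two_mul_div_lam hμ]
  · rw [CuspDatum.vel, ← L.gm_eq hP, ← L.gp_eq hP, lamMinus, lamPlus]; ring

/-- The right state of every solution is the explicit one. -/
theorem right_eq (h : S.IsDeltaShockSolution p₀ μ ρ₀ u₀ α₁ β₂ D.t₀ D.x₀ T w₀ D.v₀)
    (hD : D.Fits μ ρ₀ u₀ α₁ β₂ p₁ q₂) (hμ : 0 < μ) (hT : 0 < T) :
    EqOn S.ρp (D.rhoRight μ) (S.rightDom D.t₀ D.x₀ T) ∧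
      EqOn S.up D.velRight (S.rightDom D.t₀ D.x₀ T) := by
  have L := h.rightState hD hμ hT
  have hset : ∀ P ∈ S.rightDom D.t₀ D.x₀ T, (P.1, -P.2) ∈ leftSet (fun t => -S.b t)
      (fun t => -S.a t) (fun t => -S.X t) D.reflect.t₀ D.reflect.x₀ T := by
    intro P hP
    rw [D.reflect_t₀, D.reflect_x₀]
    exact mem_rightDom_iff.1 hP
  constructor <;> intro P hP
  · rw [CuspDatum.rhoRight, CuspDatum.rho, ← L.gm_eq (hset P hP), ← L.gp_eq (hset P hP)]
    simp only [neg_neg, neg_sub_neg]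
    rw [two_mul_div_lam hμ]
  · rw [CuspDatum.velRight, CuspDatum.vel, ← L.gm_eq (hset P hP), ← L.gp_eq (hset P hP)]
    simp only [neg_neg, lamMinus, lamPlus]
    ring

theorem X_mem_leftDom (h : S.IsDeltaShockSolution p₀ μ ρ₀ u₀ α₁ β₂ D.t₀ D.x₀ T w₀ D.v₀) {t : ℝ}
    (ht : t ∈ Ioo D.t₀ (D.t₀ + T)) : (t, S.X t) ∈ S.leftDom D.t₀ D.x₀ T :=
  ⟨D.t₀_pos.le.trans ht.1.le, ht.2, (h.a_lt_X t (Ioo_subset_Ico_self ht)).le,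
    fun k => absurd k (not_lt.2 ht.1.le), fun _ => le_rfl, fun he => ht.1.ne' (Prod.ext_iff.1 he).1⟩

theorem X_mem_rightDom (h : S.IsDeltaShockSolution p₀ μ ρ₀ u₀ α₁ β₂ D.t₀ D.x₀ T w₀ D.v₀) {t : ℝ}
    (ht : t ∈ Ioo D.t₀ (D.t₀ + T)) : (t, S.X t) ∈ S.rightDom D.t₀ D.x₀ T :=
  ⟨D.t₀_pos.le.trans ht.1.le, ht.2, (h.X_lt_b t (Ioo_subset_Ico_self ht)).le,
    fun k => absurd k (not_lt.2 ht.1.le), fun _ => le_rfl, fun he => ht.1.ne' (Prod.ext_iff.1 he).1⟩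

/-- The labels of the two states at the discontinuity are within `4 r s` of the cusp. -/
theorem labels_X (h : S.IsDeltaShockSolution p₀ μ ρ₀ u₀ α₁ β₂ D.t₀ D.x₀ T w₀ D.v₀)
    (hD : D.Fits μ ρ₀ u₀ α₁ β₂ p₁ q₂) (hμ : 0 < μ) (hT : 0 < T) (hTs : T ≤ D.s₁ ^ 2) {t : ℝ}
    (ht : t ∈ Ioo D.t₀ (D.t₀ + T)) : ∃ ξ ξ',
      (t, D.p₀ + ξ) ∈ D.U ∧ D.Y (t, D.p₀ + ξ) = S.X t ∧
      (t, D.reflect.p₀ + ξ') ∈ D.reflect.U ∧ D.reflect.Y (t, D.reflect.p₀ + ξ') = -S.X t ∧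
      -(4 * D.r * √(t - D.t₀)) ≤ ξ ∧ ξ ≤ 0 ∧ -(4 * D.r * √(t - D.t₀)) ≤ ξ' ∧ ξ' ≤ 0 ∧
      |S.X t - D.x₀ - D.v₀ * (t - D.t₀)| ≤ D.κ * D.r ^ 2 * √(t - D.t₀) ^ 2 := by
  have L := h.leftState hD hμ hT
  have R := h.rightState hD hμ hT
  obtain ⟨p, -, hU, hY, -, -⟩ := L.exists_label (h.X_mem_leftDom ht)
  obtain ⟨p', -, hU', hY', -, -⟩ := R.exists_label (t := t) (x := -S.X t) (by
    rw [D.reflect_t₀, D.reflect_x₀]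
    exact mem_rightDom_iff.1 (h.X_mem_rightDom ht))
  have hp : p < D.p₀ := hU.2.2.1.resolve_left (by simpa using ht.1.le)
  have hp' : p' < D.reflect.p₀ := hU'.2.2.1.resolve_left (by simpa using ht.1.le)
  have h1 : 0 < t - D.t₀ := sub_pos.2 ht.1
  have hs0 : 0 < √(t - D.t₀) := Real.sqrt_pos.2 h1
  have hs2 : √(t - D.t₀) ^ 2 = t - D.t₀ := Real.sq_sqrt h1.le
  have hs : √(t - D.t₀) ≤ D.s₁ :=
    Real.sqrt_le_iff.2 ⟨D.s₁_pos.le, by linarith [ht.2]⟩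
  have e1 : D.p₀ + (p - D.p₀) = p := by ring
  have e2 : D.reflect.p₀ + (p' - D.reflect.p₀) = p' := by ring
  have e3 : D.t₀ + √(t - D.t₀) ^ 2 = t := by rw [hs2]; ring
  set y := S.X t - D.x₀ - D.v₀ * (t - D.t₀) with hy
  have e4 : D.x₀ + D.v₀ * √(t - D.t₀) ^ 2 + y = S.X t := by rw [hs2, hy]; ring
  have a1 : -D.δ < p - D.p₀ := by linarith [hU.1.1]
  have a2 : -D.δ < p' - D.reflect.p₀ := by
    have : D.reflect.p₀ - D.δ < p' := hU'.1.1
    linarith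
  have a3 : D.Y (D.t₀ + √(t - D.t₀) ^ 2, D.p₀ + (p - D.p₀)) =
      D.x₀ + D.v₀ * √(t - D.t₀) ^ 2 + y := by rw [e1, e3, e4, hY]
  have a4 : D.reflect.Y (D.t₀ + √(t - D.t₀) ^ 2, D.reflect.p₀ + (p' - D.reflect.p₀)) =
      -(D.x₀ + D.v₀ * √(t - D.t₀) ^ 2 + y) := by rw [e2, e3, e4, hY']
  have a5 : D.reflect.Y (D.reflect.t₀ + √(t - D.t₀) ^ 2, D.reflect.p₀ + (p' - D.reflect.p₀)) =
      D.reflect.x₀ + D.reflect.v₀ * √(t - D.t₀) ^ 2 + -y := by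
    rw [D.reflect_t₀, D.reflect_x₀, D.reflect_v₀, a4]; ring
  have a6 : D.reflect.reflect.Y (D.reflect.t₀ + √(t - D.t₀) ^ 2,
      D.reflect.reflect.p₀ + (p - D.p₀)) =
      -(D.reflect.x₀ + D.reflect.v₀ * √(t - D.t₀) ^ 2 + -y) := by
    rw [D.reflect_reflect, D.reflect_t₀, D.reflect_x₀, D.reflect_v₀, a3]; ring
  refine ⟨p - D.p₀, p' - D.reflect.p₀, by rwa [e1], by rwa [e1], by rwa [e2], by rwa [e2],
    D.apriori hs0 hs a1 (by linarith) a2 (by linarith) a3 a4, by linarith,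
    D.reflect.apriori hs0 hs a2 (by linarith) a1 (by linarith) a5 a6, by linarith, abs_le.2 ⟨?_, ?_⟩⟩
  · have := D.reflect.apriori_y hs0 hs a2 (by linarith) a1 (by linarith) a5 a6
    change -y ≤ D.κ * D.r ^ 2 * √(t - D.t₀) ^ 2 at this
    linarith
  · exact D.apriori_y hs0 hs a1 (by linarith) a2 (by linarith) a3 a4

theorem label_X_eq {D : CuspDatum} {t ξ x : ℝ} (hU : (t, D.p₀ + ξ) ∈ D.U) (hY : D.Y (t, D.p₀ + ξ) = x) :
    D.label (t, x) - D.p₀ = ξ := by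
  rw [← hY, D.label_Y hU, add_sub_cancel_left]

theorem hasDerivAt_X (h : S.IsDeltaShockSolution p₀ μ ρ₀ u₀ α₁ β₂ D.t₀ D.x₀ T w₀ D.v₀) {t : ℝ}
    (ht : t ∈ Ioo D.t₀ (D.t₀ + T)) : HasDerivAt S.X (S.v t) t :=
  (h.X_speed t (Ioo_subset_Ico_self ht)).hasDerivAt (Ico_mem_nhds ht.1 ht.2)

/-- The mass and the momentum at the discontinuity are those given by the labels. -/
theorem mass_momentum (h : S.IsDeltaShockSolution p₀ μ ρ₀ u₀ α₁ β₂ D.t₀ D.x₀ T w₀ D.v₀)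
    (hD : D.Fits μ ρ₀ u₀ α₁ β₂ p₁ q₂) (hμ : 0 < μ) (hT : 0 < T) (hTs : T ≤ D.s₁ ^ 2) {t : ℝ}
    (ht : t ∈ Ioo D.t₀ (D.t₀ + T)) :
    S.w t * √(1 + S.v t ^ 2) = D.massAt μ (w₀ * √(1 + D.v₀ ^ 2)) t (S.X t) ∧
    S.w t * √(1 + S.v t ^ 2) * (S.v t - D.v₀) = D.momentumAt μ t (S.X t) := by
  have hr := D.r_pos
  have hκ := D.κ_pos
  have hab : D.t₀ < D.t₀ + T := by linarith
  have hev : ∀ᶠ t in 𝓝[>] D.t₀, t ∈ Ioo D.t₀ (D.t₀ + T) := Ioo_mem_nhdsGT hab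
  have hsq : ∀ n : ℕ, n ≠ 0 → ∀ C : ℝ, Tendsto (fun t => C * √(t - D.t₀) ^ n) (𝓝[>] D.t₀) (𝓝 0) := by
    intro n hn C
    have : Tendsto (fun x : ℝ => C * √(x - D.t₀) ^ n) (𝓝 D.t₀) (𝓝 (C * √(D.t₀ - D.t₀) ^ n)) :=
      (by fun_prop : Continuous fun x : ℝ => C * √(x - D.t₀) ^ n).tendsto D.t₀
    rw [sub_self, Real.sqrt_zero, zero_pow hn, mul_zero] at this
    exact this.mono_left nhdsWithin_le_nhds
  have hs : ∀ t ∈ Ioo D.t₀ (D.t₀ + T), 0 < √(t - D.t₀) ∧ √(t - D.t₀) ≤ D.s₁ ∧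
      √(t - D.t₀) ^ 2 = t - D.t₀ := fun t ht =>
    ⟨Real.sqrt_pos.2 (sub_pos.2 ht.1),
      Real.sqrt_le_iff.2 ⟨D.s₁_pos.le, by linarith [ht.2]⟩, Real.sq_sqrt (sub_pos.2 ht.1).le⟩
  have hv := tendsto_nhdsGT_of_continuousOn_Ico hab h.v_cont
  have hw := tendsto_nhdsGT_of_continuousOn_Ico hab h.w_cont
  rw [h.v_start] at hv
  rw [h.w_start] at hw
  have hm : Tendsto (fun t => S.w t * √(1 + S.v t ^ 2)) (𝓝[>] D.t₀) (𝓝 (w₀ * √(1 + D.v₀ ^ 2))) :=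
    hw.mul ((hv.pow 2).const_add 1).sqrt
  set m₀ := w₀ * √(1 + D.v₀ ^ 2)
  -- both sides have the same derivative by the Rankine–Hugoniot conditions, so that it suffices to
  -- compare their limits at the time `t₀`
  have hmass : Tendsto (fun t => D.massAt μ m₀ t (S.X t)) (𝓝[>] D.t₀) (𝓝 m₀) := by
    rw [tendsto_iff_norm_sub_tendsto_zero]
    refine squeeze_zero' (Eventually.of_forall fun _ => norm_nonneg _) ?_
      (hsq 1 one_ne_zero (16 * μ * D.r))
    filter_upwards [hev] with t ht
    obtain ⟨ξ, ξ', a1, a2, a3, a4, a5, a6, a7, a8, -⟩ := h.labels_X hD hμ hT hTs ht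
    obtain ⟨b1, b2, b3⟩ := hs t ht
    have b4 := (D.le_s₁ b2 b1).1
    rw [CuspDatum.massAt, label_X_eq a1 a2, label_X_eq a3 a4, sub_sub_cancel_left, norm_neg,
      Real.norm_eq_abs, abs_mul, abs_of_pos (by positivity : 0 < 2 * μ), pow_one]
    have : |ξ' + ξ + (t - D.t₀)| ≤ 8 * D.r * √(t - D.t₀) := by
      rw [abs_le]; constructor <;> nlinarith
    nlinarith
  have hmom : Tendsto (fun t => D.momentumAt μ t (S.X t)) (𝓝[>] D.t₀) (𝓝 0) := by
    refine squeeze_zero_norm' ?_ (hsq 2 two_ne_zero (130 * μ * D.κ * D.r ^ 2))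
    filter_upwards [hev] with t ht
    obtain ⟨ξ, ξ', a1, a2, a3, a4, a5, a6, a7, a8, a9⟩ := h.labels_X hD hμ hT hTs ht
    obtain ⟨b1, b2, b3⟩ := hs t ht
    rw [CuspDatum.momentumAt, label_X_eq a1 a2, label_X_eq a3 a4, Real.norm_eq_abs]
    have := D.abs_momentum_le (y := S.X t - D.x₀ - D.v₀ * (t - D.t₀)) hμ b1 b2 a5 a7 a6 a8 a9
    rwa [b3] at this ⊢
  have hjump : ∀ t ∈ Ioo D.t₀ (D.t₀ + T), S.ρm (t, S.X t) = D.rho μ (t, S.X t) ∧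
      S.um (t, S.X t) = D.vel (t, S.X t) ∧ S.ρp (t, S.X t) = D.rhoRight μ (t, S.X t) ∧
      S.up (t, S.X t) = D.velRight (t, S.X t) := fun t ht =>
    ⟨(h.left_eq hD hμ hT).1 (h.X_mem_leftDom ht), (h.left_eq hD hμ hT).2 (h.X_mem_leftDom ht),
      (h.right_eq hD hμ hT).1 (h.X_mem_rightDom ht), (h.right_eq hD hμ hT).2 (h.X_mem_rightDom ht)⟩
  have h1 := eq_zero_of_hasDerivAt_zero
    (f := fun t => S.w t * √(1 + S.v t ^ 2) - D.massAt μ m₀ t (S.X t)) (fun t ht => by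
      obtain ⟨ξ, ξ', a1, a2, a3, a4, -⟩ := h.labels_X hD hμ hT hTs ht
      refine ((h.rankine_mass t ht).sub
        (D.hasDerivAt_massAt a1 a2 a3 a4 (h.hasDerivAt_X ht))).congr_deriv ?_
      simp only [jump]
      rw [(hjump t ht).1, (hjump t ht).2.1, (hjump t ht).2.2.1, (hjump t ht).2.2.2, sub_self])
    (by simpa using hm.sub hmass) ht
  have h2 := eq_zero_of_hasDerivAt_zero
    (f := fun t => S.w t * S.v t * √(1 + S.v t ^ 2) - D.v₀ * (S.w t * √(1 + S.v t ^ 2)) -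
      D.momentumAt μ t (S.X t)) (fun t ht => by
      obtain ⟨ξ, ξ', a1, a2, a3, a4, -⟩ := h.labels_X hD hμ hT hTs ht
      refine (((h.rankine_momentum t ht).sub ((h.rankine_mass t ht).const_mul D.v₀)).sub
        (D.hasDerivAt_momentumAt (p₀ := p₀) a1 a2 a3 a4 (h.hasDerivAt_X ht))).congr_deriv ?_
      simp only [jump]
      rw [(hjump t ht).1, (hjump t ht).2.1, (hjump t ht).2.2.1, (hjump t ht).2.2.2, sub_self])
    (by
      have := ((hm.mul (hv.sub_const D.v₀)).sub hmom)
      rw [sub_self, mul_zero, sub_zero] at this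
      refine this.congr fun t => ?_
      ring) ht
  exact ⟨by linarith, by linarith⟩

/-- A solution moves along the path given by the equation of motion. -/
theorem X_eq_path (h : S.IsDeltaShockSolution p₀ μ ρ₀ u₀ α₁ β₂ D.t₀ D.x₀ T w₀ D.v₀)
    (hD : D.Fits μ ρ₀ u₀ α₁ β₂ p₁ q₂) (hT : 0 < T) {σ : ℝ} {y : ℝ → ℝ} (hσ : 0 < σ)
    (hTσ : T ≤ σ ^ 2) (hy : D.IsPath μ (w₀ * √(1 + D.v₀ ^ 2)) σ y)
    (huniq : ∀ z : ℝ → ℝ, ∀ σ' ≤ σ, z 0 = 0 → (∀ s ∈ Ioo 0 σ', |z s| ≤ D.θ * s ^ 3) →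
        (∀ s ∈ Ioo 0 σ', HasDerivAt z (2 * s * D.drift μ (w₀ * √(1 + D.v₀ ^ 2)) s (z s)) s) →
          EqOn z y (Ico 0 σ')) :
    EqOn S.X (D.pathX y) (Ico D.t₀ (D.t₀ + T)) ∧
      EqOn S.v (D.pathV μ (w₀ * √(1 + D.v₀ ^ 2)) y) (Ico D.t₀ (D.t₀ + T)) ∧
      ∀ t ∈ Ico D.t₀ (D.t₀ + T),
        S.w t * √(1 + S.v t ^ 2) = D.pathM μ (w₀ * √(1 + D.v₀ ^ 2)) y t := by
  have hμ := hy.μ_pos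
  have hm := hy.m₀_ne
  set m₀ := w₀ * √(1 + D.v₀ ^ 2) with hm₀
  have hm0 := abs_pos.2 hm
  have hσ1 := D.le_s₂ hμ hm hy.σ_le
  have hTs : T ≤ D.s₁ ^ 2 := hTσ.trans (pow_le_pow_left₀ hσ.le hσ1.1 2)
  set C := D.driftConst μ m₀ with hC
  have hCpos : 0 < C := D.driftConst_pos hμ hm
  have hs : ∀ t ∈ Ioo D.t₀ (D.t₀ + T), 0 < √(t - D.t₀) ∧ √(t - D.t₀) < √T ∧
      √(t - D.t₀) ^ 2 = t - D.t₀ := fun t ht =>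
    ⟨Real.sqrt_pos.2 (sub_pos.2 ht.1), Real.sqrt_lt_sqrt (sub_pos.2 ht.1).le (by linarith [ht.2]),
      Real.sq_sqrt (sub_pos.2 ht.1).le⟩
  have hTσ' : √T ≤ σ := Real.sqrt_le_iff.2 ⟨hσ.le, hTσ⟩
  have hT2 : √T ^ 2 = T := Real.sq_sqrt hT.le
  -- the mass stays away from zero, which bounds the velocity
  have hmne : ∀ t ∈ Ioo D.t₀ (D.t₀ + T), |m₀| / 2 ≤ |D.massAt μ m₀ t (S.X t)| ∧
      |S.v t - D.v₀| ≤ C * (t - D.t₀) := by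
    intro t ht
    obtain ⟨b1, b2, b3⟩ := hs t ht
    obtain ⟨b4, b5, -⟩ := D.le_s₂ hμ hm ((b2.le.trans hTσ').trans hy.σ_le)
    obtain ⟨ξ, ξ', a1, a2, a3, a4, a5, a6, a7, a8, a9⟩ := h.labels_X hD hμ hT hTs ht
    have k1 := D.le_abs_mass hμ b1 b4 b5 a5 a7 a6 a8
    have k2 := D.abs_momentum_le (y := S.X t - D.x₀ - D.v₀ * (t - D.t₀)) hμ b1 b4 a5 a7 a6 a8 a9
    rw [b3] at k1
    have k3 : D.massAt μ m₀ t (S.X t) = m₀ - 2 * μ * (ξ' + ξ + (t - D.t₀)) := by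
      rw [CuspDatum.massAt, label_X_eq a1 a2, label_X_eq a3 a4]
    have k4 : |D.momentumAt μ t (S.X t)| ≤ 130 * μ * D.κ * D.r ^ 2 * √(t - D.t₀) ^ 2 := by
      rw [CuspDatum.momentumAt, label_X_eq a1 a2, label_X_eq a3 a4]
      rwa [b3] at k2 ⊢
    rw [← k3] at k1
    obtain ⟨j1, j2⟩ := h.mass_momentum hD hμ hT hTs ht
    rw [j1] at j2
    refine ⟨k1, ?_⟩
    have hne : D.massAt μ m₀ t (S.X t) ≠ 0 := abs_pos.1 (by linarith)
    have k5 : S.v t - D.v₀ = D.momentumAt μ t (S.X t) / D.massAt μ m₀ t (S.X t) :=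
      eq_div_of_mul_eq hne (by rw [mul_comm]; exact j2)
    rw [k5, ← b3]
    exact D.quotient_le hm k4 k1
  -- hence the path stays in the cone
  have hcone : ∀ t ∈ Ico D.t₀ (D.t₀ + T), |S.X t - D.x₀ - D.v₀ * (t - D.t₀)| ≤
      C * (t - D.t₀) ^ 2 := by
    intro t ht
    have hd : ∀ r ∈ Icc D.t₀ t, HasDerivWithinAt (fun t => S.X t - D.x₀ - D.v₀ * (t - D.t₀))
        (S.v r - D.v₀) (Icc D.t₀ t) r := by
      intro r hr
      have k := (h.X_speed r ⟨hr.1, hr.2.trans_lt ht.2⟩).mono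
        (show Icc D.t₀ t ⊆ Ico D.t₀ (D.t₀ + T) from fun r hr => ⟨hr.1, hr.2.trans_lt ht.2⟩)
      exact ((k.sub_const D.x₀).sub (((hasDerivWithinAt_id r _).sub_const D.t₀).const_mul
        D.v₀)).congr_deriv (by ring)
    have := image_norm_le_of_norm_deriv_right_le_deriv_boundary
      (f := fun t => S.X t - D.x₀ - D.v₀ * (t - D.t₀)) (a := D.t₀) (b := t)
      (f' := fun r => S.v r - D.v₀) (B := fun r => C * (r - D.t₀) ^ 2)
      (B' := fun r => C * (2 * (r - D.t₀)))
      (fun r hr => (hd r hr).continuousWithinAt)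
      (fun r hr => (hd r (Ico_subset_Icc_self hr)).mono_of_mem_nhdsWithin
        (Icc_mem_nhdsGE_of_mem hr))
      (by simp [h.X_start])
      (fun r => ((((hasDerivAt_id r).sub_const D.t₀).pow 2).const_mul C).congr_deriv (by simp))
      (fun r hr => by
        rw [Real.norm_eq_abs]
        rcases hr.1.eq_or_lt with rfl | hr0
        · simp [h.v_start]
        · have := (hmne r ⟨hr0, hr.2.trans ht.2⟩).2
          have := mul_pos hCpos (sub_pos.2 hr0)
          linarith) (right_mem_Icc.2 ht.1)
    exact this
  -- in the variable `s`, the deviation from the tangent solves the equation of motion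
  have hz := huniq (fun s => S.X (D.t₀ + s ^ 2) - D.x₀ - D.v₀ * s ^ 2) √T hTσ'
    (by simp [h.X_start]) (fun s hs' => by
      have hmem : D.t₀ + s ^ 2 ∈ Ico D.t₀ (D.t₀ + T) :=
        ⟨by nlinarith [hs'.1], by
          have := pow_lt_pow_left₀ hs'.2 hs'.1.le two_ne_zero
          linarith⟩
      have k := hcone _ hmem
      rw [add_sub_cancel_left] at k
      refine k.trans ?_
      have h3 := (D.le_s₂ hμ hm ((hs'.2.le.trans hTσ').trans hy.σ_le)).2.2
      have := mul_le_mul_of_nonneg_right h3 (pow_nonneg hs'.1.le 3)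
      nlinarith) (fun s hs' => by
      have hmem : D.t₀ + s ^ 2 ∈ Ioo D.t₀ (D.t₀ + T) :=
        ⟨by nlinarith [hs'.1], by
          have := pow_lt_pow_left₀ hs'.2 hs'.1.le two_ne_zero
          linarith⟩
      have k1 := (h.hasDerivAt_X hmem).comp s (((hasDerivAt_id s).pow 2).const_add D.t₀)
      have k2 := (k1.sub_const D.x₀).sub (((hasDerivAt_id s).pow 2).const_mul D.v₀)
      refine k2.congr_deriv ?_
      obtain ⟨j1, j2⟩ := h.mass_momentum hD hμ hT hTs hmem
      have e : S.X (D.t₀ + s ^ 2) =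
          D.x₀ + D.v₀ * s ^ 2 + (S.X (D.t₀ + s ^ 2) - D.x₀ - D.v₀ * s ^ 2) := by ring
      have hne := (hmne _ hmem).1
      rw [j1] at j2
      rw [e, D.massAt_cusp] at hne
      rw [show D.momentumAt μ (D.t₀ + s ^ 2) (S.X (D.t₀ + s ^ 2)) =
        D.momentumAt μ (D.t₀ + s ^ 2) (D.x₀ + D.v₀ * s ^ 2 +
          (S.X (D.t₀ + s ^ 2) - D.x₀ - D.v₀ * s ^ 2)) by rw [← e], D.momentumAt_cusp,
        show D.massAt μ m₀ (D.t₀ + s ^ 2) (S.X (D.t₀ + s ^ 2)) =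
        D.massAt μ m₀ (D.t₀ + s ^ 2) (D.x₀ + D.v₀ * s ^ 2 +
          (S.X (D.t₀ + s ^ 2) - D.x₀ - D.v₀ * s ^ 2)) by rw [← e], D.massAt_cusp] at j2
      have hne' := abs_pos.1 (show 0 < |D.shockMass μ m₀ s
        (S.X (D.t₀ + s ^ 2) - D.x₀ - D.v₀ * s ^ 2)| by linarith)
      rw [CuspDatum.drift, ← j2, mul_div_cancel_left₀ _ hne']
      simp only [id]
      push_cast
      ring)
  have hX : EqOn S.X (D.pathX y) (Ico D.t₀ (D.t₀ + T)) := by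
    intro t ht
    rcases ht.1.eq_or_lt with rfl | h0
    · rw [h.X_start, hy.pathX_t₀]
    · obtain ⟨b1, b2, b3⟩ := hs t ⟨h0, ht.2⟩
      have := hz ⟨b1.le, b2⟩
      simp only [b3, add_sub_cancel] at this
      rw [CuspDatum.pathX, ← this]; ring
  have hsub : ∀ t ∈ Ioo D.t₀ (D.t₀ + T), t ∈ Ioo D.t₀ (D.t₀ + σ ^ 2) := fun t ht =>
    ⟨ht.1, by linarith [ht.2]⟩
  refine ⟨hX, fun t ht => ?_, fun t ht => ?_⟩
  · rcases ht.1.eq_or_lt with rfl | h0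
    · rw [h.v_start, CuspDatum.pathV, if_pos le_rfl]
    · have ht' : t ∈ Ioo D.t₀ (D.t₀ + T) := ⟨h0, ht.2⟩
      refine ((h.hasDerivAt_X ht').congr_of_eventuallyEq ?_).unique
        (hy.hasDerivAt_pathX hσ (hsub t ht'))
      filter_upwards [Ioo_mem_nhds h0 ht.2] with s hs' using (hX (Ioo_subset_Ico_self hs')).symm
  · rcases ht.1.eq_or_lt with rfl | h0
    · rw [h.v_start, h.w_start, CuspDatum.pathM, if_pos le_rfl]
    · rw [CuspDatum.pathM, if_neg (not_le.2 h0), ← hX ht]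
      exact (h.mass_momentum hD hμ hT hTs ⟨h0, ht.2⟩).1

end Profile.IsDeltaShockSolution

theorem leftDom_congr {S S' : Profile} {t₀ x₀ T : ℝ}
    (ha : EqOn S.a S'.a (Ico 0 (t₀ + T)))
    (hb : EqOn S.b S'.b (Ico 0 (t₀ + T))) (hX : EqOn S.X S'.X (Ico t₀ (t₀ + T))) :
    S.leftDom t₀ x₀ T = S'.leftDom t₀ x₀ T ∧ S.rightDom t₀ x₀ T = S'.rightDom t₀ x₀ T := by
  constructor <;> ext ⟨t, x⟩
  all_goals
    simp only [Profile.leftDom, Profile.rightDom, mem_ofPred_eq]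
    refine and_congr_right fun h1 => and_congr_right fun h2 => ?_
    rw [ha ⟨h1, h2⟩, hb ⟨h1, h2⟩]
    refine and_congr_right fun _ => and_congr_right fun _ => and_congr_left fun _ => ?_
    exact forall_congr' fun h3 => by rw [hX ⟨h3, h2⟩]

/-- Existence and uniqueness for data in characteristic coordinates. -/
theorem CuspDatum.Fits.exists_solution (hD : D.Fits μ ρ₀ u₀ α₁ β₂ p₁ q₂) (hμ : 0 < μ)
    (hw₀ : w₀ ≠ 0) : ∃ T > 0, ∃ S : Profile,
      S.IsDeltaShockSolution p₀ μ ρ₀ u₀ α₁ β₂ D.t₀ D.x₀ T w₀ D.v₀ ∧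
      ∀ T' ∈ Ioc 0 T, ∀ S' : Profile,
        S'.IsDeltaShockSolution p₀ μ ρ₀ u₀ α₁ β₂ D.t₀ D.x₀ T' w₀ D.v₀ →
        S.SameUntil S' D.t₀ D.x₀ T' := by
  have hsqrt : ∀ v : ℝ, √(1 + v ^ 2) ≠ 0 := fun v => (Real.sqrt_pos.2 (by positivity)).ne'
  have hm : w₀ * √(1 + D.v₀ ^ 2) ≠ 0 := mul_ne_zero hw₀ (hsqrt _)
  obtain ⟨y, hy0, hy, hyb, huniq⟩ := D.exists_path hμ hm
  have hr := D.r_pos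
  have k1 := sub_pos.2 hD.p₁_mem.2
  have k2 := sub_pos.2 hD.q₂_mem.1
  have k3 := D.s₂_pos hμ hm
  -- the labels at the discontinuity, within `4 r σ` of the cusp, must not leave `[p₁, q₂]`
  set σ := min (D.s₂ μ (w₀ * √(1 + D.v₀ ^ 2))) (min ((D.p₀ - p₁) / (4 * D.r))
    ((q₂ - D.q₀) / (4 * D.r))) with hσ
  have hσpos : 0 < σ := by rw [hσ]; positivity
  have hσ1 : σ ≤ D.s₂ μ (w₀ * √(1 + D.v₀ ^ 2)) := min_le_left _ _
  have hσ2 : 4 * D.r * σ ≤ D.p₀ - p₁ := by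
    have : σ ≤ (D.p₀ - p₁) / (4 * D.r) := (min_le_right _ _).trans (min_le_left _ _)
    rw [le_div_iff₀ (by positivity)] at this
    linarith
  have hσ3 : 4 * D.r * σ ≤ q₂ - D.q₀ := by
    have : σ ≤ (q₂ - D.q₀) / (4 * D.r) := (min_le_right _ _).trans (min_le_right _ _)
    rw [le_div_iff₀ (by positivity)] at this
    linarith
  have hpath : D.IsPath μ (w₀ * √(1 + D.v₀ ^ 2)) σ y :=
    { μ_pos := hμ
      m₀_ne := hm
      σ_le := hσ1
      y_zero := hy0
      y_deriv := fun s hs => (hy s ⟨hs.1.le, hs.2.le.trans hσ1⟩).hasDerivAt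
        (Icc_mem_nhds hs.1 (hs.2.trans_le hσ1))
      y_bound := fun s hs => hyb s ⟨hs.1, hs.2.le.trans hσ1⟩ }
  have hS := CuspDatum.isDeltaShockSolution (p₀ := p₀) hD hpath hσpos hσ2 hσ3
  refine ⟨σ ^ 2, by positivity, _, hS, fun T' hT' S' hS' => ?_⟩
  set S := D.profile μ (w₀ * √(1 + D.v₀ ^ 2)) p₁ q₂ y
  obtain ⟨j1, j2, j3⟩ := hS'.X_eq_path hD hT'.1 hσpos hT'.2 hpath
    (fun z σ' hσ' => huniq z σ' (hσ'.trans hσ1))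
  have L := hS'.leftState hD hμ hT'.1
  have R := hS'.rightState hD hμ hT'.1
  have ha : EqOn S.a S'.a (Ico 0 (D.t₀ + T')) := fun t ht => (L.a_eq ht).symm
  have hb : EqOn S.b S'.b (Ico 0 (D.t₀ + T')) := fun t ht => by
    have := R.a_eq (t := t) (by rwa [D.reflect_t₀])
    change -D.reflect.Y (t, -q₂) = _
    linarith
  have hX : EqOn S.X S'.X (Ico D.t₀ (D.t₀ + T')) := j1.symm
  obtain ⟨e1, e2⟩ := leftDom_congr (x₀ := D.x₀) ha hb hX
  refine ⟨ha, hb, hX, fun t ht => ?_, j2.symm, ?_, ?_, ?_, ?_⟩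
  · change D.pathM _ _ _ _ / √(1 + D.pathV _ _ _ _ ^ 2) = _
    rw [← j3 t ht, ← j2 ht, mul_div_cancel_right₀ _ (hsqrt _)]
  · rw [e1]; exact (hS'.left_eq hD hμ hT'.1).1.symm
  · rw [e1]; exact (hS'.left_eq hD hμ hT'.1).2.symm
  · rw [e2]; exact (hS'.right_eq hD hμ hT'.1).1.symm
  · rw [e2]; exact (hS'.right_eq hD hμ hT'.1).2.symm

end Uniqueness

end Chaplygin

namespace Chaplygin

/-! ### Conservation laws with a concentrated amount -/

/-- The quantity equal to `F` on the left of the discontinuity and before the time `t₀`, and to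
`F'` on its right. -/
noncomputable def Profile.glue (S : Profile) (t₀ : ℝ) (F F' : ℝ × ℝ → ℝ) (P : ℝ × ℝ) : ℝ :=
  open Classical in if P.1 < t₀ ∨ P.2 < S.X P.1 then F P else F' P

/-- A scalar conservation law `F_t + G_x = 0` with one discontinuity `x = X t`, which carries the
amount `M t` of the conserved quantity. The states on its two sides are `(F, G)` and `(F', G')`;
nothing is required of them at the starting point `(t₀, x₀)` of the discontinuity. -/
structure ConcentratedLaw (S : Profile) (t₀ x₀ T : ℝ) (F G F' G' : ℝ × ℝ → ℝ) (M : ℝ → ℝ) :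
    Prop where
  a_diff : ∀ t ∈ Ioo 0 (t₀ + T), DifferentiableAt ℝ S.a t
  b_diff : ∀ t ∈ Ioo 0 (t₀ + T), DifferentiableAt ℝ S.b t
  a_lt_b : ∀ t ∈ Ico 0 t₀, S.a t < S.b t
  a_lt_X : ∀ t ∈ Ico t₀ (t₀ + T), S.a t < S.X t
  X_lt_b : ∀ t ∈ Ico t₀ (t₀ + T), S.X t < S.b t
  X_start : S.X t₀ = x₀
  X_cont : ContinuousOn S.X (Ico t₀ (t₀ + T))
  X_speed : ∀ t ∈ Ioo t₀ (t₀ + T), HasDerivAt S.X (S.v t) t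
  v_cont : ContinuousOn S.v (Ico t₀ (t₀ + T))
  M_cont : ContinuousOn M (Ico t₀ (t₀ + T))
  F_cont : ContinuousOn F (S.leftDom t₀ x₀ T)
  G_cont : ContinuousOn G (S.leftDom t₀ x₀ T)
  F'_cont : ContinuousOn F' (S.rightDom t₀ x₀ T)
  G'_cont : ContinuousOn G' (S.rightDom t₀ x₀ T)
  law_left : ∀ P ∈ S.leftInt t₀ T, ∃ A B C D,
    HasFDerivAt F (gradForm A B) P ∧ HasFDerivAt G (gradForm C D) P ∧ A + D = 0
  law_right : ∀ P ∈ S.rightInt t₀ T, ∃ A B C D,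
    HasFDerivAt F' (gradForm A B) P ∧ HasFDerivAt G' (gradForm C D) P ∧ A + D = 0
  match_F : ∀ t ∈ Ico 0 t₀, ∀ x ∈ Icc (S.a t) (S.b t), F (t, x) = F' (t, x)
  match_G : ∀ t ∈ Ico 0 t₀, ∀ x ∈ Icc (S.a t) (S.b t), G (t, x) = G' (t, x)
  balance : ∀ t ∈ Ioo t₀ (t₀ + T), HasDerivAt M
    (S.v t * (F' (t, S.X t) - F (t, S.X t)) - (G' (t, S.X t) - G (t, S.X t))) t

/-- Multiplication by a function that vanishes near `O` removes a singularity at `O`. -/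
theorem continuousOn_mul_of_notMem_tsupport {F ψ : ℝ × ℝ → ℝ} {O : ℝ × ℝ} {R : Set (ℝ × ℝ)}
    (hF : ContinuousOn F (R \ {O})) (hψ : Continuous ψ) (hO : O ∉ tsupport ψ) :
    ContinuousOn (fun P => F P * ψ P) R := by
  intro P hP
  by_cases h : P = O
  · subst h
    have e : (fun P => F P * ψ P) =ᶠ[𝓝 P] fun _ => 0 := by
      filter_upwards [notMem_tsupport_iff_eventuallyEq.1 hO] with Q hQ
      simp [hQ]
    exact (continuousAt_const.congr e.symm).continuousWithinAt
  · refine ((hF P ⟨hP, h⟩).mono_of_mem_nhdsWithin ?_).mul hψ.continuousWithinAt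
    exact inter_mem self_mem_nhdsWithin
      (mem_nhdsWithin_of_mem_nhds (isOpen_compl_singleton.mem_nhds h))

/-- The closed region between two curves over a time interval. -/
def between (a c : ℝ → ℝ) (t₁ t₂ : ℝ) : Set (ℝ × ℝ) :=
  {P | P.1 ∈ Icc t₁ t₂ ∧ a P.1 ≤ P.2 ∧ P.2 ≤ c P.1}

theorem isClosed_between {a c : ℝ → ℝ} {t₁ t₂ : ℝ} (ha : ContinuousOn a (Icc t₁ t₂))
    (hc : ContinuousOn c (Icc t₁ t₂)) : IsClosed (between a c t₁ t₂) := by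
  have h0 : IsClosed {P : ℝ × ℝ | P.1 ∈ Icc t₁ t₂} := isClosed_Icc.preimage continuous_fst
  have h1 := h0.isClosed_le (ha.comp continuousOn_fst fun P hP => hP) continuousOn_snd
  have h2 := h0.isClosed_le continuousOn_snd (hc.comp continuousOn_fst fun P hP => hP)
  convert! h1.inter h2 using 1
  ext P
  simp only [between, mem_ofPred_eq, mem_inter_iff, Function.comp]
  tauto

namespace ConcentratedLaw

variable {S : Profile} {t₀ x₀ T : ℝ} {F G F' G' : ℝ × ℝ → ℝ} {M : ℝ → ℝ}

theorem a_cont (h : ConcentratedLaw S t₀ x₀ T F G F' G' M) :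
    ContinuousOn S.a (Ioo 0 (t₀ + T)) :=
  fun t ht => (h.a_diff t ht).continuousAt.continuousWithinAt

theorem b_cont (h : ConcentratedLaw S t₀ x₀ T F G F' G' M) :
    ContinuousOn S.b (Ioo 0 (t₀ + T)) :=
  fun t ht => (h.b_diff t ht).continuousAt.continuousWithinAt

theorem between_left_subset (ht₀ : 0 < t₀) {t₂ : ℝ} (ht₂ : t₂ < t₀ + T) :
    between S.a S.X t₀ t₂ \ {(t₀, x₀)} ⊆ S.leftDom t₀ x₀ T := by
  rintro P ⟨⟨h1, h2, h3⟩, h4⟩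
  exact ⟨ht₀.le.trans h1.1, h1.2.trans_lt ht₂, h2, fun h => absurd h1.1 h.not_ge, fun _ => h3, h4⟩

theorem between_right_subset (ht₀ : 0 < t₀) {t₂ : ℝ} (ht₂ : t₂ < t₀ + T) :
    between S.X S.b t₀ t₂ \ {(t₀, x₀)} ⊆ S.rightDom t₀ x₀ T := by
  rintro P ⟨⟨h1, h2, h3⟩, h4⟩
  exact ⟨ht₀.le.trans h1.1, h1.2.trans_lt ht₂, h3, fun h => absurd h1.1 h.not_ge, fun _ => h2, h4⟩

/-- Before the discontinuity starts, and up to that time, the glued state is continuous except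
at the starting point. -/
theorem continuousOn_glue (h : ConcentratedLaw S t₀ x₀ T F G F' G' M) (hT : 0 < T) {t₁ : ℝ}
    (ht₁ : 0 < t₁) {f f' : ℝ × ℝ → ℝ} (hf : ContinuousOn f (S.leftDom t₀ x₀ T))
    (hf' : ContinuousOn f' (S.rightDom t₀ x₀ T))
    (hm : ∀ t ∈ Ico 0 t₀, ∀ x ∈ Icc (S.a t) (S.b t), f (t, x) = f' (t, x)) :
    ContinuousOn (S.glue t₀ f f') (between S.a S.b t₁ t₀ \ {(t₀, x₀)}) := by
  set R := between S.a S.b t₁ t₀ \ {(t₀, x₀)} with hR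
  have hl : R ∩ {P | P.1 < t₀ ∨ P.2 < x₀} ⊆ S.leftDom t₀ x₀ T := by
    rintro P ⟨⟨⟨h1, h2, h3⟩, h4⟩, h5⟩
    refine ⟨ht₁.le.trans h1.1, by linarith [h1.2], h2, fun _ => h3, fun h6 => ?_, h4⟩
    have e : P.1 = t₀ := le_antisymm h1.2 h6
    rw [e, h.X_start]
    exact (h5.resolve_left h6.not_gt).le
  have hr : R ∩ {P | x₀ < P.2} ⊆ S.rightDom t₀ x₀ T := by
    rintro P ⟨⟨⟨h1, h2, h3⟩, h4⟩, h5⟩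
    refine ⟨ht₁.le.trans h1.1, by linarith [h1.2], h3, fun _ => h2, fun h6 => ?_, h4⟩
    have e : P.1 = t₀ := le_antisymm h1.2 h6
    rw [e, h.X_start]
    exact le_of_lt h5
  have ol : IsOpen {P : ℝ × ℝ | P.1 < t₀ ∨ P.2 < x₀} :=
    (isOpen_lt continuous_fst continuous_const).union (isOpen_lt continuous_snd continuous_const)
  have or : IsOpen {P : ℝ × ℝ | x₀ < P.2} := isOpen_lt continuous_const continuous_snd
  have cl : ContinuousOn (S.glue t₀ f f') (R ∩ {P | P.1 < t₀ ∨ P.2 < x₀}) := by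
    refine (hf.mono hl).congr ?_
    rintro P ⟨⟨⟨h1, h2, h3⟩, h4⟩, h5⟩
    refine if_pos ?_
    by_cases h6 : P.1 < t₀
    · exact Or.inl h6
    · have e : P.1 = t₀ := le_antisymm h1.2 (not_lt.1 h6)
      rw [e, h.X_start]
      exact Or.inr (h5.resolve_left h6)
  have cr : ContinuousOn (S.glue t₀ f f') (R ∩ {P | x₀ < P.2}) := by
    refine (hf'.mono hr).congr ?_
    rintro P ⟨⟨⟨h1, h2, h3⟩, h4⟩, h5⟩
    by_cases h6 : P.1 < t₀
    · exact (if_pos (Or.inl h6)).trans (hm P.1 ⟨ht₁.le.trans h1.1, h6⟩ P.2 ⟨h2, h3⟩)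
    · have e : P.1 = t₀ := le_antisymm h1.2 (not_lt.1 h6)
      refine if_neg ?_
      rw [e, h.X_start]
      rintro (h7 | h7)
      · exact lt_irrefl _ h7
      · exact lt_asymm h7 h5
  intro P hP
  rcases lt_or_ge x₀ P.2 with h5 | h5
  · exact (cr P ⟨hP, h5⟩).mono_of_mem_nhdsWithin
      (inter_mem_nhdsWithin _ (or.mem_nhds h5))
  · refine (cl P ⟨hP, ?_⟩).mono_of_mem_nhdsWithin (inter_mem_nhdsWithin _ (ol.mem_nhds ?_)) <;>
    · by_contra hc
      have hc' := not_or.1 hc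
      exact hP.2 (Prod.ext (le_antisymm hP.1.1.2 (not_lt.1 hc'.1))
        (le_antisymm h5 (not_lt.1 hc'.2)))

end ConcentratedLaw

/-- Leibniz rule for a conservation law tested with a smooth function. -/
theorem exists_grad_mul {F G φ : ℝ × ℝ → ℝ} {P : ℝ × ℝ} (hφ : DifferentiableAt ℝ φ P)
    (h : ∃ A B C D, HasFDerivAt F (gradForm A B) P ∧ HasFDerivAt G (gradForm C D) P ∧
      A + D = 0) :
    ∃ A B C D, HasFDerivAt (fun P => F P * φ P) (gradForm A B) P ∧
      HasFDerivAt (fun P => G P * φ P) (gradForm C D) P ∧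
      A + D = F P * fderiv ℝ φ P (1, 0) + G P * fderiv ℝ φ P (0, 1) := by
  obtain ⟨A, B, C, D, hF, hG, he⟩ := h
  have hφ' := hasFDerivAt_gradForm hφ
  refine ⟨F P * fderiv ℝ φ P (1, 0) + φ P * A, F P * fderiv ℝ φ P (0, 1) + φ P * B,
    G P * fderiv ℝ φ P (1, 0) + φ P * C, G P * fderiv ℝ φ P (0, 1) + φ P * D, ?_, ?_, ?_⟩
  · convert! hF.mul hφ' using 1
    ext <;> simp
  · convert! hG.mul hφ' using 1
    ext <;> simp
  · linear_combination φ P * he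

end Chaplygin

namespace Chaplygin

/-! ### Green's formula for a tested conservation law -/

/-- A test function for the distributional form of the system, whose support lies in the time
interval `(t₁, t₂)`. -/
structure IsTestOn (S : Profile) (t₀ x₀ T t₁ t₂ : ℝ) (φ : ℝ × ℝ → ℝ) : Prop where
  smooth : ContDiff ℝ 1 φ
  compact : HasCompactSupport φ
  support : tsupport φ ⊆ S.openDom t₀ T \ {(t₀, x₀)}
  time : ∀ P ∈ tsupport φ, t₁ < P.1 ∧ P.1 < t₂
  pos : 0 < t₁
  lt_start : t₁ < t₀
  start_lt : t₀ < t₂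
  lt_end : t₂ < t₀ + T

namespace IsTestOn

variable {S : Profile} {t₀ x₀ T t₁ t₂ : ℝ} {φ : ℝ × ℝ → ℝ}

theorem notMem_start (hφ : IsTestOn S t₀ x₀ T t₁ t₂ φ) : (t₀, x₀) ∉ tsupport φ :=
  fun h => (hφ.support h).2 rfl

theorem eq_zero (hφ : IsTestOn S t₀ x₀ T t₁ t₂ φ) {P : ℝ × ℝ}
    (hP : ¬(S.a P.1 < P.2 ∧ P.2 < S.b P.1)) : φ P = 0 :=
  image_eq_zero_of_notMem_tsupport fun h => hP ⟨(hφ.support h).1.2.2.1, (hφ.support h).1.2.2.2⟩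

theorem continuous_dt (hφ : IsTestOn S t₀ x₀ T t₁ t₂ φ) :
    Continuous fun P => fderiv ℝ φ P (1, 0) :=
  (hφ.smooth.continuous_fderiv one_ne_zero).clm_apply continuous_const

theorem continuous_dx (hφ : IsTestOn S t₀ x₀ T t₁ t₂ φ) :
    Continuous fun P => fderiv ℝ φ P (0, 1) :=
  (hφ.smooth.continuous_fderiv one_ne_zero).clm_apply continuous_const

theorem eq_zero_of_time (hφ : IsTestOn S t₀ x₀ T t₁ t₂ φ) {P : ℝ × ℝ}
    (hP : P.1 ≤ t₁ ∨ t₂ ≤ P.1) : φ P = 0 :=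
  image_eq_zero_of_notMem_tsupport fun h => by
    have := hφ.time P h
    rcases hP with hP | hP <;> linarith

end IsTestOn

namespace ConcentratedLaw

variable {S : Profile} {t₀ x₀ T t₁ t₂ : ℝ} {F G F' G' φ : ℝ × ℝ → ℝ} {M : ℝ → ℝ}

/-- The density tested against `∂φ/∂t`, plus the flux tested against `∂φ/∂x`. -/
noncomputable def tested (F G φ : ℝ × ℝ → ℝ) (P : ℝ × ℝ) : ℝ :=
  F P * fderiv ℝ φ P (1, 0) + G P * fderiv ℝ φ P (0, 1)

/-- The states may be singular at the starting point of the discontinuity, where `φ` vanishes. -/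
theorem continuousOn_tested (hφ : IsTestOn S t₀ x₀ T t₁ t₂ φ) {R : Set (ℝ × ℝ)}
    (hF : ContinuousOn F (R \ {(t₀, x₀)})) (hG : ContinuousOn G (R \ {(t₀, x₀)})) :
    ContinuousOn (tested F G φ) R :=
  (continuousOn_mul_of_notMem_tsupport hF hφ.continuous_dt fun h =>
    hφ.notMem_start (tsupport_fderiv_apply_subset ℝ (1, 0) h)).add
  (continuousOn_mul_of_notMem_tsupport hG hφ.continuous_dx fun h =>
    hφ.notMem_start (tsupport_fderiv_apply_subset ℝ (0, 1) h))

/-- The tested law over the times before the start of the discontinuity. -/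
theorem integral_before (h : ConcentratedLaw S t₀ x₀ T F G F' G' M)
    (hφ : IsTestOn S t₀ x₀ T t₁ t₂ φ) :
    (∫ t in t₁..t₀, ∫ x in S.a t..S.b t, tested (S.glue t₀ F F') (S.glue t₀ G G') φ (t, x))
      = ∫ x in S.a t₀..S.b t₀, S.glue t₀ F F' (t₀, x) * φ (t₀, x) := by
  have hT : 0 < T := by linarith [hφ.start_lt, hφ.lt_end]
  have hsub : Icc t₁ t₀ ⊆ Ioo 0 (t₀ + T) := fun t ht =>
    ⟨hφ.pos.trans_le ht.1, by linarith [ht.2]⟩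
  have ha := h.a_cont.mono hsub
  have hb := h.b_cont.mono hsub
  have hab : ∀ t ∈ Icc t₁ t₀, S.a t ≤ S.b t := by
    intro t ht
    rcases ht.2.lt_or_eq with h1 | rfl
    · exact (h.a_lt_b t ⟨hφ.pos.le.trans ht.1, h1⟩).le
    · exact (h.a_lt_X t ⟨le_rfl, by linarith⟩).le.trans (h.X_lt_b t ⟨le_rfl, by linarith⟩).le
  have cF := h.continuousOn_glue hT hφ.pos h.F_cont h.F'_cont h.match_F
  have cG := h.continuousOn_glue hT hφ.pos h.G_cont h.G'_cont h.match_G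
  have hFφ := continuousOn_mul_of_notMem_tsupport cF hφ.smooth.continuous hφ.notMem_start
  have hGφ := continuousOn_mul_of_notMem_tsupport cG hφ.smooth.continuous hφ.notMem_start
  have hE := continuousOn_tested hφ cF cG
  have key : ∀ t ∈ Ioo t₁ t₀, HasDerivAt
      (fun s => ∫ x in S.a s..S.b s, S.glue t₀ F F' (s, x) * φ (s, x))
      (∫ x in S.a t..S.b t, tested (S.glue t₀ F F') (S.glue t₀ G G') φ (t, x)) t := by
    intro t ht
    have ht' := hsub (Ioo_subset_Icc_self ht)
    have hd := hasDerivAt_integral_between ha hb hab hFφ hGφ hE ?_ ht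
      (h.a_diff t ht').hasDerivAt (h.b_diff t ht').hasDerivAt
      (h.a_lt_b t ⟨ht'.1.le, ht.2⟩)
    · refine hd.congr_deriv ?_
      rw [hφ.eq_zero (P := (t, S.a t)) (by simp), hφ.eq_zero (P := (t, S.b t)) (by simp)]
      ring
    · intro s hs x hx
      have hmem : (s, x) ∈ S.leftInt t₀ T :=
        ⟨hφ.pos.trans hs.1, by linarith [hs.2], hx.1, fun _ => hx.2, fun h => absurd hs.2 h.not_gt⟩
      have ev : ∀ f f' : ℝ × ℝ → ℝ, S.glue t₀ f f' =ᶠ[𝓝 (s, x)] f := by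
        intro f f'
        filter_upwards [(isOpen_lt continuous_fst continuous_const).mem_nhds hs.2] with P hP
        exact if_pos (Or.inl hP)
      refine exists_grad_mul (hφ.smooth.differentiable one_ne_zero _) ?_
      obtain ⟨A, B, C, D, h1, h2, h3⟩ := h.law_left _ hmem
      exact ⟨A, B, C, D, h1.congr_of_eventuallyEq (ev F F'),
        h2.congr_of_eventuallyEq (ev G G'), h3⟩
  rw [intervalIntegral.integral_eq_sub_of_hasDerivAt_of_le hφ.lt_start.le
    (continuousOn_integral_between hφ.lt_start.le ha hb hab hFφ) key
    (ContinuousOn.intervalIntegrable_of_Icc hφ.lt_start.le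
      (continuousOn_integral_between hφ.lt_start.le ha hb hab hE))]
  have : (fun x => S.glue t₀ F F' (t₁, x) * φ (t₁, x)) = fun _ => 0 := by
    funext x
    rw [hφ.eq_zero_of_time (Or.inl le_rfl), mul_zero]
  rw [this]; simp

/-- The weight of the discontinuity, tested along the discontinuity. -/
theorem continuousOn_curve_term (h : ConcentratedLaw S t₀ x₀ T F G F' G' M)
    (hφ : IsTestOn S t₀ x₀ T t₁ t₂ φ) :
    ContinuousOn (fun t => M t * (fderiv ℝ φ (t, S.X t) (1, 0)
      + S.v t * fderiv ℝ φ (t, S.X t) (0, 1))) (Icc t₀ t₂) := by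
  have hsub : Icc t₀ t₂ ⊆ Ico t₀ (t₀ + T) := fun t ht => ⟨ht.1, ht.2.trans_lt hφ.lt_end⟩
  have hX := h.X_cont.mono hsub
  have hc : ContinuousOn (fun t => (t, S.X t)) (Icc t₀ t₂) := continuousOn_id.prodMk hX
  exact (h.M_cont.mono hsub).mul ((hφ.continuous_dt.comp_continuousOn hc).add
    ((h.v_cont.mono hsub).mul (hφ.continuous_dx.comp_continuousOn hc)))

/-- The tested law over the times after the start of the discontinuity. -/
theorem integral_after (h : ConcentratedLaw S t₀ x₀ T F G F' G' M)
    (hφ : IsTestOn S t₀ x₀ T t₁ t₂ φ) :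
    (∫ t in t₀..t₂, ((∫ x in S.a t..S.X t, tested F G φ (t, x))
        + (∫ x in S.X t..S.b t, tested F' G' φ (t, x))))
      + (∫ t in t₀..t₂, M t * (fderiv ℝ φ (t, S.X t) (1, 0)
        + S.v t * fderiv ℝ φ (t, S.X t) (0, 1)))
      = -((∫ x in S.a t₀..S.X t₀, F (t₀, x) * φ (t₀, x))
        + ∫ x in S.X t₀..S.b t₀, F' (t₀, x) * φ (t₀, x)) := by
  have hT : 0 < T := by linarith [hφ.start_lt, hφ.lt_end]
  have ht₀ : 0 < t₀ := hφ.pos.trans hφ.lt_start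
  have h12 := hφ.start_lt.le
  have hsub : Icc t₀ t₂ ⊆ Ioo 0 (t₀ + T) := fun t ht =>
    ⟨ht₀.trans_le ht.1, ht.2.trans_lt hφ.lt_end⟩
  have hsub' : Icc t₀ t₂ ⊆ Ico t₀ (t₀ + T) := fun t ht => ⟨ht.1, ht.2.trans_lt hφ.lt_end⟩
  have ha := h.a_cont.mono hsub
  have hb := h.b_cont.mono hsub
  have hX := h.X_cont.mono hsub'
  have haX : ∀ t ∈ Icc t₀ t₂, S.a t ≤ S.X t := fun t ht => (h.a_lt_X t (hsub' ht)).le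
  have hXb : ∀ t ∈ Icc t₀ t₂, S.X t ≤ S.b t := fun t ht => (h.X_lt_b t (hsub' ht)).le
  have sl := between_left_subset (S := S) (x₀ := x₀) ht₀ hφ.lt_end
  have sr := between_right_subset (S := S) (x₀ := x₀) ht₀ hφ.lt_end
  have hO := hφ.notMem_start
  have hc := hφ.smooth.continuous
  have cF := continuousOn_mul_of_notMem_tsupport (h.F_cont.mono sl) hc hO
  have cG := continuousOn_mul_of_notMem_tsupport (h.G_cont.mono sl) hc hO
  have cF' := continuousOn_mul_of_notMem_tsupport (h.F'_cont.mono sr) hc hO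
  have cG' := continuousOn_mul_of_notMem_tsupport (h.G'_cont.mono sr) hc hO
  have cE := continuousOn_tested hφ (h.F_cont.mono sl) (h.G_cont.mono sl)
  have cE' := continuousOn_tested hφ (h.F'_cont.mono sr) (h.G'_cont.mono sr)
  have key : ∀ t ∈ Ioo t₀ t₂, HasDerivAt
      (fun s => (∫ x in S.a s..S.X s, F (s, x) * φ (s, x))
        + (∫ x in S.X s..S.b s, F' (s, x) * φ (s, x)) + M s * φ (s, S.X s))
      ((∫ x in S.a t..S.X t, tested F G φ (t, x)) + (∫ x in S.X t..S.b t, tested F' G' φ (t, x))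
        + M t * (fderiv ℝ φ (t, S.X t) (1, 0) + S.v t * fderiv ℝ φ (t, S.X t) (0, 1))) t := by
    intro t ht
    have ht' := hsub (Ioo_subset_Icc_self ht)
    have ht'' : t ∈ Ioo t₀ (t₀ + T) := ⟨ht.1, ht'.2⟩
    have hdX := h.X_speed t ht''
    have d1 := hasDerivAt_integral_between ha hX haX cF cG cE (by
      intro s hs x hx
      refine exists_grad_mul (hφ.smooth.differentiable one_ne_zero _) (h.law_left _ ?_)
      exact ⟨ht₀.trans hs.1, hs.2.trans hφ.lt_end, hx.1, fun h => absurd hs.1 h.not_gt,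
        fun _ => hx.2⟩) ht (h.a_diff t ht').hasDerivAt hdX (h.a_lt_X t ⟨ht.1.le, ht'.2⟩)
    have d2 := hasDerivAt_integral_between hX hb hXb cF' cG' cE' (by
      intro s hs x hx
      refine exists_grad_mul (hφ.smooth.differentiable one_ne_zero _) (h.law_right _ ?_)
      exact ⟨ht₀.trans hs.1, hs.2.trans hφ.lt_end, hx.2, fun h => absurd hs.1 h.not_gt,
        fun _ => hx.1⟩) ht hdX (h.b_diff t ht').hasDerivAt (h.X_lt_b t ⟨ht.1.le, ht'.2⟩)
    have d3 := (h.balance t ht'').mul (HasFDerivAt.comp_curve (γ := fun s => s)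
      (hasFDerivAt_gradForm (hφ.smooth.differentiable one_ne_zero (t, S.X t)))
      (hasDerivAt_id t) hdX)
    refine ((d1.add d2).add d3).congr_deriv ?_
    rw [hφ.eq_zero (P := (t, S.a t)) (by simp), hφ.eq_zero (P := (t, S.b t)) (by simp)]
    ring
  have c1 := continuousOn_integral_between h12 ha hX haX cE
  have c2 := continuousOn_integral_between h12 hX hb hXb cE'
  have c3 := h.continuousOn_curve_term hφ
  have hφX : ContinuousOn (fun t => φ (t, S.X t)) (Icc t₀ t₂) :=
    hc.comp_continuousOn (continuousOn_id.prodMk hX)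
  rw [← intervalIntegral.integral_add
      ((c1.fun_add c2).intervalIntegrable_of_Icc h12) (c3.intervalIntegrable_of_Icc h12),
    intervalIntegral.integral_eq_sub_of_hasDerivAt_of_le h12
      (((continuousOn_integral_between h12 ha hX haX cF).add
        (continuousOn_integral_between h12 hX hb hXb cF')).add
        ((h.M_cont.mono hsub').mul hφX)) key
      (((c1.add c2).add c3).intervalIntegrable_of_Icc h12)]
  have e1 : φ (t₀, S.X t₀) = 0 := by
    rw [h.X_start]
    exact image_eq_zero_of_notMem_tsupport hO
  have e2 : ∀ x, φ (t₂, x) = 0 := fun x => hφ.eq_zero_of_time (Or.inr le_rfl)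
  simp [e1, e2]

end ConcentratedLaw

end Chaplygin

namespace Chaplygin

/-! ### The distributional form of a concentrated law -/

theorem Profile.glue_mul (S : Profile) (t₀ : ℝ) (f f' ψ : ℝ × ℝ → ℝ) (P : ℝ × ℝ) :
    S.glue t₀ f f' P * ψ P = S.glue t₀ (fun P => f P * ψ P) (fun P => f' P * ψ P) P := by
  unfold Profile.glue; split_ifs <;> rfl

namespace ConcentratedLaw

variable {S : Profile} {t₀ x₀ T t₁ t₂ : ℝ} {F G F' G' φ : ℝ × ℝ → ℝ} {M : ℝ → ℝ}

theorem tested_glue (P : ℝ × ℝ) : tested (S.glue t₀ F F') (S.glue t₀ G G') φ P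
    = S.glue t₀ (tested F G φ) (tested F' G' φ) P := by
  unfold tested Profile.glue; split_ifs <;> rfl

/-- After the time `t₀`, the integral of a glued quantity splits at the discontinuity. -/
theorem integral_slice_glue (h : ConcentratedLaw S t₀ x₀ T F G F' G' M) {f f' : ℝ × ℝ → ℝ}
    (h2 : t₂ < t₀ + T) (hf : ContinuousOn f (between S.a S.X t₀ t₂))
    (hf' : ContinuousOn f' (between S.X S.b t₀ t₂)) {t : ℝ} (ht : t ∈ Icc t₀ t₂) :
    ∫ x in S.a t..S.b t, S.glue t₀ f f' (t, x)
      = (∫ x in S.a t..S.X t, f (t, x)) + ∫ x in S.X t..S.b t, f' (t, x) := by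
  have hax := h.a_lt_X t ⟨ht.1, ht.2.trans_lt h2⟩
  have hxb := h.X_lt_b t ⟨ht.1, ht.2.trans_lt h2⟩
  have e1 : EqOn (fun x => S.glue t₀ f f' (t, x)) (fun x => f (t, x)) (Ioo (S.a t) (S.X t)) :=
    fun x hx => if_pos (Or.inr hx.2)
  have e2 : EqOn (fun x => S.glue t₀ f f' (t, x)) (fun x => f' (t, x)) (Ioo (S.X t) (S.b t)) :=
    fun x hx => if_neg (not_or.2 ⟨not_lt.2 ht.1, hx.1.not_gt⟩)
  have c1 : ContinuousOn (fun x => f (t, x)) (Icc (S.a t) (S.X t)) :=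
    hf.comp (by fun_prop) fun x hx => ⟨ht, hx⟩
  have c2 : ContinuousOn (fun x => f' (t, x)) (Icc (S.X t) (S.b t)) :=
    hf'.comp (by fun_prop) fun x hx => ⟨ht, hx⟩
  have i1 : IntervalIntegrable (fun x => S.glue t₀ f f' (t, x)) volume (S.a t) (S.X t) := by
    rw [intervalIntegrable_iff_integrableOn_Ioo_of_le hax.le]
    exact (c1.integrableOn_Icc.mono_set Ioo_subset_Icc_self).congr_fun e1.symm measurableSet_Ioo
  have i2 : IntervalIntegrable (fun x => S.glue t₀ f f' (t, x)) volume (S.X t) (S.b t) := by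
    rw [intervalIntegrable_iff_integrableOn_Ioo_of_le hxb.le]
    exact (c2.integrableOn_Icc.mono_set Ioo_subset_Icc_self).congr_fun e2.symm measurableSet_Ioo
  rw [← intervalIntegral.integral_add_adjacent_intervals i1 i2,
    intervalIntegral.integral_congr_Ioo_of_le hax.le e1,
    intervalIntegral.integral_congr_Ioo_of_le hxb.le e2]

/-- A glued state is integrable over the support of a test function: on each of the three pieces
of that support it agrees with a continuous function. -/
theorem integrable_glue_mul (h : ConcentratedLaw S t₀ x₀ T F G F' G' M)
    (hφ : IsTestOn S t₀ x₀ T t₁ t₂ φ) {f f' ψ : ℝ × ℝ → ℝ}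
    (hf : ContinuousOn f (S.leftDom t₀ x₀ T)) (hf' : ContinuousOn f' (S.rightDom t₀ x₀ T))
    (hm : ∀ t ∈ Ico 0 t₀, ∀ x ∈ Icc (S.a t) (S.b t), f (t, x) = f' (t, x))
    (hψ : Continuous ψ) (hs : tsupport ψ ⊆ tsupport φ) :
    Integrable fun P => S.glue t₀ f f' P * ψ P := by
  have hT : 0 < T := by linarith [hφ.start_lt, hφ.lt_end]
  have ht₀ : 0 < t₀ := hφ.pos.trans hφ.lt_start
  have hO : (t₀, x₀) ∉ tsupport ψ := fun h => hφ.notMem_start (hs h)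
  have hK : IsCompact (tsupport φ) := hφ.compact
  have hsub : Icc t₀ t₂ ⊆ Ioo 0 (t₀ + T) := fun t ht =>
    ⟨ht₀.trans_le ht.1, ht.2.trans_lt hφ.lt_end⟩
  have hX : ContinuousOn S.X (Icc t₀ t₂) :=
    h.X_cont.mono fun t ht => ⟨ht.1, ht.2.trans_lt hφ.lt_end⟩
  have sl := between_left_subset (S := S) (x₀ := x₀) ht₀ hφ.lt_end
  have sr := between_right_subset (S := S) (x₀ := x₀) ht₀ hφ.lt_end
  have hsub1 : Icc t₁ t₀ ⊆ Ioo 0 (t₀ + T) := fun t ht =>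
    ⟨hφ.pos.trans_le ht.1, by linarith [ht.2]⟩
  have k1 := hK.inter_right (isClosed_between (h.a_cont.mono hsub1) (h.b_cont.mono hsub1))
  have k2 := hK.inter_right (isClosed_between (h.a_cont.mono hsub) hX)
  have k3 := hK.inter_right (isClosed_between hX (h.b_cont.mono hsub))
  have i1 := ((continuousOn_mul_of_notMem_tsupport
    (h.continuousOn_glue hT hφ.pos hf hf' hm) hψ hO).mono inter_subset_right).integrableOn_compact
    (μ := volume) k1
  have i2 := ((continuousOn_mul_of_notMem_tsupport (hf.mono sl) hψ hO).mono
    inter_subset_right).integrableOn_compact (μ := volume) k2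
  have i3 := ((continuousOn_mul_of_notMem_tsupport (hf'.mono sr) hψ hO).mono
    inter_subset_right).integrableOn_compact (μ := volume) k3
  have i2' : IntegrableOn (fun P => S.glue t₀ f f' P * ψ P)
      ((tsupport φ ∩ between S.a S.X t₀ t₂) \ (tsupport φ ∩ between S.X S.b t₀ t₂)) := by
    refine (i2.mono_set sdiff_subset).congr_fun ?_ (k2.measurableSet.diff k3.measurableSet)
    rintro P ⟨⟨hP, h1, h2, h3⟩, h4⟩
    have : P.2 < S.X P.1 := by
      by_contra hc
      exact h4 ⟨hP, h1, not_lt.1 hc, (hφ.support hP).1.2.2.2.le⟩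
    simp [Profile.glue, this]
  have i3' : IntegrableOn (fun P => S.glue t₀ f f' P * ψ P)
      (tsupport φ ∩ between S.X S.b t₀ t₂) := by
    refine i3.congr_fun ?_ k3.measurableSet
    rintro P ⟨hP, h1, h2, h3⟩
    simp [Profile.glue, h2, h1.1]
  rw [← integrableOn_iff_integrable_of_support_subset
    (s := tsupport φ ∩ between S.a S.b t₁ t₀ ∪ ((tsupport φ ∩ between S.a S.X t₀ t₂) \
      (tsupport φ ∩ between S.X S.b t₀ t₂) ∪ tsupport φ ∩ between S.X S.b t₀ t₂))]
  · exact i1.union (i2'.union i3')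
  · intro P hP
    have hPs : P ∈ tsupport φ := hs (subset_tsupport _ (right_ne_zero_of_mul hP))
    have hd := (hφ.support hPs).1
    have htm := hφ.time P hPs
    rcases le_total P.1 t₀ with h1 | h1
    · exact Or.inl ⟨hPs, ⟨htm.1.le, h1⟩, hd.2.2.1.le, hd.2.2.2.le⟩
    · right
      rw [sdiff_union_self]
      rcases le_total P.2 (S.X P.1) with h2 | h2
      · exact Or.inl ⟨hPs, ⟨h1, htm.2.le⟩, hd.2.2.1.le, h2⟩
      · exact Or.inr ⟨hPs, ⟨h1, htm.2.le⟩, h2, hd.2.2.2.le⟩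

/-- The conservation law in the sense of distributions. -/
theorem weak_form (h : ConcentratedLaw S t₀ x₀ T F G F' G' M)
    (hφ : IsTestOn S t₀ x₀ T t₁ t₂ φ) :
    (∫ P, S.glue t₀ F F' P * fderiv ℝ φ P (1, 0)) + (∫ P, S.glue t₀ G G' P * fderiv ℝ φ P (0, 1))
      + (∫ t in t₀..t₀ + T, M t * (fderiv ℝ φ (t, S.X t) (1, 0)
        + S.v t * fderiv ℝ φ (t, S.X t) (0, 1))) = 0 := by
  have hT : 0 < T := by linarith [hφ.start_lt, hφ.lt_end]
  have ht₀ : 0 < t₀ := hφ.pos.trans hφ.lt_start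
  have i1 := h.integrable_glue_mul hφ h.F_cont h.F'_cont h.match_F hφ.continuous_dt
    (tsupport_fderiv_apply_subset ℝ (1, 0))
  have i2 := h.integrable_glue_mul hφ h.G_cont h.G'_cont h.match_G hφ.continuous_dx
    (tsupport_fderiv_apply_subset ℝ (0, 1))
  set E := tested (S.glue t₀ F F') (S.glue t₀ G G') φ with hE
  have iE : Integrable E := i1.add i2
  have sl := between_left_subset (S := S) (x₀ := x₀) ht₀ hφ.lt_end
  have sr := between_right_subset (S := S) (x₀ := x₀) ht₀ hφ.lt_end
  have dzero : ∀ P ∉ tsupport φ, ∀ z, fderiv ℝ φ P z = 0 := fun P hP z => by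
    rw [image_eq_zero_of_notMem_tsupport fun h => hP (tsupport_fderiv_subset ℝ h)]; simp
  have Ezero : ∀ P ∉ tsupport φ, E P = 0 := fun P hP => by
    simp [hE, tested, dzero P hP]
  -- by Fubini's theorem, the double integral is one over the time slices between `a` and `b`
  have slice : ∀ t, ∫ x, E (t, x) = ∫ x in S.a t..S.b t, E (t, x) := by
    intro t
    refine (intervalIntegral.integral_eq_integral_of_support_subset fun x hx => ?_).symm
    have hx' : (t, x) ∈ tsupport φ := by
      by_contra hc
      exact hx (Ezero _ hc)
    exact ⟨(hφ.support hx').1.2.2.1, (hφ.support hx').1.2.2.2.le⟩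
  have iJ : Integrable fun t => ∫ x in S.a t..S.b t, E (t, x) := by
    simp_rw [← slice]
    exact iE.integral_prod_left
  have fub : ∫ P, E P = ∫ t in t₁..t₂, ∫ x in S.a t..S.b t, E (t, x) := by
    rw [Measure.volume_eq_prod, integral_prod _ iE]
    simp_rw [slice]
    refine (intervalIntegral.integral_eq_integral_of_support_subset fun t ht => ?_).symm
    by_contra hc
    refine ht ?_
    simp only [← slice]
    refine integral_eq_zero_of_ae (Eventually.of_forall fun x => Ezero _ fun hx => hc ?_)
    exact ⟨(hφ.time _ hx).1, (hφ.time _ hx).2.le⟩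
  have after : ∫ t in t₀..t₂, ∫ x in S.a t..S.b t, E (t, x)
      = ∫ t in t₀..t₂, ((∫ x in S.a t..S.X t, tested F G φ (t, x))
        + (∫ x in S.X t..S.b t, tested F' G' φ (t, x))) := by
    refine intervalIntegral.integral_congr fun t ht => ?_
    rw [uIcc_of_le hφ.start_lt.le] at ht
    simp only [hE, tested_glue]
    exact h.integral_slice_glue hφ.lt_end
      (continuousOn_tested hφ (h.F_cont.mono sl) (h.G_cont.mono sl))
      (continuousOn_tested hφ (h.F'_cont.mono sr) (h.G'_cont.mono sr)) ht
  have start : ∫ x in S.a t₀..S.b t₀, S.glue t₀ F F' (t₀, x) * φ (t₀, x)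
      = (∫ x in S.a t₀..S.X t₀, F (t₀, x) * φ (t₀, x))
        + ∫ x in S.X t₀..S.b t₀, F' (t₀, x) * φ (t₀, x) := by
    simp only [Profile.glue_mul]
    exact h.integral_slice_glue hφ.lt_end
      (continuousOn_mul_of_notMem_tsupport (h.F_cont.mono sl) hφ.smooth.continuous
        hφ.notMem_start)
      (continuousOn_mul_of_notMem_tsupport (h.F'_cont.mono sr) hφ.smooth.continuous
        hφ.notMem_start) ⟨le_rfl, hφ.start_lt.le⟩
  have tail : ∫ t in t₀..t₀ + T, M t * (fderiv ℝ φ (t, S.X t) (1, 0)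
        + S.v t * fderiv ℝ φ (t, S.X t) (0, 1)) = ∫ t in t₀..t₂, M t *
        (fderiv ℝ φ (t, S.X t) (1, 0) + S.v t * fderiv ℝ φ (t, S.X t) (0, 1)) := by
    have hz : EqOn (fun t => M t * (fderiv ℝ φ (t, S.X t) (1, 0)
        + S.v t * fderiv ℝ φ (t, S.X t) (0, 1))) (fun _ => 0) (uIcc t₂ (t₀ + T)) := by
      intro t ht
      rw [uIcc_of_le hφ.lt_end.le] at ht
      have : (t, S.X t) ∉ tsupport φ := fun hc => (hφ.time _ hc).2.not_ge ht.1
      simp [dzero _ this]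
    rw [← intervalIntegral.integral_add_adjacent_intervals
      ((h.continuousOn_curve_term hφ).intervalIntegrable_of_Icc hφ.start_lt.le)
      (b := t₂) (c := t₀ + T), intervalIntegral.integral_congr hz]
    · simp
    · exact (intervalIntegrable_const (c := (0 : ℝ))).congr
        fun t ht => (hz (uIoc_subset_uIcc ht)).symm
  have split : ∫ P, E P = (∫ P, S.glue t₀ F F' P * fderiv ℝ φ P (1, 0))
      + ∫ P, S.glue t₀ G G' P * fderiv ℝ φ P (0, 1) := integral_add i1 i2
  have hb := h.integral_before hφ
  have ha := h.integral_after hφ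
  rw [← split, fub, ← intervalIntegral.integral_add_adjacent_intervals (b := t₀)
    iJ.intervalIntegrable iJ.intervalIntegrable, hb, after, tail, start]
  linarith

end ConcentratedLaw

end Chaplygin

namespace Chaplygin

/-! ### δ-shocks as distributional solutions -/

theorem exists_grad_of_deriv {F G : ℝ × ℝ → ℝ} {P : ℝ × ℝ} (hF : DifferentiableAt ℝ F P)
    (hG : DifferentiableAt ℝ G P)
    (h : deriv (fun s => F (s, P.2)) P.1 + deriv (fun y => G (P.1, y)) P.2 = 0) :
    ∃ A B C D, HasFDerivAt F (gradForm A B) P ∧ HasFDerivAt G (gradForm C D) P ∧ A + D = 0 := by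
  have h1 := hasFDerivAt_gradForm hF
  have h2 := hasFDerivAt_gradForm hG
  refine ⟨_, _, _, _, h1, h2, ?_⟩
  rw [← (hasFDerivAt_partial_t (t := P.1) (x := P.2) h1).deriv,
    ← (hasFDerivAt_partial_x (t := P.1) (x := P.2) h2).deriv, h]

namespace Profile

variable {S : Profile} {p₀ μ α₁ β₂ t₀ x₀ T w₀ v₀ : ℝ} {ρ₀ u₀ : ℝ → ℝ}

/-- Both conservation laws of the system, as laws with a concentrated amount. -/
theorem IsDeltaShockSolution.concentratedLaw
    (h : S.IsDeltaShockSolution p₀ μ ρ₀ u₀ α₁ β₂ t₀ x₀ T w₀ v₀) :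
    ConcentratedLaw S t₀ x₀ T S.ρm (fun P => S.ρm P * S.um P) S.ρp (fun P => S.ρp P * S.up P)
      (fun t => S.w t * √(1 + S.v t ^ 2)) ∧
    ConcentratedLaw S t₀ x₀ T (fun P => S.ρm P * S.um P)
      (fun P => S.ρm P * S.um P ^ 2 + pressure p₀ μ (S.ρm P)) (fun P => S.ρp P * S.up P)
      (fun P => S.ρp P * S.up P ^ 2 + pressure p₀ μ (S.ρp P))
      (fun t => S.w t * S.v t * √(1 + S.v t ^ 2)) := by
  have ha : ContinuousOn S.a (Ico 0 (t₀ + T)) := fun t ht => (h.a_char t ht).continuousWithinAt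
  have hb : ContinuousOn S.b (Ico 0 (t₀ + T)) := fun t ht => (h.b_char t ht).continuousWithinAt
  have hX : ContinuousOn S.X (Ico t₀ (t₀ + T)) := fun t ht => (h.X_speed t ht).continuousWithinAt
  have dX : ∀ t ∈ Ioo t₀ (t₀ + T), HasDerivAt S.X (S.v t) t := fun t ht =>
    (h.X_speed t (Ioo_subset_Ico_self ht)).hasDerivAt (Ico_mem_nhds ht.1 ht.2)
  have da : ∀ t ∈ Ioo 0 (t₀ + T), DifferentiableAt ℝ S.a t := fun t ht =>
    ((h.a_char t (Ioo_subset_Ico_self ht)).hasDerivAt (Ico_mem_nhds ht.1 ht.2)).differentiableAt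
  have db : ∀ t ∈ Ioo 0 (t₀ + T), DifferentiableAt ℝ S.b t := fun t ht =>
    ((h.b_char t (Ioo_subset_Ico_self ht)).hasDerivAt (Ico_mem_nhds ht.1 ht.2)).differentiableAt
  have hne : ∀ {P : ℝ × ℝ}, (t₀ ≤ P.1 → P.2 ≠ S.X P.1) → P ≠ (t₀, x₀) := by
    rintro P hP rfl
    exact hP le_rfl h.X_start.symm
  have nl : ∀ P ∈ S.leftInt t₀ T, S.leftDom t₀ x₀ T ∈ 𝓝 P := fun P hP => by
    refine mem_of_superset ((isOpen_leftOpen ha hb hX h.X_lt_b).mem_nhds hP) fun Q hQ => ?_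
    exact ⟨hQ.1.le, hQ.2.1, hQ.2.2.1.le, fun k => (hQ.2.2.2.1 k).le, fun k => (hQ.2.2.2.2 k).le,
      hne fun k => (hQ.2.2.2.2 k).ne⟩
  have nr : ∀ P ∈ S.rightInt t₀ T, S.rightDom t₀ x₀ T ∈ 𝓝 P := fun P hP => by
    have ho : IsOpen (S.rightInt t₀ T) := by
      have := (isOpen_leftOpen hb.neg ha.neg hX.neg
        (fun t ht => neg_lt_neg (h.a_lt_X t ht))).preimage
        (show Continuous fun P : ℝ × ℝ => (P.1, -P.2) by fun_prop)
      convert! this using 1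
      ext P
      exact mem_rightInt_iff
    refine mem_of_superset (ho.mem_nhds hP) fun Q hQ => ?_
    exact ⟨hQ.1.le, hQ.2.1, hQ.2.2.1.le, fun k => (hQ.2.2.2.1 k).le, fun k => (hQ.2.2.2.2 k).le,
      hne fun k => (hQ.2.2.2.2 k).ne'⟩
  have cl := h.smooth_ρm.continuousOn
  have cl' := h.smooth_um.continuousOn
  have cr := h.smooth_ρp.continuousOn
  have cr' := h.smooth_up.continuousOn
  have cpl : ContinuousOn (fun P => S.ρm P * S.um P ^ 2 + pressure p₀ μ (S.ρm P))
      (S.leftDom t₀ x₀ T) :=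
    (cl.mul (cl'.pow 2)).add (continuousOn_const.sub (continuousOn_const.div cl
      fun P hP => (h.ρm_pos P hP).ne'))
  have cpr : ContinuousOn (fun P => S.ρp P * S.up P ^ 2 + pressure p₀ μ (S.ρp P))
      (S.rightDom t₀ x₀ T) :=
    (cr.mul (cr'.pow 2)).add (continuousOn_const.sub (continuousOn_const.div cr
      fun P hP => (h.ρp_pos P hP).ne'))
  have dl : ∀ P ∈ S.leftInt t₀ T, DifferentiableAt ℝ S.ρm P ∧ DifferentiableAt ℝ S.um P :=
    fun P hP => ⟨(h.smooth_ρm.contDiffAt (nl P hP)).differentiableAt one_ne_zero,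
      (h.smooth_um.contDiffAt (nl P hP)).differentiableAt one_ne_zero⟩
  have dr : ∀ P ∈ S.rightInt t₀ T, DifferentiableAt ℝ S.ρp P ∧ DifferentiableAt ℝ S.up P :=
    fun P hP => ⟨(h.smooth_ρp.contDiffAt (nr P hP)).differentiableAt one_ne_zero,
      (h.smooth_up.contDiffAt (nr P hP)).differentiableAt one_ne_zero⟩
  have dflux : ∀ {r u : ℝ × ℝ → ℝ} {P : ℝ × ℝ}, DifferentiableAt ℝ r P → DifferentiableAt ℝ u P →
      0 < r P → DifferentiableAt ℝ (fun P => r P * u P ^ 2 + pressure p₀ μ (r P)) P := by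
    intro r u P hr hu hpos
    have hi : DifferentiableAt ℝ (fun P => μ ^ 2 / r P) P := by
      simp only [div_eq_mul_inv]
      exact ((hasDerivAt_inv hpos.ne').differentiableAt.comp P hr).const_mul _
    exact (hr.mul (hu.pow 2)).add ((differentiableAt_const p₀).sub hi)
  have hsq : ContinuousOn (fun t => √(1 + S.v t ^ 2)) (Ico t₀ (t₀ + T)) :=
    (continuousOn_const.add (h.v_cont.pow 2)).sqrt
  constructor
  · exact
      { a_diff := da, b_diff := db, a_lt_b := h.a_lt_b, a_lt_X := h.a_lt_X, X_lt_b := h.X_lt_b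
        X_start := h.X_start, X_cont := hX, X_speed := dX, v_cont := h.v_cont
        M_cont := h.w_cont.mul hsq
        F_cont := cl, G_cont := cl.mul cl', F'_cont := cr, G'_cont := cr.mul cr'
        law_left := fun P hP => exists_grad_of_deriv (dl P hP).1 ((dl P hP).1.mul (dl P hP).2)
          (h.solves_left P hP).1
        law_right := fun P hP => exists_grad_of_deriv (dr P hP).1 ((dr P hP).1.mul (dr P hP).2)
          (h.solves_right P hP).1
        match_F := h.match_ρ
        match_G := fun t ht x hx => by simp only [h.match_ρ t ht x hx, h.match_u t ht x hx]
        balance := h.rankine_mass }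
  · exact
      { a_diff := da, b_diff := db, a_lt_b := h.a_lt_b, a_lt_X := h.a_lt_X, X_lt_b := h.X_lt_b
        X_start := h.X_start, X_cont := hX, X_speed := dX, v_cont := h.v_cont
        M_cont := (h.w_cont.mul h.v_cont).mul hsq
        F_cont := cl.mul cl', G_cont := cpl, F'_cont := cr.mul cr', G'_cont := cpr
        law_left := fun P hP => exists_grad_of_deriv ((dl P hP).1.mul (dl P hP).2)
          (dflux (dl P hP).1 (dl P hP).2 (h.ρm_pos P (mem_of_mem_nhds (nl P hP))))
          (h.solves_left P hP).2
        law_right := fun P hP => exists_grad_of_deriv ((dr P hP).1.mul (dr P hP).2)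
          (dflux (dr P hP).1 (dr P hP).2 (h.ρp_pos P (mem_of_mem_nhds (nr P hP))))
          (h.solves_right P hP).2
        match_F := fun t ht x hx => by simp only [h.match_ρ t ht x hx, h.match_u t ht x hx]
        match_G := fun t ht x hx => by simp only [h.match_ρ t ht x hx, h.match_u t ht x hx]
        balance := h.rankine_momentum }

/-- A compactly supported test function fits into a compact subinterval of the time interval. -/
theorem exists_isTestOn {φ : ℝ × ℝ → ℝ} (ht₀ : 0 < t₀) (hT : 0 < T) (h1 : ContDiff ℝ 1 φ)
    (h2 : HasCompactSupport φ) (h3 : tsupport φ ⊆ S.openDom t₀ T \ {(t₀, x₀)}) :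
    ∃ t₁ t₂, IsTestOn S t₀ x₀ T t₁ t₂ φ := by
  have hK : IsCompact (Prod.fst '' tsupport φ ∪ {t₀}) :=
    (IsCompact.image h2 continuous_fst).union isCompact_singleton
  have hne : (Prod.fst '' tsupport φ ∪ {t₀}).Nonempty := ⟨t₀, Or.inr rfl⟩
  have hmem : ∀ t ∈ Prod.fst '' tsupport φ ∪ {t₀}, t ∈ Ioo 0 (t₀ + T) := by
    rintro t (⟨P, hP, rfl⟩ | rfl)
    · exact ⟨(h3 hP).1.1, (h3 hP).1.2.1⟩
    · exact ⟨ht₀, by linarith⟩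
  obtain ⟨r, hr, hrm⟩ := hK.exists_isLeast hne
  obtain ⟨s, hs, hsm⟩ := hK.exists_isGreatest hne
  obtain ⟨t₁, k1, k2⟩ := exists_between (hmem r hr).1
  obtain ⟨t₂, k3, k4⟩ := exists_between (hmem s hs).2
  exact ⟨t₁, t₂, h1, h2, h3,
    fun P hP => ⟨k2.trans_le (hrm (Or.inl ⟨P, hP, rfl⟩)),
      (hsm (Or.inl ⟨P, hP, rfl⟩)).trans_lt k3⟩,
    k1, k2.trans_le (hrm (Or.inr rfl)), (hsm (Or.inr rfl)).trans_lt k3, k4⟩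

/-- The Rankine–Hugoniot conditions make a piecewise smooth solution a solution in the sense of
distributions. -/
theorem IsDeltaShockSolution.isDeltaMeasureSolution
    (h : S.IsDeltaShockSolution p₀ μ ρ₀ u₀ α₁ β₂ t₀ x₀ T w₀ v₀) (ht₀ : 0 < t₀) (hT : 0 < T) :
    S.IsDeltaMeasureSolution p₀ μ t₀ x₀ T := by
  intro φ h1 h2 h3
  obtain ⟨t₁, t₂, hφ⟩ := exists_isTestOn ht₀ hT (h1.of_le (by exact_mod_cast le_top)) h2 h3
  obtain ⟨law₁, law₂⟩ := h.concentratedLaw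
  have w₁ := law₁.weak_form hφ
  have w₂ := law₂.weak_form hφ
  have gρ : ∀ P, S.glue t₀ S.ρm S.ρp P = S.rhoHat t₀ P := fun P => rfl
  have gm : ∀ P, S.glue t₀ (fun P => S.ρm P * S.um P) (fun P => S.ρp P * S.up P) P
      = S.rhoHat t₀ P * S.uHat t₀ P := fun P => by
    unfold glue rhoHat uHat; split_ifs <;> rfl
  have gf : ∀ P, S.glue t₀ (fun P => S.ρm P * S.um P ^ 2 + pressure p₀ μ (S.ρm P))
      (fun P => S.ρp P * S.up P ^ 2 + pressure p₀ μ (S.ρp P)) P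
      = S.rhoHat t₀ P * S.uHat t₀ P ^ 2 + pressure p₀ μ (S.rhoHat t₀ P) := fun P => by
    unfold glue rhoHat uHat; split_ifs <;> rfl
  simp only [gρ, gm, gf] at w₁ w₂
  -- the weighted delta functions, in terms of the speed
  have cd : ∀ (g : ℝ → ℝ) (ψ : ℝ × ℝ → ℝ), curveDelta t₀ (t₀ + T) id S.X g ψ
      = ∫ t in t₀..t₀ + T, g t * √(1 + S.v t ^ 2) * ψ (t, S.X t) := by
    intro g ψ
    refine intervalIntegral.integral_congr_Ioo_of_le (by linarith) fun t ht => ?_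
    simp only [id_eq, deriv_id', one_pow, (law₁.X_speed t ht).deriv]
    ring
  have ii : ∀ (g : ℝ → ℝ) (ψ : ℝ × ℝ → ℝ), ContinuousOn g (Ico t₀ (t₀ + T)) → Continuous ψ →
      (∀ P ∉ tsupport φ, ψ P = 0) →
      IntervalIntegrable (fun t => g t * √(1 + S.v t ^ 2) * ψ (t, S.X t)) volume t₀ (t₀ + T) := by
    intro g ψ hg hψ hz
    have hsub : Icc t₀ t₂ ⊆ Ico t₀ (t₀ + T) := fun t ht => ⟨ht.1, ht.2.trans_lt hφ.lt_end⟩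
    have c1 : ContinuousOn (fun t => g t * √(1 + S.v t ^ 2) * ψ (t, S.X t)) (Icc t₀ t₂) :=
      ((hg.mono hsub).mul (continuousOn_const.add ((h.v_cont.mono hsub).pow 2)).sqrt).mul
        (hψ.comp_continuousOn (continuousOn_id.prodMk (law₁.X_cont.mono hsub)))
    refine (c1.intervalIntegrable_of_Icc hφ.start_lt.le).trans
      ((intervalIntegrable_const (c := (0 : ℝ))).congr fun t ht => ?_)
    rw [uIoc_of_le hφ.lt_end.le] at ht
    simp [hz (t, S.X t) fun hc => (hφ.time _ hc).2.not_gt ht.1]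
  have dz : ∀ z, ∀ P ∉ tsupport φ, fderiv ℝ φ P z = 0 := fun z P hP => by
    rw [image_eq_zero_of_notMem_tsupport fun h => hP (tsupport_fderiv_subset ℝ h)]; simp
  have join : ∀ g : ℝ → ℝ, ContinuousOn g (Ico t₀ (t₀ + T)) →
      curveDelta t₀ (t₀ + T) id S.X g (fun P => fderiv ℝ φ P (1, 0))
        + curveDelta t₀ (t₀ + T) id S.X (fun t => g t * S.v t) (fun P => fderiv ℝ φ P (0, 1))
      = ∫ t in t₀..t₀ + T, g t * √(1 + S.v t ^ 2) * (fderiv ℝ φ (t, S.X t) (1, 0)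
        + S.v t * fderiv ℝ φ (t, S.X t) (0, 1)) := by
    intro g hg
    rw [cd, cd, ← intervalIntegral.integral_add (ii g _ hg hφ.continuous_dt (dz _))
      (ii (fun t => g t * S.v t) _ (hg.mul h.v_cont) hφ.continuous_dx (dz _))]
    congr 1
    funext t
    ring
  have j₁ := join S.w h.w_cont
  have j₂ := join (fun t => S.w t * S.v t) (h.w_cont.mul h.v_cont)
  have hsq : (fun t => S.w t * S.v t * S.v t) = fun t => S.w t * S.v t ^ 2 := by
    funext t; ring
  rw [hsq] at j₂
  constructor
  · unfold pairMass pairMomentum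
    linarith
  · unfold pairMomentum pairFlux
    linarith

end Profile

end Chaplygin

namespace Chaplygin

/-! ### Expansion at a nondegenerate cusp -/

theorem sub_mem_Icc_of_hasDerivAt {f f' : ℝ → ℝ} {a b m M : ℝ} (hab : a ≤ b)
    (hf : ∀ x ∈ Icc a b, HasDerivAt f (f' x) x) (hm : ∀ x ∈ Icc a b, m ≤ f' x ∧ f' x ≤ M) :
    m * (b - a) ≤ f b - f a ∧ f b - f a ≤ M * (b - a) := by
  rcases hab.eq_or_lt with rfl | hab
  · simp
  obtain ⟨x, hx, he⟩ := exists_hasDerivAt_eq_slope f f' hab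
    (fun x hx => (hf x hx).continuousAt.continuousWithinAt)
    fun x hx => hf x (Ioo_subset_Icc_self hx)
  have h := hm x (Ioo_subset_Icc_self hx)
  have hpos : 0 < b - a := sub_pos.2 hab
  rw [he] at h
  exact ⟨(le_div_iff₀ hpos).1 h.1, (div_le_iff₀ hpos).1 h.2⟩

theorem convexOn_of_hasDerivAt_nonneg {g g' g'' : ℝ → ℝ} {s : Set ℝ} (hs : Convex ℝ s)
    (h1 : ∀ x ∈ s, HasDerivAt g (g' x) x) (h2 : ∀ x ∈ s, HasDerivAt g' (g'' x) x)
    (h3 : ∀ x ∈ s, 0 ≤ g'' x) : ConvexOn ℝ s g :=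
  convexOn_of_hasDerivWithinAt2_nonneg hs
    (fun x hx => (h1 x hx).continuousAt.continuousWithinAt)
    (fun x hx => (h1 x (interior_subset hx)).hasDerivWithinAt)
    (fun x hx => (h2 x (interior_subset hx)).hasDerivWithinAt)
    fun x hx => h3 x (interior_subset hx)

/-- A convex function with a double zero at the origin is nonnegative. -/
theorem nonneg_of_double_zero {g g' g'' : ℝ → ℝ} {r : ℝ}
    (h1 : ∀ x, |x| < r → HasDerivAt g (g' x) x) (h2 : ∀ x, |x| < r → HasDerivAt g' (g'' x) x)
    (h3 : ∀ x, |x| < r → 0 ≤ g'' x) (g0 : g 0 = 0) (g'0 : g' 0 = 0) {x : ℝ} (hx : |x| < r) :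
    0 ≤ g x := by
  have hr : |(0 : ℝ)| < r := by rw [abs_zero]; exact (abs_nonneg x).trans_lt hx
  have hmem : ∀ {x}, |x| < r ↔ x ∈ Ioo (-r) r := abs_lt
  have hc : ConvexOn ℝ (Ioo (-r) r) g := convexOn_of_hasDerivAt_nonneg (convex_Ioo _ _)
    (fun x hx => h1 x (hmem.2 hx)) (fun x hx => h2 x (hmem.2 hx)) fun x hx => h3 x (hmem.2 hx)
  have hd := h1 0 hr
  rw [g'0] at hd
  have hm := hc.isMinOn_of_rightDeriv_eq_zero (x := 0)
    (by rw [isOpen_Ioo.interior_eq]; exact hmem.1 hr)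
    (hd.hasDerivWithinAt.derivWithin (uniqueDiffWithinAt_Ioi 0))
  rw [← g0]
  exact hm (hmem.1 hx)

/-- Riemann invariants in characteristic coordinates, twice continuously differentiable on an open
interval `I`, with a nondegenerate cusp at `(p₀, q₀)`: there the two fast and slow characteristics
meet (`meet`), the fronts have a common tangent (`slope`), and the cusp opens towards later times
(`curvature`). The functions `lm₁, lm₂` and `lp₁, lp₂` are the first and second derivatives of
`lm` and `lp`. -/
structure CuspExpansion (lm lm₁ lm₂ lp lp₁ lp₂ H G : ℝ → ℝ) (I : Set ℝ) (p₀ q₀ : ℝ) : Prop where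
  isOpen : IsOpen I
  ordConnected : I.OrdConnected
  p₀_mem : p₀ ∈ I
  q₀_mem : q₀ ∈ I
  p₀_lt_q₀ : p₀ < q₀
  d_lm : ∀ p ∈ I, HasDerivAt lm (lm₁ p) p
  d_lp : ∀ p ∈ I, HasDerivAt lp (lp₁ p) p
  d_lm₁ : ∀ p ∈ I, HasDerivAt lm₁ (lm₂ p) p
  d_lp₁ : ∀ p ∈ I, HasDerivAt lp₁ (lp₂ p) p
  c_lm₂ : ContinuousOn lm₂ I
  c_lp₂ : ContinuousOn lp₂ I
  lm₁_neg : ∀ p ∈ I, lm₁ p < 0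
  lp₁_neg : ∀ p ∈ I, lp₁ p < 0
  lm_lt_lp : ∀ p ∈ I, lm p < lp p
  d_H : ∀ p ∈ I, HasDerivAt H (lp p) p
  d_G : ∀ p ∈ I, HasDerivAt G (-lm p) p
  meet : lm p₀ = lp q₀
  slope : lm₁ p₀ = lp₁ q₀
  curvature : lm₂ p₀ < lp₂ q₀

namespace CuspExpansion

variable {lm lm₁ lm₂ lp lp₁ lp₂ H G : ℝ → ℝ} {I : Set ℝ} {p₀ q₀ : ℝ}

theorem strictAntiOn_lm (h : CuspExpansion lm lm₁ lm₂ lp lp₁ lp₂ H G I p₀ q₀) :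
    StrictAntiOn lm I :=
  strictAntiOn_of_hasDerivWithinAt_neg h.ordConnected.convex
    (fun x hx => (h.d_lm x hx).continuousAt.continuousWithinAt)
    (fun x hx => (h.d_lm x (interior_subset hx)).hasDerivWithinAt)
    fun x hx => h.lm₁_neg x (interior_subset hx)

theorem strictAntiOn_lp (h : CuspExpansion lm lm₁ lm₂ lp lp₁ lp₂ H G I p₀ q₀) :
    StrictAntiOn lp I :=
  strictAntiOn_of_hasDerivWithinAt_neg h.ordConnected.convex
    (fun x hx => (h.d_lp x hx).continuousAt.continuousWithinAt)
    (fun x hx => (h.d_lp x (interior_subset hx)).hasDerivWithinAt)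
    fun x hx => h.lp₁_neg x (interior_subset hx)

theorem contDiffOn_lm (h : CuspExpansion lm lm₁ lm₂ lp lp₁ lp₂ H G I p₀ q₀) :
    ContDiffOn ℝ 1 lm I := by
  rw [show (1 : WithTop ℕ∞) = 0 + 1 by simp, contDiffOn_succ_iff_deriv_of_isOpen h.isOpen]
  refine ⟨fun x hx => (h.d_lm x hx).differentiableAt.differentiableWithinAt, by simp, ?_⟩
  rw [contDiffOn_zero]
  exact ContinuousOn.congr (fun x hx => (h.d_lm₁ x hx).continuousAt.continuousWithinAt)
    fun x hx => (h.d_lm x hx).deriv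

theorem contDiffOn_lp (h : CuspExpansion lm lm₁ lm₂ lp lp₁ lp₂ H G I p₀ q₀) :
    ContDiffOn ℝ 1 lp I := by
  rw [show (1 : WithTop ℕ∞) = 0 + 1 by simp, contDiffOn_succ_iff_deriv_of_isOpen h.isOpen]
  refine ⟨fun x hx => (h.d_lp x hx).differentiableAt.differentiableWithinAt, by simp, ?_⟩
  rw [contDiffOn_zero]
  exact ContinuousOn.congr (fun x hx => (h.d_lp₁ x hx).continuousAt.continuousWithinAt)
    fun x hx => (h.d_lp x hx).deriv

/-- Near the cusp the derivatives are almost those at the cusp. -/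
theorem exists_radius (h : CuspExpansion lm lm₁ lm₂ lp lp₁ lp₂ H G I p₀ q₀) {κ c : ℝ}
    (hκ : κ = -lm₁ p₀) (hc : c = lp₂ q₀ - lm₂ p₀) : ∃ r > 0, ∀ ξ, |ξ| < r →
      (p₀ + ξ ∈ I ∧ q₀ + ξ ∈ I) ∧
      (-(11 / 10 * κ) ≤ lm₁ (p₀ + ξ) ∧ lm₁ (p₀ + ξ) ≤ -(9 / 10 * κ)) ∧
      (-(11 / 10 * κ) ≤ lp₁ (q₀ + ξ) ∧ lp₁ (q₀ + ξ) ≤ -(9 / 10 * κ)) ∧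
      (lm₂ p₀ - c / 20 ≤ lm₂ (p₀ + ξ) ∧ lm₂ (p₀ + ξ) ≤ lm₂ p₀ + c / 20) ∧
      (lp₂ q₀ - c / 20 ≤ lp₂ (q₀ + ξ) ∧ lp₂ (q₀ + ξ) ≤ lp₂ q₀ + c / 20) := by
  have hκ0 : 0 < κ := by rw [hκ]; exact neg_pos.2 (h.lm₁_neg _ h.p₀_mem)
  have hc0 : 0 < c := by rw [hc]; exact sub_pos.2 h.curvature
  have ev : ∀ {s : ℝ} {f : ℝ → ℝ} {u v : ℝ}, ContinuousAt f s → f s ∈ Ioo u v →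
      ∀ᶠ ξ in 𝓝 (0 : ℝ), u ≤ f (s + ξ) ∧ f (s + ξ) ≤ v := by
    intro s f u v hf hs
    have ht : Tendsto (fun ξ => f (s + ξ)) (𝓝 0) (𝓝 (f s)) := by
      refine hf.tendsto.comp ?_
      have : ContinuousAt (fun ξ => s + ξ) 0 := by fun_prop
      simpa [ContinuousAt] using this
    filter_upwards [ht (isOpen_Ioo.mem_nhds hs)] with ξ hξ using ⟨hξ.1.le, hξ.2.le⟩
  have evI : ∀ {s : ℝ}, s ∈ I → ∀ᶠ ξ in 𝓝 (0 : ℝ), s + ξ ∈ I := by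
    intro s hs
    have : ContinuousAt (fun ξ => s + ξ) 0 := by fun_prop
    exact this.preimage_mem_nhds (h.isOpen.mem_nhds (by simpa using hs))
  have e1 := (evI h.p₀_mem).and (evI h.q₀_mem)
  have e2 := ev (h.d_lm₁ _ h.p₀_mem).continuousAt
    (u := -(11 / 10 * κ)) (v := -(9 / 10 * κ)) (by constructor <;> linarith)
  have e3 := ev (h.d_lp₁ _ h.q₀_mem).continuousAt
    (u := -(11 / 10 * κ)) (v := -(9 / 10 * κ)) (by rw [← h.slope]; constructor <;> linarith)
  have e4 := ev (h.c_lm₂.continuousAt (h.isOpen.mem_nhds h.p₀_mem))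
    (u := lm₂ p₀ - c / 20) (v := lm₂ p₀ + c / 20) (by constructor <;> linarith)
  have e5 := ev (h.c_lp₂.continuousAt (h.isOpen.mem_nhds h.q₀_mem))
    (u := lp₂ q₀ - c / 20) (v := lp₂ q₀ + c / 20) (by constructor <;> linarith)
  obtain ⟨r, hr, hr'⟩ := Metric.eventually_nhds_iff.1 (e1.and (e2.and (e3.and (e4.and e5))))
  exact ⟨r, hr, fun ξ hξ => hr' (by simpa [Real.dist_eq] using hξ)⟩

/-- A nondegenerate cusp provides the bounds collected in `CuspDatum`. -/
theorem exists_cuspDatum (h : CuspExpansion lm lm₁ lm₂ lp lp₁ lp₂ H G I p₀ q₀) :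
    ∃ D : CuspDatum, D.lm = lm ∧ D.lp = lp ∧ D.H = H ∧ D.G = G ∧ D.p₀ = p₀ ∧ D.q₀ = q₀ := by
  obtain ⟨κ, hκ⟩ : ∃ κ, κ = -lm₁ p₀ := ⟨_, rfl⟩
  obtain ⟨c, hc⟩ : ∃ c, c = lp₂ q₀ - lm₂ p₀ := ⟨_, rfl⟩
  have hκ0 : 0 < κ := by rw [hκ]; exact neg_pos.2 (h.lm₁_neg _ h.p₀_mem)
  have hc0 : 0 < c := by rw [hc]; exact sub_pos.2 h.curvature
  obtain ⟨r, hr, hR⟩ := h.exists_radius hκ hc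
  have dL : ∀ ξ, |ξ| < r → HasDerivAt (fun ξ => lm (p₀ + ξ)) (lm₁ (p₀ + ξ)) ξ := fun ξ hξ =>
    (h.d_lm _ (hR ξ hξ).1.1).comp_const_add p₀ ξ
  have dP : ∀ ξ, |ξ| < r → HasDerivAt (fun ξ => lp (q₀ + ξ)) (lp₁ (q₀ + ξ)) ξ := fun ξ hξ =>
    (h.d_lp _ (hR ξ hξ).1.2).comp_const_add q₀ ξ
  have dL₁ : ∀ ξ, |ξ| < r → HasDerivAt (fun ξ => lm₁ (p₀ + ξ)) (lm₂ (p₀ + ξ)) ξ := fun ξ hξ =>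
    (h.d_lm₁ _ (hR ξ hξ).1.1).comp_const_add p₀ ξ
  have dP₁ : ∀ ξ, |ξ| < r → HasDerivAt (fun ξ => lp₁ (q₀ + ξ)) (lp₂ (q₀ + ξ)) ξ := fun ξ hξ =>
    (h.d_lp₁ _ (hR ξ hξ).1.2).comp_const_add q₀ ξ
  have habs : ∀ {a b x : ℝ}, |a| < r → |b| < r → x ∈ Icc a b → |x| < r := fun ha hb hx =>
    abs_lt.2 ⟨(abs_lt.1 ha).1.trans_le hx.1, hx.2.trans_lt (abs_lt.1 hb).2⟩
  -- increments of the two invariants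
  have iL : ∀ a b, |a| < r → |b| < r → a ≤ b →
      -(11 / 10 * κ) * (b - a) ≤ lm (p₀ + b) - lm (p₀ + a) ∧
        lm (p₀ + b) - lm (p₀ + a) ≤ -(9 / 10 * κ) * (b - a) := fun a b ha hb hab =>
    sub_mem_Icc_of_hasDerivAt (f := fun ξ => lm (p₀ + ξ)) hab (fun x hx => dL x (habs ha hb hx))
      fun x hx => (hR x (habs ha hb hx)).2.1
  have iP : ∀ a b, |a| < r → |b| < r → a ≤ b →
      -(11 / 10 * κ) * (b - a) ≤ lp (q₀ + b) - lp (q₀ + a) ∧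
        lp (q₀ + b) - lp (q₀ + a) ≤ -(9 / 10 * κ) * (b - a) := fun a b ha hb hab =>
    sub_mem_Icc_of_hasDerivAt (f := fun ξ => lp (q₀ + ξ)) hab (fun x hx => dP x (habs ha hb hx))
      fun x hx => (hR x (habs ha hb hx)).2.2.1
  -- the difference of the two invariants vanishes to second order
  have n1 : ∀ ξ, |ξ| < r → 9 / 20 * c * ξ ^ 2 ≤ lp (q₀ + ξ) - lm (p₀ + ξ) := by
    intro ξ hξ
    have := nonneg_of_double_zero (r := r) (x := ξ)
      (g := fun ξ => lp (q₀ + ξ) - lm (p₀ + ξ) - 9 / 20 * c * ξ ^ 2)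
      (g' := fun ξ => lp₁ (q₀ + ξ) - lm₁ (p₀ + ξ) - 9 / 10 * c * ξ)
      (g'' := fun ξ => lp₂ (q₀ + ξ) - lm₂ (p₀ + ξ) - 9 / 10 * c)
      (fun x hx => (((dP x hx).sub (dL x hx)).sub
        ((hasDerivAt_pow 2 x).const_mul (9 / 20 * c))).congr_deriv (by push_cast; ring))
      (fun x hx => (((dP₁ x hx).sub (dL₁ x hx)).sub
        ((hasDerivAt_id x).const_mul (9 / 10 * c))).congr_deriv (by ring))
      (fun x hx => by linarith [(hR x hx).2.2.2.1.2, (hR x hx).2.2.2.2.1])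
      (by simp [h.meet]) (by simp [h.slope]) hξ
    linarith
  have n2 : ∀ ξ, |ξ| < r → lp (q₀ + ξ) - lm (p₀ + ξ) ≤ 11 / 20 * c * ξ ^ 2 := by
    intro ξ hξ
    have := nonneg_of_double_zero (r := r) (x := ξ)
      (g := fun ξ => 11 / 20 * c * ξ ^ 2 - (lp (q₀ + ξ) - lm (p₀ + ξ)))
      (g' := fun ξ => 11 / 10 * c * ξ - (lp₁ (q₀ + ξ) - lm₁ (p₀ + ξ)))
      (g'' := fun ξ => 11 / 10 * c - (lp₂ (q₀ + ξ) - lm₂ (p₀ + ξ)))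
      (fun x hx => (((hasDerivAt_pow 2 x).const_mul (11 / 20 * c)).sub
        ((dP x hx).sub (dL x hx))).congr_deriv (by push_cast; ring))
      (fun x hx => (((hasDerivAt_id x).const_mul (11 / 10 * c)).sub
        ((dP₁ x hx).sub (dL₁ x hx))).congr_deriv (by ring))
      (fun x hx => by linarith [(hR x hx).2.2.2.1.1, (hR x hx).2.2.2.2.2])
      (by simp [h.meet]) (by simp [h.slope]) hξ
    linarith
  have small : ∀ {ξ : ℝ}, -(r / 4) < ξ → ξ < r / 4 → |ξ| < r := fun h1 h2 =>
    abs_lt.2 ⟨by linarith, by linarith⟩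
  have hB : Ioo (p₀ - r / 4) (q₀ + r / 4) ⊆ I := by
    have h1 := (hR (-(r / 4)) (by rw [abs_neg, abs_of_pos] <;> linarith)).1.1
    have h2 := (hR (r / 4) (by rw [abs_of_pos] <;> linarith)).1.2
    exact fun x hx => h.ordConnected.out h1 h2 ⟨by linarith [hx.1], by linarith [hx.2]⟩
  have h00 : |(0 : ℝ)| < r := by simpa using hr
  refine ⟨
    { lm := lm, lp := lp, H := H, G := G, p₀ := p₀, q₀ := q₀, δ := r / 4, κ := κ, c := c
      p₀_lt_q₀ := h.p₀_lt_q₀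
      δ_pos := by linarith
      κ_pos := hκ0
      c_pos := hc0
      hasDerivAt_H := fun q hq => h.d_H q (hB hq)
      hasDerivAt_G := fun q hq => h.d_G q (hB hq)
      contDiff_lm := h.contDiffOn_lm.mono hB
      contDiff_lp := h.contDiffOn_lp.mono hB
      meet := h.meet
      anti_lm := h.strictAntiOn_lm.mono hB
      anti_lp := h.strictAntiOn_lp.mono hB
      pos := ?_
      est_left := fun ξ η h1 h2 h3 => ?_
      est_right := fun ξ η h1 h2 h3 => ?_
      lip_lm := fun ξ hξ => ?_
      lip_lp := fun ξ hξ => ?_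
      seg_left := fun p p' t h1 h2 h3 h4 h5 h6 => ?_
      seg_right := fun q q' t h1 h2 h3 h4 h5 h6 => ?_ }, rfl, rfl, rfl, rfl, rfl, rfl⟩
  -- `lm p < lp q` before the blowup: near the cusp by the second order expansion
  · intro p hp q hq hpq
    rcases le_or_gt q p with hqp | hqp
    · exact (h.strictAntiOn_lm.antitoneOn (hB hq) (hB hp) hqp).trans_lt (h.lm_lt_lp q (hB hq))
    obtain ⟨ξ, rfl⟩ : ∃ ξ, p = p₀ + ξ := ⟨p - p₀, by ring⟩
    rcases lt_or_ge ξ (r / 2) with hξ | hξ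
    · have hξr : |ξ| < r := abs_lt.2 ⟨by linarith [hp.1], by linarith⟩
      have k1 := n1 ξ hξr
      have k2 := h.strictAntiOn_lp (hB hq) (hR ξ hξr).1.2 (by linarith : q < q₀ + ξ)
      have : 0 ≤ 9 / 20 * c * ξ ^ 2 := by positivity
      linarith
    -- far from the cusp, the two values are separated by monotonicity
    · have hr2 : |r / 2| < r := by rw [abs_of_pos] <;> linarith
      have hr4 : |r / 4| < r := by rw [abs_of_pos] <;> linarith
      have k1 := (iL 0 (r / 2) h00 hr2 (by linarith)).2
      have k2 := (iP 0 (r / 4) h00 hr4 (by linarith)).1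
      have k3 := h.strictAntiOn_lm.antitoneOn (hR _ hr2).1.1 (hB hp) (by linarith)
      have k4 := h.strictAntiOn_lp.antitoneOn (hB hq) (hR _ hr4).1.2 hq.2.le
      have := h.meet
      have : 0 < κ * r := by positivity
      simp only [add_zero] at k1 k2
      linarith
  · have a1 := small h1 (h2.trans_lt h3)
    have a2 := small (h1.trans_le h2) h3
    have k := iP ξ η a1 a2 h2
    constructor <;> linarith [n1 ξ a1, n2 ξ a1]
  · have a1 := small h1 (h2.trans_lt h3)
    have a2 := small (h1.trans_le h2) h3
    have k := iL ξ η a1 a2 h2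
    constructor <;> linarith [n1 η a2, n2 η a2]
  · have hξr : |ξ| < r := hξ.trans (by linarith)
    have hp : 0 ≤ κ * |ξ| := by positivity
    rcases le_total 0 ξ with hs | hs
    · have k := iL 0 ξ h00 hξr hs
      rw [abs_of_nonneg hs] at hp ⊢
      simp only [add_zero] at k
      rw [abs_le]; constructor <;> linarith
    · have k := iL ξ 0 hξr h00 hs
      rw [abs_of_nonpos hs] at hp ⊢
      simp only [add_zero] at k
      rw [abs_le]; constructor <;> linarith
  · have hξr : |ξ| < r := hξ.trans (by linarith)
    have hp : 0 ≤ κ * |ξ| := by positivity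
    rcases le_total 0 ξ with hs | hs
    · have k := iP 0 ξ h00 hξr hs
      rw [abs_of_nonneg hs] at hp ⊢
      simp only [add_zero] at k
      rw [abs_le]; constructor <;> linarith
    · have k := iP ξ 0 hξr h00 hs
      rw [abs_of_nonpos hs] at hp ⊢
      simp only [add_zero] at k
      rw [abs_le]; constructor <;> linarith
  · obtain ⟨τ, rfl⟩ : ∃ τ, t = q₀ - p₀ + τ := ⟨t - (q₀ - p₀), by ring⟩
    obtain ⟨ξ, rfl⟩ : ∃ ξ, p = p₀ + ξ := ⟨p - p₀, by ring⟩
    obtain ⟨ξ', rfl⟩ : ∃ ξ', p' = p₀ + ξ' := ⟨p' - p₀, by ring⟩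
    rw [show p₀ + ξ + (q₀ - p₀ + τ) = q₀ + (ξ + τ) by ring]
    rw [show p₀ + ξ' + (q₀ - p₀ + τ) = q₀ + (ξ' + τ) by ring] at h6
    have hs : ∀ x ∈ Icc ξ 0, |x| < r ∧ |x + τ| < r := fun x hx =>
      ⟨abs_lt.2 ⟨by linarith [hx.1], by linarith [hx.2]⟩,
        abs_lt.2 ⟨by linarith [hx.1], by linarith [hx.2]⟩⟩
    -- along the time slice, `λ₊ - λ₋` is a convex function of the label that is not positive at the
    -- cusp: if it is positive at `ξ'`, then also at `ξ`, farther from the cusp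
    have hcv := convexOn_of_hasDerivAt_nonneg (convex_Icc ξ 0)
      (g := fun x => lp (q₀ + (x + τ)) - lm (p₀ + x))
      (fun x hx => ((dP _ (hs x hx).2).comp_add_const x τ).sub (dL x (hs x hx).1))
      (fun x hx => ((dP₁ _ (hs x hx).2).comp_add_const x τ).sub (dL₁ x (hs x hx).1))
      (fun x hx => by
        linarith [(hR x (hs x hx).1).2.2.2.1.2, (hR _ (hs x hx).2).2.2.2.2.1])
    have h0 : (0 : ℝ) ∈ Icc ξ 0 := ⟨by linarith, le_rfl⟩
    have hmax := hcv.le_max_of_mem_Icc (left_mem_Icc.2 h0.1) h0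
      (z := ξ') ⟨by linarith, by linarith⟩
    have k := (iP 0 (0 + τ) h00 (hs 0 h0).2 (by linarith)).2
    have hκτ : 0 ≤ κ * τ := mul_nonneg hκ0.le (by linarith)
    have := h.meet
    simp only [add_zero, zero_add] at k hmax
    by_contra hcon
    have := hmax.trans (max_le (c := 0) (by linarith) (by linarith))
    linarith
  · obtain ⟨τ, rfl⟩ : ∃ τ, t = q₀ - p₀ + τ := ⟨t - (q₀ - p₀), by ring⟩
    obtain ⟨ξ, rfl⟩ : ∃ ξ, q = q₀ + ξ := ⟨q - q₀, by ring⟩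
    obtain ⟨ξ', rfl⟩ : ∃ ξ', q' = q₀ + ξ' := ⟨q' - q₀, by ring⟩
    rw [show q₀ + ξ - (q₀ - p₀ + τ) = p₀ + (ξ - τ) by ring]
    rw [show q₀ + ξ' - (q₀ - p₀ + τ) = p₀ + (ξ' - τ) by ring] at h6
    have hs : ∀ x ∈ Icc 0 ξ, |x| < r ∧ |x - τ| < r := fun x hx =>
      ⟨abs_lt.2 ⟨by linarith [hx.1], by linarith [hx.2]⟩,
        abs_lt.2 ⟨by linarith [hx.1], by linarith [hx.2]⟩⟩
    have hcv := convexOn_of_hasDerivAt_nonneg (convex_Icc 0 ξ)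
      (g := fun x => lp (q₀ + x) - lm (p₀ + (x - τ)))
      (fun x hx => (dP x (hs x hx).1).sub ((dL _ (hs x hx).2).comp_sub_const x τ))
      (fun x hx => (dP₁ x (hs x hx).1).sub ((dL₁ _ (hs x hx).2).comp_sub_const x τ))
      (fun x hx => by
        linarith [(hR _ (hs x hx).2).2.2.2.1.2, (hR x (hs x hx).1).2.2.2.2.1])
    have h0 : (0 : ℝ) ∈ Icc 0 ξ := ⟨le_rfl, by linarith⟩
    have hmax := hcv.le_max_of_mem_Icc h0 (right_mem_Icc.2 h0.2)
      (z := ξ') ⟨by linarith, by linarith⟩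
    have k := (iL (0 - τ) 0 (hs 0 h0).2 h00 (by linarith)).2
    have hκτ : 0 ≤ κ * τ := mul_nonneg hκ0.le (by linarith)
    have := h.meet
    simp only [add_zero, zero_sub] at k hmax
    by_contra hcon
    have := hmax.trans (max_le (c := 0) (by linarith) (by linarith))
    linarith

end CuspExpansion

end Chaplygin

namespace Chaplygin

/-! ### Characteristic coordinates of the initial data -/

/-- The derivative at the cusp of the function whose sign change there is assumed, together with the
tangency of the two fronts that the vanishing of this function amounts to. -/
theorem hasDerivAt_cuspFun {Lm Lp : ℝ → ℝ} (hm : ContDiff ℝ 2 Lm) (hp : ContDiff ℝ 2 Lp)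
    {α₀ β₀ : ℝ} (H : CuspAssumptions Lm Lp α₀ β₀) {a b : ℝ} (ha : a = Lp α₀ - Lm α₀)
    (hb : b = Lp β₀ - Lm β₀) :
    deriv Lm α₀ * a = deriv Lp β₀ * b ∧
    HasDerivAt (cuspFun Lm Lp)
      ((a * (deriv (deriv Lm) α₀ * a + deriv Lm α₀ * (deriv Lp α₀ - deriv Lm α₀))
        - b * (deriv (deriv Lp) β₀ * b + deriv Lp β₀ * (deriv Lp β₀ - deriv Lm β₀)))
        / (a ^ 2 * b)) α₀ := by
  have ha0 : a ≠ 0 := by rw [ha]; exact (sub_pos.2 (H.h1 α₀)).ne'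
  have hb0 : b ≠ 0 := by rw [hb]; exact (sub_pos.2 (H.h1 β₀)).ne'
  have hk0 : deriv Lp β₀ ≠ 0 := (H.h2 β₀).2.ne
  have dm : ∀ x, HasDerivAt Lm (deriv Lm x) x := fun x =>
    (hm.differentiable two_ne_zero x).hasDerivAt
  have dp : ∀ x, HasDerivAt Lp (deriv Lp x) x := fun x =>
    (hp.differentiable two_ne_zero x).hasDerivAt
  have dm' : ∀ x, HasDerivAt (deriv Lm) (deriv (deriv Lm) x) x := fun x =>
    ((contDiff_succ_iff_deriv (n := 1)).1 hm).2.2.differentiable one_ne_zero x |>.hasDerivAt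
  have dp' : ∀ x, HasDerivAt (deriv Lp) (deriv (deriv Lp) x) x := fun x =>
    ((contDiff_succ_iff_deriv (n := 1)).1 hp).2.2.differentiable one_ne_zero x |>.hasDerivAt
  have hanti : StrictAnti Lp := strictAnti_of_deriv_neg fun x => (H.h2 x).2
  have hinv : Function.LeftInverse (Function.invFun Lp) Lp :=
    Function.leftInverse_invFun hanti.injective
  have hβ : betaOf Lm Lp α₀ = β₀ := by rw [betaOf, H.h3, hinv]
  have dinv : HasDerivAt (Function.invFun Lp) (deriv Lp β₀)⁻¹ (Lm α₀) := by
    rw [H.h3]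
    exact ((hp.contDiffAt.hasStrictDerivAt two_ne_zero).to_local_left_inverse hk0
      (Eventually.of_forall hinv)).hasDerivAt
  have dβ : HasDerivAt (betaOf Lm Lp) ((deriv Lp β₀)⁻¹ * deriv Lm α₀) α₀ := dinv.comp α₀ (dm α₀)
  have e := H.h4
  rw [cuspFun, hβ, ← ha, ← hb, div_sub_div _ _ hb0 ha0, div_eq_zero_iff] at e
  have e1 : deriv Lm α₀ * a = deriv Lp β₀ * b := by
    have := e.resolve_right (mul_ne_zero hb0 ha0)
    linarith
  refine ⟨e1, ?_⟩
  have cm : HasDerivAt (fun α => Lm (betaOf Lm Lp α)) _ α₀ :=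
    HasDerivAt.comp α₀ (by rw [hβ]; exact dm β₀) dβ
  have cp : HasDerivAt (fun α => Lp (betaOf Lm Lp α)) _ α₀ :=
    HasDerivAt.comp α₀ (by rw [hβ]; exact dp β₀) dβ
  have cp' : HasDerivAt (fun α => deriv Lp (betaOf Lm Lp α))
      (deriv (deriv Lp) β₀ * ((deriv Lp β₀)⁻¹ * deriv Lm α₀)) α₀ :=
    HasDerivAt.comp (h₂ := deriv Lp) α₀ (by rw [hβ]; exact dp' β₀) dβ
  have d := ((dm' α₀).div (cp.sub cm) (by simp only [Pi.sub_apply, hβ]; rw [← hb]; exact hb0)).sub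
    (cp'.div ((dp α₀).sub (dm α₀)) (by simp only [Pi.sub_apply]; rw [← ha]; exact ha0))
  refine (HasDerivAt.congr_deriv d ?_ : HasDerivAt _ _ α₀)
  simp only [Pi.sub_apply, hβ, ← ha, ← hb]
  have e2 : deriv Lm α₀ = deriv Lp β₀ * b / a := by field_simp; linarith
  rw [e2]
  field_simp
  ring

/-- The time along a characteristic as a coordinate: `ζ ↦ ∫ dξ / (Λ₊ - Λ₋)` is a diffeomorphism
onto an open interval, whose inverse has the derivative `Λ₊ - Λ₋`. -/
theorem exists_time_coordinate {d : ℝ → ℝ} (hd : Continuous d) (hpos : ∀ x, 0 < d x) (α₀ : ℝ) :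
    ∃ A : ℝ → ℝ, IsOpen (range fun ζ => ∫ x in α₀..ζ, 1 / d x) ∧
      (range fun ζ => ∫ x in α₀..ζ, 1 / d x).OrdConnected ∧
      StrictMono (fun ζ => ∫ x in α₀..ζ, 1 / d x) ∧
      Continuous (fun ζ => ∫ x in α₀..ζ, 1 / d x) ∧
      (∀ ζ, A (∫ x in α₀..ζ, 1 / d x) = ζ) ∧
      ∀ ζ, HasDerivAt A (d ζ) (∫ x in α₀..ζ, 1 / d x) := by
  have hc : Continuous fun x => 1 / d x := continuous_const.div hd fun x => (hpos x).ne'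
  have hs : ∀ ζ, HasStrictDerivAt (fun ζ => ∫ x in α₀..ζ, 1 / d x) (1 / d ζ) ζ := fun ζ =>
    intervalIntegral.integral_hasStrictDerivAt_right (hc.intervalIntegrable _ _)
      (hc.stronglyMeasurableAtFilter _ _) hc.continuousAt
  have hcont : Continuous fun ζ => ∫ x in α₀..ζ, 1 / d x :=
    continuous_iff_continuousAt.2 fun ζ => (hs ζ).hasDerivAt.continuousAt
  have hmono : StrictMono fun ζ => ∫ x in α₀..ζ, 1 / d x :=
    strictMono_of_deriv_pos fun ζ => by
      rw [(hs ζ).hasDerivAt.deriv]; exact one_div_pos.2 (hpos ζ)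
  have hne : ∀ ζ, 1 / d ζ ≠ 0 := fun ζ => (one_div_pos.2 (hpos ζ)).ne'
  have hinv := Function.leftInverse_invFun hmono.injective
  refine ⟨Function.invFun fun ζ => ∫ x in α₀..ζ, 1 / d x,
    (isOpenMap_of_hasStrictDerivAt hs hne).isOpen_range,
    (isPreconnected_range hcont).ordConnected, hmono, hcont, hinv, fun ζ => ?_⟩
  have := ((hs ζ).to_local_left_inverse (hne ζ) (Eventually.of_forall hinv)).hasDerivAt
  exact this.congr_deriv (by simp)

/-- The data near the cusp in characteristic coordinates. -/
theorem exists_fits {μ : ℝ} (hμ : 0 < μ) {ρ₀ u₀ : ℝ → ℝ} (hρ₀ : ContDiff ℝ 2 ρ₀)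
    (hu₀ : ContDiff ℝ 2 u₀) {α₀ β₀ : ℝ}
    (H : CuspAssumptions (LamMinus μ ρ₀ u₀) (LamPlus μ ρ₀ u₀) α₀ β₀) :
    ∃ D : CuspDatum, D.t₀ = charTime (LamMinus μ ρ₀ u₀) (LamPlus μ ρ₀ u₀) α₀ β₀ ∧
      D.x₀ = charPlace (LamMinus μ ρ₀ u₀) (LamPlus μ ρ₀ u₀) α₀ β₀ ∧
      D.v₀ = LamMinus μ ρ₀ u₀ α₀ ∧
      ∃ ε > 0, ∀ α₁ ∈ Ioo (α₀ - ε) α₀, ∀ β₂ ∈ Ioo β₀ (β₀ + ε),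
        ∃ p₁ q₂, D.Fits μ ρ₀ u₀ α₁ β₂ p₁ q₂ := by
  set Lm := LamMinus μ ρ₀ u₀ with hLm
  set Lp := LamPlus μ ρ₀ u₀ with hLp
  have hgap : ∀ x, Lp x - Lm x = 2 * μ / ρ₀ x := fun x => by
    simp only [hLm, hLp, LamMinus, LamPlus]; ring
  have hgpos : ∀ x, 0 < Lp x - Lm x := fun x => sub_pos.2 (H.h1 x)
  -- as `Λ₊ - Λ₋ = 2 μ / ρ₀`, the first assumption makes the density positive
  have hρpos : ∀ x, 0 < ρ₀ x := fun x => by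
    have h1 := hgpos x
    rw [hgap] at h1
    exact (div_pos_iff_of_pos_left (by positivity)).1 h1
  have hi : ContDiff ℝ 2 fun x => μ / ρ₀ x :=
    contDiff_const.div hρ₀ fun x => (hρpos x).ne'
  have hm : ContDiff ℝ 2 Lm := hu₀.sub hi
  have hp : ContDiff ℝ 2 Lp := hu₀.add hi
  have dm : ∀ x, HasDerivAt Lm (deriv Lm x) x := fun x =>
    (hm.differentiable two_ne_zero x).hasDerivAt
  have dp : ∀ x, HasDerivAt Lp (deriv Lp x) x := fun x =>
    (hp.differentiable two_ne_zero x).hasDerivAt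
  have hm' := ((contDiff_succ_iff_deriv (n := 1)).1 hm).2.2
  have hp' := ((contDiff_succ_iff_deriv (n := 1)).1 hp).2.2
  have dm' : ∀ x, HasDerivAt (deriv Lm) (deriv (deriv Lm) x) x := fun x =>
    (hm'.differentiable one_ne_zero x).hasDerivAt
  have dp' : ∀ x, HasDerivAt (deriv Lp) (deriv (deriv Lp) x) x := fun x =>
    (hp'.differentiable one_ne_zero x).hasDerivAt
  have cm'' : Continuous (deriv (deriv Lm)) := hm'.continuous_deriv le_rfl
  have cp'' : Continuous (deriv (deriv Lp)) := hp'.continuous_deriv le_rfl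
  have hgc : Continuous fun x => Lp x - Lm x := hp.continuous.sub hm.continuous
  obtain ⟨A, hIo, hIc, hmono, hRc, hA, hdA⟩ := exists_time_coordinate hgc hgpos α₀
  set R := fun ζ => ∫ x in α₀..ζ, 1 / (Lp x - Lm x) with hR
  have hA' : ∀ ζ, A (R ζ) = ζ := hA
  have hR0 : R α₀ = 0 := by simp [hR]
  have hsum : ∀ ζ, HasDerivAt (fun ζ => ∫ x in α₀..ζ, (Lp x + Lm x) / (Lp x - Lm x))
      ((Lp ζ + Lm ζ) / (Lp ζ - Lm ζ)) ζ := by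
    have hc : Continuous fun x => (Lp x + Lm x) / (Lp x - Lm x) :=
      (hp.continuous.add hm.continuous).div hgc fun x => (hgpos x).ne'
    exact fun ζ => intervalIntegral.integral_hasDerivAt_right (hc.intervalIntegrable _ _)
      (hc.stronglyMeasurableAtFilter _ _) hc.continuousAt
  set J := fun ζ => ∫ x in α₀..ζ, (Lp x + Lm x) / (Lp x - Lm x) with hJ
  have hcomp : ∀ {f : ℝ → ℝ} {f' ζ : ℝ}, HasDerivAt f f' ζ →
      HasDerivAt (fun p => f (A p)) (f' * (Lp ζ - Lm ζ)) (R ζ) := by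
    intro f f' ζ hf
    exact HasDerivAt.comp (R ζ) (by rw [hA']; exact hf) (hdA ζ)
  obtain ⟨hslope, hcf⟩ := hasDerivAt_cuspFun hm hp H rfl rfl
  have hneg : ∀ {x y : ℝ}, x < 0 → 0 < y → x * y < 0 := fun hx hy => mul_neg_of_neg_of_pos hx hy
  have cA : ContinuousOn A (range R) := by
    rintro _ ⟨ζ, rfl⟩
    exact (hdA ζ).continuousAt.continuousWithinAt
  -- in the time coordinate `p = R ζ` the derivatives of the invariants are `dΛ / dp = Λ' (Λ₊ -
  -- Λ₋)`
  have hexp : CuspExpansion (fun p => Lm (A p)) (fun p => deriv Lm (A p) * (Lp (A p) - Lm (A p)))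
      (fun p => (deriv (deriv Lm) (A p) * (Lp (A p) - Lm (A p))
        + deriv Lm (A p) * (deriv Lp (A p) - deriv Lm (A p))) * (Lp (A p) - Lm (A p)))
      (fun p => Lp (A p)) (fun p => deriv Lp (A p) * (Lp (A p) - Lm (A p)))
      (fun p => (deriv (deriv Lp) (A p) * (Lp (A p) - Lm (A p))
        + deriv Lp (A p) * (deriv Lp (A p) - deriv Lm (A p))) * (Lp (A p) - Lm (A p)))
      (fun p => 1 / 2 * (A p + J (A p))) (fun p => 1 / 2 * (A p - J (A p)))
      (range R) (R α₀) (R β₀) :=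
    { isOpen := hIo
      ordConnected := hIc
      p₀_mem := mem_range_self _
      q₀_mem := mem_range_self _
      p₀_lt_q₀ := hmono H.lt
      d_lm := by rintro _ ⟨ζ, rfl⟩; rw [hA']; exact hcomp (dm ζ)
      d_lp := by rintro _ ⟨ζ, rfl⟩; rw [hA']; exact hcomp (dp ζ)
      d_lm₁ := by
        rintro _ ⟨ζ, rfl⟩; rw [hA']
        exact hcomp ((dm' ζ).mul ((dp ζ).sub (dm ζ)))
      d_lp₁ := by
        rintro _ ⟨ζ, rfl⟩; rw [hA']
        exact hcomp ((dp' ζ).mul ((dp ζ).sub (dm ζ)))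
      c_lm₂ := by
        have hc : Continuous fun x => (deriv (deriv Lm) x * (Lp x - Lm x)
            + deriv Lm x * (deriv Lp x - deriv Lm x)) * (Lp x - Lm x) :=
          ((cm''.mul hgc).add (hm'.continuous.mul (hp'.continuous.sub hm'.continuous))).mul hgc
        exact hc.comp_continuousOn cA
      c_lp₂ := by
        have hc : Continuous fun x => (deriv (deriv Lp) x * (Lp x - Lm x)
            + deriv Lp x * (deriv Lp x - deriv Lm x)) * (Lp x - Lm x) :=
          ((cp''.mul hgc).add (hp'.continuous.mul (hp'.continuous.sub hm'.continuous))).mul hgc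
        exact hc.comp_continuousOn cA
      lm₁_neg := fun p _ => hneg (H.h2 _).1 (hgpos _)
      lp₁_neg := fun p _ => hneg (H.h2 _).2 (hgpos _)
      lm_lt_lp := fun p _ => H.h1 _
      d_H := by
        rintro _ ⟨ζ, rfl⟩
        refine (hcomp (((hasDerivAt_id ζ).add (hsum ζ)).const_mul (1 / 2))).congr_deriv ?_
        rw [hA']
        have := (hgpos ζ).ne'
        field_simp
        ring
      d_G := by
        rintro _ ⟨ζ, rfl⟩
        refine (hcomp (((hasDerivAt_id ζ).sub (hsum ζ)).const_mul (1 / 2))).congr_deriv ?_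
        rw [hA']
        have := (hgpos ζ).ne'
        field_simp
        ring
      meet := by rw [hA', hA']; exact H.h3
      slope := by rw [hA', hA']; exact hslope
      curvature := by
        have h5 := H.h5
        rw [hcf.deriv, div_lt_iff₀ (mul_pos (pow_pos (hgpos α₀) 2) (hgpos β₀)), zero_mul] at h5
        simp only [hA']
        linarith }
  obtain ⟨D, e1, e2, e3, e4, e5, e6⟩ := hexp.exists_cuspDatum
  have hY : ∀ ζ, D.Y (0, R ζ) = ζ := fun ζ => by
    simp only [CuspDatum.Y, e3, e4, add_zero, hA']; ring
  refine ⟨D, ?_, ?_, ?_, ?_⟩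
  · rw [CuspDatum.t₀, e5, e6, hR0, sub_zero]; rfl
  · rw [CuspDatum.x₀, e3, e4, e5, e6]
    simp only [hA', charPlace, hJ, intervalIntegral.integral_same]
    ring
  · rw [CuspDatum.v₀, e1, e5]; simp only [hA']
  · have n1 : ∀ᶠ ζ in 𝓝 α₀, R α₀ - D.δ < R ζ :=
      hRc.continuousAt.eventually_const_lt (by linarith [D.δ_pos])
    have n2 : ∀ᶠ ζ in 𝓝 β₀, R ζ < R β₀ + D.δ :=
      hRc.continuousAt.eventually_lt_const (by linarith [D.δ_pos])
    obtain ⟨r₁, hr₁, h₁⟩ := Metric.eventually_nhds_iff.1 n1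
    obtain ⟨r₂, hr₂, h₂⟩ := Metric.eventually_nhds_iff.1 n2
    refine ⟨min r₁ r₂, lt_min hr₁ hr₂, fun α₁ hα₁ β₂ hβ₂ => ⟨R α₁, R β₂, ?_⟩⟩
    have k1 := min_le_left r₁ r₂
    have k2 := min_le_right r₁ r₂
    have hin : ∀ p ∈ Icc (R α₁) (R β₂), p ∈ range R := fun p hp =>
      hIc.out (mem_range_self _) (mem_range_self _) hp
    exact
      { p₁_mem := by
          rw [e5]
          exact ⟨h₁ (by rw [Real.dist_eq, abs_lt]; constructor <;> linarith [hα₁.1, hα₁.2]),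
            hmono hα₁.2⟩
        q₂_mem := by
          rw [e6]
          exact ⟨hmono hβ₂.1,
            h₂ (by rw [Real.dist_eq, abs_lt]; constructor <;> linarith [hβ₂.1, hβ₂.2])⟩
        left := hY α₁
        right := hY β₂
        density := fun p hp => by
          obtain ⟨ζ, rfl⟩ := hin p hp
          rw [hY, e1, e2]
          simp only [hA', hgap]
          have := (hρpos ζ).ne'
          field_simp
        velocity := fun p hp => by
          obtain ⟨ζ, rfl⟩ := hin p hp
          rw [hY, e1, e2]
          simp only [hA', hLm, hLp, LamMinus, LamPlus]
          ring }

end Chaplygin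

theorem theorem3p1 (p₀ μ : ℝ) (hp₀ : 0 < p₀) (hμ : 0 < μ) (ρ₀ u₀ : ℝ → ℝ)
    (hρ₀ : ContDiff ℝ 2 ρ₀) (hu₀ : ContDiff ℝ 2 u₀) (Lm Lp : ℝ → ℝ)
    (hLm : Lm = Chaplygin.LamMinus μ ρ₀ u₀) (hLp : Lp = Chaplygin.LamPlus μ ρ₀ u₀)
    (α₀ β₀ t₀ x₀ : ℝ) (H : Chaplygin.CuspAssumptions Lm Lp α₀ β₀)
    (ht₀ : t₀ = Chaplygin.charTime Lm Lp α₀ β₀)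
    (hx₀ : x₀ = Chaplygin.charPlace Lm Lp α₀ β₀) :
    ∃ ε > 0, ∀ α₁ ∈ Set.Ioo (α₀ - ε) α₀, ∀ β₂ ∈ Set.Ioo β₀ (β₀ + ε), ∀ w₀ : ℝ, w₀ ≠ 0 →
      ∃ T > 0, ∃ S : Chaplygin.Profile,
        S.IsDeltaShockSolution p₀ μ ρ₀ u₀ α₁ β₂ t₀ x₀ T w₀ (Lm α₀) ∧
        S.IsDeltaMeasureSolution p₀ μ t₀ x₀ T ∧
        ∀ T' ∈ Set.Ioc 0 T, ∀ S' : Chaplygin.Profile,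
          S'.IsDeltaShockSolution p₀ μ ρ₀ u₀ α₁ β₂ t₀ x₀ T' w₀ (Lm α₀) →
          S.SameUntil S' t₀ x₀ T' := by
  subst hLm hLp
  obtain ⟨D, e1, e2, e3, ε, hε, hfit⟩ := Chaplygin.exists_fits hμ hρ₀ hu₀ H
  rw [ht₀, hx₀, ← e1, ← e2, ← e3]
  refine ⟨ε, hε, fun α₁ hα₁ β₂ hβ₂ w₀ hw₀ => ?_⟩
  obtain ⟨p₁, q₂, hD⟩ := hfit α₁ hα₁ β₂ hβ₂
  obtain ⟨T, hT, S, hS, huniq⟩ := hD.exists_solution (p₀ := p₀) hμ hw₀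
  exact ⟨T, hT, S, hS, hS.isDeltaMeasureSolution D.t₀_pos hT, huniq⟩
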